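/- Fix two universes of sets, $\mathcal U_1\in\mathcal U_2$; a set is small if it lies in $\mathcal U_1$. Let $\mathbf{VDBL}$ be the (strict) $2$-category of $\mathcal U_2$-virtual double categories (objects, a category of vertical morphisms, horizontal morphisms, multicells with a finite, possibly empty, path of horizontal morphisms on top and a single horizontal morphism at the bottom), virtual double functors and vertical transformations. Slices are strict slice $2$-categories; $2$-functors, $2$-natural transformations and $2$-adjunctions are strict. Let $\mathbb{S}\mathrm{pan}$ (resp. $\mathbb{S}\mathrm{pan}_*$) be the virtual double category of small sets (resp. small pointed sets), functions (resp. pointed functions) and spans of such; a multicell from $S_1,\dots,S_n$ to $S$ is a (pointed) function $S_1\times_{I_1}\cdots\times_{I_{n-1}}S_n\to S$ compatible with the outer legs (for $n=0$ the domain is $I_0$). Let $Q\colon\mathbb{S}\mathrm{pan}_*\to\mathbb{S}\mathrm{pan}$ be the forgetful functor. For $\mathbb A\in\mathbf{VDBL}$, let $\mathbb{F}\mathrm{am}(\mathbb A)$ be the virtual double category whose objects are families $(A_i)_{i\in I}$ of objects of $\mathbb A$ with $I$ small; whose vertical morphisms $(A_i)_{i\in I}\to(B_j)_{j\in J}$ are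 functions $v\colon I\to J$ with vertical morphisms $A_i\to B_{v(i)}$; whose horizontal morphisms are spans $I\leftarrow S\to I'$ of small sets with horizontal morphisms $\Gamma_s$ from $A_{s_-}$ to $A'_{s_+}$ $(s\in S)$; and whose multicells from $(S_k,\Gamma_k)_{1\le k\le n}$ to $(S,\Gamma)$ are multicells $m$ of spans with multicells of $\mathbb A$ from $\Gamma_{1,s_1},\dots,\Gamma_{n,s_n}$ to $\Gamma_{m(s_1,\dots,s_n)}$, for all $(s_1,\dots,s_n)\in S_1\times_{I_1}\cdots\times_{I_{n-1}}S_n$ (for $n=0$: indexed by $I_0$). This gives a $2$-functor $\mathbb{F}\mathrm{am}\colon\mathbf{VDBL}\to\mathbf{VDBL}$. For $F\colon\mathbb A\to\mathbb{S}\mathrm{pan}$, let $\mathbb{E}\mathrm{lts}(F)$ be the virtual double category whose objects are pairs $(A,a)$ with $a\in FA$; whose vertical morphisms $(A,a)\to(A',a')$ are vertical morphisms $f$ of $\mathbb A$ with $(Ff)(a)=a'$; whose horizontal morphisms from $(A,a)$ to $(A',a')$ are pairs $(\Gamma,\gamma)$ with $\gamma\in F\Gamma$, $\gamma_-=a$,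 $\gamma_+=a'$; and whose multicells from $(\Gamma_1,\gamma_1),\dots,(\Gamma_n,\gamma_n)$ to $(\Gamma,\gamma)$ are multicells $\alpha$ of $\mathbb A$ with $(F\alpha)(\gamma_1,\dots,\gamma_n)=\gamma$ (for $n=0$, starting at $(A_0,a_0)$: $(F\alpha)(a_0)=\gamma$). With its evident functor to $\mathbb{S}\mathrm{pan}_*$ it defines a $2$-functor $Q^*\colon\mathbf{VDBL}/\mathbb{S}\mathrm{pan}\to\mathbf{VDBL}/\mathbb{S}\mathrm{pan}_*$, and hence, on composing with the forgetful $2$-functor, a $2$-functor $\mathbb{E}\mathrm{lts}\colon\mathbf{VDBL}/\mathbb{S}\mathrm{pan}\to\mathbf{VDBL}$. A virtual double functor $P\colon\mathbb X\to\mathbb Y$ is a discrete opfibration if every vertical morphism of $\mathbb Y$ with domain $PX$ has a unique lift with domain $X$, and every multicell of $\mathbb Y$ with top boundary $P\Phi_1,\dots,P\Phi_n$ (starting at $PX_0$ if $n=0$) has a unique lift with top boundary $\Phi_1,\dots,\Phi_n$. A morphism $p\colon E\to B$ of a $2$-category $\mathcal L$ is a split fibration if each functor $\mathcal L(X,p)$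 is equipped with a split cleavage, preserved by precomposition with each $Y\to X$. A $2$-functor $R\colon\mathcal K\to\mathcal L$, where $\mathcal K$ has a terminal object $1$, is familial if the induced $2$-functor $R_1\colon\mathcal K\to\mathcal L/R1$ is a right $2$-adjoint and factors through the $2$-category of split fibrations over $R1$, that is, each $RA\to R1$ can be equipped with a split fibration structure in such a way that each $Rf$ preserves the chosen cartesian lifts. Proposition. 1. $Q$ is a discrete opfibration. 2. For each $F\colon\mathbb A\to\mathbb{S}\mathrm{pan}$, the projection $\mathbb{E}\mathrm{lts}(F)\to\mathbb A$ and the functor $\mathbb{E}\mathrm{lts}(F)\to\mathbb{S}\mathrm{pan}_*$ exhibit $\mathbb{E}\mathrm{lts}(F)$ as the ($2$-categorical) pullback of $Q$ along $F$. 3. $Q$ is powerful, i.e. $Q^*$ has a right $2$-adjoint $\prod_Q$, and $\mathbb{F}\mathrm{am}$ is the polynomial $2$-functor induced by $Q$: for any right $2$-adjoint $\prod_Q$ of $Q^*$, $\mathbb{F}\mathrm{am}$ is $2$-naturally isomorphic to the composite $$\mathbf{VDBL}\xrightarrow{\ \mathbb{S}\mathrm{pan}_*\times(-)\ }\mathbf{VDBL}/\mathbb{S}\mathrm{pan}_*\xrightarrow{\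 \prod_Q\ }\mathbf{VDBL}/\mathbb{S}\mathrm{pan}\xrightarrow{\ \text{forgetful}\ }\mathbf{VDBL},$$ and the composite of the first two factors is $2$-naturally isomorphic, over $\mathbb{S}\mathrm{pan}$, to $\mathbb{F}\mathrm{am}$ with its functors $\mathbb{F}\mathrm{am}(\mathbb A)\to\mathbb{F}\mathrm{am}(1)\to\mathbb{S}\mathrm{pan}$ sending families to their indexing sets and spans. 4. $\mathbb{F}\mathrm{am}$ is familial. 5. The functor $\mathbb{F}\mathrm{am}(1)\to\mathbb{S}\mathrm{pan}$ is an isomorphism, and, under it, $\mathbb{E}\mathrm{lts}\colon\mathbf{VDBL}/\mathbb{S}\mathrm{pan}\to\mathbf{VDBL}$ is left $2$-adjoint to $\mathbb{F}\mathrm{am}_1\colon\mathbf{VDBL}\to\mathbf{VDBL}/\mathbb{F}\mathrm{am}(1)\cong\mathbf{VDBL}/\mathbb{S}\mathrm{pan}$. -/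

import Mathlib

open CategoryTheory

set_option linter.unusedVariables false
set_option linter.unusedSectionVars false
set_option linter.checkUnivs false

universe u v w

/-! ### Virtual double categories -/

/-- Composable strings of edges (finite paths, possibly empty). -/
inductive HPath {O : Type u} (H : O → O → Type v) : O → O → Type (max u v)
  | nil (A : O) : HPath H A A
  | cons {A B C : O} (Γ : H A B) (Γs : HPath H B C) : HPath H A C

namespace HPath

variable {O : Type u} {H : O → O → Type v}

/-- The path of length one. -/
abbrev single {A B : O} (Γ : H A B) : HPath H A B := .cons Γ (.nil B)

/-- Concatenation of paths. -/
def append : ∀ {A B C : O}, HPath H A B → HPath H B C → HPath H A C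
  | _, _, _, .nil _, Δs => Δs
  | _, _, _, .cons Γ Γs, Δs => .cons Γ (append Γs Δs)

theorem append_nil : ∀ {A B : O} (Γs : HPath H A B), Γs.append (.nil B) = Γs
  | _, _, .nil _ => rfl
  | _, _, .cons Γ Γs => congrArg (HPath.cons Γ) (append_nil Γs)

theorem append_assoc : ∀ {A B C D : O} (Γs : HPath H A B) (Δs : HPath H B C) (Λs : HPath H C D),
    (Γs.append Δs).append Λs = Γs.append (Δs.append Λs)
  | _, _, _, _, .nil _, _, _ => rfl
  | _, _, _, _, .cons Γ Γs, Δs, Λs => congrArg (HPath.cons Γ) (append_assoc Γs Δs Λs)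

/-- The image of a path under a map of graphs. -/
def map {O' : Type u} {H' : O' → O' → Type v} (f : O → O')
    (g : ∀ A B : O, H A B → H' (f A) (f B)) :
    ∀ {A B : O}, HPath H A B → HPath H' (f A) (f B)
  | _, _, .nil A => .nil (f A)
  | _, _, .cons Γ Γs => .cons (g _ _ Γ) (map f g Γs)

theorem map_append {O' : Type u} {H' : O' → O' → Type v} (f : O → O')
    (g : ∀ A B : O, H A B → H' (f A) (f B)) :
    ∀ {A B C : O} (Γs : HPath H A B) (Δs : HPath H B C),
      (Γs.append Δs).map f g = (Γs.map f g).append (Δs.map f g)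
  | _, _, _, .nil _, _ => rfl
  | _, _, _, .cons Γ Γs, Δs => congrArg (HPath.cons (g _ _ Γ)) (map_append f g Γs Δs)

theorem map_id : ∀ {A B : O} (Γs : HPath H A B), Γs.map (fun A => A) (fun _ _ Γ => Γ) = Γs
  | _, _, .nil _ => rfl
  | _, _, .cons Γ Γs => congrArg (HPath.cons Γ) (map_id Γs)

theorem map_map {O' O'' : Type u} {H' : O' → O' → Type v} {H'' : O'' → O'' → Type v}
    (f : O → O') (f' : O' → O'') (g : ∀ A B : O, H A B → H' (f A) (f B))
    (g' : ∀ A B : O', H' A B → H'' (f' A) (f' B)) :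
    ∀ {A B : O} (Γs : HPath H A B),
      (Γs.map f g).map f' g' = Γs.map (fun A => f' (f A)) (fun _ _ Γ => g' _ _ (g _ _ Γ))
  | _, _, .nil _ => rfl
  | _, _, .cons Γ Γs => congrArg (HPath.cons (g' _ _ (g _ _ Γ))) (map_map f f' g g' Γs)

end HPath

/-- The underlying data of a virtual double category: a category of objects and vertical morphisms,
horizontal morphisms, and multicells `Cell Γs u u' Δ` with top boundary the path `Γs`,
vertical boundaries `u`, `u'`, and bottom boundary `Δ`. -/
structure VDGraph where
  Obj : Type v
  [vert : Category.{v} Obj]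
  Hor : Obj → Obj → Type v
  Cell : ∀ {A A' B B' : Obj}, HPath Hor A A' → (A ⟶ B) → (A' ⟶ B') → Hor B B' → Type v

attribute [instance] VDGraph.vert

/-- `X.CellPath Δs u u'` is the type of sequences `θ₁, …, θₘ` of horizontally adjacent multicells
whose bottom boundaries form the path `Δs`, and whose outer vertical boundaries are `u` and `u'`.
For `m = 0` such a sequence is a single vertical morphism. -/
inductive VDGraph.CellPath (X : VDGraph.{v}) :
    ∀ {A A' B B' : X.Obj}, HPath X.Hor B B' → (A ⟶ B) → (A' ⟶ B') → Type v
  | nil {A B : X.Obj} (u : A ⟶ B) : CellPath X (.nil B) u u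
  | cons {A A' A'' B B' B'' : X.Obj} {Γs : HPath X.Hor A A'} {u : A ⟶ B} {u' : A' ⟶ B'}
      {u'' : A'' ⟶ B''} {Δ : X.Hor B B'} {Δs : HPath X.Hor B' B''}
      (θ : X.Cell Γs u u' Δ) (θs : CellPath X Δs u' u'') : CellPath X (.cons Δ Δs) u u''

namespace VDGraph

variable {X : VDGraph.{v}}

/-- The concatenation of the top boundaries of a sequence of multicells. -/
def CellPath.top : ∀ {A A' B B' : X.Obj} {Δs : HPath X.Hor B B'} {u : A ⟶ B} {u' : A' ⟶ B'},
    X.CellPath Δs u u' → HPath X.Hor A A'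
  | _, _, _, _, _, _, _, .nil (A := A) _ => .nil A
  | _, _, _, _, _, _, _, .cons (Γs := Γs) _ θs => Γs.append θs.top

/-- Concatenation of sequences of multicells. -/
def CellPath.append : ∀ {A A' A'' B B' B'' : X.Obj} {Δs : HPath X.Hor B B'}
    {Δs' : HPath X.Hor B' B''} {u : A ⟶ B} {u' : A' ⟶ B'} {u'' : A'' ⟶ B''},
    X.CellPath Δs u u' → X.CellPath Δs' u' u'' → X.CellPath (Δs.append Δs') u u''
  | _, _, _, _, _, _, _, _, _, _, _, .nil _, κs => κs
  | _, _, _, _, _, _, _, _, _, _, _, .cons θ θs, κs => .cons θ (θs.append κs)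

theorem CellPath.top_append : ∀ {A A' A'' B B' B'' : X.Obj} {Δs : HPath X.Hor B B'}
    {Δs' : HPath X.Hor B' B''} {u : A ⟶ B} {u' : A' ⟶ B'} {u'' : A'' ⟶ B''}
    (θs : X.CellPath Δs u u') (κs : X.CellPath Δs' u' u''),
    (θs.append κs).top = θs.top.append κs.top
  | _, _, _, _, _, _, _, _, _, _, _, .nil _, _ => rfl
  | _, _, _, _, _, _, _, _, _, _, _, .cons (Γs := Γs) θ θs, κs => by
    simp only [append, top, top_append θs κs, HPath.append_assoc]

/-- The sequence consisting of one multicell. -/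
abbrev CellPath.single {A A' B B' : X.Obj} {Γs : HPath X.Hor A A'} {u : A ⟶ B} {u' : A' ⟶ B'}
    {Δ : X.Hor B B'} (θ : X.Cell Γs u u' Δ) : X.CellPath (.single Δ) u u' :=
  .cons θ (.nil u')

/-- Transport of a multicell along equalities of its boundary. -/
def cast {A A' B B' : X.Obj} {Γs Γs' : HPath X.Hor A A'} {u w : A ⟶ B} {u' w' : A' ⟶ B'}
    {Δ : X.Hor B B'} (hΓ : Γs = Γs') (h : u = w) (h' : u' = w') (θ : X.Cell Γs u u' Δ) :
    X.Cell Γs' w w' Δ := by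
  subst hΓ h h'; exact θ

/-- Transport of a sequence of multicells along equalities of its boundary. -/
def CellPath.cast {A A' B B' : X.Obj} {Δs Δs' : HPath X.Hor B B'} {u w : A ⟶ B} {u' w' : A' ⟶ B'}
    (hΔ : Δs = Δs') (h : u = w) (h' : u' = w') (θs : X.CellPath Δs u u') :
    X.CellPath Δs' w w' := by
  subst hΔ h h'; exact θs

@[simp]
theorem cast_rfl {A A' B B' : X.Obj} {Γs : HPath X.Hor A A'} {u : A ⟶ B} {u' : A' ⟶ B'}
    {Δ : X.Hor B B'} (hΓ : Γs = Γs) (h : u = u) (h' : u' = u') (θ : X.Cell Γs u u' Δ) :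
    X.cast hΓ h h' θ = θ := rfl

@[simp]
theorem cast_cast {A A' B B' : X.Obj} {Γs Γs' Γs'' : HPath X.Hor A A'} {u w z : A ⟶ B}
    {u' w' z' : A' ⟶ B'} {Δ : X.Hor B B'} (hΓ : Γs = Γs') (h : u = w) (h' : u' = w')
    (hΓ' : Γs' = Γs'') (k : w = z) (k' : w' = z') (θ : X.Cell Γs u u' Δ) :
    X.cast hΓ' k k' (X.cast hΓ h h' θ) = X.cast (hΓ.trans hΓ') (h.trans k) (h'.trans k') θ := by
  subst hΓ h h' hΓ' k k'; rfl

@[simp]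
theorem CellPath.cast_rfl {A A' B B' : X.Obj} {Δs : HPath X.Hor B B'} {u : A ⟶ B} {u' : A' ⟶ B'}
    (hΔ : Δs = Δs) (h : u = u) (h' : u' = u') (θs : X.CellPath Δs u u') :
    θs.cast hΔ h h' = θs := rfl

theorem CellPath.top_cast {A A' B B' : X.Obj} {Δs Δs' : HPath X.Hor B B'} {u w : A ⟶ B}
    {u' w' : A' ⟶ B'} (hΔ : Δs = Δs') (h : u = w) (h' : u' = w') (θs : X.CellPath Δs u u') :
    (θs.cast hΔ h h').top = θs.top := by
  subst hΔ h h'; rfl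

theorem CellPath.cons_cast {A A' A'' B B' B'' : X.Obj} {Γs Γs' : HPath X.Hor A A'} {u : A ⟶ B}
    {u' : A' ⟶ B'} {u'' : A'' ⟶ B''} {Δ : X.Hor B B'} {Δs Δs' : HPath X.Hor B' B''}
    (hΓ : Γs = Γs') (hΔ : Δs = Δs') (θ : X.Cell Γs u u' Δ) (θs : X.CellPath Δs u' u'') :
    CellPath.cons (X.cast hΓ rfl rfl θ) (θs.cast hΔ rfl rfl) =
      (CellPath.cons θ θs).cast (congrArg (HPath.cons Δ) hΔ) rfl rfl := by
  subst hΓ hΔ; rfl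

theorem CellPath.append_nil : ∀ {A A' B B' : X.Obj} {Δs : HPath X.Hor B B'} {u : A ⟶ B}
    {u' : A' ⟶ B'} (θs : X.CellPath Δs u u'),
    θs.append (.nil u') = θs.cast (HPath.append_nil Δs).symm rfl rfl
  | _, _, _, _, _, _, _, .nil _ => rfl
  | _, _, _, _, _, _, _, .cons θ θs =>
    (congrArg (CellPath.cons θ) (append_nil θs)).trans (cons_cast rfl _ _ _)

/-- Two-level configurations of multicells: a sequence of multicells `κ₁, …, κₘ` with bottom
boundary `Λs` and outer vertical boundaries `v`, `v'`, and for each `κᵢ` a sequence of multicells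
on top of it, adjacent to each other, with outer vertical boundaries `u`, `u'`. -/
inductive CellTree (X : VDGraph.{v}) : ∀ {A A' B B' C C' : X.Obj},
    HPath X.Hor C C' → (A ⟶ B) → (A' ⟶ B') → (B ⟶ C) → (B' ⟶ C') → Type v
  | nil {A B C : X.Obj} (u : A ⟶ B) (v : B ⟶ C) : CellTree X (.nil C) u u v v
  | cons {A A' A'' B B' B'' C C' C'' : X.Obj} {Δs : HPath X.Hor B B'} {u : A ⟶ B} {u' : A' ⟶ B'}
      {u'' : A'' ⟶ B''} {v : B ⟶ C} {v' : B' ⟶ C'} {v'' : B'' ⟶ C''} {Λ : X.Hor C C'}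
      {Λs : HPath X.Hor C' C''} (θs : X.CellPath Δs u u') (κ : X.Cell Δs v v' Λ)
      (t : CellTree X Λs u' u'' v' v'') : CellTree X (.cons Λ Λs) u u'' v v''

/-- The lower level of a two-level configuration. -/
def CellTree.lower : ∀ {A A' B B' C C' : X.Obj} {Λs : HPath X.Hor C C'} {u : A ⟶ B} {u' : A' ⟶ B'}
    {v : B ⟶ C} {v' : B' ⟶ C'}, X.CellTree Λs u u' v v' → X.CellPath Λs v v'
  | _, _, _, _, _, _, _, _, _, _, _, .nil _ v => .nil v
  | _, _, _, _, _, _, _, _, _, _, _, .cons _ κ t => .cons κ t.lower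

/-- The upper level of a two-level configuration, as one sequence of multicells. -/
def CellTree.upper : ∀ {A A' B B' C C' : X.Obj} {Λs : HPath X.Hor C C'} {u : A ⟶ B} {u' : A' ⟶ B'}
    {v : B ⟶ C} {v' : B' ⟶ C'} (t : X.CellTree Λs u u' v v'), X.CellPath t.lower.top u u'
  | _, _, _, _, _, _, _, _, _, _, _, .nil u _ => .nil u
  | _, _, _, _, _, _, _, _, _, _, _, .cons θs _ t => θs.append t.upper

end VDGraph

/-- A virtual double graph with identity cells and composition of multicells. The composite
`κ ∘ (θ₁, …, θₘ)` is given with its boundary up to the stated equations, so that no transport along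
equalities is needed. For `m = 0` it is the composite `κ ∘ (u)` with a vertical morphism. -/
structure VDCData extends VDGraph.{v} where
  id : ∀ {A B : Obj} (Γ : Hor A B), Cell (.single Γ) (𝟙 A) (𝟙 B) Γ
  comp : ∀ {A A' B B' C C' : Obj} {Δs : HPath Hor B B'} {u : A ⟶ B} {u' : A' ⟶ B'}
    (θs : toVDGraph.CellPath Δs u u') {v : B ⟶ C} {v' : B' ⟶ C'} {Λ : Hor C C'}
    (_ : Cell Δs v v' Λ) {Γs : HPath Hor A A'} {w : A ⟶ C} {w' : A' ⟶ C'}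
    (_ : θs.top = Γs) (_ : u ≫ v = w) (_ : u' ≫ v' = w'), Cell Γs w w' Λ

namespace VDCData

variable (X : VDCData.{v})

/-- The sequence of identity cells on a path of horizontal morphisms. -/
def ids : ∀ {A B : X.Obj} (Γs : HPath X.Hor A B), X.CellPath Γs (𝟙 A) (𝟙 B)
  | _, _, .nil A => .nil (𝟙 A)
  | _, _, .cons Γ Γs => .cons (X.id Γ) (ids Γs)

theorem top_ids : ∀ {A B : X.Obj} (Γs : HPath X.Hor A B), (X.ids Γs).top = Γs
  | _, _, .nil _ => rfl
  | _, _, .cons Γ Γs => congrArg (HPath.cons Γ) (top_ids Γs)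

/-- The sequence of composites determined by a two-level configuration. -/
def treeComp : ∀ {A A' B B' C C' : X.Obj} {Λs : HPath X.Hor C C'} {u : A ⟶ B} {u' : A' ⟶ B'}
    {v : B ⟶ C} {v' : B' ⟶ C'}, X.CellTree Λs u u' v v' → X.CellPath Λs (u ≫ v) (u' ≫ v')
  | _, _, _, _, _, _, _, _, _, _, _, .nil u v => .nil (u ≫ v)
  | _, _, _, _, _, _, _, _, _, _, _, .cons θs κ t => .cons (X.comp θs κ rfl rfl rfl) (treeComp t)

theorem top_treeComp : ∀ {A A' B B' C C' : X.Obj} {Λs : HPath X.Hor C C'} {u : A ⟶ B}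
    {u' : A' ⟶ B'} {v : B ⟶ C} {v' : B' ⟶ C'} (t : X.CellTree Λs u u' v v'),
    (X.treeComp t).top = t.upper.top
  | _, _, _, _, _, _, _, _, _, _, _, .nil _ _ => rfl
  | _, _, _, _, _, _, _, _, _, _, _, .cons θs _ t => by
    simp only [treeComp, VDGraph.CellPath.top, top_treeComp t]
    exact (VDGraph.CellPath.top_append θs t.upper).symm

end VDCData

/-- A virtual double category whose objects, vertical and horizontal morphisms and multicells all
form sets in the universe `v`. -/
structure VDC extends VDCData.{v} where
  id_comp : ∀ {A A' B B' : Obj} {Γs : HPath Hor A A'} {u : A ⟶ B} {u' : A' ⟶ B'} {Δ : Hor B B'}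
    (κ : Cell Γs u u' Δ), comp (toVDCData.ids Γs) κ (toVDCData.top_ids Γs)
      (Category.id_comp u) (Category.id_comp u') = κ
  comp_id : ∀ {A A' B B' : Obj} {Γs : HPath Hor A A'} {u : A ⟶ B} {u' : A' ⟶ B'} {Δ : Hor B B'}
    (θ : Cell Γs u u' Δ), comp (VDGraph.CellPath.single θ) (id Δ) (HPath.append_nil Γs)
      (Category.comp_id u) (Category.comp_id u') = θ
  assoc : ∀ {A A' B B' C C' D D' : Obj} {Λs : HPath Hor C C'} {u : A ⟶ B} {u' : A' ⟶ B'}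
    {v : B ⟶ C} {v' : B' ⟶ C'} {w : C ⟶ D} {w' : C' ⟶ D'} {Ξ : Hor D D'}
    (t : toVDGraph.CellTree Λs u u' v v') (l : Cell Λs w w' Ξ),
    comp (toVDCData.treeComp t) l (toVDCData.top_treeComp t) (Category.assoc u v w)
      (Category.assoc u' v' w') = comp t.upper (comp t.lower l rfl rfl rfl) rfl rfl rfl

/-! ### Virtual double functors -/

/-- A map of the underlying data of virtual double categories, functorial on vertical morphisms. -/
structure VDGraphHom (X Y : VDGraph.{v}) where
  vert : X.Obj ⥤ Y.Obj
  hor : ∀ {A B : X.Obj}, X.Hor A B → Y.Hor (vert.obj A) (vert.obj B)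
  cell : ∀ {A A' B B' : X.Obj} {Γs : HPath X.Hor A A'} {u : A ⟶ B} {u' : A' ⟶ B'} {Δ : X.Hor B B'},
    X.Cell Γs u u' Δ → Y.Cell (Γs.map vert.obj (fun _ _ Γ => hor Γ)) (vert.map u) (vert.map u')
      (hor Δ)

namespace VDGraphHom

variable {X Y : VDGraph.{v}} (F : VDGraphHom X Y)

/-- The image of a path of horizontal morphisms. -/
abbrev path {A B : X.Obj} (Γs : HPath X.Hor A B) : HPath Y.Hor (F.vert.obj A) (F.vert.obj B) :=
  Γs.map F.vert.obj (fun _ _ Γ => F.hor Γ)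

/-- The image of a sequence of multicells. -/
def mapCells : ∀ {A A' B B' : X.Obj} {Δs : HPath X.Hor B B'} {u : A ⟶ B} {u' : A' ⟶ B'},
    X.CellPath Δs u u' → Y.CellPath (F.path Δs) (F.vert.map u) (F.vert.map u')
  | _, _, _, _, _, _, _, .nil u => .nil (F.vert.map u)
  | _, _, _, _, _, _, _, .cons θ θs => .cons (F.cell θ) (mapCells θs)

theorem top_mapCells : ∀ {A A' B B' : X.Obj} {Δs : HPath X.Hor B B'} {u : A ⟶ B} {u' : A' ⟶ B'}
    (θs : X.CellPath Δs u u'), (F.mapCells θs).top = F.path θs.top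
  | _, _, _, _, _, _, _, .nil _ => rfl
  | _, _, _, _, _, _, _, .cons _ θs => by
    simp only [mapCells, VDGraph.CellPath.top, HPath.map_append, top_mapCells θs, path]

end VDGraphHom

/-- A virtual double functor. -/
structure VDFunctor (X Y : VDC.{v}) extends VDGraphHom X.toVDGraph Y.toVDGraph where
  cell_id : ∀ {A B : X.Obj} (Γ : X.Hor A B), cell (X.id Γ) =
    Y.cast rfl (vert.map_id A).symm (vert.map_id B).symm (Y.id (hor Γ))
  cell_comp : ∀ {A A' B B' C C' : X.Obj} {Δs : HPath X.Hor B B'} {u : A ⟶ B} {u' : A' ⟶ B'}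
    (θs : X.CellPath Δs u u') {v : B ⟶ C} {v' : B' ⟶ C'} {Λ : X.Hor C C'} (κ : X.Cell Δs v v' Λ),
    cell (X.comp θs κ rfl rfl rfl) = Y.comp (toVDGraphHom.mapCells θs) (cell κ)
      (toVDGraphHom.top_mapCells θs) (vert.map_comp u v).symm (vert.map_comp u' v').symm

namespace VDCData

variable (X : VDCData.{v})

theorem cast_comp {A A' B B' C C' : X.Obj} {Δs : HPath X.Hor B B'} {u : A ⟶ B} {u' : A' ⟶ B'}
    (θs : X.CellPath Δs u u') {v : B ⟶ C} {v' : B' ⟶ C'} {Λ : X.Hor C C'} (κ : X.Cell Δs v v' Λ)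
    {Γs Γs' : HPath X.Hor A A'} {w z : A ⟶ C} {w' z' : A' ⟶ C'} (hΓ : θs.top = Γs)
    (h : u ≫ v = w) (h' : u' ≫ v' = w') (hΓ' : Γs = Γs') (k : w = z) (k' : w' = z') :
    X.cast hΓ' k k' (X.comp θs κ hΓ h h') =
      X.comp θs κ (hΓ.trans hΓ') (h.trans k) (h'.trans k') := by
  subst hΓ' k k'; rfl

theorem comp_cast {A A' B B' C C' : X.Obj} {Δs Δs' : HPath X.Hor B B'} {u : A ⟶ B} {u' : A' ⟶ B'}
    (θs : X.CellPath Δs' u u') {v z : B ⟶ C} {v' z' : B' ⟶ C'} {Λ : X.Hor C C'}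
    (κ : X.Cell Δs v v' Λ) {Γs : HPath X.Hor A A'} {w : A ⟶ C} {w' : A' ⟶ C'} (hΓ : θs.top = Γs)
    (hΔ : Δs = Δs') (k : v = z) (k' : v' = z') (h : u ≫ z = w) (h' : u' ≫ z' = w') :
    X.comp θs (X.cast hΔ k k' κ) hΓ h h' =
      X.comp (θs.cast hΔ.symm rfl rfl) κ ((θs.top_cast _ _ _).trans hΓ)
        (k ▸ h) (k' ▸ h') := by
  subst hΔ k k'; rfl

theorem cast_path_comp {A A' B B' C C' : X.Obj} {Δs Δs' : HPath X.Hor B B'} {u z : A ⟶ B}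
    {u' z' : A' ⟶ B'} (θs : X.CellPath Δs u u') {v : B ⟶ C} {v' : B' ⟶ C'} {Λ : X.Hor C C'}
    (κ : X.Cell Δs' v v' Λ) {Γs : HPath X.Hor A A'} {w : A ⟶ C} {w' : A' ⟶ C'}
    (hΔ : Δs = Δs') (k : u = z) (k' : u' = z') (hΓ : (θs.cast hΔ k k').top = Γs)
    (h : z ≫ v = w) (h' : z' ≫ v' = w') :
    X.comp (θs.cast hΔ k k') κ hΓ h h' =
      X.comp θs (X.cast hΔ.symm rfl rfl κ) ((θs.top_cast _ _ _).symm.trans hΓ)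
        (k ▸ h) (k' ▸ h') := by
  subst hΔ k k'; rfl

theorem comp_single_cast {A A' B B' C C' : X.Obj} {Γs Γs' : HPath X.Hor A A'} {u z : A ⟶ B}
    {u' z' : A' ⟶ B'} {Δ : X.Hor B B'} (θ : X.Cell Γs u u' Δ) {v : B ⟶ C} {v' : B' ⟶ C'}
    {Λ : X.Hor C C'} (κ : X.Cell (.single Δ) v v' Λ) {Γs'' : HPath X.Hor A A'} {w : A ⟶ C}
    {w' : A' ⟶ C'} (hΓ : Γs = Γs') (k : u = z) (k' : u' = z')
    (hΓ' : (VDGraph.CellPath.single (X.cast hΓ k k' θ)).top = Γs'')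
    (h : z ≫ v = w) (h' : z' ≫ v' = w') :
    X.comp (.single (X.cast hΓ k k' θ)) κ hΓ' h h' =
      X.comp (.single θ) κ (by subst hΓ k k'; exact hΓ') (k ▸ h) (k' ▸ h') := by
  subst hΓ k k'; rfl

end VDCData

namespace VDC

variable {X Y Z W : VDC.{v}}

theorem assoc' {A A' B B' C C' D D' : X.Obj} {Λs : HPath X.Hor C C'} {u : A ⟶ B} {u' : A' ⟶ B'}
    {v : B ⟶ C} {v' : B' ⟶ C'} {w : C ⟶ D} {w' : C' ⟶ D'} {Ξ : X.Hor D D'}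
    (t : X.CellTree Λs u u' v v') (l : X.Cell Λs w w' Ξ) {Γs : HPath X.Hor A A'} {z : A ⟶ D}
    {z' : A' ⟶ D'} (hΓ : t.upper.top = Γs) (h : u ≫ v ≫ w = z) (h' : u' ≫ v' ≫ w' = z') :
    X.comp (X.treeComp t) l ((X.top_treeComp t).trans hΓ) ((Category.assoc u v w).trans h)
      ((Category.assoc u' v' w').trans h') =
    X.comp t.upper (X.comp t.lower l rfl rfl rfl) hΓ h h' := by
  subst hΓ h h'; exact X.assoc t l

theorem comp_id' {A A' B B' : X.Obj} {Γs Γs' : HPath X.Hor A A'} {u w : A ⟶ B} {u' w' : A' ⟶ B'}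
    {Δ : X.Hor B B'} (θ : X.Cell Γs u u' Δ) (hΓ : (VDGraph.CellPath.single θ).top = Γs')
    (h : u ≫ 𝟙 B = w) (h' : u' ≫ 𝟙 B' = w') :
    X.comp (.single θ) (X.id Δ) hΓ h h' =
      X.cast ((HPath.append_nil Γs).symm.trans hΓ) ((Category.comp_id u).symm.trans h)
        ((Category.comp_id u').symm.trans h') θ := by
  have e : Γs = Γs' := (HPath.append_nil Γs).symm.trans hΓ
  have f : u = w := (Category.comp_id u).symm.trans h
  have f' : u' = w' := (Category.comp_id u').symm.trans h'
  subst e f f'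
  exact X.comp_id θ

theorem id_comp' {A A' B B' : X.Obj} {Γs Γs' : HPath X.Hor A A'} {u w : A ⟶ B} {u' w' : A' ⟶ B'}
    {Δ : X.Hor B B'} (θ : X.Cell Γs u u' Δ) (hΓ : (X.ids Γs).top = Γs')
    (h : 𝟙 A ≫ u = w) (h' : 𝟙 A' ≫ u' = w') :
    X.comp (X.ids Γs) θ hΓ h h' =
      X.cast ((X.top_ids Γs).symm.trans hΓ) ((Category.id_comp u).symm.trans h)
        ((Category.id_comp u').symm.trans h') θ := by
  have e : Γs = Γs' := (X.top_ids Γs).symm.trans hΓ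
  have f : u = w := (Category.id_comp u).symm.trans h
  have f' : u' = w' := (Category.id_comp u').symm.trans h'
  subst e f f'
  exact X.id_comp θ

theorem assoc_of {A A' B B' C C' D D' : X.Obj} {Λs : HPath X.Hor C C'} {u : A ⟶ B} {u' : A' ⟶ B'}
    {v : B ⟶ C} {v' : B' ⟶ C'} {w : C ⟶ D} {w' : C' ⟶ D'} {Ξ : X.Hor D D'}
    (t : X.CellTree Λs u u' v v') (l : X.Cell Λs w w' Ξ) {Γs : HPath X.Hor A A'} {z : A ⟶ D}
    {z' : A' ⟶ D'} {κs : X.CellPath Λs v v'} (hκ : t.lower = κs) {Δs : HPath X.Hor B B'}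
    (hΔ : κs.top = Δs) {θs : X.CellPath Δs u u'}
    (hθ : t.upper = θs.cast (hΔ.symm.trans (congrArg _ hκ.symm)) rfl rfl)
    {x : B ⟶ D} {x' : B' ⟶ D'} (f : v ≫ w = x) (f' : v' ≫ w' = x')
    (hΓ : (X.treeComp t).top = Γs) (h : (u ≫ v) ≫ w = z) (h' : (u' ≫ v') ≫ w' = z') :
    X.comp (X.treeComp t) l hΓ h h' =
    X.comp θs (X.comp κs l hΔ f f')
      (by rw [← hΓ, X.top_treeComp, hθ, VDGraph.CellPath.top_cast])
      (by rw [← h, ← f, Category.assoc]) (by rw [← h', ← f', Category.assoc]) := by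
  subst hκ hΔ f f' h h' hΓ
  have hθ' : t.upper = θs := hθ
  subst hθ'
  exact assoc' t l _ _ _

theorem assoc_single {A A' B B' C C' D D' : X.Obj} {Δs : HPath X.Hor B B'}
    {Λ : X.Hor C C'} {Ξ : X.Hor D D'} {u : A ⟶ B} {u' : A' ⟶ B'}
    {v : B ⟶ C} {v' : B' ⟶ C'} {w : C ⟶ D} {w' : C' ⟶ D'} (θs : X.CellPath Δs u u')
    (κ : X.Cell Δs v v' Λ) (l : X.Cell (.single Λ) w w' Ξ)
    {Γs Γs' : HPath X.Hor A A'} {x : A ⟶ C} {x' : A' ⟶ C'} {z : A ⟶ D} {z' : A' ⟶ D'}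
    {y : B ⟶ D} {y' : B' ⟶ D'}
    (e : θs.top = Γs) (f : u ≫ v = x) (f' : u' ≫ v' = x')
    (g : v ≫ w = y) (g' : v' ≫ w' = y')
    (hΓ : Γs.append (.nil A') = Γs') (h : x ≫ w = z) (h' : x' ≫ w' = z') :
    X.comp (.single (X.comp θs κ e f f')) l hΓ h h' =
    X.comp θs (X.comp (.single κ) l (HPath.append_nil Δs) g g')
      (by rw [e, ← hΓ, HPath.append_nil])
      (by rw [← h, ← f, ← g, Category.assoc]) (by rw [← h', ← f', ← g', Category.assoc]) := by
  subst e f f' h h'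
  exact assoc_of (.cons θs κ (.nil u' v')) l rfl (HPath.append_nil Δs)
    (VDGraph.CellPath.append_nil θs) g g' hΓ rfl rfl

end VDC

namespace VDFunctor

variable {X Y Z W : VDC.{v}}

theorem cell_comp' (F : VDFunctor X Y) {A A' B B' C C' : X.Obj} {Δs : HPath X.Hor B B'} {u : A ⟶ B}
    {u' : A' ⟶ B'} (θs : X.CellPath Δs u u') {v : B ⟶ C} {v' : B' ⟶ C'} {Λ : X.Hor C C'}
    (κ : X.Cell Δs v v' Λ) {Γs : HPath X.Hor A A'} {w : A ⟶ C} {w' : A' ⟶ C'} (hΓ : θs.top = Γs)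
    (h : u ≫ v = w) (h' : u' ≫ v' = w') :
    F.cell (X.comp θs κ hΓ h h') = Y.comp (F.mapCells θs) (F.cell κ)
      ((F.top_mapCells θs).trans (congrArg F.path hΓ))
      ((F.vert.map_comp u v).symm.trans (congrArg F.vert.map h))
      ((F.vert.map_comp u' v').symm.trans (congrArg F.vert.map h')) := by
  subst hΓ h h'; exact F.cell_comp θs κ

theorem cell_cast (F : VDFunctor X Y) {A A' B B' : X.Obj} {Γs Γs' : HPath X.Hor A A'} {u w : A ⟶ B}
    {u' w' : A' ⟶ B'} {Δ : X.Hor B B'} (hΓ : Γs = Γs') (h : u = w) (h' : u' = w')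
    (θ : X.Cell Γs u u' Δ) :
    F.cell (X.cast hΓ h h' θ) = Y.cast (congrArg F.path hΓ) (congrArg F.vert.map h)
      (congrArg F.vert.map h') (F.cell θ) := by
  subst hΓ h h'; rfl

/-- Functors which agree on vertical and horizontal morphisms are equal once they agree on
multicells. -/
theorem ext_cell {F G : VDFunctor X Y} (hv : F.vert = G.vert)
    (hh : ∀ {A B : X.Obj} (Γ : X.Hor A B), HEq (F.hor Γ) (G.hor Γ))
    (hc : ∀ {A A' B B' : X.Obj} {Γs : HPath X.Hor A A'} {u : A ⟶ B} {u' : A' ⟶ B'}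
      {Δ : X.Hor B B'} (θ : X.Cell Γs u u' Δ), HEq (F.cell θ) (G.cell θ)) : F = G := by
  rcases F with ⟨⟨Fv, Fh, Fc⟩, _, _⟩
  rcases G with ⟨⟨Gv, Gh, Gc⟩, _, _⟩
  dsimp only at hv
  subst hv
  have e : @Fh = @Gh := by
    funext A B Γ
    exact eq_of_heq (hh Γ)
  subst e
  have e' : @Fc = @Gc := by
    funext A A' B B' Γs u u' Δ θ
    exact eq_of_heq (hc θ)
  subst e'
  rfl

/-- The identity virtual double functor. -/
def id (X : VDC.{v}) : VDFunctor X X where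
  vert := 𝟭 X.Obj
  hor Γ := Γ
  cell {A A' B B' Γs u u' Δ} θ := X.cast (HPath.map_id Γs).symm rfl rfl θ
  cell_id _ := rfl
  cell_comp := by
    intro A A' B B' C C' Δs u u' θs v v' Λ κ
    have key : ∀ {A A' B B' : X.Obj} {Δs : HPath X.Hor B B'} {u : A ⟶ B} {u' : A' ⟶ B'}
        (θs : X.CellPath Δs u u'),
        VDGraphHom.mapCells (X := X.toVDGraph) (Y := X.toVDGraph) ⟨𝟭 X.Obj, fun Γ => Γ,
          fun {A A' B B' Γs u u' Δ} θ => X.cast (HPath.map_id Γs).symm rfl rfl θ⟩ θs =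
        θs.cast (HPath.map_id Δs).symm rfl rfl := by
      intro A A' B B' Δs u u' θs
      induction θs with
      | nil u => rfl
      | cons θ θs ih =>
        simp only [VDGraphHom.mapCells]
        rw [ih]
        exact VDGraph.CellPath.cons_cast _ _ _ _
    simp only [key]
    rw [VDCData.cast_comp, VDCData.cast_path_comp]
    simp only [VDGraph.cast_cast, VDGraph.cast_rfl]

/-- Composition of virtual double functors. -/
def comp (F : VDFunctor X Y) (G : VDFunctor Y Z) : VDFunctor X Z where
  vert := F.vert ⋙ G.vert
  hor Γ := G.hor (F.hor Γ)
  cell {A A' B B' Γs u u' Δ} θ := Z.cast (HPath.map_map _ _ _ _ Γs) rfl rfl (G.cell (F.cell θ))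
  cell_id := by
    intro A B Γ
    have h : G.cell (F.cell (X.id Γ)) = Z.cast rfl
        ((G.vert.map_id (F.vert.obj A)).symm.trans (congrArg G.vert.map (F.vert.map_id A).symm))
        ((G.vert.map_id (F.vert.obj B)).symm.trans (congrArg G.vert.map (F.vert.map_id B).symm))
        (Z.id (G.hor (F.hor Γ))) := by
      rw [F.cell_id]
      refine (G.cell_cast _ _ _ _).trans ?_
      rw [G.cell_id]
      exact VDGraph.cast_cast _ _ _ _ _ _ _
    exact (congrArg _ h).trans (VDGraph.cast_cast _ _ _ _ _ _ _)
  cell_comp := by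
    intro A A' B B' C C' Δs u u' θs v v' Λ κ
    have key : ∀ {A A' B B' : X.Obj} {Δs : HPath X.Hor B B'} {u : A ⟶ B} {u' : A' ⟶ B'}
        (θs : X.CellPath Δs u u'),
        VDGraphHom.mapCells (X := X.toVDGraph) (Y := Z.toVDGraph) ⟨F.vert ⋙ G.vert,
          fun Γ => G.hor (F.hor Γ), fun {A A' B B' Γs u u' Δ} θ =>
            Z.cast (HPath.map_map _ _ _ _ Γs) rfl rfl (G.cell (F.cell θ))⟩ θs =
        (G.mapCells (F.mapCells θs)).cast (HPath.map_map _ _ _ _ Δs) rfl rfl := by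
      intro A A' B B' Δs u u' θs
      induction θs with
      | nil u => rfl
      | cons θ θs ih =>
        simp only [VDGraphHom.mapCells]
        rw [ih]
        exact VDGraph.CellPath.cons_cast _ _ _ _
    simp only [key, F.cell_comp, G.cell_comp']
    rw [VDCData.cast_comp, VDCData.cast_path_comp]
    simp only [VDGraph.cast_cast, VDGraph.cast_rfl]

theorem mapCells_comp (F : VDFunctor X Y) (G : VDFunctor Y Z) {A A' B B' : X.Obj}
    {Δs : HPath X.Hor B B'} {u : A ⟶ B} {u' : A' ⟶ B'} (θs : X.CellPath Δs u u') :
    (F.comp G).mapCells θs =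
      (G.mapCells (F.mapCells θs)).cast (HPath.map_map _ _ _ _ Δs) rfl rfl := by
  induction θs with
  | nil u => rfl
  | cons θ θs ih =>
    simp only [VDGraphHom.mapCells]
    rw [ih]
    exact VDGraph.CellPath.cons_cast _ _ _ _

theorem cell_heq {Y : VDC.{v}} {F : VDFunctor X Y} {A A' B B' : X.Obj} {Γs Γs' : HPath X.Hor A A'}
    {u w : A ⟶ B} {u' w' : A' ⟶ B'} {Δ : X.Hor B B'} {θ : X.Cell Γs u u' Δ}
    {θ' : X.Cell Γs' w w' Δ} (hΓ : Γs = Γs') (h : u = w) (h' : u' = w') (hθ : HEq θ θ') :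
    HEq (F.cell θ) (F.cell θ') := by
  subst hΓ h h'; rw [eq_of_heq hθ]

theorem heq_cast {A A' B B' : X.Obj} {Γs Γs' : HPath X.Hor A A'} {u w : A ⟶ B}
    {u' w' : A' ⟶ B'} {Δ : X.Hor B B'} (hΓ : Γs = Γs') (h : u = w) (h' : u' = w')
    (θ : X.Cell Γs u u' Δ) : HEq (X.cast hΓ h h' θ) θ := by
  subst hΓ h h'; rfl

theorem id_cell_heq {A A' B B' : X.Obj} {Γs : HPath X.Hor A A'} {u : A ⟶ B} {u' : A' ⟶ B'}
    {Δ : X.Hor B B'} (θ : X.Cell Γs u u' Δ) : HEq ((id X).cell θ) θ :=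
  heq_cast (HPath.map_id Γs).symm rfl rfl θ

theorem comp_cell (F : VDFunctor X Y) (G : VDFunctor Y Z) {A A' B B' : X.Obj}
    {Γs : HPath X.Hor A A'} {u : A ⟶ B} {u' : A' ⟶ B'} {Δ : X.Hor B B'}
    (θ : X.Cell Γs u u' Δ) :
    (F.comp G).cell θ = Z.cast (HPath.map_map _ _ _ _ Γs) rfl rfl (G.cell (F.cell θ)) := rfl

theorem comp_cell_heq (F : VDFunctor X Y) (G : VDFunctor Y Z) {A A' B B' : X.Obj}
    {Γs : HPath X.Hor A A'} {u : A ⟶ B} {u' : A' ⟶ B'} {Δ : X.Hor B B'}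
    (θ : X.Cell Γs u u' Δ) : HEq ((F.comp G).cell θ) (G.cell (F.cell θ)) :=
  heq_cast (X := Z) (HPath.map_map _ _ _ _ Γs) rfl rfl (G.cell (F.cell θ))

theorem id_comp (F : VDFunctor X Y) : (id X).comp F = F :=
  ext_cell rfl (fun _ => HEq.rfl) fun θ => (comp_cell_heq _ _ θ).trans
    (cell_heq (HPath.map_id _) rfl rfl (id_cell_heq θ))

theorem comp_id (F : VDFunctor X Y) : F.comp (id Y) = F :=
  ext_cell rfl (fun _ => HEq.rfl) fun θ => (comp_cell_heq _ _ θ).trans (id_cell_heq _)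

theorem assoc (F : VDFunctor X Y) (G : VDFunctor Y Z) (H : VDFunctor Z W) :
    (F.comp G).comp H = F.comp (G.comp H) :=
  ext_cell rfl (fun _ => HEq.rfl) fun {_ _ _ _ Γs _ _ _} θ => (comp_cell_heq _ _ θ).trans
    ((cell_heq (HPath.map_map _ _ _ _ Γs).symm rfl rfl (comp_cell_heq F G θ)).trans
      ((comp_cell_heq F (G.comp H) θ).trans (comp_cell_heq G H (F.cell θ))).symm)

end VDFunctor

/-! ### Vertical transformations and the 2-category of virtual double categories -/

/-- The data of a vertical transformation: a natural transformation between the vertical parts, and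
a cell for each horizontal morphism. -/
structure VDTransData {X Y : VDC.{v}} (F G : VDFunctor X Y) where
  vert : F.vert ⟶ G.vert
  cell : ∀ {A B : X.Obj} (Γ : X.Hor A B),
    Y.Cell (.single (F.hor Γ)) (vert.app A) (vert.app B) (G.hor Γ)

namespace VDTransData

variable {X Y : VDC.{v}} {F G : VDFunctor X Y} (α : VDTransData F G)

/-- The sequence of component cells along a path of horizontal morphisms. -/
def cells : ∀ {A B : X.Obj} (Γs : HPath X.Hor A B),
    Y.CellPath (G.path Γs) (α.vert.app A) (α.vert.app B)
  | _, _, .nil A => .nil (α.vert.app A)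
  | _, _, .cons Γ Γs => .cons (α.cell Γ) (cells Γs)

theorem top_cells : ∀ {A B : X.Obj} (Γs : HPath X.Hor A B), (α.cells Γs).top = F.path Γs
  | _, _, .nil _ => rfl
  | _, _, .cons Γ Γs => congrArg (HPath.cons (F.hor Γ)) (top_cells Γs)

end VDTransData

/-- A vertical transformation between virtual double functors. -/
structure VDTrans {X Y : VDC.{v}} (F G : VDFunctor X Y) extends VDTransData F G where
  naturality : ∀ {A A' B B' : X.Obj} {Γs : HPath X.Hor A A'} {u : A ⟶ B} {u' : A' ⟶ B'}
    {Δ : X.Hor B B'} (θ : X.Cell Γs u u' Δ),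
    Y.comp (.single (F.cell θ)) (cell Δ) (HPath.append_nil _) rfl rfl =
      Y.comp (toVDTransData.cells Γs) (G.cell θ) (toVDTransData.top_cells Γs)
        (vert.naturality u).symm (vert.naturality u').symm

namespace VDTrans

variable {X Y Z W : VDC.{v}}

theorem ext' {F G : VDFunctor X Y} {α β : VDTrans F G} (hv : ∀ A, α.vert.app A = β.vert.app A)
    (hc : ∀ {A B : X.Obj} (Γ : X.Hor A B),
      α.cell Γ = Y.cast rfl (hv A).symm (hv B).symm (β.cell Γ)) : α = β := by
  rcases α with ⟨⟨αv, αc⟩, _⟩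
  rcases β with ⟨⟨βv, βc⟩, _⟩
  have e : αv = βv := by
    ext A; exact hv A
  subst e
  have e' : @αc = @βc := by
    funext A B Γ
    exact hc Γ
  subst e'
  rfl

theorem naturality' {F G : VDFunctor X Y} (α : VDTrans F G)
    {A A' B B' : X.Obj} {Γs : HPath X.Hor A A'} {u : A ⟶ B} {u' : A' ⟶ B'}
    {Δ : X.Hor B B'} (θ : X.Cell Γs u u' Δ) {Γs' : HPath Y.Hor (F.vert.obj A) (F.vert.obj A')}
    {w : F.vert.obj A ⟶ G.vert.obj B} {w' : F.vert.obj A' ⟶ G.vert.obj B'}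
    (hΓ : (F.path Γs).append (.nil _) = Γs') (h : F.vert.map u ≫ α.vert.app B = w)
    (h' : F.vert.map u' ≫ α.vert.app B' = w') :
    Y.comp (.single (F.cell θ)) (α.cell Δ) hΓ h h' =
      Y.comp (α.cells Γs) (G.cell θ)
        ((α.top_cells Γs).trans ((HPath.append_nil _).symm.trans hΓ))
        ((α.vert.naturality u).symm.trans h) ((α.vert.naturality u').symm.trans h') := by
  subst h h'
  have e : F.path Γs = Γs' := (HPath.append_nil _).symm.trans hΓ
  subst e
  exact α.naturality θ

/-- The identity vertical transformation. -/
def id (F : VDFunctor X Y) : VDTrans F F where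
  vert := 𝟙 F.vert
  cell Γ := Y.id (F.hor Γ)
  naturality := by
    intro A A' B B' Γs u u' Δ θ
    have key : ∀ {A B : X.Obj} (Γs : HPath X.Hor A B),
        VDTransData.cells (F := F) (G := F) ⟨𝟙 F.vert, fun Γ => Y.id (F.hor Γ)⟩ Γs = Y.ids _ := by
      intro A B Γs
      induction Γs with
      | nil A => rfl
      | cons Γ Γs ih =>
        simp only [VDTransData.cells]
        rw [ih]
        rfl
    simp only [key]
    exact (Y.comp_id' _ _ _ _).trans (Y.id_comp' _ _ _ _).symm

/-- Two-level configuration given by the components of two composable vertical transformations. -/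
def tree {F G H : VDFunctor X Y} (α : VDTransData F G) (β : VDTransData G H) :
    ∀ {A B : X.Obj} (Γs : HPath X.Hor A B), Y.CellTree (H.path Γs) (α.vert.app A) (α.vert.app B)
      (β.vert.app A) (β.vert.app B)
  | _, _, .nil A => .nil (α.vert.app A) (β.vert.app A)
  | _, _, .cons Γ Γs => .cons (.single (α.cell Γ)) (β.cell Γ) (tree α β Γs)

theorem tree_lower {F G H : VDFunctor X Y} (α : VDTransData F G) (β : VDTransData G H) :
    ∀ {A B : X.Obj} (Γs : HPath X.Hor A B), (tree α β Γs).lower = β.cells Γs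
  | _, _, .nil A => rfl
  | _, _, .cons Γ Γs => congrArg (VDGraph.CellPath.cons (β.cell Γ)) (tree_lower α β Γs)

theorem tree_upper {F G H : VDFunctor X Y} (α : VDTransData F G) (β : VDTransData G H) :
    ∀ {A B : X.Obj} (Γs : HPath X.Hor A B), (tree α β Γs).upper = (α.cells Γs).cast
      ((β.top_cells Γs).symm.trans (congrArg _ (tree_lower α β Γs).symm)) rfl rfl
  | _, _, .nil A => rfl
  | _, _, .cons Γ Γs =>
    (congrArg (VDGraph.CellPath.cons (α.cell Γ)) (tree_upper α β Γs)).trans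
      (VDGraph.CellPath.cons_cast rfl _ _ _)

/-- Composition of vertical transformations. -/
def comp {F G H : VDFunctor X Y} (α : VDTrans F G) (β : VDTrans G H) : VDTrans F H where
  vert := α.vert ≫ β.vert
  cell Γ := Y.comp (.single (α.cell Γ)) (β.cell Γ) rfl rfl rfl
  naturality := by
    intro A A' B B' Γs u u' Δ θ
    have key : ∀ {A B : X.Obj} (Γs : HPath X.Hor A B),
        VDTransData.cells (F := F) (G := H) ⟨α.vert ≫ β.vert, fun Γ =>
          Y.comp (.single (α.cell Γ)) (β.cell Γ) rfl rfl rfl⟩ Γs =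
          Y.treeComp (tree α.toVDTransData β.toVDTransData Γs) := by
      intro A B Γs
      induction Γs with
      | nil A => rfl
      | cons Γ Γs ih =>
        simp only [VDTransData.cells]
        rw [ih]
        rfl
    simp only [key]
    refine Eq.trans ?_ (VDC.assoc_of (tree α.toVDTransData β.toVDTransData Γs) (H.cell θ)
      (tree_lower _ _ Γs) (β.top_cells Γs) (tree_upper _ _ Γs) (β.vert.naturality u).symm
      (β.vert.naturality u').symm _ _ _).symm
    rw [← β.naturality θ]
    refine Eq.trans ?_ (VDC.assoc_single (α.cells Γs) (G.cell θ) (β.cell Δ) (α.top_cells Γs)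
      (α.vert.naturality u).symm (α.vert.naturality u').symm rfl rfl
      (HPath.append_nil _) (Category.assoc _ _ _) (Category.assoc _ _ _))
    rw [← α.naturality θ]
    exact (VDC.assoc_single (.single (F.cell θ)) (α.cell Δ) (β.cell Δ) (HPath.append_nil _)
      rfl rfl rfl rfl (HPath.append_nil _) (Category.assoc _ _ _) (Category.assoc _ _ _)).symm

/-- Whiskering of a vertical transformation by a virtual double functor on the left. -/
def whiskerLeft (F : VDFunctor X Y) {G H : VDFunctor Y Z} (α : VDTrans G H) :
    VDTrans (F.comp G) (F.comp H) where
  vert := Functor.whiskerLeft F.vert α.vert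
  cell Γ := α.cell (F.hor Γ)
  naturality := by
    intro A A' B B' Γs u u' Δ θ
    have key : ∀ {A B : X.Obj} (Γs : HPath X.Hor A B),
        VDTransData.cells (F := F.comp G) (G := F.comp H) ⟨Functor.whiskerLeft F.vert α.vert,
          fun Γ => α.cell (F.hor Γ)⟩ Γs =
          (α.cells (F.path Γs)).cast (HPath.map_map _ _ _ _ Γs) rfl rfl := by
      intro A B Γs
      induction Γs with
      | nil A => rfl
      | cons Γ Γs ih =>
        simp only [VDTransData.cells]
        rw [ih]
        exact VDGraph.CellPath.cons_cast rfl _ _ _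
    simp only [key]
    refine Eq.trans ?_ (VDCData.cast_path_comp _ _ _ _ _ _ _ _ _).symm
    refine (VDCData.comp_single_cast Z.toVDCData (G.cell (F.cell θ)) (α.cell (F.hor Δ))
      (HPath.map_map _ _ _ _ Γs) rfl rfl _ _ _).trans ?_
    refine (α.naturality' (F.cell θ) _ _ _).trans ?_
    refine congrArg (fun κ => Z.comp _ κ _ _ _) ?_
    exact (eq_of_heq ((VDFunctor.heq_cast (X := Z) _ _ _ _).trans
      (VDFunctor.comp_cell_heq F H θ))).symm

/-- Whiskering of a vertical transformation by a virtual double functor on the right. -/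
def whiskerRight {F G : VDFunctor X Y} (α : VDTrans F G) (H : VDFunctor Y Z) :
    VDTrans (F.comp H) (G.comp H) where
  vert := Functor.whiskerRight α.vert H.vert
  cell Γ := H.cell (α.cell Γ)
  naturality := by
    intro A A' B B' Γs u u' Δ θ
    have key : ∀ {A B : X.Obj} (Γs : HPath X.Hor A B),
        VDTransData.cells (F := F.comp H) (G := G.comp H) ⟨Functor.whiskerRight α.vert H.vert,
          fun Γ => H.cell (α.cell Γ)⟩ Γs =
          (H.mapCells (α.cells Γs)).cast (HPath.map_map _ _ _ _ Γs) rfl rfl := by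
      intro A B Γs
      induction Γs with
      | nil A => rfl
      | cons Γ Γs ih =>
        simp only [VDTransData.cells]
        rw [ih]
        exact VDGraph.CellPath.cons_cast rfl _ _ _
    simp only [key]
    refine Eq.trans ?_ (VDCData.cast_path_comp _ _ _ _ _ _ _ _ _).symm
    refine (VDCData.comp_single_cast Z.toVDCData (H.cell (F.cell θ)) (H.cell (α.cell Δ))
      (HPath.map_map _ _ _ _ Γs) rfl rfl _ _ _).trans ?_
    have h := (H.cell_comp' (VDGraph.CellPath.single (F.cell θ)) (α.cell Δ)
      (HPath.append_nil _) rfl rfl).symm.trans ((congrArg H.cell (α.naturality θ)).trans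
      (H.cell_comp' _ _ _ _ _))
    have h2 := congrArg (Z.cast (HPath.map_map _ _ _ _ Γs)
      ((H.vert.map_comp _ _)) ((H.vert.map_comp _ _))) h
    rw [VDCData.cast_comp, VDCData.cast_comp] at h2
    refine Eq.trans h2 ?_
    refine congrArg (fun κ => Z.comp _ κ _ _ _) ?_
    exact (eq_of_heq ((VDFunctor.heq_cast (X := Z) _ _ _ _).trans
      (VDFunctor.comp_cell_heq G H θ))).symm

end VDTrans

instance VDFunctor.category (X Y : VDC.{v}) : Category (VDFunctor X Y) where
  Hom F G := VDTrans F G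
  id F := VDTrans.id F
  comp α β := VDTrans.comp α β
  id_comp α := VDTrans.ext' (fun _ => Category.id_comp _)
    (fun Γ => Y.id_comp' (α.cell Γ) rfl rfl rfl)
  comp_id α := VDTrans.ext' (fun _ => Category.comp_id _)
    (fun Γ => Y.comp_id' (α.cell Γ) rfl rfl rfl)
  assoc α β γ := VDTrans.ext' (fun _ => Category.assoc _ _ _)
    (fun Γ => (VDC.assoc_single (.single (α.cell Γ)) (β.cell Γ) (γ.cell Γ) rfl rfl rfl rfl rfl
      rfl rfl rfl).trans (VDCData.cast_comp _ _ _ _ _ _ _ _ _).symm)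

namespace VDTrans

variable {X Y Z W : VDC.{v}}

theorem eqToHom_app {F G : VDFunctor X Y} (e : F = G) (A : X.Obj) :
    (eqToHom e : VDTrans F G).vert.app A = eqToHom (congrArg (fun K => K.vert.obj A) e) := by
  subst e; rfl

theorem comp_app {F G H : VDFunctor X Y} (α : F ⟶ G) (β : G ⟶ H) (A : X.Obj) :
    (α ≫ β).vert.app A = α.vert.app A ≫ β.vert.app A := rfl

theorem comp_cell {F G H : VDFunctor X Y} (α : F ⟶ G) (β : G ⟶ H) {A B : X.Obj} (Γ : X.Hor A B) :
    (α ≫ β).cell Γ = Y.comp (.single (α.cell Γ)) (β.cell Γ) rfl rfl rfl := rfl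

theorem eqToHom_cell {V : X.Obj ⥤ Y.Obj} {h : ∀ {A B : X.Obj}, X.Hor A B → Y.Hor (V.obj A) (V.obj B)}
    {c c' : _} {p : _} {q : _} {p' : _} {q' : _}
    (e : (⟨⟨V, h, c⟩, p, q⟩ : VDFunctor X Y) = ⟨⟨V, h, c'⟩, p', q'⟩) {A B : X.Obj} (Γ : X.Hor A B) :
    (eqToHom e : VDTrans _ _).cell Γ =
      Y.cast rfl (eqToHom_app e A).symm (eqToHom_app e B).symm (Y.id (h Γ)) := by
  have e' : @c = @c' := by
    injection e with e1
    injection e1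
  subst e'
  rfl

end VDTrans


namespace VDTrans

variable {X Y Z W : VDC.{v}}

theorem whiskerLeft_eqToHom (F : VDFunctor X Y) {G H : VDFunctor Y Z} (e : G = H) :
    whiskerLeft F (eqToHom e) = eqToHom (congrArg F.comp e) := by
  subst e; rfl

theorem id_whiskerRight (F : VDFunctor X Y) (G : VDFunctor Y Z) :
    whiskerRight (𝟙 F) G = 𝟙 (F.comp G) :=
  ext' (fun _ => G.vert.map_id _) (fun _ => G.cell_id _)

theorem eqToHom_whiskerRight {F G : VDFunctor X Y} (e : F = G) (H : VDFunctor Y Z) :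
    whiskerRight (eqToHom e) H = eqToHom (congrArg (fun K => VDFunctor.comp K H) e) := by
  subst e; exact id_whiskerRight F H

/-- Conjugating by equalities between functors with the same vertical and horizontal parts does not
change components. -/
theorem conj_eq {V V' : X.Obj ⥤ Y.Obj}
    {h : ∀ {A B : X.Obj}, X.Hor A B → Y.Hor (V.obj A) (V.obj B)}
    {h' : ∀ {A B : X.Obj}, X.Hor A B → Y.Hor (V'.obj A) (V'.obj B)}
    {c d : _} {c' d' : _} {p : _} {q : _} {p' : _} {q' : _} {r : _} {s : _} {r' : _} {s' : _}
    (α : VDTrans (⟨⟨V, h, c⟩, p, q⟩ : VDFunctor X Y) ⟨⟨V', h', c'⟩, p', q'⟩)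
    (β : VDTrans (⟨⟨V, h, d⟩, r, s⟩ : VDFunctor X Y) ⟨⟨V', h', d'⟩, r', s'⟩)
    (e : (⟨⟨V, h, c⟩, p, q⟩ : VDFunctor X Y) = ⟨⟨V, h, d⟩, r, s⟩)
    (e' : (⟨⟨V', h', d'⟩, r', s'⟩ : VDFunctor X Y) = ⟨⟨V', h', c'⟩, p', q'⟩)
    (hv : α.vert = β.vert)
    (hc : ∀ {A B : X.Obj} (Γ : X.Hor A B), HEq (α.cell Γ) (β.cell Γ)) :
    α = eqToHom e ≫ β ≫ eqToHom e' := by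
  have e1 : @c = @d := by
    injection e with e1
    injection e1
  have e2 : @d' = @c' := by
    injection e' with e1
    injection e1
  subst e1 e2
  rw [eqToHom_refl, eqToHom_refl, Category.id_comp, Category.comp_id]
  rcases α with ⟨⟨αv, αc⟩, _⟩
  rcases β with ⟨⟨βv, βc⟩, _⟩
  dsimp only at hv
  subst hv
  have e' : @αc = @βc := by
    funext A B Γ
    exact eq_of_heq (hc Γ)
  subst e'
  rfl

end VDTrans

instance VDC.bicategory : Bicategory.{v, v} VDC.{v} where
  Hom X Y := VDFunctor X Y
  id X := VDFunctor.id X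
  comp F G := F.comp G
  homCategory X Y := VDFunctor.category X Y
  whiskerLeft F _ _ α := VDTrans.whiskerLeft F α
  whiskerRight α H := VDTrans.whiskerRight α H
  associator F G H := eqToIso (VDFunctor.assoc F G H)
  leftUnitor F := eqToIso (VDFunctor.id_comp F)
  rightUnitor F := eqToIso (VDFunctor.comp_id F)
  whiskerLeft_id _ _ := rfl
  whiskerLeft_comp _ _ _ _ _ _ := rfl
  id_whiskerLeft {_ _ F G} η := VDTrans.conj_eq _ _ (VDFunctor.id_comp F)
    (VDFunctor.id_comp G).symm rfl (fun _ => HEq.rfl)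
  comp_whiskerLeft F G H H' _ := VDTrans.conj_eq _ _ (VDFunctor.assoc F G H)
    (VDFunctor.assoc F G H').symm rfl (fun _ => HEq.rfl)
  id_whiskerRight F G := VDTrans.id_whiskerRight F G
  comp_whiskerRight α β G := VDTrans.ext' (fun _ => G.vert.map_comp _ _)
    (fun _ => (G.cell_comp' _ _ _ _ _).trans (VDCData.cast_comp _ _ _ _ _ _ _ _ _).symm)
  whiskerRight_id {_ _ F G} η := VDTrans.conj_eq _ _ (VDFunctor.comp_id F)
    (VDFunctor.comp_id G).symm rfl (fun Γ => VDFunctor.id_cell_heq (η.cell Γ))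
  whiskerRight_comp {_ _ _ _ F F'} η G H := VDTrans.conj_eq _ _
    (VDFunctor.assoc F G H).symm (VDFunctor.assoc F' G H) rfl
    (fun Γ => VDFunctor.comp_cell_heq G H (η.cell Γ))
  whisker_assoc F G G' _ H := VDTrans.conj_eq _ _ (VDFunctor.assoc F G H)
    (VDFunctor.assoc F G' H).symm rfl (fun _ => HEq.rfl)
  whisker_exchange {X Y Z F G H K} α β := VDTrans.ext' (fun _ => (β.vert.naturality _).symm)
    (fun Γ => by
      refine Eq.trans ?_ (congrArg (VDGraph.cast (X := Z.toVDGraph) _ _ _)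
        (β.naturality' (α.cell Γ) rfl rfl rfl).symm)
      exact (VDCData.cast_comp _ _ _ _ _ _ _ _ _).symm)
  pentagon F G H K := by
    simp only [eqToIso.hom, VDTrans.whiskerLeft_eqToHom, VDTrans.eqToHom_whiskerRight,
      eqToHom_trans]
  triangle F G := by
    simp only [eqToIso.hom, VDTrans.whiskerLeft_eqToHom, VDTrans.eqToHom_whiskerRight,
      eqToHom_trans]

instance : Bicategory.Strict VDC.{v} where
  id_comp F := VDFunctor.id_comp F
  comp_id F := VDFunctor.comp_id F
  assoc F G H := VDFunctor.assoc F G H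
  leftUnitor_eqToIso _ := rfl
  rightUnitor_eqToIso _ := rfl
  associator_eqToIso _ _ _ := rfl

/-! ### Strict 2-categories

Strict 2-categories are bicategories satisfying `Bicategory.Strict`; 2-functors between them are
`StrictPseudofunctor`s. -/

namespace TwoCat

open Bicategory

universe w₁ w₂ v₁ v₂ u₁ u₂

section Slice

variable {K : Type u₁} [Bicategory.{w₁, v₁} K]

/-- Objects of the strict slice 2-category `K/X`. -/
structure Slice (X : K) where
  dom : K
  arr : dom ⟶ X

namespace Slice

variable {X Y : K}

/-- A 1-cell of `K/X`: a strictly commuting triangle. -/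
@[ext]
structure Hom (P Q : Slice X) where
  hom : P.dom ⟶ Q.dom
  w : hom ≫ Q.arr = P.arr

/-- A 2-cell of `K/X`: a 2-cell of `K` whose whiskering with the projection to `X` is an
identity. -/
@[ext]
structure Hom₂ {P Q : Slice X} (f g : Hom P Q) where
  hom : f.hom ⟶ g.hom
  w : hom ▷ Q.arr = eqToHom (f.w.trans g.w.symm)

instance homCategory (P Q : Slice X) : Category (Hom P Q) where
  Hom f g := Hom₂ f g
  id f := ⟨𝟙 f.hom, by simp⟩
  comp α β := ⟨α.hom ≫ β.hom, by simp [α.w, β.w]⟩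
  id_comp α := Hom₂.ext (Category.id_comp α.hom)
  comp_id α := Hom₂.ext (Category.comp_id α.hom)
  assoc α β γ := Hom₂.ext (Category.assoc α.hom β.hom γ.hom)

theorem comp_hom {P Q : Slice X} {f g h : Hom P Q} (α : f ⟶ g) (β : g ⟶ h) :
    (α ≫ β).hom = α.hom ≫ β.hom := rfl

theorem id_hom {P Q : Slice X} (f : Hom P Q) : (𝟙 f : f ⟶ f).hom = 𝟙 f.hom := rfl

theorem eqToHom_hom {P Q : Slice X} {f g : Hom P Q} (e : f = g) :
    (eqToHom e : f ⟶ g).hom = eqToHom (congrArg Hom.hom e) := by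
  subst e; rfl

theorem whiskerRight_congr {A B C : K} {f g : A ⟶ B} (η : f ⟶ g) {h k : B ⟶ C} (e : h = k) :
    η ▷ h = eqToHom (by rw [e]) ≫ η ▷ k ≫ eqToHom (by rw [e]) := by
  subst e; simp

variable [Strict K]

/-- The strict slice 2-category `K/X`. -/
instance bicategory (X : K) : Bicategory.{w₁, v₁} (Slice X) where
  Hom P Q := Hom P Q
  id P := ⟨𝟙 P.dom, Strict.id_comp P.arr⟩
  comp {P Q R} f g := ⟨f.hom ≫ g.hom, by rw [Strict.assoc, g.w, f.w]⟩
  homCategory P Q := homCategory P Q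
  whiskerLeft f _ _ η := ⟨f.hom ◁ η.hom, by
    simp [Strict.associator_eqToIso, η.w]⟩
  whiskerRight {P Q R f g} η h := ⟨η.hom ▷ h.hom, by
    have h1 : η.hom ▷ h.hom ▷ R.arr =
        (α_ _ _ _).hom ≫ η.hom ▷ (h.hom ≫ R.arr) ≫ (α_ _ _ _).inv := by simp
    rw [h1, whiskerRight_congr η.hom h.w, η.w]
    simp [Strict.associator_eqToIso]⟩
  associator f g h := eqToIso (Hom.ext (Strict.assoc f.hom g.hom h.hom))
  leftUnitor f := eqToIso (Hom.ext (Strict.id_comp f.hom))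
  rightUnitor f := eqToIso (Hom.ext (Strict.comp_id f.hom))
  whiskerLeft_id f g := Hom₂.ext (whiskerLeft_id f.hom g.hom)
  whiskerLeft_comp f _ _ _ η θ := Hom₂.ext (whiskerLeft_comp f.hom η.hom θ.hom)
  id_whiskerLeft η := Hom₂.ext (by
    simp [comp_hom, eqToHom_hom, Strict.leftUnitor_eqToIso])
  comp_whiskerLeft f g _ _ η := Hom₂.ext (by
    simp [comp_hom, eqToHom_hom, Strict.associator_eqToIso])
  id_whiskerRight f g := Hom₂.ext (id_whiskerRight f.hom g.hom)
  comp_whiskerRight η θ g := Hom₂.ext (comp_whiskerRight η.hom θ.hom g.hom)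
  whiskerRight_id η := Hom₂.ext (by
    simp [comp_hom, eqToHom_hom, Strict.rightUnitor_eqToIso])
  whiskerRight_comp η f g := Hom₂.ext (by
    simp [comp_hom, eqToHom_hom, Strict.associator_eqToIso])
  whisker_assoc f _ _ η g := Hom₂.ext (by
    simp [comp_hom, eqToHom_hom, Strict.associator_eqToIso])
  whisker_exchange η θ := Hom₂.ext (whisker_exchange η.hom θ.hom)
  pentagon f g h i := Hom₂.ext (by
    simp [comp_hom, eqToHom_hom])
  triangle f g := Hom₂.ext (by
    simp [comp_hom, eqToHom_hom])

instance strict (X : K) : Strict (Slice X) where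
  id_comp f := Hom.ext (Strict.id_comp f.hom)
  comp_id f := Hom.ext (Strict.comp_id f.hom)
  assoc f g h := Hom.ext (Strict.assoc f.hom g.hom h.hom)
  leftUnitor_eqToIso _ := rfl
  rightUnitor_eqToIso _ := rfl
  associator_eqToIso _ _ _ := rfl

theorem hom₂_comp {P Q : Slice X} {f g h : P ⟶ Q} (α : f ⟶ g) (β : g ⟶ h) :
    Hom₂.hom (α ≫ β) = Hom₂.hom α ≫ Hom₂.hom β := rfl

theorem hom₂_eqToHom {P Q : Slice X} {f g : P ⟶ Q} (e : f = g) :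
    Hom₂.hom (eqToHom e) = eqToHom (congrArg Hom.hom e) := by
  subst e; rfl

theorem hom₂_whiskerLeft {P Q R : Slice X} (f : P ⟶ Q) {g h : Q ⟶ R} (α : g ⟶ h) :
    Hom₂.hom (f ◁ α) = Hom.hom f ◁ Hom₂.hom α := rfl

theorem hom₂_whiskerRight {P Q R : Slice X} {f g : P ⟶ Q} (α : f ⟶ g) (h : Q ⟶ R) :
    Hom₂.hom (α ▷ h) = Hom₂.hom α ▷ Hom.hom h := rfl

/-- The forgetful 2-functor `K/X → K`. -/
def forget (X : K) : StrictPseudofunctor (Slice X) K := StrictPseudofunctor.mk''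
  { obj := fun P => P.dom
    map := fun f => f.hom
    map₂ := fun η => η.hom
    map₂_id := fun _ => rfl
    map₂_comp := fun _ _ => rfl
    map_id := fun _ => rfl
    map_comp := fun _ _ => rfl
    map₂_whisker_left := fun f _ _ η => by simp; rfl
    map₂_whisker_right := fun η g => by simp; rfl }

/-- The 2-functor `Σ_t : K/X → K/Y` given by composition with `t : X ⟶ Y`. -/
def sum (t : X ⟶ Y) : StrictPseudofunctor (Slice X) (Slice Y) := StrictPseudofunctor.mk''
  { obj := fun P => ⟨P.dom, P.arr ≫ t⟩
    map := fun f => ⟨f.hom, by rw [← Strict.assoc, f.w]⟩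
    map₂ := fun {P Q f g} η => ⟨η.hom, by
      have h1 : η.hom ▷ (Q.arr ≫ t) =
          (α_ _ _ _).inv ≫ η.hom ▷ Q.arr ▷ t ≫ (α_ _ _ _).hom := by simp
      rw [h1, η.w]
      simp [Strict.associator_eqToIso]⟩
    map₂_id := fun _ => rfl
    map₂_comp := fun _ _ => rfl
    map_id := fun _ => rfl
    map_comp := fun _ _ => rfl
    map₂_whisker_left := fun f _ _ η => by simp; rfl
    map₂_whisker_right := fun η g => by simp; rfl }

end Slice

end Slice

section Adjunction

variable {K : Type u₁} [Bicategory.{w₁, v₁} K] {L : Type u₂} [Bicategory.{w₂, v₂} L]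

/-- Strictly 2-natural transformations between 2-functors. -/
structure TwoNatTrans (F G : StrictPseudofunctor K L) where
  app : ∀ X : K, F.obj X ⟶ G.obj X
  naturality : ∀ {X Y : K} (f : X ⟶ Y), F.map f ≫ app Y = app X ≫ G.map f
  naturality₂ : ∀ {X Y : K} {f g : X ⟶ Y} (η : f ⟶ g),
    F.map₂ η ▷ app Y =
      eqToHom (naturality f) ≫ app X ◁ G.map₂ η ≫ eqToHom (naturality g).symm

/-- 2-natural isomorphisms between 2-functors. -/
structure TwoNatIso (F G : StrictPseudofunctor K L) where
  hom : TwoNatTrans F G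
  inv : TwoNatTrans G F
  hom_inv : ∀ X, hom.app X ≫ inv.app X = 𝟙 (F.obj X)
  inv_hom : ∀ X, inv.app X ≫ hom.app X = 𝟙 (G.obj X)

/-- A 2-adjunction `F ⊣ G` between 2-functors, given by 2-natural unit and counit satisfying the
triangle identities. -/
structure TwoAdjunction (F : StrictPseudofunctor K L) (G : StrictPseudofunctor L K) where
  unit : TwoNatTrans (StrictPseudofunctor.id K) (F.comp G)
  counit : TwoNatTrans (G.comp F) (StrictPseudofunctor.id L)
  left_triangle : ∀ X : K, F.map (unit.app X) ≫ counit.app (F.obj X) = 𝟙 (F.obj X)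
  right_triangle : ∀ Y : L, unit.app (G.obj Y) ≫ G.map (counit.app Y) = 𝟙 (G.obj Y)

/-- The property of being a right 2-adjoint. -/
def IsRightTwoAdjoint (G : StrictPseudofunctor L K) : Prop :=
  ∃ F : StrictPseudofunctor K L, Nonempty (TwoAdjunction F G)

/-- An isomorphism 1-cell in a 2-category. -/
def IsIsoCell {X Y : K} (f : X ⟶ Y) : Prop :=
  ∃ g : Y ⟶ X, f ≫ g = 𝟙 X ∧ g ≫ f = 𝟙 Y

end Adjunction

section Limits

variable {K : Type u₁} [Bicategory.{w₁, v₁} K]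

/-- A terminal object of a 2-category: each hom-category into it is terminal. -/
structure IsTwoTerminal (T : K) where
  toT : ∀ X : K, X ⟶ T
  uniq : ∀ {X : K} (f g : X ⟶ T), f = g
  uniq₂ : ∀ {X : K} {f g : X ⟶ T} (η θ : f ⟶ g), η = θ

variable [Strict K]

/-- A commuting square is a 2-pullback if it satisfies the universal property of the pullback for
1-cells and for 2-cells. -/
structure IsTwoPullback {P A B C : K} (p₁ : P ⟶ A) (p₂ : P ⟶ B) (f : A ⟶ C) (g : B ⟶ C) :
    Prop where
  w : p₁ ≫ f = p₂ ≫ g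
  existsUnique : ∀ {W : K} (a : W ⟶ A) (b : W ⟶ B), a ≫ f = b ≫ g →
    ∃! l : W ⟶ P, l ≫ p₁ = a ∧ l ≫ p₂ = b
  existsUnique₂ : ∀ {W : K} (l l' : W ⟶ P) (α : l ≫ p₁ ⟶ l' ≫ p₁) (β : l ≫ p₂ ⟶ l' ≫ p₂),
    α ▷ f = eqToHom (by rw [Strict.assoc, w, ← Strict.assoc]) ≫ β ▷ g ≫
      eqToHom (by rw [Strict.assoc, ← w, ← Strict.assoc]) →
    ∃! γ : l ⟶ l', γ ▷ p₁ = α ∧ γ ▷ p₂ = β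

end Limits

section Functoriality

variable {K : Type u₁} [Bicategory.{w₁, v₁} K] {L : Type u₂} [Bicategory.{w₂, v₂} L]

theorem map₂_whiskerLeft (R : StrictPseudofunctor K L) {A B C : K} (f : A ⟶ B) {g h : B ⟶ C}
    (η : g ⟶ h) : R.map₂ (f ◁ η) =
      eqToHom (R.map_comp f g) ≫ R.map f ◁ R.map₂ η ≫ eqToHom (R.map_comp f h).symm := by
  rw [R.map₂_whisker_left, R.mapComp_eq_eqToIso, R.mapComp_eq_eqToIso]
  rfl

theorem map₂_whiskerRight (R : StrictPseudofunctor K L) {A B C : K} {f g : A ⟶ B} (η : f ⟶ g)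
    (h : B ⟶ C) : R.map₂ (η ▷ h) =
      eqToHom (R.map_comp f h) ≫ R.map₂ η ▷ R.map h ≫ eqToHom (R.map_comp g h).symm := by
  rw [R.map₂_whisker_right, R.mapComp_eq_eqToIso, R.mapComp_eq_eqToIso]
  rfl

end Functoriality

section Familial

variable {K : Type u₁} [Bicategory.{w₁, v₁} K] [Strict K]
  {L : Type u₂} [Bicategory.{w₂, v₂} L] [Strict L]

/-- The 2-functor `K → L/X` determined by a 2-functor `R : K → L` and a strict cocone `arr` from
`R` to `X`. -/
def Slice.lift (R : StrictPseudofunctor K L) {X : L} (arr : ∀ A : K, R.obj A ⟶ X)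
    (w : ∀ {A B : K} (f : A ⟶ B), R.map f ≫ arr B = arr A)
    (w₂ : ∀ {A B : K} {f g : A ⟶ B} (η : f ⟶ g),
      R.map₂ η ▷ arr B = eqToHom ((w f).trans (w g).symm)) :
    StrictPseudofunctor K (Slice X) := StrictPseudofunctor.mk''
  { obj := fun A => ⟨R.obj A, arr A⟩
    map := fun f => ⟨R.map f, w f⟩
    map₂ := fun η => ⟨R.map₂ η, w₂ η⟩
    map₂_id := fun f => Slice.Hom₂.ext (R.map₂_id f)
    map₂_comp := fun η θ => Slice.Hom₂.ext (R.map₂_comp η θ)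
    map_id := fun A => Slice.Hom.ext (R.map_id A)
    map_comp := fun f g => Slice.Hom.ext (R.map_comp f g)
    map₂_whisker_left := fun f _ _ η => Slice.Hom₂.ext (by
      refine (map₂_whiskerLeft R f η).trans ?_
      simp only [Slice.hom₂_comp, Slice.hom₂_eqToHom, Slice.hom₂_whiskerLeft])
    map₂_whisker_right := fun η g => Slice.Hom₂.ext (by
      refine (map₂_whiskerRight R η g).trans ?_
      simp only [Slice.hom₂_comp, Slice.hom₂_eqToHom, Slice.hom₂_whiskerRight]) }

/-- For a terminal object `T` of `K`, the 2-functor `K → L/RT` sending `A` to the image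
`RA ⟶ RT` of the unique 1-cell `A ⟶ T`. -/
def toSlice (R : StrictPseudofunctor K L) {T : K} (hT : IsTwoTerminal T) :
    StrictPseudofunctor K (Slice (R.obj T)) :=
  Slice.lift R (fun A => R.map (hT.toT A))
    (fun f => by rw [← R.map_comp, hT.uniq (f ≫ hT.toT _) (hT.toT _)])
    (fun {A B f g} η => by
      have h : R.map₂ (η ▷ hT.toT B) = R.map₂ (eqToHom (hT.uniq _ _)) :=
        congrArg R.map₂ (hT.uniq₂ _ _)
      rw [map₂_whiskerRight, PrelaxFunctor.map₂_eqToHom] at h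
      rw [← cancel_epi (eqToHom (R.map_comp f (hT.toT B))),
        ← cancel_mono (eqToHom (R.map_comp g (hT.toT B)).symm), Category.assoc, h]
      simp)

end Familial

/-- A splitting of a functor `P`: a choice of cartesian lifts which is strictly functorial. -/
structure Splitting {E : Type u₁} [Category.{v₁} E] {B : Type u₂} [Category.{v₂} B]
    (P : E ⥤ B) where
  obj : ∀ {b : B} {e : E}, (b ⟶ P.obj e) → E
  obj_over : ∀ {b : B} {e : E} (f : b ⟶ P.obj e), P.obj (obj f) = b
  lift : ∀ {b : B} {e : E} (f : b ⟶ P.obj e), obj f ⟶ e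
  cartesian : ∀ {b : B} {e : E} (f : b ⟶ P.obj e), P.IsStronglyCartesian f (lift f)
  obj_id : ∀ e : E, obj (𝟙 (P.obj e)) = e
  lift_id : ∀ e : E, lift (𝟙 (P.obj e)) = eqToHom (obj_id e)
  obj_comp : ∀ {c b : B} {e : E} (g : c ⟶ b) (f : b ⟶ P.obj e),
    obj (g ≫ f) = obj (g ≫ eqToHom (obj_over f).symm)
  lift_comp : ∀ {c b : B} {e : E} (g : c ⟶ b) (f : b ⟶ P.obj e),
    lift (g ≫ f) = eqToHom (obj_comp g f) ≫ lift (g ≫ eqToHom (obj_over f).symm) ≫ lift f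

section SplitFibration

variable {K : Type u₁} [Bicategory.{w₁, v₁} K] [Strict K]

/-- The structure of a split fibration on a 1-cell `p : E ⟶ B` of a 2-category: splittings of the
functors `K(X, E) ⥤ K(X, B)` given by composition with `p`, which are preserved by precomposition
with each `f : Y ⟶ X`. -/
structure SplitFibration {E B : K} (p : E ⟶ B) where
  split : ∀ X : K, Splitting (postcomp X p)
  obj_precomp : ∀ {X Y : K} (f : Y ⟶ X) {b : X ⟶ B} {e : X ⟶ E} (β : b ⟶ e ≫ p),
    f ≫ (split X).obj (e := e) β = (split Y).obj (e := f ≫ e) (f ◁ β ≫ (α_ f e p).inv)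
  lift_precomp : ∀ {X Y : K} (f : Y ⟶ X) {b : X ⟶ B} {e : X ⟶ E} (β : b ⟶ e ≫ p),
    f ◁ (split X).lift (e := e) β = eqToHom (obj_precomp f β) ≫
      (split Y).lift (e := f ≫ e) (f ◁ β ≫ (α_ f e p).inv)

/-- A morphism `h` over `B` between split fibrations over `B` preserves the chosen cartesian
lifts. -/
structure PreservesLifts {E E' B : K} {p : E ⟶ B} {p' : E' ⟶ B} (s : SplitFibration p)
    (s' : SplitFibration p') (h : E ⟶ E') : Prop where
  w : h ≫ p' = p
  obj_comp : ∀ {X : K} {b : X ⟶ B} {e : X ⟶ E} (β : b ⟶ e ≫ p),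
    (s.split X).obj (e := e) β ≫ h =
      (s'.split X).obj (e := e ≫ h) (β ≫ eqToHom ((congrArg (fun k => e ≫ k) w.symm).trans
        (Strict.assoc e h p').symm))
  lift_comp : ∀ {X : K} {b : X ⟶ B} {e : X ⟶ E} (β : b ⟶ e ≫ p),
    (s.split X).lift (e := e) β ▷ h = eqToHom (obj_comp β) ≫
      (s'.split X).lift (e := e ≫ h) (β ≫ eqToHom ((congrArg (fun k => e ≫ k) w.symm).trans
        (Strict.assoc e h p').symm))

variable {L : Type u₂} [Bicategory.{w₂, v₂} L] [Strict L]

/-- A 2-functor `R : K → L`, where `K` has a terminal object `T`, is familial if `K → L/RT` is a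
right 2-adjoint, and this 2-functor factorizes through the 2-category of split fibrations over
`RT`: each `RA ⟶ RT` is equipped with the structure of a split fibration, and each `Rf` preserves
the chosen cartesian lifts. -/
def IsFamilial (R : StrictPseudofunctor K L) {T : K} (hT : IsTwoTerminal T) : Prop :=
  IsRightTwoAdjoint (toSlice R hT) ∧
  ∃ s : ∀ A : K, SplitFibration (R.map (hT.toT A)),
    ∀ {A B : K} (f : A ⟶ B), PreservesLifts (s A) (s B) (R.map f)

end SplitFibration

end TwoCat

/-! ### Constructing virtual double categories -/

namespace VDGraphHom

variable {X : VDCData.{v}} {Y : VDC.{v}} (F : VDGraphHom X.toVDGraph Y.toVDGraph)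

/-- Preservation of identity cells and of composites. -/
structure Preserves : Prop where
  cell_id : ∀ {A B : X.Obj} (Γ : X.Hor A B), F.cell (X.id Γ) =
    Y.cast rfl (F.vert.map_id A).symm (F.vert.map_id B).symm (Y.id (F.hor Γ))
  cell_comp : ∀ {A A' B B' C C' : X.Obj} {Δs : HPath X.Hor B B'} {u : A ⟶ B} {u' : A' ⟶ B'}
    (θs : X.CellPath Δs u u') {v : B ⟶ C} {v' : B' ⟶ C'} {Λ : X.Hor C C'} (κ : X.Cell Δs v v' Λ),
    F.cell (X.comp θs κ rfl rfl rfl) = Y.comp (F.mapCells θs) (F.cell κ)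
      (F.top_mapCells θs) (F.vert.map_comp u v).symm (F.vert.map_comp u' v').symm

variable {F}

theorem Preserves.cell_comp' (hF : F.Preserves) {A A' B B' C C' : X.Obj} {Δs : HPath X.Hor B B'}
    {u : A ⟶ B} {u' : A' ⟶ B'} (θs : X.CellPath Δs u u') {v : B ⟶ C} {v' : B' ⟶ C'}
    {Λ : X.Hor C C'} (κ : X.Cell Δs v v' Λ) {Γs : HPath X.Hor A A'} {w : A ⟶ C} {w' : A' ⟶ C'}
    (hΓ : θs.top = Γs) (h : u ≫ v = w) (h' : u' ≫ v' = w') :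
    F.cell (X.comp θs κ hΓ h h') = Y.comp (F.mapCells θs) (F.cell κ)
      ((F.top_mapCells θs).trans (congrArg F.path hΓ))
      ((F.vert.map_comp u v).symm.trans (congrArg F.vert.map h))
      ((F.vert.map_comp u' v').symm.trans (congrArg F.vert.map h')) := by
  subst hΓ h h'; exact hF.cell_comp θs κ

theorem cons_heq {A A' A'' B B' B'' : Y.Obj} {Γs Γs' : HPath Y.Hor A A'} {u w : A ⟶ B}
    {u' w' : A' ⟶ B'} {u'' w'' : A'' ⟶ B''} {Δ : Y.Hor B B'} {Δs Δs' : HPath Y.Hor B' B''}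
    (hΓ : Γs = Γs') (hΔ : Δs = Δs') (h : u = w) (h' : u' = w') (h'' : u'' = w'')
    {θ : Y.Cell Γs u u' Δ} {κ : Y.Cell Γs' w w' Δ} (hθ : HEq θ κ) {θs : Y.CellPath Δs u' u''}
    {κs : Y.CellPath Δs' w' w''} (hθs : HEq θs κs) :
    HEq (VDGraph.CellPath.cons θ θs) (VDGraph.CellPath.cons κ κs) := by
  subst hΓ hΔ h h' h''
  rw [eq_of_heq hθ, eq_of_heq hθs]

theorem comp_heq {A A' B B' C C' : Y.Obj} {Δs Δs' : HPath Y.Hor B B'} {u z : A ⟶ B}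
    {u' z' : A' ⟶ B'} {θs : Y.CellPath Δs u u'} {θs' : Y.CellPath Δs' z z'} {v x : B ⟶ C}
    {v' x' : B' ⟶ C'} {Λ : Y.Hor C C'} {κ : Y.Cell Δs v v' Λ} {κ' : Y.Cell Δs' x x' Λ}
    {Γs : HPath Y.Hor A A'} {w : A ⟶ C} {w' : A' ⟶ C'} (hΔ : Δs = Δs') (hu : u = z)
    (hu' : u' = z') (hv : v = x) (hv' : v' = x') (hθ : HEq θs θs') (hκ : HEq κ κ')
    (hΓ : θs.top = Γs) (h : u ≫ v = w) (h' : u' ≫ v' = w') (hΓ' : θs'.top = Γs) (k : z ≫ x = w)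
    (k' : z' ≫ x' = w') :
    Y.comp θs κ hΓ h h' = Y.comp θs' κ' hΓ' k k' := by
  subst hΔ hu hu' hv hv'
  have hθ' := eq_of_heq hθ
  have hκ' := eq_of_heq hκ
  subst hθ' hκ'
  rfl

theorem heq_cast {A A' B B' : Y.Obj} {Γs Γs' : HPath Y.Hor A A'} {u w : A ⟶ B}
    {u' w' : A' ⟶ B'} {Δ : Y.Hor B B'} (hΓ : Γs = Γs') (h : u = w) (h' : u' = w')
    (θ : Y.Cell Γs u u' Δ) : HEq (Y.cast hΓ h h' θ) θ := by
  subst hΓ h h'; rfl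

theorem heq_path_cast {A A' B B' : Y.Obj} {Γs Γs' : HPath Y.Hor B B'} {u w : A ⟶ B}
    {u' w' : A' ⟶ B'} (hΓ : Γs = Γs') (h : u = w) (h' : u' = w')
    (θ : Y.CellPath Γs u u') : HEq (θ.cast hΓ h h') θ := by
  subst hΓ h h'; rfl

theorem Preserves.mapCells_ids (hF : F.Preserves) {A B : X.Obj} (Γs : HPath X.Hor A B) :
    HEq (F.mapCells (X.ids Γs)) (Y.ids (F.path Γs)) := by
  induction Γs with
  | nil A =>
    simp only [VDCData.ids, mapCells]
    rw [F.vert.map_id]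
    rfl
  | cons Γ Γs ih =>
    refine cons_heq rfl rfl (F.vert.map_id _) (F.vert.map_id _) (F.vert.map_id _) ?_ ih
    exact (heq_of_eq (hF.cell_id Γ)).trans (heq_cast _ _ _ _)

variable (F) in
/-- The image of a two-level configuration. -/
def mapTree : ∀ {A A' B B' C C' : X.Obj} {Λs : HPath X.Hor C C'} {u : A ⟶ B} {u' : A' ⟶ B'}
    {v : B ⟶ C} {v' : B' ⟶ C'}, X.CellTree Λs u u' v v' →
    Y.CellTree (F.path Λs) (F.vert.map u) (F.vert.map u') (F.vert.map v) (F.vert.map v')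
  | _, _, _, _, _, _, _, _, _, _, _, .nil u v => .nil (F.vert.map u) (F.vert.map v)
  | _, _, _, _, _, _, _, _, _, _, _, .cons θs κ t =>
    .cons (F.mapCells θs) (F.cell κ) (mapTree t)

theorem mapTree_lower {A A' B B' C C' : X.Obj} {Λs : HPath X.Hor C C'} {u : A ⟶ B} {u' : A' ⟶ B'}
    {v : B ⟶ C} {v' : B' ⟶ C'} (t : X.CellTree Λs u u' v v') :
    (F.mapTree t).lower = F.mapCells t.lower := by
  induction t with
  | nil u v => rfl
  | cons θs κ t ih => exact congrArg (VDGraph.CellPath.cons (F.cell κ)) ih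

theorem mapCells_append {A A' A'' B B' B'' : X.Obj} {Δs : HPath X.Hor B B'}
    {Δs' : HPath X.Hor B' B''} {u : A ⟶ B} {u' : A' ⟶ B'} {u'' : A'' ⟶ B''}
    (θs : X.CellPath Δs u u') (κs : X.CellPath Δs' u' u'') :
    HEq (F.mapCells (θs.append κs)) ((F.mapCells θs).append (F.mapCells κs)) := by
  induction θs with
  | nil u => rfl
  | cons θ θs ih =>
    exact cons_heq rfl (HPath.map_append _ _ _ _) rfl rfl rfl HEq.rfl (ih κs)

theorem append_heq {A A' A'' B B' B'' : Y.Obj} {Δs : HPath Y.Hor B B'}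
    {Δs' Δs'' : HPath Y.Hor B' B''} {u : A ⟶ B} {u' : A' ⟶ B'} {u'' : A'' ⟶ B''}
    (θs : Y.CellPath Δs u u') (h : Δs' = Δs'') {κs : Y.CellPath Δs' u' u''}
    {κs' : Y.CellPath Δs'' u' u''} (hκ : HEq κs κs') :
    HEq (θs.append κs) (θs.append κs') := by
  subst h; rw [eq_of_heq hκ]

theorem top_heq {A A' B B' : Y.Obj} {Δs Δs' : HPath Y.Hor B B'} {u : A ⟶ B} {u' : A' ⟶ B'}
    (h : Δs = Δs') {θs : Y.CellPath Δs u u'} {θs' : Y.CellPath Δs' u u'} (hθ : HEq θs θs') :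
    θs.top = θs'.top := by
  subst h; rw [eq_of_heq hθ]

theorem mapTree_upper {A A' B B' C C' : X.Obj} {Λs : HPath X.Hor C C'} {u : A ⟶ B} {u' : A' ⟶ B'}
    {v : B ⟶ C} {v' : B' ⟶ C'} (t : X.CellTree Λs u u' v v') :
    HEq (F.mapTree t).upper (F.mapCells t.upper) := by
  induction t with
  | nil u v => rfl
  | cons θs κ t ih =>
    refine HEq.trans ?_ (mapCells_append θs t.upper).symm
    exact append_heq _ ((congrArg _ (mapTree_lower t)).trans (F.top_mapCells t.lower)) ih

theorem Preserves.mapCells_treeComp (hF : F.Preserves) {A A' B B' C C' : X.Obj}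
    {Λs : HPath X.Hor C C'} {u : A ⟶ B} {u' : A' ⟶ B'} {v : B ⟶ C} {v' : B' ⟶ C'}
    (t : X.CellTree Λs u u' v v') :
    HEq (F.mapCells (X.treeComp t)) (Y.treeComp (F.mapTree t)) := by
  induction t with
  | nil u v =>
    simp only [VDCData.treeComp, mapCells, mapTree]
    rw [F.vert.map_comp]
    rfl
  | cons θs κ t ih =>
    refine cons_heq (F.top_mapCells θs).symm rfl (F.vert.map_comp _ _) (F.vert.map_comp _ _)
      (F.vert.map_comp _ _) ?_ ih
    refine (heq_of_eq (hF.cell_comp θs κ)).trans ?_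
    exact (heq_of_eq (VDCData.cast_comp _ _ _ rfl rfl rfl (F.top_mapCells θs)
      (F.vert.map_comp _ _).symm (F.vert.map_comp _ _).symm).symm).trans (heq_cast _ _ _ _)

end VDGraphHom

/-- Data mapping to virtual double categories in a structure-preserving and jointly faithful way
satisfy the axioms of a virtual double category. -/
def VDC.ofFaithful (E : VDCData.{v}) {ι : Type} (Y : ι → VDC.{v})
    (F : ∀ i, VDGraphHom E.toVDGraph (Y i).toVDGraph) (hF : ∀ i, (F i).Preserves)
    (inj : ∀ {A A' B B' : E.Obj} {Γs : HPath E.Hor A A'} {u : A ⟶ B} {u' : A' ⟶ B'}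
      {Δ : E.Hor B B'} (θ κ : E.Cell Γs u u' Δ), (∀ i, (F i).cell θ = (F i).cell κ) → θ = κ) :
    VDC.{v} where
  toVDCData := E
  id_comp {A A' B B' Γs u u' Δ} κ := inj _ _ fun i =>
    ((hF i).cell_comp' _ _ _ _ _).trans
    ((VDGraphHom.comp_heq rfl ((F i).vert.map_id A) ((F i).vert.map_id A') rfl rfl
      ((hF i).mapCells_ids Γs) HEq.rfl _ _ _ ((Y i).top_ids _) (Category.id_comp _)
      (Category.id_comp _)).trans ((Y i).id_comp _))
  comp_id {A A' B B' Γs u u' Δ} θ := inj _ _ fun i =>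
    ((hF i).cell_comp' _ _ _ _ _).trans
    ((VDGraphHom.comp_heq (θs' := .single ((F i).cell θ)) (κ' := (Y i).id ((F i).hor Δ))
      rfl rfl rfl ((F i).vert.map_id B) ((F i).vert.map_id B')
      HEq.rfl ((heq_of_eq ((hF i).cell_id Δ)).trans (VDGraphHom.heq_cast _ _ _ _)) _ _ _
      (HPath.append_nil _) (Category.comp_id _) (Category.comp_id _)).trans ((Y i).comp_id _))
  assoc {A A' B B' C C' D D' Λs u u' v v' w w' Ξ} t l := inj _ _ fun i => by
    refine ((hF i).cell_comp' _ _ _ _ _).trans (Eq.trans ?_ ((hF i).cell_comp' _ _ _ _ _).symm)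
    have e : ((F i).mapTree t).lower.top = (F i).path t.lower.top :=
      (congrArg _ (VDGraphHom.mapTree_lower t)).trans ((F i).top_mapCells t.lower)
    have e' : ((F i).mapTree t).upper.top = (F i).path t.upper.top :=
      (VDGraphHom.top_heq e (VDGraphHom.mapTree_upper t)).trans ((F i).top_mapCells t.upper)
    refine (VDGraphHom.comp_heq (θs' := (Y i).treeComp ((F i).mapTree t)) rfl
      ((F i).vert.map_comp _ _) ((F i).vert.map_comp _ _) rfl rfl ((hF i).mapCells_treeComp t)
      HEq.rfl _ _ _ (((Y i).top_treeComp _).trans e') ?_ ?_).trans ?_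
    · simp
    · simp
    · refine (VDC.assoc_of ((F i).mapTree t) ((F i).cell l) (VDGraphHom.mapTree_lower t)
        ((F i).top_mapCells t.lower) (θs := (F i).mapCells t.upper) ?_
        ((F i).vert.map_comp v w).symm ((F i).vert.map_comp v' w').symm _ _ _).trans ?_
      · exact eq_of_heq ((VDGraphHom.mapTree_upper t).trans
          (VDGraphHom.heq_path_cast _ _ _ _).symm)
      · exact congrArg (fun κ => (Y i).comp _ κ _ _ _) ((hF i).cell_comp' _ _ _ _ _).symm

namespace VDGraphHom

/-- Composition of maps of underlying data. -/
def comp {X Y Z : VDGraph.{v}} (F : VDGraphHom X Y) (G : VDGraphHom Y Z) : VDGraphHom X Z where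
  vert := F.vert ⋙ G.vert
  hor Γ := G.hor (F.hor Γ)
  cell {A A' B B' Γs u u' Δ} θ := Z.cast (HPath.map_map _ _ _ _ Γs) rfl rfl (G.cell (F.cell θ))

theorem mapCells_comp {X Y Z : VDGraph.{v}} (F : VDGraphHom X Y) (G : VDGraphHom Y Z)
    {A A' B B' : X.Obj} {Δs : HPath X.Hor B B'} {u : A ⟶ B} {u' : A' ⟶ B'}
    (θs : X.CellPath Δs u u') :
    (F.comp G).mapCells θs =
      (G.mapCells (F.mapCells θs)).cast (HPath.map_map _ _ _ _ Δs) rfl rfl := by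
  induction θs with
  | nil u => rfl
  | cons θ θs ih =>
    simp only [VDGraphHom.mapCells]
    rw [ih]
    exact VDGraph.CellPath.cons_cast _ _ _ _

end VDGraphHom

theorem VDGraph.cast_injective {X : VDGraph.{v}} {A A' B B' : X.Obj} {Γs Γs' : HPath X.Hor A A'}
    {u w : A ⟶ B} {u' w' : A' ⟶ B'} {Δ : X.Hor B B'} (hΓ : Γs = Γs') (h : u = w) (h' : u' = w')
    {θ κ : X.Cell Γs u u' Δ} (e : X.cast hΓ h h' θ = X.cast hΓ h h' κ) : θ = κ := by
  subst hΓ h h'; exact e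

namespace VDFunctor

variable {W P : VDC.{v}} {ι : Type} {Y : ι → VDC.{v}}

theorem preserves {X Y : VDC.{v}} (F : VDFunctor X Y) : F.toVDGraphHom.Preserves :=
  ⟨F.cell_id, F.cell_comp⟩

/-- A map of underlying data is a functor if its composites with a jointly faithful family of
functors are. -/
def ofFaithful (L : VDGraphHom W.toVDGraph P.toVDGraph) (π : ∀ i, VDFunctor P (Y i))
    (inj : ∀ {A A' B B' : P.Obj} {Γs : HPath P.Hor A A'} {u : A ⟶ B} {u' : A' ⟶ B'}
      {Δ : P.Hor B B'} (θ κ : P.Cell Γs u u' Δ), (∀ i, (π i).cell θ = (π i).cell κ) → θ = κ)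
    (hL : ∀ i, (L.comp (π i).toVDGraphHom).Preserves) : VDFunctor W P where
  toVDGraphHom := L
  cell_id {A B} Γ := inj _ _ fun i => by
    refine VDGraph.cast_injective (HPath.map_map _ _ _ _ _) rfl rfl
      (((hL i).cell_id Γ).trans ?_)
    refine Eq.trans ?_ (congrArg _ ((π i).cell_cast _ _ _ _).symm)
    rw [(π i).cell_id]
    refine Eq.trans ?_ (VDGraph.cast_cast _ _ _ _ _ _ _).symm
    exact (VDGraph.cast_cast _ _ _ _ _ _ _).symm
  cell_comp {A A' B B' C C' Δs u u'} θs {v v' Λ} κ := inj _ _ fun i => by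
    refine VDGraph.cast_injective (HPath.map_map _ _ _ _ _) rfl rfl
      (((hL i).cell_comp θs κ).trans ?_)
    refine Eq.trans ?_ (congrArg _ ((π i).cell_comp' _ _ _ _ _).symm)
    refine Eq.trans ?_ (VDCData.cast_comp _ _ _ _ _ _ _ _ _).symm
    refine VDGraphHom.comp_heq (HPath.map_map _ _ _ _ Δs).symm rfl rfl rfl rfl ?_ ?_ _ _ _ _ _ _
    · exact (heq_of_eq (VDGraphHom.mapCells_comp _ _ θs)).trans
        (VDGraphHom.heq_path_cast _ _ _ _)
    · exact VDGraphHom.heq_cast (Y := Y i) (HPath.map_map _ _ _ _ Δs) rfl rfl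
        ((π i).cell (L.cell κ))

/-- Functors into the domain of a jointly faithful family are determined on multicells by their
composites with that family. -/
theorem ext_faithful {F G : VDFunctor W P} (π : ∀ i, VDFunctor P (Y i))
    (inj : ∀ {A A' B B' : P.Obj} {Γs : HPath P.Hor A A'} {u : A ⟶ B} {u' : A' ⟶ B'}
      {Δ : P.Hor B B'} (θ κ : P.Cell Γs u u' Δ), (∀ i, (π i).cell θ = (π i).cell κ) → θ = κ)
    (hv : F.vert = G.vert) (hh : ∀ {A B : W.Obj} (Γ : W.Hor A B), HEq (F.hor Γ) (G.hor Γ))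
    (hc : ∀ i, F.comp (π i) = G.comp (π i)) : F = G := by
  rcases F with ⟨⟨Fv, Fh, Fc⟩, p, q⟩
  rcases G with ⟨⟨Gv, Gh, Gc⟩, p', q'⟩
  dsimp only at hv
  subst hv
  have e : @Fh = @Gh := by
    funext A B Γ
    exact eq_of_heq (hh Γ)
  subst e
  have e' : @Fc = @Gc := by
    funext A A' B B' Γs u u' Δ θ
    refine inj _ _ fun i => ?_
    have h := hc i
    simp only [comp] at h
    injection h with h
    injection h with _ _ h
    exact VDGraph.cast_injective (HPath.map_map _ _ _ _ _) rfl rfl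
      (congrFun (congrFun (congrFun (congrFun (congrFun (congrFun (congrFun (congrFun (congrFun
        h A) A') B) B') Γs) u) u') Δ) θ)
  subst e'
  rfl

end VDFunctor

namespace VDTrans

variable {W P : VDC.{v}} {ι : Type} {Y : ι → VDC.{v}}

theorem mapCells_cells {Y : VDC.{v}} {F G : VDFunctor W P} (γ : VDTransData F G)
    (π : VDFunctor P Y) (α : VDTransData (F.comp π) (G.comp π))
    (hv : ∀ A, α.vert.app A = π.vert.map (γ.vert.app A))
    (hc : ∀ {A B : W.Obj} (Γ : W.Hor A B),
      α.cell Γ = Y.cast rfl (hv A).symm (hv B).symm (π.cell (γ.cell Γ)))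
    {A B : W.Obj} (Γs : HPath W.Hor A B) :
    HEq (π.mapCells (γ.cells Γs)) (α.cells Γs) := by
  induction Γs with
  | nil A =>
    simp only [VDTransData.cells, VDGraphHom.mapCells]
    rw [hv]
    rfl
  | cons Γ Γs ih =>
    refine VDGraphHom.cons_heq rfl (HPath.map_map _ _ _ _ Γs) (hv _).symm (hv _).symm
      (hv _).symm ?_ ih
    rw [hc]
    exact (VDGraphHom.heq_cast _ _ _ _).symm

/-- A family of components is a vertical transformation if its images under a jointly faithful
family of functors are. -/
def ofFaithful {F G : VDFunctor W P} (γ : VDTransData F G) (π : ∀ i, VDFunctor P (Y i))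
    (inj : ∀ {A A' B B' : P.Obj} {Γs : HPath P.Hor A A'} {u : A ⟶ B} {u' : A' ⟶ B'}
      {Δ : P.Hor B B'} (θ κ : P.Cell Γs u u' Δ), (∀ i, (π i).cell θ = (π i).cell κ) → θ = κ)
    (α : ∀ i, VDTrans (F.comp (π i)) (G.comp (π i)))
    (hv : ∀ i A, (α i).vert.app A = (π i).vert.map (γ.vert.app A))
    (hc : ∀ i {A B : W.Obj} (Γ : W.Hor A B),
      (α i).cell Γ = (Y i).cast rfl (hv i A).symm (hv i B).symm ((π i).cell (γ.cell Γ))) :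
    VDTrans F G where
  toVDTransData := γ
  naturality {A A' B B' Γs u u' Δ} θ := inj _ _ fun i => by
    refine ((π i).cell_comp' _ _ _ _ _).trans (Eq.trans ?_ ((π i).cell_comp' _ _ _ _ _).symm)
    refine VDGraph.cast_injective (HPath.map_map _ _ _ _ _)
      (w := (F.comp (π i)).vert.map u ≫ (α i).vert.app B)
      (w' := (F.comp (π i)).vert.map u' ≫ (α i).vert.app B')
      (((π i).vert.map_comp _ _).trans (congrArg (fun x => _ ≫ x) (hv i B).symm))
      (((π i).vert.map_comp _ _).trans (congrArg (fun x => _ ≫ x) (hv i B').symm)) ?_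
    refine (VDCData.cast_comp _ _ _ _ _ _ _ _ _).trans
      (Eq.trans ?_ (VDCData.cast_comp _ _ _ _ _ _ _ _ _).symm)
    refine Eq.trans ?_ (((α i).naturality θ).trans ?_)
    · refine VDGraphHom.comp_heq rfl rfl rfl (hv i B).symm (hv i B').symm ?_ ?_ _ _ _ _ _ _
      · refine VDGraphHom.cons_heq (HPath.map_map _ _ _ _ _) rfl rfl rfl rfl ?_ HEq.rfl
        exact (VDFunctor.comp_cell_heq F (π i) θ).symm
      · rw [hc i]
        exact (VDGraphHom.heq_cast _ _ _ _).symm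
    · refine VDGraphHom.comp_heq (HPath.map_map _ _ _ _ _).symm (hv i A) (hv i A') rfl rfl ?_ ?_
        _ _ _ _ _ _
      · exact (mapCells_cells γ (π i) _ (hv i) (hc i) Γs).symm
      · exact VDFunctor.comp_cell_heq G (π i) θ

end VDTrans

/-! ### The terminal virtual double category and products -/

namespace VDC

/-- The terminal virtual double category. -/
def unit : VDC.{v} where
  Obj := PUnit
  vert := { Hom := fun _ _ => PUnit, id := fun _ => ⟨⟩, comp := fun _ _ => ⟨⟩ }
  Hor _ _ := PUnit
  Cell _ _ _ _ := PUnit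
  id _ := ⟨⟩
  comp _ _ _ _ _ _ _ _ _ _ _ := ⟨⟩
  id_comp _ := rfl
  comp_id _ := rfl
  assoc _ _ := rfl

/-- The functor to the terminal virtual double category. -/
def toUnit (X : VDC.{v}) : VDFunctor X unit.{v} where
  vert := { obj := fun _ => ⟨⟩, map := fun _ => ⟨⟩ }
  hor _ := ⟨⟩
  cell _ := ⟨⟩
  cell_id _ := rfl
  cell_comp _ _ _ _ _ := rfl

theorem toUnit_uniq {X : VDC.{v}} (F G : VDFunctor X unit.{v}) : F = G :=
  VDFunctor.ext_cell (by
    refine CategoryTheory.Functor.ext (fun _ => rfl) (fun _ _ _ => rfl))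
    (fun _ => HEq.rfl) (fun _ => HEq.rfl)

theorem toUnit_uniq₂ {X : VDC.{v}} {F G : VDFunctor X unit.{v}} (α β : VDTrans F G) : α = β :=
  VDTrans.ext' (fun _ => rfl) (fun _ => rfl)

/-- The virtual double category `unit` is terminal. -/
def unitTerminal : TwoCat.IsTwoTerminal unit.{v} where
  toT X := toUnit X
  uniq F G := toUnit_uniq F G
  uniq₂ α β := toUnit_uniq₂ α β

end VDC

theorem VDGraphHom.ext_cell {X Y : VDGraph.{v}} {F G : VDGraphHom X Y} (hv : F.vert = G.vert)
    (hh : ∀ {A B : X.Obj} (Γ : X.Hor A B), HEq (F.hor Γ) (G.hor Γ))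
    (hc : ∀ {A A' B B' : X.Obj} {Γs : HPath X.Hor A A'} {u : A ⟶ B} {u' : A' ⟶ B'}
      {Δ : X.Hor B B'} (θ : X.Cell Γs u u' Δ), HEq (F.cell θ) (G.cell θ)) : F = G := by
  rcases F with ⟨Fv, Fh, Fc⟩
  rcases G with ⟨Gv, Gh, Gc⟩
  dsimp only at hv
  subst hv
  have e : @Fh = @Gh := by
    funext A B Γ
    exact eq_of_heq (hh Γ)
  subst e
  have e' : @Fc = @Gc := by
    funext A A' B B' Γs u u' Δ θ
    exact eq_of_heq (hc θ)
  subst e'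
  rfl

theorem VDGraph.heq_cast {X : VDGraph.{v}} {A A' B B' : X.Obj} {Γs Γs' : HPath X.Hor A A'}
    {u w : A ⟶ B} {u' w' : A' ⟶ B'} {Δ : X.Hor B B'} (hΓ : Γs = Γs') (h : u = w) (h' : u' = w')
    (θ : X.Cell Γs u u' Δ) : HEq (X.cast hΓ h h' θ) θ := by
  subst hΓ h h'; rfl

theorem VDGraphHom.comp_cell_heq {X Y Z : VDGraph.{v}} (F : VDGraphHom X Y) (G : VDGraphHom Y Z)
    {A A' B B' : X.Obj} {Γs : HPath X.Hor A A'} {u : A ⟶ B} {u' : A' ⟶ B'} {Δ : X.Hor B B'}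
    (θ : X.Cell Γs u u' Δ) : HEq ((F.comp G).cell θ) (G.cell (F.cell θ)) :=
  VDGraph.heq_cast (HPath.map_map _ _ _ _ Γs) rfl rfl (G.cell (F.cell θ))

namespace VDProd

variable (E A : VDC.{v})

/-- The underlying data of the product. -/
def graph : VDGraph.{v} where
  Obj := E.Obj × A.Obj
  vert := CategoryTheory.prod' E.Obj A.Obj
  Hor p q := E.Hor p.1 q.1 × A.Hor p.2 q.2
  Cell Γs u u' Δ := E.Cell (Γs.map Prod.fst (fun _ _ Γ => Γ.1)) u.1 u'.1 Δ.1 ×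
    A.Cell (Γs.map Prod.snd (fun _ _ Γ => Γ.2)) u.2 u'.2 Δ.2

/-- The first projection. -/
def fstHom : VDGraphHom (graph E A) E.toVDGraph where
  vert := CategoryTheory.Prod.fst E.Obj A.Obj
  hor Γ := Γ.1
  cell θ := θ.1

/-- The second projection. -/
def sndHom : VDGraphHom (graph E A) A.toVDGraph where
  vert := CategoryTheory.Prod.snd E.Obj A.Obj
  hor Γ := Γ.2
  cell θ := θ.2

/-- The identities and composites of the product. -/
def data : VDCData.{v} where
  toVDGraph := graph E A
  id Γ := ⟨E.id Γ.1, A.id Γ.2⟩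
  comp θs _ _ _ κ _ _ _ hΓ h h' :=
    ⟨E.comp ((fstHom E A).mapCells θs) κ.1
      (((fstHom E A).top_mapCells θs).trans (congrArg (fstHom E A).path hΓ))
      (congrArg Prod.fst h) (congrArg Prod.fst h'),
    A.comp ((sndHom E A).mapCells θs) κ.2
      (((sndHom E A).top_mapCells θs).trans (congrArg (sndHom E A).path hΓ))
      (congrArg Prod.snd h) (congrArg Prod.snd h')⟩

/-- The factors. -/
def fac : Bool → VDC.{v}
  | true => E
  | false => A

/-- The two projections, as one family. -/
def projHom : ∀ i, VDGraphHom (data E A).toVDGraph (fac E A i).toVDGraph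
  | true => fstHom E A
  | false => sndHom E A

theorem projHom_preserves : ∀ i, (projHom E A i).Preserves
  | true => ⟨fun _ => rfl, fun _ _ _ _ _ => rfl⟩
  | false => ⟨fun _ => rfl, fun _ _ _ _ _ => rfl⟩

/-- The product of two virtual double categories. -/
def prod : VDC.{v} := VDC.ofFaithful (data E A) (fac E A) (projHom E A) (projHom_preserves E A)
  (fun _ _ h => _root_.Prod.ext (h true) (h false))

/-- The projections of the product. -/
def proj (i : Bool) : VDFunctor (prod E A) (fac E A i) where
  toVDGraphHom := projHom E A i
  cell_id := (projHom_preserves E A i).cell_id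
  cell_comp := (projHom_preserves E A i).cell_comp

/-- The first projection. -/
abbrev fst : VDFunctor (prod E A) E := proj E A true

/-- The second projection. -/
abbrev snd : VDFunctor (prod E A) A := proj E A false

variable {E A} {W : VDC.{v}}

theorem inj {p p' q q' : (prod E A).Obj} {Γs : HPath (prod E A).Hor p p'} {u : p ⟶ q} {u' : p' ⟶ q'}
    {Δ : (prod E A).Hor q q'} (θ κ : (prod E A).Cell Γs u u' Δ)
    (h : ∀ i, (proj E A i).cell θ = (proj E A i).cell κ) : θ = κ :=
  _root_.Prod.ext (h true) (h false)

/-- The underlying data of the pairing of two functors. -/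
def liftHom (F : VDFunctor W E) (G : VDFunctor W A) : VDGraphHom W.toVDGraph (graph E A) where
  vert := F.vert.prod' G.vert
  hor Γ := ⟨F.hor Γ, G.hor Γ⟩
  cell {_ _ _ _ Γs _ _ _} θ :=
    ⟨E.cast (HPath.map_map _ _ _ _ Γs).symm rfl rfl (F.cell θ),
      A.cast (HPath.map_map _ _ _ _ Γs).symm rfl rfl (G.cell θ)⟩

theorem liftHom_fst (F : VDFunctor W E) (G : VDFunctor W A) :
    (liftHom F G).comp (fstHom E A) = F.toVDGraphHom := by
  refine VDGraphHom.ext_cell rfl (fun _ => HEq.rfl) fun {_ _ _ _ Γs _ _ _} θ => ?_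
  refine (VDGraphHom.comp_cell_heq _ _ θ).trans ?_
  dsimp only [liftHom, fstHom]
  exact VDGraphHom.heq_cast (Y := E) _ rfl rfl (F.cell θ)

theorem liftHom_snd (F : VDFunctor W E) (G : VDFunctor W A) :
    (liftHom F G).comp (sndHom E A) = G.toVDGraphHom := by
  refine VDGraphHom.ext_cell rfl (fun _ => HEq.rfl) fun {_ _ _ _ Γs _ _ _} θ => ?_
  refine (VDGraphHom.comp_cell_heq _ _ θ).trans ?_
  dsimp only [liftHom, sndHom]
  exact VDGraphHom.heq_cast (Y := A) _ rfl rfl (G.cell θ)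

/-- The pairing of two functors. -/
def lift (F : VDFunctor W E) (G : VDFunctor W A) : VDFunctor W (prod E A) :=
  VDFunctor.ofFaithful (liftHom F G) (proj E A) inj fun
    | true => (liftHom_fst F G).symm ▸ F.preserves
    | false => (liftHom_snd F G).symm ▸ G.preserves

theorem toHom_injective {X Y : VDC.{v}} {F G : VDFunctor X Y}
    (h : F.toVDGraphHom = G.toVDGraphHom) : F = G := by
  cases F; cases G; cases h; rfl

theorem lift_fst (F : VDFunctor W E) (G : VDFunctor W A) : (lift F G).comp (fst E A) = F :=
  toHom_injective (liftHom_fst F G)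

theorem lift_snd (F : VDFunctor W E) (G : VDFunctor W A) : (lift F G).comp (snd E A) = G :=
  toHom_injective (liftHom_snd F G)

theorem lift_eta (L : VDFunctor W (prod E A)) : lift (L.comp (fst E A)) (L.comp (snd E A)) = L :=
  VDFunctor.ext_faithful (proj E A) inj rfl (fun _ => HEq.rfl) fun
    | true => lift_fst _ _
    | false => lift_snd _ _

/-- The pairing of two vertical transformations. -/
def lift₂ {L L' : VDFunctor W (prod E A)} (α : VDTrans (L.comp (fst E A)) (L'.comp (fst E A)))
    (β : VDTrans (L.comp (snd E A)) (L'.comp (snd E A))) : VDTrans L L' :=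
  VDTrans.ofFaithful
    { vert :=
        { app := fun X => (⟨α.vert.app X, β.vert.app X⟩ : (_ ⟶ _) × (_ ⟶ _))
          naturality := fun _ _ f =>
            _root_.Prod.ext (α.vert.naturality f) (β.vert.naturality f) }
      cell := fun Γ => ⟨α.cell Γ, β.cell Γ⟩ }
    (proj E A) inj
    (fun | true => α | false => β) (fun | true, _ => rfl | false, _ => rfl)
    (fun i => match i with
      | true => fun _ => rfl
      | false => fun _ => rfl)

end VDProd

namespace TwoCat

open Bicategory

universe w₁ v₁ u₁

section Products

variable {K : Type u₁} [Bicategory.{w₁, v₁} K]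

/-- A product of `E` and `A` in a strict 2-category. -/
structure TwoProduct (E A : K) where
  pt : K
  fst : pt ⟶ E
  snd : pt ⟶ A
  lift : ∀ {W : K}, (W ⟶ E) → (W ⟶ A) → (W ⟶ pt)
  lift_fst : ∀ {W : K} (f : W ⟶ E) (g : W ⟶ A), lift f g ≫ fst = f
  lift_snd : ∀ {W : K} (f : W ⟶ E) (g : W ⟶ A), lift f g ≫ snd = g
  ext : ∀ {W : K} {l l' : W ⟶ pt}, l ≫ fst = l' ≫ fst → l ≫ snd = l' ≫ snd → l = l'
  lift₂ : ∀ {W : K} {l l' : W ⟶ pt}, (l ≫ fst ⟶ l' ≫ fst) → (l ≫ snd ⟶ l' ≫ snd) → (l ⟶ l')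
  lift₂_fst : ∀ {W : K} {l l' : W ⟶ pt} (α : l ≫ fst ⟶ l' ≫ fst) (β : l ≫ snd ⟶ l' ≫ snd),
    lift₂ α β ▷ fst = α
  lift₂_snd : ∀ {W : K} {l l' : W ⟶ pt} (α : l ≫ fst ⟶ l' ≫ fst) (β : l ≫ snd ⟶ l' ≫ snd),
    lift₂ α β ▷ snd = β
  ext₂ : ∀ {W : K} {l l' : W ⟶ pt} {γ δ : l ⟶ l'}, γ ▷ fst = δ ▷ fst → γ ▷ snd = δ ▷ snd → γ = δ

theorem whiskerLeft_congr {A B C : K} {f f' : A ⟶ B} (e : f = f') {g h : B ⟶ C} (η : g ⟶ h) :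
    f ◁ η = eqToHom (by rw [e]) ≫ f' ◁ η ≫ eqToHom (by rw [e]) := by
  subst e; simp

theorem eqToHom_whiskerRight' {A B C : K} {f g : A ⟶ B} (e : f = g) (h : B ⟶ C) :
    eqToHom e ▷ h = eqToHom (congrArg (fun k => k ≫ h) e) := by
  subst e; simp

theorem whiskerLeft_eqToHom' {A B C : K} (f : A ⟶ B) {g h : B ⟶ C} (e : g = h) :
    f ◁ eqToHom e = eqToHom (congrArg (fun k => f ≫ k) e) := by
  subst e; simp

theorem whiskerLeft_whiskerLeft {A B C D : K} (f : A ⟶ B) (g : B ⟶ C) {h k : C ⟶ D} (η : h ⟶ k) :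
    f ◁ g ◁ η = (α_ _ _ _).inv ≫ (f ≫ g) ◁ η ≫ (α_ _ _ _).hom := by
  simp

theorem whiskerRight_whiskerRight {A B C D : K} {f g : A ⟶ B} (η : f ⟶ g) (h : B ⟶ C) (k : C ⟶ D) :
    η ▷ h ▷ k = (α_ _ _ _).hom ≫ η ▷ (h ≫ k) ≫ (α_ _ _ _).inv := by
  simp

variable [Strict K] {E : K} (P : ∀ A : K, TwoProduct E A)

/-- The action on 2-cells of the functor `E × -`. -/
def prodMap₂ {A B : K} {f g : A ⟶ B} (η : f ⟶ g) :
    (P B).lift (P A).fst ((P A).snd ≫ f) ⟶ (P B).lift (P A).fst ((P A).snd ≫ g) :=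
  (P B).lift₂ (eqToHom (((P B).lift_fst _ _).trans ((P B).lift_fst _ _).symm))
    (eqToHom ((P B).lift_snd _ _) ≫ (P A).snd ◁ η ≫ eqToHom ((P B).lift_snd _ _).symm)

theorem prodMap₂_fst {A B : K} {f g : A ⟶ B} (η : f ⟶ g) : prodMap₂ P η ▷ (P B).fst =
    eqToHom (((P B).lift_fst _ _).trans ((P B).lift_fst _ _).symm) := (P B).lift₂_fst _ _

theorem prodMap₂_snd {A B : K} {f g : A ⟶ B} (η : f ⟶ g) : prodMap₂ P η ▷ (P B).snd =
    eqToHom ((P B).lift_snd _ _) ≫ (P A).snd ◁ η ≫ eqToHom ((P B).lift_snd _ _).symm :=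
  (P B).lift₂_snd _ _

theorem prodMap_comp {A B C : K} (f : A ⟶ B) (g : B ⟶ C) :
    (P C).lift (P A).fst ((P A).snd ≫ f ≫ g) =
      (P B).lift (P A).fst ((P A).snd ≫ f) ≫ (P C).lift (P B).fst ((P B).snd ≫ g) :=
  (P C).ext
    (by rw [(P C).lift_fst, Strict.assoc, (P C).lift_fst, (P B).lift_fst])
    (by rw [(P C).lift_snd, Strict.assoc, (P C).lift_snd, ← Strict.assoc, ← Strict.assoc,
      (P B).lift_snd])

/-- The 2-functor `E × - : K → K/E`. -/
def prodOver : StrictPseudofunctor K (Slice E) := StrictPseudofunctor.mk''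
  { obj := fun A => ⟨(P A).pt, (P A).fst⟩
    map := fun {A B} f => ⟨(P B).lift (P A).fst ((P A).snd ≫ f), (P B).lift_fst _ _⟩
    map₂ := fun η => ⟨prodMap₂ P η, prodMap₂_fst P η⟩
    map₂_id := fun {A B} f => Slice.Hom₂.ext ((P B).ext₂
      ((prodMap₂_fst P _).trans (by
        refine Eq.trans ?_ (id_whiskerRight _ _).symm
        rw [eqToHom_refl]))
      ((prodMap₂_snd P _).trans (by
        refine Eq.trans ?_ (id_whiskerRight _ _).symm
        simp)))
    map₂_comp := fun {A B f g h} η θ => Slice.Hom₂.ext ((P B).ext₂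
      ((prodMap₂_fst P _).trans (by
        refine Eq.trans ?_ (comp_whiskerRight _ _ _).symm
        simp only [prodMap₂_fst, eqToHom_trans]))
      ((prodMap₂_snd P _).trans (by
        refine Eq.trans ?_ (comp_whiskerRight _ _ _).symm
        simp [prodMap₂_snd])))
    map_id := fun A => Slice.Hom.ext ((P A).ext
      (((P A).lift_fst _ _).trans (Strict.id_comp _).symm)
      (((P A).lift_snd _ _).trans ((Strict.comp_id _).trans (Strict.id_comp _).symm)))
    map_comp := fun f g => Slice.Hom.ext (prodMap_comp P f g)
    map₂_whisker_left := fun {A B C} f g h η => Slice.Hom₂.ext ((P C).ext₂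
      (by
        simp only [Slice.hom₂_comp, Slice.hom₂_eqToHom, Slice.hom₂_whiskerLeft, comp_whiskerRight,
          eqToHom_whiskerRight']
        rw [prodMap₂_fst, whisker_assoc, prodMap₂_fst]
        simp [Strict.associator_eqToIso])
      (by
        simp only [Slice.hom₂_comp, Slice.hom₂_eqToHom, Slice.hom₂_whiskerLeft, comp_whiskerRight,
          eqToHom_whiskerRight']
        rw [prodMap₂_snd, whisker_assoc, prodMap₂_snd, whiskerLeft_comp, whiskerLeft_comp,
          whiskerLeft_whiskerLeft ((P B).lift (P A).fst ((P A).snd ≫ f)) (P B).snd η,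
          whiskerLeft_congr ((P B).lift_snd (P A).fst ((P A).snd ≫ f)) η,
          comp_whiskerLeft (P A).snd f η]
        simp [Strict.associator_eqToIso]))
    map₂_whisker_right := fun {A B C f g} η h => Slice.Hom₂.ext ((P C).ext₂
      (by
        simp only [Slice.hom₂_comp, Slice.hom₂_eqToHom, Slice.hom₂_whiskerRight, comp_whiskerRight,
          eqToHom_whiskerRight']
        rw [prodMap₂_fst, whiskerRight_whiskerRight,
          Slice.whiskerRight_congr (prodMap₂ P η) ((P C).lift_fst (P B).fst ((P B).snd ≫ h)),
          prodMap₂_fst]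
        simp [Strict.associator_eqToIso])
      (by
        simp only [Slice.hom₂_comp, Slice.hom₂_eqToHom, Slice.hom₂_whiskerRight, comp_whiskerRight,
          eqToHom_whiskerRight']
        rw [prodMap₂_snd, whiskerRight_whiskerRight,
          Slice.whiskerRight_congr (prodMap₂ P η) ((P C).lift_snd (P B).fst ((P B).snd ≫ h)),
          whiskerRight_comp (prodMap₂ P η) (P B).snd h, prodMap₂_snd, comp_whiskerRight,
          comp_whiskerRight, eqToHom_whiskerRight', eqToHom_whiskerRight', whisker_assoc]
        simp [Strict.associator_eqToIso])) }

end Products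

end TwoCat

theorem VDTrans.cell_congr {X Y : VDC.{v}} {F G : VDFunctor X Y} {α β : VDTrans F G} (h : α = β)
    {A B : X.Obj} (Γ : X.Hor A B) : HEq (α.cell Γ) (β.cell Γ) := by
  subst h; rfl

open TwoCat in
/-- The product of two virtual double categories, as a product in the 2-category of virtual double
categories. -/
def VDProd.twoProduct (E A : VDC.{v}) : TwoProduct E A where
  pt := prod E A
  fst := fst E A
  snd := snd E A
  lift F G := lift F G
  lift_fst F G := lift_fst F G
  lift_snd F G := lift_snd F G
  ext {W l l'} h h' := by
    have e : lift (VDFunctor.comp l (fst E A)) (VDFunctor.comp l (snd E A)) =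
      lift (VDFunctor.comp l' (fst E A)) (VDFunctor.comp l' (snd E A)) :=
        congrArg₂ lift h h'
    rwa [lift_eta, lift_eta] at e
  lift₂ α β := lift₂ α β
  lift₂_fst _ _ := rfl
  lift₂_snd _ _ := rfl
  ext₂ {W l l' γ δ} h h' := by
    obtain ⟨⟨γv, γc⟩, _⟩ := γ
    obtain ⟨⟨δv, δc⟩, _⟩ := δ
    have ev : γv = δv := by
      refine NatTrans.ext (funext fun X => _root_.Prod.ext ?_ ?_)
      · exact congrArg (fun (α : VDTrans _ _) => α.vert.app X) h
      · exact congrArg (fun (α : VDTrans _ _) => α.vert.app X) h'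
    subst ev
    have ec : @γc = @δc := by
      funext X Y Γ
      exact _root_.Prod.ext (eq_of_heq (VDTrans.cell_congr h Γ))
        (eq_of_heq (VDTrans.cell_congr h' Γ))
    subst ec
    rfl

/-! ### Chains of elements along paths -/

/-- Given a set `car A` for each vertex `A` and sets `fib Γ i j` for each edge `Γ : A ⟶ B`,
`i ∈ car A`, `j ∈ car B`, the set of chains of elements along a path `Γ₁, …, Γₙ` from `i` to `j`:
elements `sₘ ∈ fib Γₘ iₘ₋₁ iₘ` for some elements `iₘ` with `i₀ = i` and `iₙ = j`. For `n = 0` there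
is one chain from `i` to `j` if `i = j`, and none otherwise. -/
def Chain {O : Type w} {H : O → O → Type w} (car : O → Type u)
    (fib : ∀ A B : O, H A B → car A → car B → Type u) :
    ∀ {A B : O}, HPath H A B → car A → car B → Type u
  | _, _, .nil _, i, j => ULift.{u} (PLift (i = j))
  | _, _, .cons Γ Γs, i, j => Σ k, fib _ _ Γ i k × Chain car fib Γs k j

namespace Chain

variable {O : Type w} {H : O → O → Type w} {car : O → Type u}
  {fib : ∀ A B : O, H A B → car A → car B → Type u}

/-- The chain of length zero. -/
def nil (A : O) (i : car A) : Chain car fib (.nil A) i i := ⟨⟨rfl⟩⟩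

/-- Extension of a chain. -/
def cons {A B C : O} {Γ : H A B} {Γs : HPath H B C} {i : car A} {k : car B} {j : car C}
    (s : fib _ _ Γ i k) (c : Chain car fib Γs k j) : Chain car fib (.cons Γ Γs) i j := ⟨k, s, c⟩

/-- Transport of a chain along an equality of paths. -/
def cast {A B : O} {Γs Δs : HPath H A B} {i : car A} {j : car B} (h : Γs = Δs)
    (c : Chain car fib Γs i j) : Chain car fib Δs i j := by
  subst h; exact c

/-- Concatenation of chains. -/
def append : ∀ {A B C : O} {Γs : HPath H A B} {Δs : HPath H B C} {i : car A} {k : car B}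
    {j : car C}, Chain car fib Γs i k → Chain car fib Δs k j → Chain car fib (Γs.append Δs) i j
  | _, _, _, .nil _, _, _, _, _, c, d => c.down.down ▸ d
  | _, _, _, .cons _ _, _, _, _, _, c, d => ⟨c.1, c.2.1, append c.2.2 d⟩

variable (car fib) in
/-- Two consecutive chains. -/
structure Pair {A B C : O} (Γs : HPath H A B) (Δs : HPath H B C) (i : car A) (j : car C) where
  mid : car B
  fst : Chain car fib Γs i mid
  snd : Chain car fib Δs mid j

/-- Splitting of a chain along a concatenation of paths. -/
def split : ∀ {A B C : O} (Γs : HPath H A B) {Δs : HPath H B C} {i : car A} {j : car C},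
    Chain car fib (Γs.append Δs) i j → Pair car fib Γs Δs i j
  | _, _, _, .nil _, _, i, _, c => ⟨i, ⟨⟨rfl⟩⟩, c⟩
  | _, _, _, .cons _ Γs, _, _, _, c =>
    ⟨(split Γs c.2.2).mid, ⟨c.1, c.2.1, (split Γs c.2.2).fst⟩, (split Γs c.2.2).snd⟩

theorem split_append : ∀ {A B C : O} {Γs : HPath H A B} {Δs : HPath H B C} {i : car A} {k : car B}
    {j : car C} (c : Chain car fib Γs i k) (d : Chain car fib Δs k j),
    split Γs (c.append d) = ⟨k, c, d⟩
  | _, _, _, .nil _, _, _, _, _, c, d => by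
    obtain ⟨⟨rfl⟩⟩ := c; rfl
  | _, _, _, .cons _ _, _, _, _, _, c, d =>
    congrArg (fun p : Pair car fib _ _ c.1 _ =>
      (⟨p.mid, Chain.cons c.2.1 p.fst, p.snd⟩ : Pair car fib (.cons _ _) _ _ _))
      (split_append c.2.2 d)

theorem append_split : ∀ {A B C : O} (Γs : HPath H A B) {Δs : HPath H B C} {i : car A} {j : car C}
    (c : Chain car fib (Γs.append Δs) i j), (split Γs c).fst.append (split Γs c).snd = c
  | _, _, _, .nil _, _, i, _, c => rfl
  | _, _, _, .cons Γ Γs, _, _, _, c =>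
    congrArg (Chain.cons (car := car) (Γ := Γ) c.2.1) (append_split Γs c.2.2)

theorem cast_cons {A B C : O} {Γ : H A B} {Γs Γs' : HPath H B C} {i : car A} {k : car B} {j : car C}
    (s : fib _ _ Γ i k) (c : Chain car fib Γs k j) (h : Γs = Γs') :
    (Chain.cons s c).cast (congrArg (HPath.cons Γ) h) = .cons s (c.cast h) := by
  subst h; rfl

theorem append_nil : ∀ {A B : O} {Γs : HPath H A B} {i : car A} {j : car B}
    (c : Chain car fib Γs i j), c.append (.nil B j) = c.cast (HPath.append_nil Γs).symm
  | _, _, .nil _, _, _, c => by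
    obtain ⟨⟨rfl⟩⟩ := c; rfl
  | _, _, .cons _ _, _, _, c =>
    (congrArg (Chain.cons c.2.1) (append_nil c.2.2)).trans (cast_cons c.2.1 c.2.2 _).symm

theorem append_cast {A B C : O} {Γs : HPath H A B} {Δs Δs' : HPath H B C} {i : car A} {k : car B}
    {j : car C} (c : Chain car fib Γs i k) (d : Chain car fib Δs k j) (h : Δs = Δs') :
    c.append (d.cast h) = (c.append d).cast (congrArg Γs.append h) := by
  subst h; rfl

theorem append_assoc : ∀ {A B C D : O} {Γs : HPath H A B} {Δs : HPath H B C} {Λs : HPath H C D}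
    {i : car A} {k : car B} {l : car C} {j : car D} (c : Chain car fib Γs i k)
    (d : Chain car fib Δs k l) (e : Chain car fib Λs l j),
    (c.append d).append e = (c.append (d.append e)).cast (HPath.append_assoc Γs Δs Λs).symm
  | _, _, _, _, .nil _, _, _, _, _, _, _, c, _, _ => by
    obtain ⟨⟨rfl⟩⟩ := c; rfl
  | _, _, _, _, .cons _ _, _, _, _, _, _, _, c, d, e =>
    (congrArg (Chain.cons c.2.1) (append_assoc c.2.2 d e)).trans (cast_cons c.2.1 _ _).symm

@[simp]
theorem cast_cast {A B : O} {Γs Δs Λs : HPath H A B} {i : car A} {j : car B} (h : Γs = Δs)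
    (h' : Δs = Λs) (c : Chain car fib Γs i j) : (c.cast h).cast h' = c.cast (h.trans h') := by
  subst h h'; rfl

@[simp]
theorem cast_rfl {A B : O} {Γs : HPath H A B} {i : car A} {j : car B} (h : Γs = Γs)
    (c : Chain car fib Γs i j) : c.cast h = c := rfl

theorem eq_cast_cast {A B : O} {Γs Δs : HPath H A B} {i : car A} {j : car B} (h : Γs = Δs)
    (c : Chain car fib Γs i j) : c = (c.cast h).cast h.symm := by
  subst h; rfl

variable {O' : Type w} {H' : O' → O' → Type w} {car' : O' → Type u}
  {fib' : ∀ A B : O', H' A B → car' A → car' B → Type u}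

/-- Chains along the image of a path, as chains along the original path. -/
def unmap (f : O → O') (g : ∀ A B : O, H A B → H' (f A) (f B)) :
    ∀ {A B : O} (Γs : HPath H A B) {i : car' (f A)} {j : car' (f B)},
      Chain car' fib' (Γs.map f g) i j →
        Chain (fun A => car' (f A)) (fun A B Γ i j => fib' _ _ (g A B Γ) i j) Γs i j
  | _, _, .nil _, _, _, c => c
  | _, _, .cons _ Γs, _, _, c => ⟨c.1, c.2.1, unmap f g Γs c.2.2⟩

/-- Image of a chain under a map of graphs and compatible maps of sets. -/
def map (f : O → O') (g : ∀ A B : O, H A B → H' (f A) (f B)) (a : ∀ A : O, car A → car' (f A))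
    (b : ∀ (A B : O) (Γ : H A B) (i : car A) (j : car B), fib A B Γ i j →
      fib' _ _ (g A B Γ) (a A i) (a B j)) :
    ∀ {A B : O} {Γs : HPath H A B} {i : car A} {j : car B}, Chain car fib Γs i j →
      Chain car' fib' (Γs.map f g) (a A i) (a B j)
  | _, _, .nil _, _, _, c => ⟨⟨congrArg (a _) c.down.down⟩⟩
  | _, _, .cons _ _, _, _, c => ⟨a _ c.1, b _ _ _ _ _ c.2.1, map f g a b c.2.2⟩

end Chain

/-! ### The virtual double category of spans -/

/-- A set in the universe `u`, as an object of the virtual double category of spans. -/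
structure SpanObj : Type (max (u + 1) v) where
  carrier : Type u

/-- A function between sets. -/
@[ext]
structure SpanMap (I J : SpanObj.{u, v}) : Type (max (u + 1) v) where
  fn : I.carrier → J.carrier

/-- A span of sets. -/
structure SpanHor (I J : SpanObj.{u, v}) : Type (max (u + 1) v) where
  apex : Type u
  left : apex → I.carrier
  right : apex → J.carrier

/-- The elements of the apex of a span lying over given elements of its feet. -/
def SpanHor.Fiber {I J : SpanObj.{u, v}} (S : SpanHor I J) (i : I.carrier) (j : J.carrier) :
    Type u :=
  {s : S.apex // S.left s = i ∧ S.right s = j}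

instance SpanObj.category : Category.{max (u + 1) v} SpanObj.{u, v} where
  Hom I J := SpanMap I J
  id I := ⟨fun i => i⟩
  comp f g := ⟨fun i => g.fn (f.fn i)⟩

/-- Chains of elements along a path of spans: the elements of the iterated pullback of the path. -/
abbrev SpanChain {I J : SpanObj.{u, v}} (Ss : HPath SpanHor.{u, v} I J) (i : I.carrier)
    (j : J.carrier) : Type u :=
  Chain (H := SpanHor.{u, v}) SpanObj.carrier (fun _ _ S i j => S.Fiber i j) Ss i j

/-- A multicell of spans: a function from the iterated pullback of the path on top to the apex of
the span on the bottom, compatible with the projections to the outer feet. -/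
structure SpanCell {I I' J J' : SpanObj.{u, v}} (Ss : HPath SpanHor.{u, v} I I') (f : I ⟶ J)
    (f' : I' ⟶ J') (T : SpanHor J J') : Type (max (u + 1) v) where
  fn : ∀ {i : I.carrier} {i' : I'.carrier}, SpanChain Ss i i' → T.Fiber (f.fn i) (f'.fn i')

/-- The underlying data of the virtual double category of spans. -/
abbrev spanGraph : VDGraph.{max (u + 1) v} where
  Obj := SpanObj.{u, v}
  vert := SpanObj.category.{u, v}
  Hor := SpanHor.{u, v}
  Cell Ss f f' T := SpanCell Ss f f' T

namespace Spans

theorem ext_cell {I I' J J' : SpanObj.{u, v}} {Ss : HPath SpanHor.{u, v} I I'} {f : I ⟶ J}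
    {f' : I' ⟶ J'} {T : SpanHor J J'} {θ κ : SpanCell Ss f f' T}
    (h : ∀ {i : I.carrier} {i' : I'.carrier} (c : SpanChain Ss i i'), (θ.fn c).1 = (κ.fn c).1) :
    θ = κ := by
  rcases θ with ⟨θ⟩
  rcases κ with ⟨κ⟩
  congr 1
  funext i i' c
  exact Subtype.ext (h c)

/-- The action of a sequence of multicells on chains. -/
def push : ∀ {I I' J J' : SpanObj.{u, v}} {Ts : HPath SpanHor.{u, v} J J'} {f : I ⟶ J} {f' : I' ⟶ J'}
    (θs : spanGraph.{u, v}.CellPath Ts f f') {i : I.carrier} {i' : I'.carrier},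
    SpanChain θs.top i i' → SpanChain Ts (f.fn i) (f'.fn i')
  | _, _, _, _, _, _, _, .nil f, _, _, c => ⟨⟨congrArg f.fn c.down.down⟩⟩
  | _, _, _, _, _, _, _, .cons (Γs := Ss) θ θs, _, _, c =>
    Chain.cons (θ.fn (c.split Ss).fst) (push θs (c.split Ss).snd)

/-- The identity cell on a span. -/
def idCell {I J : SpanObj.{u, v}} (S : SpanHor I J) : SpanCell (.single S) (𝟙 I) (𝟙 J) S where
  fn {i j} c := ⟨c.2.1.1, c.2.1.2.1, c.2.1.2.2.trans c.2.2.down.down⟩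

/-- Identities and composition of multicells of spans. -/
abbrev data : VDCData.{max (u + 1) v} where
  toVDGraph := spanGraph.{u, v}
  id S := idCell S
  comp {I I' J J' K K' Ts f f'} θs {g g' U} κ {Ss h h'} e e₁ e₂ := by
    subst e e₁ e₂
    exact ⟨fun c => κ.fn (push θs c)⟩

theorem comp_fn {I I' J J' K K' : SpanObj.{u, v}} {Ts : HPath SpanHor.{u, v} J J'} {f : I ⟶ J}
    {f' : I' ⟶ J'} (θs : spanGraph.{u, v}.CellPath Ts f f') {g : J ⟶ K} {g' : J' ⟶ K'}
    {U : SpanHor K K'} (κ : SpanCell Ts g g' U) {Ss : HPath SpanHor.{u, v} I I'} {h : I ⟶ K}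
    {h' : I' ⟶ K'} (e : θs.top = Ss) (e₁ : f ≫ g = h) (e₂ : f' ≫ g' = h') {i : I.carrier}
    {i' : I'.carrier} (c : SpanChain Ss i i') :
    (SpanCell.fn (data.{u, v}.comp θs κ e e₁ e₂) c).1 = (κ.fn (push θs (c.cast e.symm))).1 := by
  subst e e₁ e₂
  rfl

theorem push_ids : ∀ {I J : SpanObj.{u, v}} {Ss : HPath SpanHor.{u, v} I J} {i : I.carrier}
    {j : J.carrier} (c : SpanChain Ss i j),
    push (data.{u, v}.ids Ss) (c.cast (data.{u, v}.top_ids Ss).symm) = c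
  | _, _, .nil _, _, _, _ => rfl
  | _, _, .cons S Ss, _, _, c => by
    have h := Chain.cast_cons (Γ := S) c.2.1 c.2.2 (data.{u, v}.top_ids Ss).symm
    refine (congrArg (push (data.{u, v}.ids (.cons S Ss))) h).trans ?_
    exact congrArg (Chain.cons c.2.1) (push_ids c.2.2)

theorem push_cons {I I' I'' J J' J'' : SpanObj.{u, v}} {Ss : HPath SpanHor.{u, v} I I'}
    {T : SpanHor.{u, v} J J'} {Ts : HPath SpanHor.{u, v} J' J''} {f : I ⟶ J} {f' : I' ⟶ J'}
    {f'' : I'' ⟶ J''} (θ : SpanCell Ss f f' T) (θs : spanGraph.{u, v}.CellPath Ts f' f'')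
    {i : I.carrier} {i' : I'.carrier} {i'' : I''.carrier} (c : SpanChain Ss i i')
    (d : SpanChain θs.top i' i'') :
    push (VDGraph.CellPath.cons (X := spanGraph.{u, v}) θ θs) (c.append d) =
      Chain.cons (θ.fn c) (push θs d) :=
  congrArg (fun p : Chain.Pair _ _ Ss θs.top i i'' => Chain.cons (θ.fn p.fst) (push θs p.snd))
    (Chain.split_append c d)

theorem push_append : ∀ {I I' I'' J J' J'' : SpanObj.{u, v}} {Ts : HPath SpanHor.{u, v} J J'}
    {Ts' : HPath SpanHor.{u, v} J' J''} {f : I ⟶ J} {f' : I' ⟶ J'} {f'' : I'' ⟶ J''}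
    (θs : spanGraph.{u, v}.CellPath Ts f f') (κs : spanGraph.{u, v}.CellPath Ts' f' f'')
    {i : I.carrier} {i' : I'.carrier} {i'' : I''.carrier} (c : SpanChain θs.top i i')
    (d : SpanChain κs.top i' i''),
    push (θs.append κs) ((c.append d).cast (VDGraph.CellPath.top_append θs κs).symm) =
      (push θs c).append (push κs d)
  | _, _, _, _, _, _, _, _, _, _, _, .nil _, κs, _, _, _, c, d => by
    obtain ⟨⟨rfl⟩⟩ := c; rfl
  | _, _, _, _, _, _, _, _, _, _, _, .cons (Γs := Ss) θ θs, κs, _, _, _, c, d => by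
    obtain ⟨k, c₁, c₂, rfl⟩ : ∃ (k : _) (c₁ : SpanChain Ss _ k) (c₂ : SpanChain θs.top k _),
        c = c₁.append c₂ := ⟨_, _, _, (Chain.append_split Ss c).symm⟩
    have h : ((c₁.append c₂).append d).cast (VDGraph.CellPath.top_append
        (VDGraph.CellPath.cons θ θs) κs).symm =
        c₁.append ((c₂.append d).cast (VDGraph.CellPath.top_append θs κs).symm) :=
      (congrArg (Chain.cast _) (Chain.append_assoc c₁ c₂ d)).trans
        ((Chain.cast_cast _ _ _).trans (Chain.append_cast _ _ _).symm)
    refine (congrArg (push ((VDGraph.CellPath.cons θ θs).append κs)) h).trans ?_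
    refine (push_cons θ (θs.append κs) c₁ _).trans ?_
    refine (congrArg (Chain.cons (θ.fn c₁)) (push_append θs κs c₂ d)).trans ?_
    exact (congrArg (fun e => Chain.append e (push κs d)) (push_cons θ θs c₁ c₂)).symm

theorem push_treeComp : ∀ {I I' J J' K K' : SpanObj.{u, v}} {Us : HPath SpanHor.{u, v} K K'}
    {f : I ⟶ J} {f' : I' ⟶ J'} {g : J ⟶ K} {g' : J' ⟶ K'}
    (t : spanGraph.{u, v}.CellTree Us f f' g g') {i : I.carrier} {i' : I'.carrier}
    (c : SpanChain t.upper.top i i'),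
    push (data.{u, v}.treeComp t) (c.cast (data.{u, v}.top_treeComp t).symm) =
      push t.lower (push t.upper c)
  | _, _, _, _, _, _, _, _, _, _, _, .nil _ _, _, _, _ => rfl
  | _, _, _, _, _, _, _, _, _, _, _, .cons θs κ t, _, _, c => by
    obtain ⟨c', rfl⟩ : ∃ c', c = Chain.cast (VDGraph.CellPath.top_append θs t.upper).symm c' :=
      ⟨_, Chain.eq_cast_cast (VDGraph.CellPath.top_append θs t.upper) c⟩
    obtain ⟨k, c₁, c₂, rfl⟩ : ∃ (k : _) (c₁ : SpanChain θs.top _ k) (c₂ : SpanChain t.upper.top k _),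
        c' = c₁.append c₂ := ⟨_, _, _, (Chain.append_split θs.top c').symm⟩
    have h : ((c₁.append c₂).cast (VDGraph.CellPath.top_append θs t.upper).symm).cast
        (data.{u, v}.top_treeComp (VDGraph.CellTree.cons θs κ t)).symm =
        c₁.append (c₂.cast (data.{u, v}.top_treeComp t).symm) :=
      (Chain.cast_cast _ _ _).trans (Chain.append_cast _ _ _).symm
    refine (congrArg (push (data.{u, v}.treeComp (VDGraph.CellTree.cons θs κ t))) h).trans ?_
    refine Eq.trans ?_ (congrArg (push (VDGraph.CellTree.cons θs κ t).lower)
      (push_append θs t.upper c₁ c₂)).symm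
    refine (push_cons _ (data.{u, v}.treeComp t) c₁ _).trans ?_
    refine Eq.trans ?_ (push_cons κ t.lower (push θs c₁) (push t.upper c₂)).symm
    exact congrArg (Chain.cons _) (push_treeComp t c₂)

end Spans

/-- The virtual double category of sets in the universe `u`, functions and spans. -/
def Span : VDC.{max (u + 1) v} where
  toVDCData := Spans.data.{u, v}
  id_comp κ := Spans.ext_cell fun c =>
    (Spans.comp_fn _ _ _ _ _ c).trans (congrArg (fun c => (SpanCell.fn κ c).1) (Spans.push_ids c))
  comp_id {_ _ _ _ Ss _ _ _} θ := Spans.ext_cell fun c => by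
    refine (Spans.comp_fn _ _ _ _ _ c).trans ?_
    have h := (congrArg (Spans.push (VDGraph.CellPath.single θ)) (Chain.append_nil c)).symm
    refine (congrArg (fun c => (SpanCell.fn (Spans.idCell _) c).1) h).trans ?_
    exact congrArg (fun c => (SpanCell.fn (Spans.idCell _) c).1) (Spans.push_cons θ (.nil _) c _)
  assoc t l := Spans.ext_cell fun c => by
    refine (Spans.comp_fn _ _ _ _ _ c).trans ?_
    exact (congrArg (fun c => (SpanCell.fn l c).1) (Spans.push_treeComp t c))

/-! ### The virtual double category of families -/

/-- An object of the virtual double category of families in `A`: a family of objects of `A` indexed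
by a set in the universe `u`. -/
structure FamObj (A : VDC.{max (u + 1) v}) : Type (max (u + 1) v) where
  idx : Type u
  fam : idx → A.Obj

/-- A vertical morphism of families. -/
structure FamMap {A : VDC.{max (u + 1) v}} (P Q : FamObj.{u, v} A) : Type (max (u + 1) v) where
  fn : P.idx → Q.idx
  map : ∀ i, P.fam i ⟶ Q.fam (fn i)

/-- The set of indices of a family. -/
def FamObj.set {A : VDC.{max (u + 1) v}} (P : FamObj.{u, v} A) : SpanObj.{u, v} := ⟨P.idx⟩

/-- A horizontal morphism of families: a span `S` between the sets of indices, and a family of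
horizontal morphisms indexed by `S`. The horizontal morphism with index `s`, lying over `i` and `j`,
goes from the object with index `i` to the object with index `j`. -/
structure FamHor {A : VDC.{max (u + 1) v}} (P Q : FamObj.{u, v} A) : Type (max (u + 1) v) where
  span : SpanHor P.set Q.set
  fam : ∀ {i : P.idx} {j : Q.idx}, span.Fiber i j → A.Hor (P.fam i) (Q.fam j)

instance FamObj.category (A : VDC.{max (u + 1) v}) :
    Category.{max (u + 1) v} (FamObj.{u, v} A) where
  Hom P Q := FamMap P Q
  id P := ⟨fun i => i, fun i => 𝟙 (P.fam i)⟩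
  comp f g := ⟨fun i => g.fn (f.fn i), fun i => f.map i ≫ g.map (f.fn i)⟩
  id_comp f := congrArg (FamMap.mk f.fn) (funext fun _ => Category.id_comp _)
  comp_id f := congrArg (FamMap.mk f.fn) (funext fun _ => Category.comp_id _)
  assoc f g h := congrArg (FamMap.mk _) (funext fun _ => Category.assoc _ _ _)

/-- Chains of indices along a path of horizontal morphisms of families. -/
abbrev FamChain {A : VDC.{max (u + 1) v}} {P Q : FamObj.{u, v} A}
    (Γs : HPath (FamHor (A := A)) P Q) (i : P.idx) (j : Q.idx) : Type u :=
  Chain (H := FamHor (A := A)) FamObj.idx (fun _ _ Γ i j => Γ.span.Fiber i j) Γs i j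

namespace Fams

variable {A : VDC.{max (u + 1) v}}

/-- The path of horizontal morphisms of `A` selected by a chain of indices. -/
def path : ∀ {P Q : FamObj.{u, v} A} {Γs : HPath (FamHor (A := A)) P Q} {i : P.idx} {j : Q.idx},
    FamChain Γs i j → HPath A.Hor (P.fam i) (Q.fam j)
  | P, _, .nil _, i, _, c => c.down.down ▸ HPath.nil (P.fam i)
  | _, _, .cons Γ _, _, _, c => .cons (Γ.fam c.2.1) (path c.2.2)

theorem path_append : ∀ {P Q R : FamObj.{u, v} A} {Γs : HPath (FamHor (A := A)) P Q}
    {Δs : HPath (FamHor (A := A)) Q R} {i : P.idx} {j : Q.idx} {k : R.idx}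
    (c : FamChain Γs i j) (d : FamChain Δs j k),
    path (Chain.append c d) = (path c).append (path d)
  | _, _, _, .nil _, _, _, _, _, c, d => by
    obtain ⟨⟨rfl⟩⟩ := c; rfl
  | _, _, _, .cons Γ _, _, _, _, _, c, d =>
    congrArg (HPath.cons (Γ.fam c.2.1)) (path_append c.2.2 d)

theorem path_cast {P Q : FamObj.{u, v} A} {Γs Δs : HPath (FamHor (A := A)) P Q}
    (h : Γs = Δs) {i : P.idx} {j : Q.idx} (c : FamChain Γs i j) :
    path (Chain.cast h c) = path c := by
  subst h; rfl

end Fams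

/-- A multicell of families with top boundary a path `Γs` over spans `S₁, …, Sₙ`, and bottom
boundary `Δ` over a span `T`: a multicell of spans from `S₁, …, Sₙ` to `T`, and a family of
multicells of `A` indexed by the iterated pullback of `S₁, …, Sₙ`. -/
structure FamCell {A : VDC.{max (u + 1) v}} {P P' Q Q' : FamObj.{u, v} A}
    (Γs : HPath (FamHor (A := A)) P P') (f : P ⟶ Q) (f' : P' ⟶ Q') (Δ : FamHor Q Q') :
    Type (max (u + 1) v) where
  fn : ∀ {i : P.idx} {i' : P'.idx}, FamChain Γs i i' → Δ.span.Fiber (f.fn i) (f'.fn i')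
  cell : ∀ {i : P.idx} {i' : P'.idx} (c : FamChain Γs i i'),
    A.Cell (Fams.path c) (f.map i) (f'.map i') (Δ.fam (fn c))

/-- The underlying data of the virtual double category of families. -/
abbrev famGraph (A : VDC.{max (u + 1) v}) : VDGraph.{max (u + 1) v} where
  Obj := FamObj.{u, v} A
  vert := FamObj.category.{u, v} A
  Hor := FamHor
  Cell Γs f f' Δ := FamCell Γs f f' Δ

namespace Fams

variable {A : VDC.{max (u + 1) v}}

/-- The possible values of a multicell of families on a chain. -/
def Val {P P' Q Q' : FamObj.{u, v} A} (f : P ⟶ Q) (f' : P' ⟶ Q') (Δ : FamHor Q Q') (i : P.idx)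
    (i' : P'.idx) (πs : HPath A.Hor (P.fam i) (P'.fam i')) : Type (max (u + 1) v) :=
  Σ t : Δ.span.Fiber (f.fn i) (f'.fn i'), A.Cell πs (f.map i) (f'.map i') (Δ.fam t)

/-- The value of a multicell of families on a chain. -/
def toFn {P P' Q Q' : FamObj.{u, v} A} {Γs : HPath (FamHor (A := A)) P P'} {f : P ⟶ Q}
    {f' : P' ⟶ Q'} {Δ : FamHor Q Q'} (θ : FamCell Γs f f' Δ) {i : P.idx} {i' : P'.idx}
    (c : FamChain Γs i i') : Val f f' Δ i i' (path c) := ⟨θ.fn c, θ.cell c⟩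

theorem ext_cell {P P' Q Q' : FamObj.{u, v} A} {Γs : HPath (FamHor (A := A)) P P'} {f : P ⟶ Q}
    {f' : P' ⟶ Q'} {Δ : FamHor Q Q'} {θ κ : FamCell Γs f f' Δ}
    (h : ∀ {i : P.idx} {i' : P'.idx} (c : FamChain Γs i i'), toFn θ c = toFn κ c) : θ = κ := by
  have e : (fun (i : P.idx) (i' : P'.idx) (c : FamChain Γs i i') => toFn θ c) =
      fun i i' c => toFn κ c := by
    funext i i' c
    exact h c
  exact congrArg (fun (F : ∀ (i : P.idx) (i' : P'.idx) (c : FamChain Γs i i'),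
    Val f f' Δ i i' (path c)) =>
      FamCell.mk (fun {i i'} c => (F i i' c).1) (fun {i i'} c => (F i i' c).2)) e

/-- Transport of values. -/
def castVal {P P' Q Q' : FamObj.{u, v} A} {f g : P ⟶ Q} {f' g' : P' ⟶ Q'} {Δ : FamHor Q Q'}
    {i : P.idx} {i' : P'.idx} {πs ρs : HPath A.Hor (P.fam i) (P'.fam i')} (e : πs = ρs)
    (e₁ : f = g) (e₂ : f' = g') (x : Val f f' Δ i i' πs) : Val g g' Δ i i' ρs := by
  subst e e₁ e₂; exact x

theorem castVal_eq {P P' Q Q' : FamObj.{u, v} A} {f g : P ⟶ Q} {f' g' : P' ⟶ Q'} {Δ : FamHor Q Q'}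
    {i : P.idx} {i' : P'.idx} {πs ρs : HPath A.Hor (P.fam i) (P'.fam i')} (e : πs = ρs)
    (e₁ : f = g) (e₂ : f' = g') {x : Val f f' Δ i i' πs} {y : Val g g' Δ i i' ρs}
    (h : x.1.1 = y.1.1) (h' : HEq x.2 y.2) : castVal e e₁ e₂ x = y := by
  subst e e₁ e₂
  obtain ⟨s, θ⟩ := x
  obtain ⟨t, κ⟩ := y
  have hs : s = t := Subtype.ext h
  subst hs
  exact congrArg (Sigma.mk s) (eq_of_heq h')

/-- A chain along a path of horizontal morphisms of families, together with a sequence of multicells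
on top of the path of horizontal morphisms of `A` which it selects. -/
structure Push {P P' Q Q' : FamObj.{u, v} A} (Δs : HPath (FamHor (A := A)) Q Q') (f : P ⟶ Q)
    (f' : P' ⟶ Q') (i : P.idx) (i' : P'.idx) where
  chain : FamChain Δs (f.fn i) (f'.fn i')
  cells : A.CellPath (path chain) (f.map i) (f'.map i')

/-- Extension of such a pair by a multicell. -/
def pushCons {P P' P'' Q Q' Q'' : FamObj.{u, v} A} {Γs : HPath (FamHor (A := A)) P P'}
    {Δ : FamHor Q Q'} {Δs : HPath (FamHor (A := A)) Q' Q''} {f : P ⟶ Q} {f' : P' ⟶ Q'}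
    {f'' : P'' ⟶ Q''} (θ : FamCell Γs f f' Δ) {i : P.idx} {i' : P'.idx} {i'' : P''.idx}
    (c : FamChain Γs i i') (r : Push Δs f' f'' i' i'') : Push (.cons Δ Δs) f f'' i i'' :=
  ⟨⟨f'.fn i', θ.fn c, r.chain⟩, .cons (θ.cell c) r.cells⟩

/-- The action of a sequence of multicells of families on chains. -/
def push : ∀ {P P' Q Q' : FamObj.{u, v} A} {Δs : HPath (FamHor (A := A)) Q Q'} {f : P ⟶ Q}
    {f' : P' ⟶ Q'} (θs : (famGraph.{u, v} A).CellPath Δs f f') {i : P.idx} {i' : P'.idx},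
    FamChain θs.top i i' → Push Δs f f' i i'
  | _, _, _, _, _, _, _, .nil f, i, _, c =>
    ⟨⟨⟨congrArg f.fn c.down.down⟩⟩, by
      obtain ⟨⟨rfl⟩⟩ := c; exact .nil (f.map i)⟩
  | _, _, _, _, _, _, _, .cons (Γs := Γs) θ θs, _, _, c =>
    pushCons θ (c.split Γs).fst (push θs (c.split Γs).snd)

theorem push_top : ∀ {P P' Q Q' : FamObj.{u, v} A} {Δs : HPath (FamHor (A := A)) Q Q'} {f : P ⟶ Q}
    {f' : P' ⟶ Q'} (θs : (famGraph.{u, v} A).CellPath Δs f f') {i : P.idx} {i' : P'.idx}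
    (c : FamChain θs.top i i'), (push θs c).cells.top = path c
  | _, _, _, _, _, _, _, .nil f, i, _, c => by
    obtain ⟨⟨rfl⟩⟩ := c; rfl
  | _, _, _, _, _, _, _, .cons (Γs := Γs) θ θs, _, _, c =>
    (congrArg (HPath.append (path (c.split Γs).fst)) (push_top θs (c.split Γs).snd)).trans
      ((path_append _ _).symm.trans (congrArg path (Chain.append_split Γs c)))

/-- The identity cell on a horizontal morphism of families. -/
def idCell {P Q : FamObj.{u, v} A} (Γ : FamHor P Q) : FamCell (.single Γ) (𝟙 P) (𝟙 Q) Γ where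
  fn c := ⟨c.2.1.1, c.2.1.2.1, c.2.1.2.2.trans c.2.2.down.down⟩
  cell c := by
    obtain ⟨k, s, ⟨⟨rfl⟩⟩⟩ := c
    exact A.id (Γ.fam s)

variable (A) in
/-- Identities and composition of multicells of families. -/
abbrev data : VDCData.{max (u + 1) v} where
  toVDGraph := famGraph.{u, v} A
  id Γ := idCell Γ
  comp θs _ _ _ κ _ _ _ e e₁ e₂ := by
    subst e e₁ e₂
    exact ⟨fun c => κ.fn (push θs c).chain,
      fun c => A.comp (push θs c).cells (κ.cell (push θs c).chain) (push_top θs c) rfl rfl⟩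

/-- The value of a multicell on a chain with a sequence of multicells on top of it. -/
def val {P P' Q Q' R R' : FamObj.{u, v} A} {Δs : HPath (FamHor (A := A)) Q Q'} {f : P ⟶ Q}
    {f' : P' ⟶ Q'} {g : Q ⟶ R} {g' : Q' ⟶ R'} {Λ : FamHor R R'} (κ : FamCell Δs g g' Λ) {i : P.idx}
    {i' : P'.idx} (p : Push Δs f f' i i') {πs : HPath A.Hor (P.fam i) (P'.fam i')}
    (h : p.cells.top = πs) : Val (f ≫ g) (f' ≫ g') Λ i i' πs :=
  ⟨κ.fn p.chain, A.comp p.cells (κ.cell p.chain) h rfl rfl⟩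

theorem comp_fn {P P' Q Q' R R' : FamObj.{u, v} A} {Δs : HPath (FamHor (A := A)) Q Q'} {f : P ⟶ Q}
    {f' : P' ⟶ Q'} (θs : (famGraph.{u, v} A).CellPath Δs f f') {g : Q ⟶ R} {g' : Q' ⟶ R'}
    {Λ : FamHor R R'} (κ : FamCell Δs g g' Λ) {Γs : HPath (FamHor (A := A)) P P'} {h : P ⟶ R}
    {h' : P' ⟶ R'} (e : θs.top = Γs) (e₁ : f ≫ g = h) (e₂ : f' ≫ g' = h') {i : P.idx}
    {i' : P'.idx} (c : FamChain Γs i i') :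
    toFn ((data.{u, v} A).comp θs κ e e₁ e₂) c =
      castVal (path_cast e.symm c) e₁ e₂ (val κ (push θs (c.cast e.symm)) (push_top θs _)) := by
  subst e e₁ e₂
  rfl

theorem push_cons {P P' P'' Q Q' Q'' : FamObj.{u, v} A} {Γs : HPath (FamHor (A := A)) P P'}
    {Δ : FamHor Q Q'} {Δs : HPath (FamHor (A := A)) Q' Q''} {f : P ⟶ Q} {f' : P' ⟶ Q'}
    {f'' : P'' ⟶ Q''} (θ : FamCell Γs f f' Δ) (θs : (famGraph.{u, v} A).CellPath Δs f' f'')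
    {i : P.idx} {i' : P'.idx} {i'' : P''.idx} (c : FamChain Γs i i') (d : FamChain θs.top i' i'') :
    push (VDGraph.CellPath.cons (X := famGraph.{u, v} A) θ θs) (c.append d) =
      pushCons θ c (push θs d) :=
  congrArg (fun p : Chain.Pair _ _ Γs θs.top i i'' => pushCons θ p.fst (push θs p.snd))
    (Chain.split_append c d)

theorem push_ids : ∀ {P Q : FamObj.{u, v} A} {Γs : HPath (FamHor (A := A)) P Q} {i : P.idx}
    {j : Q.idx} (c : FamChain Γs i j),
    push ((data.{u, v} A).ids Γs) (c.cast ((data.{u, v} A).top_ids Γs).symm) = ⟨c, A.ids (path c)⟩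
  | _, _, .nil _, _, _, c => by
    obtain ⟨⟨rfl⟩⟩ := c; rfl
  | _, _, .cons Γ Γs, _, _, c => by
    have h := Chain.cast_cons (Γ := Γ) c.2.1 c.2.2 ((data.{u, v} A).top_ids Γs).symm
    refine (congrArg (push ((data.{u, v} A).ids (.cons Γ Γs))) h).trans ?_
    exact congrArg (pushCons (idCell Γ) ⟨_, c.2.1, ⟨⟨rfl⟩⟩⟩) (push_ids c.2.2)

/-- Concatenation of chains with sequences of multicells on top. -/
def pushAppend {P P' P'' Q Q' Q'' : FamObj.{u, v} A} {Δs : HPath (FamHor (A := A)) Q Q'}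
    {Δs' : HPath (FamHor (A := A)) Q' Q''} {f : P ⟶ Q} {f' : P' ⟶ Q'} {f'' : P'' ⟶ Q''}
    {i : P.idx} {i' : P'.idx} {i'' : P''.idx} (p : Push Δs f f' i i') (q : Push Δs' f' f'' i' i'') :
    Push (Δs.append Δs') f f'' i i'' :=
  ⟨Chain.append p.chain q.chain, (p.cells.append q.cells).cast (path_append _ _).symm rfl rfl⟩

theorem push_append : ∀ {P P' P'' Q Q' Q'' : FamObj.{u, v} A} {Δs : HPath (FamHor (A := A)) Q Q'}
    {Δs' : HPath (FamHor (A := A)) Q' Q''} {f : P ⟶ Q} {f' : P' ⟶ Q'} {f'' : P'' ⟶ Q''}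
    (θs : (famGraph.{u, v} A).CellPath Δs f f') (κs : (famGraph.{u, v} A).CellPath Δs' f' f'')
    {i : P.idx} {i' : P'.idx} {i'' : P''.idx} (c : FamChain θs.top i i')
    (d : FamChain κs.top i' i''),
    push (θs.append κs) (Chain.cast (VDGraph.CellPath.top_append θs κs).symm (c.append d)) =
      pushAppend (push θs c) (push κs d)
  | _, _, _, _, _, _, _, _, _, _, _, .nil _, κs, _, _, _, c, d => by
    obtain ⟨⟨rfl⟩⟩ := c; rfl
  | _, _, _, _, _, _, _, _, _, _, _, .cons (Γs := Γs) θ θs, κs, _, _, _, c, d => by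
    obtain ⟨k, c₁, c₂, rfl⟩ : ∃ (k : _) (c₁ : FamChain Γs _ k) (c₂ : FamChain θs.top k _),
        c = c₁.append c₂ := ⟨_, _, _, (Chain.append_split Γs c).symm⟩
    have h : ((c₁.append c₂).append d).cast (VDGraph.CellPath.top_append
        (VDGraph.CellPath.cons θ θs) κs).symm =
        c₁.append ((c₂.append d).cast (VDGraph.CellPath.top_append θs κs).symm) :=
      (congrArg (Chain.cast _) (Chain.append_assoc c₁ c₂ d)).trans
        ((Chain.cast_cast _ _ _).trans (Chain.append_cast _ _ _).symm)
    refine (congrArg (push ((VDGraph.CellPath.cons θ θs).append κs)) h).trans ?_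
    refine (push_cons θ (θs.append κs) c₁ _).trans ?_
    refine (congrArg (pushCons θ c₁) (push_append θs κs c₂ d)).trans ?_
    refine Eq.trans ?_ (congrArg (fun e => pushAppend e (push κs d)) (push_cons θ θs c₁ c₂)).symm
    refine congrArg (Push.mk _) ?_
    exact VDGraph.CellPath.cons_cast rfl _ _ _

theorem cons_comp {X : VDC.{v}} {A A' A'' B B' C C' C'' : X.Obj} {Δs : HPath X.Hor B B'} {u : A ⟶ B}
    {u' : A' ⟶ B'} (θs : X.CellPath Δs u u') {v : B ⟶ C} {v' : B' ⟶ C'} {Λ : X.Hor C C'}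
    (κ : X.Cell Δs v v' Λ) {Γs : HPath X.Hor A A'} (h : θs.top = Γs) {Λs : HPath X.Hor C' C''}
    {w : A'' ⟶ C''} (r : X.CellPath Λs (u' ≫ v') w) :
    VDGraph.CellPath.cons (X.comp θs κ h rfl rfl) r =
      VDGraph.CellPath.cons (X.comp θs κ rfl rfl rfl) r := by
  subst h; rfl

theorem push_treeComp : ∀ {P P' Q Q' R R' : FamObj.{u, v} A} {Λs : HPath (FamHor (A := A)) R R'}
    {f : P ⟶ Q} {f' : P' ⟶ Q'} {g : Q ⟶ R} {g' : Q' ⟶ R'}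
    (t : (famGraph.{u, v} A).CellTree Λs f f' g g') {i : P.idx} {i' : P'.idx}
    (c : FamChain t.upper.top i i'),
    ∃ (e : FamChain Λs (g.fn (f.fn i)) (g'.fn (f'.fn i')))
      (T : A.CellTree (path e) (f.map i) (f'.map i') (g.map (f.fn i)) (g'.map (f'.fn i'))),
      push ((data.{u, v} A).treeComp t) (c.cast ((data.{u, v} A).top_treeComp t).symm) =
        ⟨e, A.treeComp T⟩ ∧
      push t.lower (push t.upper c).chain = ⟨e, T.lower⟩ ∧
      HEq (push t.upper c).cells T.upper
  | _, _, _, _, _, _, _, _, _, _, _, .nil f g, i, _, c => by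
    obtain ⟨⟨rfl⟩⟩ := c
    exact ⟨⟨⟨rfl⟩⟩, .nil (f.map i) (g.map (f.fn i)), rfl, rfl, HEq.rfl⟩
  | _, _, _, _, _, _, _, _, _, _, _, .cons θs κ t, _, _, c => by
    obtain ⟨c', rfl⟩ : ∃ c', c = Chain.cast (VDGraph.CellPath.top_append θs t.upper).symm c' :=
      ⟨_, Chain.eq_cast_cast (VDGraph.CellPath.top_append θs t.upper) c⟩
    obtain ⟨k, c₁, c₂, rfl⟩ : ∃ (k : _) (c₁ : FamChain θs.top _ k) (c₂ : FamChain t.upper.top k _),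
        c' = c₁.append c₂ := ⟨_, _, _, (Chain.append_split θs.top c').symm⟩
    obtain ⟨e, T, h₁, h₂, h₃⟩ := push_treeComp t c₂
    have h : ((c₁.append c₂).cast (VDGraph.CellPath.top_append θs t.upper).symm).cast
        ((data.{u, v} A).top_treeComp (VDGraph.CellTree.cons θs κ t)).symm =
        c₁.append (c₂.cast ((data.{u, v} A).top_treeComp t).symm) :=
      (Chain.cast_cast _ _ _).trans (Chain.append_cast _ _ _).symm
    have hu := push_append θs t.upper c₁ c₂
    have hT : path (push t.upper c₂).chain = T.lower.top := by
      have := push_top t.lower (push t.upper c₂).chain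
      rw [h₂] at this
      exact this.symm
    refine ⟨⟨_, κ.fn (push θs c₁).chain, e⟩, .cons (push θs c₁).cells (κ.cell _) T, ?_, ?_, ?_⟩
    · refine (congrArg (push ((data.{u, v} A).treeComp (VDGraph.CellTree.cons θs κ t))) h).trans ?_
      refine (push_cons _ ((data.{u, v} A).treeComp t) c₁ _).trans ?_
      refine (congrArg (pushCons _ c₁) h₁).trans ?_
      refine congrArg (Push.mk _) ?_
      exact cons_comp _ _ _ _
    · refine (congrArg (fun p => push (VDGraph.CellTree.cons θs κ t).lower p.chain) hu).trans ?_
      refine (push_cons κ t.lower (push θs c₁).chain (push t.upper c₂).chain).trans ?_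
      exact congrArg (pushCons κ (push θs c₁).chain) h₂
    · have hu' : HEq (push (VDGraph.CellTree.cons θs κ t).upper (Chain.cast
          (VDGraph.CellPath.top_append θs t.upper).symm (c₁.append c₂))).cells
          (pushAppend (push θs c₁) (push t.upper c₂)).cells := by
        exact congr_arg_heq Push.cells hu
      refine hu'.trans ((VDGraphHom.heq_path_cast (Y := A) _ rfl rfl _).trans ?_)
      exact VDGraphHom.append_heq _ hT h₃

theorem val_congr {P P' Q Q' R R' : FamObj.{u, v} A} {Δs : HPath (FamHor (A := A)) Q Q'} {f : P ⟶ Q}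
    {f' : P' ⟶ Q'} {g : Q ⟶ R} {g' : Q' ⟶ R'} {Λ : FamHor R R'} (κ : FamCell Δs g g' Λ) {i : P.idx}
    {i' : P'.idx} {p q : Push Δs f f' i i'} {πs : HPath A.Hor (P.fam i) (P'.fam i')}
    (h : p.cells.top = πs) (e : p = q) : val κ p h = val κ q (e ▸ h) := by
  subst e; rfl

theorem assoc_val {P P' Q Q' R R' S S' : FamObj.{u, v} A} {Δs : HPath (FamHor (A := A)) Q Q'}
    {Λs : HPath (FamHor (A := A)) R R'} {f : P ⟶ Q} {f' : P' ⟶ Q'} {g : Q ⟶ R} {g' : Q' ⟶ R'}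
    {h : R ⟶ S} {h' : R' ⟶ S'} {Ξ : FamHor S S'} (l : FamCell Λs h h' Ξ) {i : P.idx} {i' : P'.idx}
    (p : Push Δs f f' i i') (q : Push Λs g g' (f.fn i) (f'.fn i'))
    (hq : q.cells.top = path p.chain)
    {e : FamChain Λs (g.fn (f.fn i)) (g'.fn (f'.fn i'))}
    (T : A.CellTree (path e) (f.map i) (f'.map i') (g.map (f.fn i)) (g'.map (f'.fn i')))
    (e₁ : q = ⟨e, T.lower⟩) (e₂ : HEq p.cells T.upper)
    {πs ρs : HPath A.Hor (P.fam i) (P'.fam i')} (eπ : πs = ρs) (k : (A.treeComp T).top = πs)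
    (k' : p.cells.top = ρs) :
    castVal eπ (Category.assoc f g h) (Category.assoc f' g' h')
      (val (f := f ≫ g) (f' := f' ≫ g') l ⟨e, A.treeComp T⟩ k) =
    ⟨l.fn q.chain, A.comp p.cells (A.comp q.cells (l.cell q.chain) hq rfl rfl) k' rfl rfl⟩ := by
  subst e₁ eπ
  refine castVal_eq _ _ _ rfl ?_
  have h1 := VDC.assoc_of (X := A) T (l.cell e) rfl hq (θs := p.cells)
    (eq_of_heq (e₂.symm.trans (VDGraphHom.heq_path_cast (Y := A) _ rfl rfl p.cells).symm))
    rfl rfl k (Category.assoc _ _ _) (Category.assoc _ _ _)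
  refine HEq.trans ?_ (heq_of_eq h1)
  have h2 := VDCData.cast_comp A.toVDCData (A.treeComp T) (l.cell e) k rfl rfl rfl
    (Category.assoc _ _ _) (Category.assoc _ _ _)
  exact (VDGraphHom.heq_cast (Y := A) rfl (Category.assoc _ _ _) (Category.assoc _ _ _) _).symm.trans
    (heq_of_eq h2)

end Fams

/-- The virtual double category of families in a virtual double category `A`. -/
def FamVDC (A : VDC.{max (u + 1) v}) : VDC.{max (u + 1) v} where
  toVDCData := Fams.data.{u, v} A
  id_comp {_ _ _ _ Γs _ _ _} κ := Fams.ext_cell fun c => by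
    refine (Fams.comp_fn _ _ _ _ _ c).trans ?_
    refine (congrArg (Fams.castVal _ _ _) (Fams.val_congr κ _ (Fams.push_ids c))).trans ?_
    refine Fams.castVal_eq _ _ _ rfl ?_
    exact (heq_of_eq (A.id_comp' (κ.cell c) _ rfl rfl)).trans
      (VDGraphHom.heq_cast (Y := A) _ _ _ _)
  comp_id {_ _ _ _ Γs _ _ _} θ := Fams.ext_cell fun {i i'} c => by
    refine (Fams.comp_fn _ _ _ _ _ c).trans ?_
    have h := (congrArg (Fams.push (VDGraph.CellPath.single θ)) (Chain.append_nil c)).symm.trans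
      (Fams.push_cons θ (.nil _) c _)
    refine (congrArg (Fams.castVal _ _ _) (Fams.val_congr _ _ h)).trans ?_
    refine Fams.castVal_eq _ _ _ rfl ?_
    exact (heq_of_eq (A.comp_id' (θ.cell c) _ rfl rfl)).trans
      (VDGraphHom.heq_cast (Y := A) _ _ _ _)
  assoc t l := Fams.ext_cell fun c => by
    refine (Fams.comp_fn _ _ _ _ _ c).trans ?_
    obtain ⟨e, T, h₁, h₂, h₃⟩ := Fams.push_treeComp t c
    refine (congrArg (Fams.castVal _ _ _) (Fams.val_congr _ _ h₁)).trans ?_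
    exact Fams.assoc_val l (Fams.push t.upper c) (Fams.push t.lower (Fams.push t.upper c).chain)
      (Fams.push_top _ _) T h₂ h₃ _ _ (Fams.push_top _ _)

namespace Chain

variable {O O' : Type w} {H : O → O → Type w} {H' : O' → O' → Type w} {car' : O' → Type u}
  {fib' : ∀ A B : O', H' A B → car' A → car' B → Type u}

theorem unmap_append (f : O → O') (g : ∀ A B : O, H A B → H' (f A) (f B)) :
    ∀ {A B C : O} (Γs : HPath H A B) (Δs : HPath H B C) {i : car' (f A)} {j : car' (f B)}
      {k : car' (f C)} (c : Chain car' fib' (Γs.map f g) i j)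
      (d : Chain car' fib' (Δs.map f g) j k),
      unmap f g (Γs.append Δs) (cast (HPath.map_append f g Γs Δs).symm (c.append d)) =
        (unmap f g Γs c).append (unmap f g Δs d)
  | _, _, _, .nil _, Δs, _, _, _, c, d => by
    obtain ⟨⟨rfl⟩⟩ := c; rfl
  | _, _, _, .cons Γ Γs, Δs, _, _, _, c, d => by
    refine (congrArg (unmap f g (HPath.cons Γ (Γs.append Δs)))
      (cast_cons (Γ := g _ _ Γ) c.2.1 _ (HPath.map_append f g Γs Δs).symm)).trans ?_
    exact congrArg (Chain.cons (car := fun A => car' (f A)) (Γ := Γ) c.2.1)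
      (unmap_append f g Γs Δs c.2.2 d)

theorem unmap_id {car : O → Type u} {fib : ∀ A B : O, H A B → car A → car B → Type u} :
    ∀ {A B : O} (Γs : HPath H A B) {i : car A} {j : car B} (c : Chain car fib Γs i j),
      unmap (fun A => A) (fun _ _ Γ => Γ) Γs (cast (HPath.map_id Γs).symm c) = c
  | _, _, .nil _, _, _, _ => rfl
  | _, _, .cons Γ Γs, _, _, c => by
    refine (congrArg (unmap (fun A => A) (fun _ _ Γ => Γ) (HPath.cons Γ Γs))
      (cast_cons (Γ := Γ) c.2.1 c.2.2 (HPath.map_id Γs).symm)).trans ?_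
    exact congrArg (Chain.cons c.2.1) (unmap_id Γs c.2.2)

theorem unmap_unmap {O'' : Type w} {H'' : O'' → O'' → Type w} {car'' : O'' → Type u}
    {fib'' : ∀ A B : O'', H'' A B → car'' A → car'' B → Type u}
    (f : O → O') (f' : O' → O'') (g : ∀ A B : O, H A B → H' (f A) (f B))
    (g' : ∀ A B : O', H' A B → H'' (f' A) (f' B)) :
    ∀ {A B : O} (Γs : HPath H A B) {i : car'' (f' (f A))} {j : car'' (f' (f B))}
      (c : Chain car'' fib'' ((Γs.map f g).map f' g') i j),
      unmap (fun A => f' (f A)) (fun _ _ Γ => g' _ _ (g _ _ Γ)) Γs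
        (cast (HPath.map_map f f' g g' Γs) c) = unmap f g Γs (unmap f' g' (Γs.map f g) c)
  | _, _, .nil _, _, _, _ => rfl
  | _, _, .cons Γ Γs, _, _, c => by
    refine (congrArg (unmap (fun A => f' (f A)) (fun _ _ Γ => g' _ _ (g _ _ Γ)) (HPath.cons Γ Γs))
      (cast_cons (Γ := g' _ _ (g _ _ Γ)) c.2.1 c.2.2 (HPath.map_map f f' g g' Γs))).trans ?_
    exact congrArg (Chain.cons (car := fun A => car'' (f' (f A))) (Γ := Γ) c.2.1)
      (unmap_unmap f f' g g' Γs c.2.2)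

/-- Chains along a path, as chains along its image. -/
def remap (f : O → O') (g : ∀ A B : O, H A B → H' (f A) (f B)) :
    ∀ {A B : O} {Γs : HPath H A B} {i : car' (f A)} {j : car' (f B)},
      Chain (fun A => car' (f A)) (fun A B Γ i j => fib' _ _ (g A B Γ) i j) Γs i j →
        Chain car' fib' (Γs.map f g) i j
  | _, _, .nil _, _, _, c => c
  | _, _, .cons _ _, _, _, c => ⟨c.1, c.2.1, remap f g c.2.2⟩

theorem unmap_remap (f : O → O') (g : ∀ A B : O, H A B → H' (f A) (f B)) :
    ∀ {A B : O} {Γs : HPath H A B} {i : car' (f A)} {j : car' (f B)}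
      (c : Chain (fun A => car' (f A)) (fun A B Γ i j => fib' _ _ (g A B Γ) i j) Γs i j),
      unmap f g Γs (remap (fib' := fib') f g c) = c
  | _, _, .nil _, _, _, _ => rfl
  | _, _, .cons Γ _, _, _, c =>
    congrArg (Chain.cons (car := fun A => car' (f A))
      (fib := fun A B Γ i j => fib' _ _ (g A B Γ) i j) (Γ := Γ) c.2.1) (unmap_remap f g c.2.2)

theorem remap_unmap (f : O → O') (g : ∀ A B : O, H A B → H' (f A) (f B)) :
    ∀ {A B : O} {Γs : HPath H A B} {i : car' (f A)} {j : car' (f B)}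
      (c : Chain car' fib' (Γs.map f g) i j), remap f g (unmap f g Γs c) = c
  | _, _, .nil _, _, _, _ => rfl
  | _, _, .cons Γ _, _, _, c =>
    congrArg (Chain.cons (Γ := g _ _ Γ) c.2.1) (remap_unmap f g c.2.2)

end Chain

namespace Fams

variable {A B C : VDC.{max (u + 1) v}}

/-- The action of a functor on objects and vertical morphisms of families. -/
def mapVert (F : VDFunctor A B) : FamObj.{u, v} A ⥤ FamObj.{u, v} B where
  obj P := ⟨P.idx, fun i => F.vert.obj (P.fam i)⟩
  map f := ⟨f.fn, fun i => F.vert.map (f.map i)⟩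
  map_id _ := congrArg (FamMap.mk _) (funext fun _ => F.vert.map_id _)
  map_comp _ _ := congrArg (FamMap.mk _) (funext fun _ => F.vert.map_comp _ _)

/-- The action of a functor on horizontal morphisms of families. -/
def mapHor (F : VDFunctor A B) {P Q : FamObj.{u, v} A} (Γ : FamHor P Q) :
    FamHor ((mapVert F).obj P) ((mapVert F).obj Q) :=
  ⟨Γ.span, fun s => F.hor (Γ.fam s)⟩

/-- A chain along the image of a path of families is a chain along the path. -/
abbrev unmap (F : VDFunctor A B) {P Q : FamObj.{u, v} A} (Γs : HPath (FamHor (A := A)) P Q)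
    {i : P.idx} {j : Q.idx}
    (c : FamChain (Γs.map (mapVert F).obj (fun _ _ Γ => mapHor F Γ)) i j) : FamChain Γs i j :=
  Chain.unmap (mapVert F).obj (fun _ _ Γ => mapHor F Γ) Γs c

/-- A chain along a path of families is a chain along its image. -/
abbrev remap (F : VDFunctor A B) {P Q : FamObj.{u, v} A} {Γs : HPath (FamHor (A := A)) P Q}
    {i : P.idx} {j : Q.idx} (c : FamChain Γs i j) :
    FamChain (Γs.map (mapVert F).obj (fun _ _ Γ => mapHor F Γ)) i j :=
  Chain.remap (H' := FamHor (A := B)) (car' := FamObj.idx)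
    (fib' := fun _ _ Γ i j => Γ.span.Fiber i j) (mapVert F).obj (fun _ _ Γ => mapHor F Γ) c

theorem unmap_remap (F : VDFunctor A B) {P Q : FamObj.{u, v} A} {Γs : HPath (FamHor (A := A)) P Q}
    {i : P.idx} {j : Q.idx} (c : FamChain Γs i j) : unmap F Γs (remap F c) = c :=
  Chain.unmap_remap (H' := FamHor (A := B)) (car' := FamObj.idx)
    (fib' := fun _ _ Γ i j => Γ.span.Fiber i j) (mapVert F).obj (fun _ _ Γ => mapHor F Γ) c

theorem path_unmap (F : VDFunctor A B) : ∀ {P Q : FamObj.{u, v} A}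
    (Γs : HPath (FamHor (A := A)) P Q) {i : P.idx} {j : Q.idx}
    (c : FamChain (Γs.map (mapVert F).obj (fun _ _ Γ => mapHor F Γ)) i j),
    F.path (path (unmap F Γs c)) = path c
  | _, _, .nil _, _, _, c => by
    obtain ⟨⟨rfl⟩⟩ := c; rfl
  | _, _, .cons Γ Γs, _, _, c =>
    congrArg (HPath.cons (F.hor (Γ.fam c.2.1))) (path_unmap F Γs c.2.2)

theorem path_remap (F : VDFunctor A B) {P Q : FamObj.{u, v} A}
    {Γs : HPath (FamHor (A := A)) P Q} {i : P.idx} {j : Q.idx} (c : FamChain Γs i j) :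
    F.path (path c) = path (remap F c) :=
  (congrArg (fun c => F.path (path c)) (unmap_remap F c)).symm.trans
    (path_unmap F Γs (remap F c))

/-- The action of a functor on families. -/
def mapHom (F : VDFunctor A B) : VDGraphHom (famGraph.{u, v} A) (famGraph.{u, v} B) where
  vert := mapVert F
  hor Γ := mapHor F Γ
  cell {_ _ _ _ Γs _ _ _} θ :=
    { fn := fun c => θ.fn (unmap F Γs c)
      cell := fun c => B.cast (path_unmap F Γs c) rfl rfl (F.cell (θ.cell (unmap F Γs c))) }

/-- The action of a functor on chains with sequences of multicells on top. -/
def mapPush (F : VDFunctor A B) {P P' Q Q' : FamObj.{u, v} A} {Δs : HPath (FamHor (A := A)) Q Q'}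
    {f : P ⟶ Q} {f' : P' ⟶ Q'} {i : P.idx} {i' : P'.idx} (p : Push Δs f f' i i') :
    Push ((mapHom F).path Δs) ((mapVert F).map f) ((mapVert F).map f') i i' :=
  ⟨remap F p.chain, (F.mapCells p.cells).cast (path_remap F p.chain) rfl rfl⟩

theorem push_mapCells (F : VDFunctor A B) : ∀ {P P' Q Q' : FamObj.{u, v} A}
    {Δs : HPath (FamHor (A := A)) Q Q'} {f : P ⟶ Q} {f' : P' ⟶ Q'}
    (θs : (famGraph.{u, v} A).CellPath Δs f f') {i : P.idx} {i' : P'.idx}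
    (c : FamChain ((mapHom F).mapCells θs).top i i'),
    push ((mapHom F).mapCells θs) c =
      mapPush F (push θs (unmap F θs.top (c.cast ((mapHom F).top_mapCells θs))))
  | _, _, _, _, _, _, _, .nil f, i, _, c => by
    obtain ⟨⟨rfl⟩⟩ := c; rfl
  | _, _, _, _, _, _, _, .cons (Γs := Γs) θ θs, _, _, c => by
    obtain ⟨k, c₁, c₂, rfl⟩ : ∃ (k : _) (c₁ : FamChain ((mapHom F).path Γs) _ k)
        (c₂ : FamChain ((mapHom F).mapCells θs).top k _), c = Chain.append c₁ c₂ :=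
      ⟨_, _, _, (Chain.append_split ((mapHom F).path Γs) c).symm⟩
    refine (push_cons ((mapHom F).cell θ) ((mapHom F).mapCells θs) c₁ c₂).trans ?_
    have h : (Chain.append c₁ c₂).cast
        ((mapHom F).top_mapCells (VDGraph.CellPath.cons (X := famGraph.{u, v} A) θ θs)) =
        Chain.cast (HPath.map_append _ _ Γs θs.top).symm
          (Chain.append c₁ (Chain.cast ((mapHom F).top_mapCells θs) c₂)) :=
      Eq.symm ((congrArg (Chain.cast _) (Chain.append_cast _ _ _)).trans (Chain.cast_cast _ _ _))
    have h' := Chain.unmap_append (mapVert F).obj (fun _ _ Γ => mapHor F Γ) Γs θs.top c₁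
      (Chain.cast ((mapHom F).top_mapCells θs) c₂)
    have h'' := (congrArg (unmap F (Γs.append θs.top)) h).trans h'
    refine Eq.trans ?_ (congrArg (fun c => mapPush F (push (VDGraph.CellPath.cons θ θs) c)) h'').symm
    refine Eq.trans ?_ (congrArg (mapPush F) (push_cons θ θs _ _)).symm
    refine (congrArg (pushCons _ c₁) (push_mapCells F θs c₂)).trans ?_
    refine congrArg (Push.mk _) ?_
    exact VDGraph.CellPath.cons_cast (X := B.toVDGraph) _ _ _ _

theorem val_map (F : VDFunctor A B) {P P' Q Q' R R' : FamObj.{u, v} A}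
    {Δs : HPath (FamHor (A := A)) Q Q'} {f : P ⟶ Q}
    {f' : P' ⟶ Q'} {g : Q ⟶ R} {g' : Q' ⟶ R'} {Λ : FamHor R R'} (κ : FamCell Δs g g' Λ) {i : P.idx}
    {i' : P'.idx} (p : Push Δs f f' i i') {πs : HPath A.Hor (P.fam i) (P'.fam i')}
    (hp : p.cells.top = πs)
    {ρs ρs' : HPath B.Hor (F.vert.obj (P.fam i)) (F.vert.obj (P'.fam i'))}
    (h : (mapPush F p).cells.top = ρs) (e : ρs = ρs') (hρ : F.path πs = ρs') :
    castVal (g := (mapVert F).map (f ≫ g)) (g' := (mapVert F).map (f' ≫ g')) e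
      ((mapVert F).map_comp f g).symm ((mapVert F).map_comp f' g').symm
      (val ((mapHom F).cell κ) (mapPush F p) h) =
      ⟨κ.fn p.chain, B.cast hρ rfl rfl (F.cell (A.comp p.cells (κ.cell p.chain) hp rfl rfl))⟩ := by
  subst hp hρ e
  refine castVal_eq _ _ _ (congrArg (fun c => (κ.fn c).1) (unmap_remap F p.chain)) ?_
  have key : ∀ (d : FamChain Δs (f.fn i) (f'.fn i')) (hd : d = p.chain)
      (hd' : F.path (path d) = path (remap F p.chain)),
      HEq (B.comp (mapPush F p).cells (B.cast hd' rfl rfl (F.cell (κ.cell d))) h rfl rfl)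
        (F.cell (A.comp p.cells (κ.cell p.chain) rfl rfl rfl)) := by
    intro d hd hd'
    subst hd
    rw [F.cell_comp']
    have h1 := VDCData.cast_comp B.toVDCData (F.mapCells p.cells) (F.cell (κ.cell p.chain))
      (F.top_mapCells _) rfl rfl rfl (F.vert.map_comp _ _).symm (F.vert.map_comp _ _).symm
    refine HEq.trans ?_ (heq_of_eq h1)
    refine HEq.trans ?_ (VDGraphHom.heq_cast (Y := B) _ _ _ _).symm
    exact heq_of_eq (VDGraphHom.comp_heq (path_remap F p.chain).symm rfl rfl rfl rfl
      (VDGraphHom.heq_path_cast _ rfl rfl _) (VDGraphHom.heq_cast _ _ _ _) _ _ _ _ _ _)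
  exact key _ (unmap_remap F p.chain) _

theorem toFn_cast {P P' Q Q' : FamObj.{u, v} A} {Γs Γs' : HPath (FamHor (A := A)) P P'}
    {f g : P ⟶ Q} {f' g' : P' ⟶ Q'} {Δ : FamHor Q Q'} (e : Γs = Γs') (e₁ : f = g) (e₂ : f' = g')
    (θ : FamCell Γs f f' Δ) {i : P.idx} {i' : P'.idx} (c : FamChain Γs' i i') :
    toFn (VDGraph.cast (X := famGraph.{u, v} A) e e₁ e₂ θ) c =
      castVal (path_cast e.symm c) e₁ e₂ (toFn θ (c.cast e.symm)) := by
  subst e e₁ e₂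
  rfl

theorem map_id_cell (F : VDFunctor A B) {P Q : FamObj.{u, v} A} (Γ : FamHor P Q) :
    (mapHom F).cell (idCell Γ) = VDGraph.cast (X := famGraph.{u, v} B) rfl
      ((mapVert F).map_id P).symm ((mapVert F).map_id Q).symm (idCell (mapHor F Γ)) :=
  ext_cell fun c => by
    refine Eq.trans ?_ (toFn_cast _ _ _ _ c).symm
    refine (castVal_eq (x := toFn (idCell (mapHor F Γ)) (Chain.cast rfl c))
      (y := toFn ((mapHom F).cell (idCell Γ)) c) _ _ _ rfl ?_).symm
    obtain ⟨k, s, ⟨⟨rfl⟩⟩⟩ := c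
    exact ((heq_of_eq (F.cell_id (Γ.fam s))).trans (VDGraphHom.heq_cast (Y := B) _ _ _ _)).symm

theorem map_comp_cell (F : VDFunctor A B) {P P' Q Q' R R' : FamObj.{u, v} A}
    {Δs : HPath (FamHor (A := A)) Q Q'} {f : P ⟶ Q} {f' : P' ⟶ Q'}
    (θs : (famGraph.{u, v} A).CellPath Δs f f') {g : Q ⟶ R} {g' : Q' ⟶ R'} {Λ : FamHor R R'}
    (κ : FamCell Δs g g' Λ) :
    (mapHom F).cell ((data.{u, v} A).comp θs κ rfl rfl rfl) =
      (data.{u, v} B).comp ((mapHom F).mapCells θs) ((mapHom F).cell κ)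
        ((mapHom F).top_mapCells θs) ((mapVert F).map_comp f g).symm
        ((mapVert F).map_comp f' g').symm :=
  ext_cell fun {i i'} c => by
    refine Eq.trans ?_ (comp_fn _ _ _ _ _ c).symm
    have h := push_mapCells F θs (c.cast ((mapHom F).top_mapCells θs).symm)
    refine Eq.trans ?_ (congrArg (castVal _ _ _) (val_congr _ _ h)).symm
    have hc : Chain.cast ((mapHom F).top_mapCells θs)
        (c.cast ((mapHom F).top_mapCells θs).symm) = c :=
      (Chain.eq_cast_cast ((mapHom F).top_mapCells θs).symm c).symm
    have hρ : F.path (path (unmap F θs.top (Chain.cast ((mapHom F).top_mapCells θs)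
        (c.cast ((mapHom F).top_mapCells θs).symm)))) = path c :=
      (path_unmap F θs.top _).trans (congrArg path hc)
    refine Eq.trans ?_ (val_map F κ (push θs _) (push_top θs _) _ _ hρ).symm
    have key : ∀ (d : FamChain ((mapHom F).path θs.top) i i') (_ : d = c)
        (hd : F.path (path (unmap F θs.top d)) = path c),
        toFn ((mapHom F).cell ((data.{u, v} A).comp θs κ rfl rfl rfl)) c =
        (⟨κ.fn (push θs (unmap F θs.top d)).chain, B.cast hd rfl rfl
          (F.cell (A.comp (push θs (unmap F θs.top d)).cells
            (κ.cell (push θs (unmap F θs.top d)).chain) (push_top θs _) rfl rfl))⟩ :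
          Val ((mapVert F).map (f ≫ g)) ((mapVert F).map (f' ≫ g')) (mapHor F Λ) i i' _) := by
      intro d e hd
      subst e
      rfl
    exact key _ hc hρ

end Fams

/-- The functor between virtual double categories of families induced by a functor. -/
def FamVDC.map {A B : VDC.{max (u + 1) v}} (F : VDFunctor A B) :
    VDFunctor (FamVDC.{u, v} A) (FamVDC.{u, v} B) where
  toVDGraphHom := Fams.mapHom F
  cell_id Γ := Fams.map_id_cell F Γ
  cell_comp θs _ _ _ κ := Fams.map_comp_cell F θs κ

namespace Fams

variable {A B C : VDC.{max (u + 1) v}}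

/-- The components of the transformation induced by a vertical transformation. -/
def mapData {F G : VDFunctor A B} (α : VDTransData F G) :
    VDTransData (FamVDC.map.{u, v} F) (FamVDC.map.{u, v} G) where
  vert :=
    { app := fun P => (⟨fun i => i, fun i => α.vert.app (P.fam i)⟩ :
        FamMap ((mapVert F).obj P) ((mapVert G).obj P))
      naturality := fun P Q f =>
        congrArg (FamMap.mk (P := (mapVert F).obj P) (Q := (mapVert G).obj Q) f.fn)
          (a₁ := fun i => F.vert.map (f.map i) ≫ α.vert.app (Q.fam (f.fn i)))
          (a₂ := fun i => α.vert.app (P.fam i) ≫ G.vert.map (f.map i))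
          (funext fun i => α.vert.naturality (f.map i)) }
  cell Γ :=
    { fn := fun c => ⟨c.2.1.1, c.2.1.2.1, c.2.1.2.2.trans c.2.2.down.down⟩
      cell := fun c => by
        obtain ⟨k, s, ⟨⟨rfl⟩⟩⟩ := c
        exact α.cell (Γ.fam s) }

theorem push_cells {F G : VDFunctor A B} (α : VDTransData F G) : ∀ {P Q : FamObj.{u, v} A}
    (Γs : HPath (FamHor (A := A)) P Q) {i : P.idx} {j : Q.idx}
    (c : FamChain (Γs.map (mapVert F).obj (fun _ _ Γ => mapHor F Γ)) i j),
    push ((mapData α).cells Γs) (Chain.cast ((mapData α).top_cells Γs).symm c) =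
      (⟨remap G (unmap F Γs c), (α.cells (path (unmap F Γs c))).cast (path_remap G _) rfl rfl⟩ :
        Push ((mapHom G).path Γs) ((mapData α).vert.app P) ((mapData α).vert.app Q) i j)
  | _, _, .nil _, _, _, c => by
    obtain ⟨⟨rfl⟩⟩ := c; rfl
  | _, _, .cons Γ Γs, _, _, c => by
    have h := Chain.cast_cons (Γ := mapHor F Γ) c.2.1 c.2.2 ((mapData α).top_cells Γs).symm
    refine (congrArg (push ((mapData α).cells (.cons Γ Γs))) h).trans ?_
    refine (congrArg (pushCons ((mapData α).cell Γ) ⟨_, c.2.1, ⟨⟨rfl⟩⟩⟩)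
      (push_cells α Γs c.2.2)).trans ?_
    refine congrArg (Push.mk _) ?_
    exact VDGraph.CellPath.cons_cast (X := B.toVDGraph) rfl _ _ _

theorem castVal_val {P P' Q Q' R R' : FamObj.{u, v} A} {Δs : HPath (FamHor (A := A)) Q Q'}
    {f : P ⟶ Q} {f' : P' ⟶ Q'} {g : Q ⟶ R} {g' : Q' ⟶ R'} {h : P ⟶ R} {h' : P' ⟶ R'}
    {Λ : FamHor R R'} (κ : FamCell Δs g g' Λ) {i : P.idx}
    {i' : P'.idx} (p : Push Δs f f' i i') {πs ρs : HPath A.Hor (P.fam i) (P'.fam i')}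
    (k : p.cells.top = πs) (e : πs = ρs) (e₁ : f ≫ g = h) (e₂ : f' ≫ g' = h') :
    castVal e e₁ e₂ (val κ p k) = castVal rfl e₁ e₂ (val κ p (k.trans e)) := by
  subst e; rfl

theorem map_naturality {F G : VDFunctor A B} (α : VDTrans F G) {P P' Q Q' : FamObj.{u, v} A}
    {Γs : HPath (FamHor (A := A)) P P'} {f : P ⟶ Q} {f' : P' ⟶ Q'} {Δ : FamHor Q Q'}
    (θ : FamCell Γs f f' Δ) :
    (data.{u, v} B).comp (VDGraph.CellPath.single (X := famGraph.{u, v} B) ((mapHom F).cell θ))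
      ((mapData α.toVDTransData).cell Δ) (HPath.append_nil _) rfl rfl =
    (data.{u, v} B).comp ((mapData α.toVDTransData).cells Γs) ((mapHom G).cell θ)
      ((mapData α.toVDTransData).top_cells Γs) ((mapData α.toVDTransData).vert.naturality f).symm
      ((mapData α.toVDTransData).vert.naturality f').symm :=
  ext_cell fun {i i'} c => by
    refine (comp_fn _ _ _ _ _ c).trans (Eq.trans ?_ (comp_fn _ _ _ _ _ c).symm)
    have h₁ := (congrArg (push (VDGraph.CellPath.single (X := famGraph.{u, v} B)
      ((mapHom F).cell θ))) (Chain.append_nil c)).symm.trans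
      (push_cons ((mapHom F).cell θ) (.nil _) c _)
    have h₂ := push_cells α.toVDTransData Γs c
    refine (congrArg (castVal _ _ _) (val_congr _ _ h₁)).trans
      (Eq.trans ?_ (congrArg (castVal _ _ _) (val_congr _ _ h₂)).symm)
    refine (castVal_val _ _ _ _ _ _).trans (Eq.trans ?_ (castVal_val _ _ _ _ _ _).symm)
    refine Eq.symm (castVal_eq _ _ _ (congrArg (fun c => (θ.fn c).1) (unmap_remap G _)) ?_)
    have key : ∀ (d : FamChain Γs i i') (hd : d = unmap F Γs c)
        (hd' : G.path (path d) = path (remap G (unmap F Γs c))) (h : VDGraph.CellPath.top (VDGraph.CellPath.cast (path_remap G _) rfl rfl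
          (α.cells (path (unmap F Γs c)))) = path c),
        HEq (B.comp ((α.cells (path (unmap F Γs c))).cast (path_remap G _) rfl rfl)
          (B.cast hd' rfl rfl (G.cell (θ.cell d))) h rfl rfl)
        (B.comp (VDGraph.CellPath.single (B.cast (path_unmap F Γs c) rfl rfl
          (F.cell (θ.cell (unmap F Γs c))))) (α.cell (Δ.fam (θ.fn (unmap F Γs c))))
          (HPath.append_nil _) rfl rfl) := by
      intro d hd hd' h
      subst hd
      have n := α.naturality' (θ.cell (unmap F Γs c))
        ((HPath.append_nil _).trans (path_unmap F Γs c)) rfl rfl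
      have e1 := VDGraphHom.comp_heq (Y := B) (path_remap G (unmap F Γs c)) rfl rfl rfl rfl
        (VDGraphHom.heq_path_cast (path_remap G _) rfl rfl (α.cells (path (unmap F Γs c)))).symm
        (VDGraphHom.heq_cast hd' rfl rfl (G.cell (θ.cell (unmap F Γs c)))).symm
        ((α.top_cells _).trans (path_unmap F Γs c)) rfl rfl h rfl rfl
      refine (heq_of_eq e1.symm).trans ?_
      have e2 := VDGraphHom.comp_heq (Y := B) rfl rfl rfl rfl rfl
        (θs := VDGraph.CellPath.single (F.cell (θ.cell (unmap F Γs c))))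
        (θs' := VDGraph.CellPath.single (B.cast (path_unmap F Γs c) rfl rfl
          (F.cell (θ.cell (unmap F Γs c)))))
        (VDGraphHom.cons_heq (path_unmap F Γs c) rfl rfl rfl rfl
          (VDGraphHom.heq_cast _ _ _ _).symm HEq.rfl) (HEq.refl (α.cell (Δ.fam (θ.fn (unmap F Γs c)))))
        ((HPath.append_nil _).trans (path_unmap F Γs c)) rfl rfl (HPath.append_nil _) rfl rfl
      refine HEq.trans ?_ (heq_of_eq (n.symm.trans e2))
      exact (VDGraphHom.heq_cast (Y := B) rfl (α.vert.naturality (f.map i)).symm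
        (α.vert.naturality (f'.map i')).symm _).symm.trans (heq_of_eq (VDCData.cast_comp _ _ _ _ _ _ _ _ _))
    exact key _ (unmap_remap G _) _ _

end Fams

/-- The transformation between functors of families induced by a vertical transformation. -/
def FamVDC.map₂ {A B : VDC.{max (u + 1) v}} {F G : VDFunctor A B} (α : VDTrans F G) :
    VDTrans (FamVDC.map.{u, v} F) (FamVDC.map.{u, v} G) where
  toVDTransData := Fams.mapData α.toVDTransData
  naturality θ := Fams.map_naturality α θ

namespace Fams

variable {A B C : VDC.{max (u + 1) v}}

theorem heq_cell {P P' Q Q' : FamObj.{u, v} A} {Γs Γs' : HPath (FamHor (A := A)) P P'}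
    {f : P ⟶ Q} {f' : P' ⟶ Q'} {Δ : FamHor Q Q'} {θ : FamCell Γs f f' Δ} {κ : FamCell Γs' f f' Δ}
    (e : Γs = Γs') (h : ∀ {i : P.idx} {i' : P'.idx} (c : FamChain Γs' i i'),
      (θ.fn (c.cast e.symm)).1 = (κ.fn c).1)
    (h' : ∀ {i : P.idx} {i' : P'.idx} (c : FamChain Γs' i i'),
      HEq (θ.cell (c.cast e.symm)) (κ.cell c)) : HEq θ κ := by
  subst e
  refine heq_of_eq (ext_cell fun c => ?_)
  exact (castVal_eq (x := toFn θ c) (y := toFn κ c) rfl rfl rfl (h c) (h' c))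

theorem cell_congr {P P' Q Q' : FamObj.{u, v} A} {Γs : HPath (FamHor (A := A)) P P'}
    {f : P ⟶ Q} {f' : P' ⟶ Q'} {Δ : FamHor Q Q'} (θ : FamCell Γs f f' Δ) {i : P.idx} {i' : P'.idx}
    {c d : FamChain Γs i i'} (h : c = d) : HEq (θ.cell c) (θ.cell d) := by
  subst h; rfl

theorem fcell_congr (F : VDFunctor A B) {P P' Q Q' : FamObj.{u, v} A}
    {Γs : HPath (FamHor (A := A)) P P'}
    {f : P ⟶ Q} {f' : P' ⟶ Q'} {Δ : FamHor Q Q'} (θ : FamCell Γs f f' Δ) {i : P.idx} {i' : P'.idx}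
    {c d : FamChain Γs i i'} (h : c = d) : HEq (F.cell (θ.cell c)) (F.cell (θ.cell d)) := by
  subst h; rfl

theorem map_id (A : VDC.{max (u + 1) v}) :
    FamVDC.map.{u, v} (VDFunctor.id A) = VDFunctor.id (FamVDC.{u, v} A) :=
  VDFunctor.ext_cell rfl (fun _ => HEq.rfl) fun {P P' _ _ Γs _ _ _} θ => by
    refine HEq.trans ?_ (VDFunctor.id_cell_heq (X := FamVDC.{u, v} A) θ).symm
    have hc : ∀ {i : FamObj.idx P} {i' : FamObj.idx P'} (c : FamChain Γs i i'),
        unmap (VDFunctor.id A) Γs (c.cast (HPath.map_id Γs).symm) = c := fun c =>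
      Chain.unmap_id (car := FamObj.idx) (fib := fun _ _ (Γ : FamHor _ _) i j => Γ.span.Fiber i j) Γs c
    refine heq_cell (A := A) (HPath.map_id Γs) (fun c => ?_) (fun c => ?_)
    · exact congrArg (fun c => (FamCell.fn θ c).1) (hc c)
    · refine (VDGraphHom.heq_cast (Y := A) (path_unmap (VDFunctor.id A) Γs _) rfl rfl _).trans ?_
      refine (fcell_congr (VDFunctor.id A) θ (hc c)).trans ?_
      exact VDFunctor.id_cell_heq _

theorem map_comp (F : VDFunctor A B) (G : VDFunctor B C) :
    FamVDC.map.{u, v} (F.comp G) = (FamVDC.map.{u, v} F).comp (FamVDC.map.{u, v} G) :=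
  VDFunctor.ext_cell rfl (fun _ => HEq.rfl) fun {P P' _ _ Γs _ _ _} θ => by
    refine HEq.trans ?_ (VDFunctor.comp_cell_heq (FamVDC.map.{u, v} F) (FamVDC.map.{u, v} G) θ).symm
    have hc : ∀ {i : FamObj.idx P} {i' : FamObj.idx P'}
        (c : FamChain ((Γs.map (mapVert F).obj (fun _ _ Γ => mapHor F Γ)).map (mapVert G).obj
          (fun _ _ Γ => mapHor G Γ)) i i'),
        unmap (F.comp G) Γs (c.cast (HPath.map_map _ _ _ _ Γs)) = unmap F Γs (unmap G _ c) :=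
      fun c => Chain.unmap_unmap (mapVert F).obj (mapVert G).obj (fun _ _ Γ => mapHor F Γ)
        (fun _ _ Γ => mapHor G Γ) Γs c
    refine heq_cell (A := C) (HPath.map_map (mapVert F).obj (mapVert G).obj
      (fun _ _ Γ => mapHor F Γ) (fun _ _ Γ => mapHor G Γ) Γs).symm (fun c => ?_) (fun c => ?_)
    · exact congrArg (fun c => (FamCell.fn θ c).1) (hc c)
    · refine (VDGraphHom.heq_cast (Y := C) (path_unmap (F.comp G) Γs _) rfl rfl _).trans ?_
      refine (fcell_congr (F.comp G) θ (hc c)).trans ?_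
      refine (VDFunctor.comp_cell_heq F G _).trans ?_
      refine HEq.trans ?_ (VDGraphHom.heq_cast (Y := C) (path_unmap G _ c) rfl rfl _).symm
      exact (VDFunctor.cell_heq (F := G) (path_unmap F Γs (unmap G _ c)) rfl rfl
        (VDGraphHom.heq_cast (Y := B) (path_unmap F Γs (unmap G _ c)) rfl rfl _).symm)

theorem map₂_id (F : VDFunctor A B) :
    FamVDC.map₂.{u, v} (𝟙 F) = 𝟙 (FamVDC.map.{u, v} F) :=
  VDTrans.ext' (fun _ => rfl) fun Γ => ext_cell (A := B) fun c => by
    obtain ⟨k, s, ⟨⟨rfl⟩⟩⟩ := c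
    rfl

theorem map₂_comp {F G H : VDFunctor A B} (α : F ⟶ G) (β : G ⟶ H) :
    FamVDC.map₂.{u, v} (α ≫ β) = VDTrans.comp (FamVDC.map₂.{u, v} α) (FamVDC.map₂.{u, v} β) :=
  VDTrans.ext' (fun _ => rfl) fun Γ => ext_cell (A := B) fun c => by
    obtain ⟨k, s, ⟨⟨rfl⟩⟩⟩ := c
    rfl

theorem map₂_whiskerLeft (F : VDFunctor A B) {G H : VDFunctor B C} (η : VDTrans G H)
    {P Q : FamObj.{u, v} A} (Γ : FamHor P Q) :
    (FamVDC.map₂.{u, v} (VDTrans.whiskerLeft F η)).cell Γ =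
      (FamVDC.map₂.{u, v} η).cell ((FamVDC.map.{u, v} F).hor Γ) :=
  ext_cell (A := C) fun c => by
    obtain ⟨k, s, ⟨⟨rfl⟩⟩⟩ := c
    rfl

theorem map₂_whiskerRight {F G : VDFunctor A B} (η : VDTrans F G) (H : VDFunctor B C)
    {P Q : FamObj.{u, v} A} (Γ : FamHor P Q) :
    (FamVDC.map₂.{u, v} (VDTrans.whiskerRight η H)).cell Γ =
      (FamVDC.map.{u, v} H).cell ((FamVDC.map₂.{u, v} η).cell Γ) :=
  ext_cell (A := C) fun c => by
    obtain ⟨k, s, ⟨⟨rfl⟩⟩⟩ := c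
    rfl

end Fams

theorem VDTrans.eq_conj {X Y : VDC.{v}} {F F' G G' : VDFunctor X Y} (α : VDTrans F G)
    (β : VDTrans F' G') (e : F = F') (e' : G' = G)
    (hv : ∀ A, HEq (α.vert.app A) (β.vert.app A))
    (hc : ∀ {A B : X.Obj} (Γ : X.Hor A B), HEq (α.cell Γ) (β.cell Γ)) :
    α = (eqToHom e : F ⟶ F') ≫ (β : F' ⟶ G') ≫ (eqToHom e' : G' ⟶ G) := by
  subst e e'
  rw [eqToHom_refl, eqToHom_refl, Category.id_comp, Category.comp_id]
  exact VDTrans.ext' (fun A => eq_of_heq (hv A)) (fun Γ => eq_of_heq ((hc Γ).trans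
    (VDFunctor.heq_cast (X := Y) _ _ _ _).symm))

/-- The families construction, as a 2-functor. An object of `Fam A` is a family of objects of `A`,
a vertical morphism is a function between the indexing sets and a family of vertical morphisms,
a horizontal morphism is a span of indexing sets and a family of horizontal morphisms, and a
multicell is a multicell of spans and a family of multicells. -/
def Fam : StrictPseudofunctor VDC.{max (u + 1) v} VDC.{max (u + 1) v} := StrictPseudofunctor.mk''
  { obj := fun A => FamVDC.{u, v} A
    map := fun F => FamVDC.map.{u, v} F
    map₂ := fun α => FamVDC.map₂.{u, v} α
    map₂_id := fun F => Fams.map₂_id F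
    map₂_comp := fun α β => Fams.map₂_comp α β
    map_id := fun A => Fams.map_id A
    map_comp := fun F G => Fams.map_comp F G
    map₂_whisker_left := fun F G H η => VDTrans.eq_conj _ _ (Fams.map_comp F G)
      (Fams.map_comp F H).symm (fun _ => HEq.rfl) (fun Γ => heq_of_eq (Fams.map₂_whiskerLeft F η Γ))
    map₂_whisker_right := fun {_ _ _ F G} η H => VDTrans.eq_conj _ _ (Fams.map_comp F H)
      (Fams.map_comp G H).symm (fun _ => HEq.rfl) (fun Γ => heq_of_eq (Fams.map₂_whiskerRight η H Γ)) }

/-! ### Pointed spans -/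

namespace Spans

/-- Transport of a chain of elements along equalities of its endpoints. -/
def castEnds {I J : SpanObj.{u, v}} {Ss : HPath SpanHor.{u, v} I J} {i i' : I.carrier}
    {j j' : J.carrier} (h : i = i') (h' : j = j') (c : SpanChain Ss i j) : SpanChain Ss i' j' := by
  subst h h'; exact c

theorem cons_castEnds {I J K : SpanObj.{u, v}} {S : SpanHor.{u, v} I J}
    {Ss : HPath SpanHor.{u, v} J K} {i i' : I.carrier} {j j' : J.carrier} {k k' : K.carrier}
    (h : i = i') (h' : j = j') (h'' : k = k') (s : S.Fiber i j) (s' : S.Fiber i' j')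
    (hs : s.1 = s'.1) (c : SpanChain Ss j k) :
    Chain.cons s' (castEnds h' h'' c) = castEnds (Ss := .cons S Ss) h h'' (Chain.cons s c) := by
  subst h h' h''
  have e : s = s' := Subtype.ext hs
  subst e
  rfl

theorem fn_castEnds {I I' J J' : SpanObj.{u, v}} {Ss : HPath SpanHor.{u, v} I I'} {f : I ⟶ J}
    {f' : I' ⟶ J'} {T : SpanHor J J'} (θ : SpanCell Ss f f' T) {i i' : I.carrier}
    {j j' : I'.carrier} (h : i = i') (h' : j = j') (c : SpanChain Ss i j) :
    (θ.fn (castEnds h h' c)).1 = (θ.fn c).1 := by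
  subst h h'; rfl

theorem fn_cast {I I' J J' : SpanObj.{u, v}} {Ss Ss' : HPath SpanHor.{u, v} I I'} {f g : I ⟶ J}
    {f' g' : I' ⟶ J'} {T : SpanHor J J'} (e : Ss = Ss') (e₁ : f = g) (e₂ : f' = g')
    (θ : SpanCell Ss f f' T) {i : I.carrier} {j : I'.carrier} (c : SpanChain Ss' i j) :
    (SpanCell.fn (VDGraph.cast (X := spanGraph.{u, v}) e e₁ e₂ θ) c).1 =
      (θ.fn (Chain.cast e.symm c)).1 := by
  subst e e₁ e₂; rfl

/-- A compatible choice of elements in the images of a map to the virtual double category of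
spans. -/
structure Pointing {G : VDGraph.{max (u + 1) v}} (L : VDGraphHom G spanGraph.{u, v}) where
  pt : ∀ A : G.Obj, (L.vert.obj A).carrier
  map_pt : ∀ {A B : G.Obj} (f : A ⟶ B), (L.vert.map f).fn (pt A) = pt B
  hor : ∀ {A B : G.Obj} (Γ : G.Hor A B), (L.hor Γ).Fiber (pt A) (pt B)

namespace Pointing

variable {G : VDGraph.{max (u + 1) v}} {L : VDGraphHom G spanGraph.{u, v}} (p : Pointing L)

/-- The chain of chosen elements along a path. -/
def chain : ∀ {A B : G.Obj} (Γs : HPath G.Hor A B), SpanChain (L.path Γs) (p.pt A) (p.pt B)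
  | _, _, .nil _ => ⟨⟨rfl⟩⟩
  | _, _, .cons Γ Γs => ⟨_, p.hor Γ, chain Γs⟩

theorem chain_append : ∀ {A B C : G.Obj} (Γs : HPath G.Hor A B) (Δs : HPath G.Hor B C),
    p.chain (Γs.append Δs) =
      Chain.cast (HPath.map_append _ _ Γs Δs).symm ((p.chain Γs).append (p.chain Δs))
  | _, _, _, .nil _, _ => rfl
  | _, _, _, .cons Γ Γs, Δs =>
    (congrArg (Chain.cons (p.hor Γ)) (chain_append Γs Δs)).trans
      (Chain.cast_cons (p.hor Γ) _ _).symm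

/-- The condition that all multicells are compatible with the chosen elements. -/
def Compatible : Prop :=
  ∀ {A A' B B' : G.Obj} {Γs : HPath G.Hor A A'} {u : A ⟶ B} {u' : A' ⟶ B'} {Δ : G.Hor B B'}
    (θ : G.Cell Γs u u' Δ), (SpanCell.fn (L.cell θ) (p.chain Γs)).1 = (p.hor Δ).1

variable {p} in
theorem push_chain (hp : p.Compatible) : ∀ {A A' B B' : G.Obj} {Δs : HPath G.Hor B B'} {u : A ⟶ B}
    {u' : A' ⟶ B'} (θs : G.CellPath Δs u u'),
    push (L.mapCells θs) (Chain.cast (L.top_mapCells θs).symm (p.chain θs.top)) =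
      castEnds (p.map_pt u).symm (p.map_pt u').symm (p.chain Δs)
  | _, _, _, _, _, _, _, .nil _ => rfl
  | _, _, _, _, _, _, _, .cons (Γs := Γs) (Δ := Δ) θ θs => by
    have h : Chain.cast (L.top_mapCells (VDGraph.CellPath.cons θ θs)).symm
        (p.chain (Γs.append θs.top)) =
        Chain.append (p.chain Γs) (Chain.cast (L.top_mapCells θs).symm (p.chain θs.top)) :=
      (congrArg (Chain.cast _) (p.chain_append Γs θs.top)).trans
        ((Chain.cast_cast _ _ _).trans (Chain.append_cast _ _ _).symm)
    refine (congrArg (push (L.mapCells (VDGraph.CellPath.cons θ θs))) h).trans ?_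
    refine (push_cons (L.cell θ) (L.mapCells θs) _ _).trans ?_
    refine (congrArg (Chain.cons (SpanCell.fn (L.cell θ) (p.chain Γs)))
      (push_chain hp θs)).trans ?_
    exact cons_castEnds _ _ _ _ _ (hp θ).symm _

variable {p} in
theorem comp_pt (hp : p.Compatible) {A A' B B' : G.Obj} {K K' : SpanObj.{u, v}}
    {Δs : HPath G.Hor B B'} {u : A ⟶ B} {u' : A' ⟶ B'} (θs : G.CellPath Δs u u')
    {g : L.vert.obj B ⟶ K} {g' : L.vert.obj B' ⟶ K'} {U : SpanHor K K'}
    (κ : SpanCell (L.path Δs) g g' U)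
    {Ss : HPath SpanHor.{u, v} (L.vert.obj A) (L.vert.obj A')} {h : L.vert.obj A ⟶ K}
    {h' : L.vert.obj A' ⟶ K'} (e : (L.mapCells θs).top = Ss) (e₁ : L.vert.map u ≫ g = h)
    (e₂ : L.vert.map u' ≫ g' = h') (e' : L.path θs.top = Ss) :
    (SpanCell.fn (data.{u, v}.comp (L.mapCells θs) κ e e₁ e₂)
      (Chain.cast e' (p.chain θs.top))).1 = (κ.fn (p.chain Δs)).1 := by
  refine (comp_fn _ _ _ _ _ _).trans ?_
  have h1 : Chain.cast e.symm (Chain.cast e' (p.chain θs.top)) =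
      Chain.cast (L.top_mapCells θs).symm (p.chain θs.top) := Chain.cast_cast _ _ _
  refine (congrArg (fun c => (κ.fn (push (L.mapCells θs) c)).1) h1).trans ?_
  refine (congrArg (fun c => (κ.fn c).1) (push_chain hp θs)).trans ?_
  exact fn_castEnds _ _ _ _

end Pointing

end Spans

/-- A pointed set. -/
structure PtObj : Type (max (u + 1) v) where
  set : SpanObj.{u, v}
  pt : set.carrier

/-- A point-preserving function. -/
@[ext]
structure PtMap (I J : PtObj.{u, v}) : Type (max (u + 1) v) where
  map : I.set ⟶ J.set
  map_pt : map.fn I.pt = J.pt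

/-- A pointed span: a span with an element of its apex lying over the chosen elements of its
feet. -/
structure PtHor (I J : PtObj.{u, v}) : Type (max (u + 1) v) where
  span : SpanHor I.set J.set
  pt : span.Fiber I.pt J.pt

instance PtObj.category : Category.{max (u + 1) v} PtObj.{u, v} where
  Hom I J := PtMap I J
  id I := ⟨𝟙 I.set, rfl⟩
  comp f g := ⟨f.map ≫ g.map, (congrArg g.map.fn f.map_pt).trans g.map_pt⟩

/-- The chain of chosen elements along a path of pointed spans. -/
def ptChain : ∀ {I J : PtObj.{u, v}} (Ss : HPath PtHor.{u, v} I J),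
    SpanChain (Ss.map PtObj.set (fun _ _ S => S.span)) I.pt J.pt
  | I, _, .nil _ => Chain.nil I.set I.pt
  | _, _, .cons S Ss => Chain.cons S.pt (ptChain Ss)

/-- A multicell of pointed spans: a multicell of spans sending the chain of chosen elements to the
chosen element. -/
structure PtCell {I I' J J' : PtObj.{u, v}} (Ss : HPath PtHor.{u, v} I I') (f : I ⟶ J)
    (f' : I' ⟶ J') (T : PtHor J J') : Type (max (u + 1) v) where
  cell : SpanCell (Ss.map PtObj.set (fun _ _ S => S.span)) f.map f'.map T.span
  cell_pt : (cell.fn (ptChain Ss)).1 = T.pt.1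

/-- The underlying data of the virtual double category of pointed spans. -/
abbrev ptGraph : VDGraph.{max (u + 1) v} where
  Obj := PtObj.{u, v}
  vert := PtObj.category.{u, v}
  Hor := PtHor.{u, v}
  Cell Ss f f' T := PtCell Ss f f' T

/-- Forgetting the chosen elements. -/
def ptForget : VDGraphHom ptGraph.{u, v} spanGraph.{u, v} where
  vert := { obj := PtObj.set, map := PtMap.map }
  hor S := S.span
  cell θ := θ.cell

/-- The tautological choice of elements. -/
def ptPointing : Spans.Pointing ptForget.{u, v} where
  pt I := I.pt
  map_pt f := f.map_pt
  hor S := S.pt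

theorem ptPointing_chain : ∀ {I J : PtObj.{u, v}} (Ss : HPath PtHor.{u, v} I J),
    ptPointing.chain Ss = ptChain Ss
  | _, _, .nil _ => rfl
  | _, _, .cons S Ss => congrArg (Chain.cons S.pt) (ptPointing_chain Ss)

theorem ptPointing_compatible : ptPointing.{u, v}.Compatible := fun {_ _ _ _ Γs _ _ _} θ =>
  (congrArg (fun c => (θ.cell.fn c).1) (ptPointing_chain Γs)).trans θ.cell_pt

/-- Identities and composition of multicells of pointed spans. -/
abbrev ptData : VDCData.{max (u + 1) v} where
  toVDGraph := ptGraph.{u, v}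
  id S := ⟨Spans.idCell S.span, rfl⟩
  comp {_ _ _ _ _ _ Δs _ _} θs _ _ _ κ {Γs _ _} e e₁ e₂ :=
    ⟨Span.{u, v}.comp (ptForget.mapCells θs) κ.cell
      ((ptForget.top_mapCells θs).trans (congrArg ptForget.path e)) (congrArg PtMap.map e₁)
      (congrArg PtMap.map e₂), by
        have h := Spans.Pointing.comp_pt ptPointing_compatible θs κ.cell
          ((ptForget.top_mapCells θs).trans (congrArg ptForget.path e)) (congrArg PtMap.map e₁)
          (congrArg PtMap.map e₂) (congrArg ptForget.path e)
        have h1 : Chain.cast (congrArg ptForget.path e) (ptPointing.chain θs.top) =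
            ptChain Γs := by
          subst e; exact ptPointing_chain _
        have h2 := (congrArg (fun c => (κ.cell.fn c).1) (ptPointing_chain Δs)).trans κ.cell_pt
        exact (congrArg (fun c => (SpanCell.fn (Span.{u, v}.comp (ptForget.mapCells θs) κ.cell
          _ _ _) c).1) h1).symm.trans (h.trans h2)⟩

theorem ptForget_preserves : VDGraphHom.Preserves (X := ptData.{u, v}) (Y := Span.{u, v})
    ptForget.{u, v} := ⟨fun _ => rfl, fun _ _ _ _ _ => rfl⟩

/-- The virtual double category of pointed sets, point-preserving functions and pointed spans. -/
def SpanPt : VDC.{max (u + 1) v} :=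
  VDC.ofFaithful ptData.{u, v} (ι := Unit) (fun _ => Span.{u, v}) (fun _ => ptForget.{u, v})
    (fun _ => ptForget_preserves) (fun θ κ h => by
      cases θ; cases κ
      have h1 := h ()
      dsimp only [ptForget] at h1
      subst h1
      rfl)

/-- The functor from pointed spans to spans which forgets the chosen elements. -/
def Q : VDFunctor SpanPt.{u, v} Span.{u, v} where
  toVDGraphHom := ptForget.{u, v}
  cell_id := ptForget_preserves.cell_id
  cell_comp := ptForget_preserves.cell_comp

theorem ptForget_inj {I I' J J' : PtObj.{u, v}} {Ss : HPath PtHor.{u, v} I I'} {f : I ⟶ J}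
    {f' : I' ⟶ J'} {T : PtHor J J'} (θ κ : PtCell Ss f f' T) (h : θ.cell = κ.cell) : θ = κ := by
  cases θ; cases κ
  dsimp only at h
  subst h
  rfl

theorem Q_inj {I I' J J' : SpanPt.{u, v}.Obj} {Ss : HPath SpanPt.{u, v}.Hor I I'} {f : I ⟶ J}
    {f' : I' ⟶ J'} {T : SpanPt.{u, v}.Hor J J'} (θ κ : SpanPt.{u, v}.Cell Ss f f' T)
    (h : Q.cell θ = Q.cell κ) : θ = κ :=
  ptForget_inj θ κ h

/-! ### The virtual double category of elements -/

section Elts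

variable {A B C : VDC.{max (u + 1) v}}

/-- An object of the virtual double category of elements: an object and an element of its image. -/
structure EltsObj (F : VDFunctor A Span.{u, v}) : Type (max (u + 1) v) where
  obj : A.Obj
  elt : SpanObj.carrier (F.vert.obj obj)

/-- A vertical morphism preserving the chosen elements. -/
@[ext]
structure EltsMap {F : VDFunctor A Span.{u, v}} (a b : EltsObj F) : Type (max (u + 1) v) where
  map : a.obj ⟶ b.obj
  map_elt : SpanMap.fn (F.vert.map map) a.elt = b.elt

/-- A horizontal morphism with an element of its image lying over the chosen elements. -/
structure EltsHor {F : VDFunctor A Span.{u, v}} (a b : EltsObj F) : Type (max (u + 1) v) where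
  hor : A.Hor a.obj b.obj
  elt : SpanHor.Fiber (F.hor hor) a.elt b.elt

instance EltsObj.category (F : VDFunctor A Span.{u, v}) : Category.{max (u + 1) v} (EltsObj F) where
  Hom a b := EltsMap a b
  id a := ⟨𝟙 a.obj, congrArg (fun f => SpanMap.fn f a.elt) (F.vert.map_id a.obj)⟩
  comp {a b c} f g := ⟨f.map ≫ g.map,
    (congrArg (fun f => SpanMap.fn f a.elt) (F.vert.map_comp f.map g.map)).trans
      ((congrArg (SpanMap.fn (F.vert.map g.map)) f.map_elt).trans g.map_elt)⟩
  id_comp f := EltsMap.ext (Category.id_comp f.map)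
  comp_id f := EltsMap.ext (Category.comp_id f.map)
  assoc f g h := EltsMap.ext (Category.assoc f.map g.map h.map)

/-- The chain of chosen elements along a path. -/
def eltsChain {F : VDFunctor A Span.{u, v}} : ∀ {a b : EltsObj F}
    (Γs : HPath (EltsHor (F := F)) a b),
    SpanChain (F.path (Γs.map EltsObj.obj (fun _ _ Γ => Γ.hor))) a.elt b.elt
  | a, _, .nil _ => Chain.nil (F.vert.obj a.obj) a.elt
  | _, _, .cons Γ Γs => Chain.cons Γ.elt (eltsChain Γs)

/-- A multicell whose image sends the chain of chosen elements to the chosen element. -/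
structure EltsCell {F : VDFunctor A Span.{u, v}} {a a' b b' : EltsObj F}
    (Γs : HPath (EltsHor (F := F)) a a') (f : a ⟶ b) (f' : a' ⟶ b') (Δ : EltsHor b b') :
    Type (max (u + 1) v) where
  cell : A.Cell (Γs.map EltsObj.obj (fun _ _ Γ => Γ.hor)) f.map f'.map Δ.hor
  cell_elt : (SpanCell.fn (F.cell cell) (eltsChain Γs)).1 = Δ.elt.1

/-- The underlying data of the virtual double category of elements. -/
abbrev eltsGraph (F : VDFunctor A Span.{u, v}) : VDGraph.{max (u + 1) v} where
  Obj := EltsObj F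
  vert := EltsObj.category F
  Hor := EltsHor (F := F)
  Cell Γs f f' Δ := EltsCell Γs f f' Δ

/-- Forgetting the chosen elements. -/
def eltsForget (F : VDFunctor A Span.{u, v}) : VDGraphHom (eltsGraph F) A.toVDGraph where
  vert := { obj := EltsObj.obj, map := EltsMap.map }
  hor Γ := Γ.hor
  cell θ := θ.cell

/-- The tautological choice of elements. -/
def eltsPointing (F : VDFunctor A Span.{u, v}) :
    Spans.Pointing ((eltsForget F).comp F.toVDGraphHom) where
  pt a := a.elt
  map_pt f := f.map_elt
  hor Γ := Γ.elt

theorem eltsPath_eq (F : VDFunctor A Span.{u, v}) {a b : EltsObj F}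
    (Γs : HPath (EltsHor (F := F)) a b) :
    ((eltsForget F).comp F.toVDGraphHom).path Γs = F.path ((eltsForget F).path Γs) :=
  (HPath.map_map (H' := A.Hor) (H'' := SpanHor.{u, v}) (eltsForget F).vert.obj F.vert.obj
    (fun _ _ Γ => EltsHor.hor Γ) (fun _ _ Γ => F.hor Γ) Γs).symm

theorem eltsPointing_chain (F : VDFunctor A Span.{u, v}) : ∀ {a b : EltsObj F}
    (Γs : HPath (EltsHor (F := F)) a b), Chain.cast (eltsPath_eq F Γs)
      ((eltsPointing F).chain Γs) = eltsChain Γs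
  | _, _, .nil _ => rfl
  | _, _, .cons Γ Γs => (Chain.cast_cons (Γ := F.hor Γ.hor) Γ.elt _ (eltsPath_eq F Γs)).trans
      (congrArg (Chain.cons Γ.elt) (eltsPointing_chain F Γs))

theorem eltsPointing_compatible (F : VDFunctor A Span.{u, v}) : (eltsPointing F).Compatible :=
  fun {_ _ _ _ Γs _ _ _} θ => by
    refine (Spans.fn_cast (HPath.map_map _ _ _ _ Γs) rfl rfl (F.cell θ.cell) _).trans ?_
    exact (congrArg (fun c => (SpanCell.fn (F.cell θ.cell) c).1) (eltsPointing_chain F Γs)).trans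
      θ.cell_elt

theorem elts_comp {F : VDFunctor A Span.{u, v}} {a a' b b' c c' : EltsObj F}
    {Δs : HPath (EltsHor (F := F)) b b'} {f : a ⟶ b} {f' : a' ⟶ b'}
    (θs : (eltsGraph F).CellPath Δs f f') {g : b ⟶ c} {g' : b' ⟶ c'} {Λ : EltsHor c c'}
    (κ : EltsCell Δs g g' Λ) {Γs : HPath (EltsHor (F := F)) a a'} {h : a ⟶ c} {h' : a' ⟶ c'}
    (e : θs.top = Γs) (e₁ : f ≫ g = h) (e₂ : f' ≫ g' = h') :
    (SpanCell.fn (F.cell (A.comp ((eltsForget F).mapCells θs) κ.cell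
      (((eltsForget F).top_mapCells θs).trans (congrArg (eltsForget F).path e))
      (congrArg EltsMap.map e₁) (congrArg EltsMap.map e₂))) (eltsChain Γs)).1 = Λ.elt.1 := by
  subst e e₁ e₂
  have h := Spans.Pointing.comp_pt (eltsPointing_compatible F) θs
    (((eltsForget F).comp F.toVDGraphHom).cell κ)
    (((eltsForget F).comp F.toVDGraphHom).top_mapCells θs)
    (((eltsForget F).comp F.toVDGraphHom).vert.map_comp f g).symm
    (((eltsForget F).comp F.toVDGraphHom).vert.map_comp f' g').symm rfl
  refine Eq.trans ?_ (h.trans (eltsPointing_compatible F κ))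
  have h1 := F.cell_comp' ((eltsForget F).mapCells θs) κ.cell
    (((eltsForget F).top_mapCells θs)) (w := (f ≫ g).map) (w' := (f' ≫ g').map) rfl rfl
  have h2 : VDGraph.cast (X := spanGraph.{u, v}) (HPath.map_map _ _ _ _ θs.top) rfl rfl
      (F.cell (A.comp ((eltsForget F).mapCells θs) κ.cell
        (((eltsForget F).top_mapCells θs)) rfl rfl)) =
      Spans.data.{u, v}.comp (((eltsForget F).comp F.toVDGraphHom).mapCells θs)
        (((eltsForget F).comp F.toVDGraphHom).cell κ)
        (((eltsForget F).comp F.toVDGraphHom).top_mapCells θs)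
        (((eltsForget F).comp F.toVDGraphHom).vert.map_comp f g).symm
        (((eltsForget F).comp F.toVDGraphHom).vert.map_comp f' g').symm := by
    refine (congrArg (VDGraph.cast (X := spanGraph.{u, v}) _ _ _) h1).trans ?_
    refine (VDCData.cast_comp (X := Spans.data.{u, v}) _ _ _ _ _ _ _ _).trans ?_
    refine VDGraphHom.comp_heq (Y := Span.{u, v}) (HPath.map_map _ _ _ _ Δs) rfl rfl rfl rfl ?_ ?_
      _ _ _ _ _ _
    · exact ((heq_of_eq (VDGraphHom.mapCells_comp _ _ θs)).trans
        (VDGraphHom.heq_path_cast (Y := Span.{u, v}) _ rfl rfl _)).symm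
    · exact (VDGraphHom.comp_cell_heq (eltsForget F) F.toVDGraphHom κ).symm
  refine Eq.trans ?_ (congrArg (fun θ => (SpanCell.fn θ ((eltsPointing F).chain θs.top)).1) h2)
  refine Eq.trans ?_ (Spans.fn_cast (HPath.map_map _ _ _ _ θs.top) rfl rfl _ _).symm
  exact congrArg (fun c => (SpanCell.fn (F.cell _) c).1) (eltsPointing_chain F θs.top).symm

/-- Identities and composition of multicells of the virtual double category of elements. -/
abbrev eltsData (F : VDFunctor A Span.{u, v}) : VDCData.{max (u + 1) v} where
  toVDGraph := eltsGraph F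
  id {a b} Γ := ⟨A.id Γ.hor, (congrArg (fun θ => (SpanCell.fn θ (eltsChain (.single Γ))).1)
    (F.cell_id Γ.hor)).trans (Spans.fn_cast rfl _ _ _ _)⟩
  comp θs _ _ _ κ _ _ _ e e₁ e₂ := ⟨_, elts_comp θs κ e e₁ e₂⟩

theorem eltsForget_preserves (F : VDFunctor A Span.{u, v}) :
    VDGraphHom.Preserves (X := eltsData F) (Y := A) (eltsForget F) :=
  ⟨fun _ => rfl, fun _ _ _ _ _ => rfl⟩

theorem eltsForget_inj {F : VDFunctor A Span.{u, v}} {a a' b b' : EltsObj F}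
    {Γs : HPath (EltsHor (F := F)) a a'} {f : a ⟶ b} {f' : a' ⟶ b'} {Δ : EltsHor b b'}
    (θ κ : EltsCell Γs f f' Δ) (h : θ.cell = κ.cell) : θ = κ := by
  cases θ; cases κ
  dsimp only at h
  subst h
  rfl

/-- The virtual double category of elements of a functor to the virtual double category of
spans. -/
def EltsVDC (F : VDFunctor A Span.{u, v}) : VDC.{max (u + 1) v} :=
  VDC.ofFaithful (eltsData F) (ι := Unit) (fun _ => A) (fun _ => eltsForget F)
    (fun _ => eltsForget_preserves F) (fun θ κ h => eltsForget_inj θ κ (h ()))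

/-- The projection which forgets the elements. -/
def EltsVDC.proj (F : VDFunctor A Span.{u, v}) : VDFunctor (EltsVDC F) A where
  toVDGraphHom := eltsForget F
  cell_id := (eltsForget_preserves F).cell_id
  cell_comp := (eltsForget_preserves F).cell_comp

/-- The image of a path of horizontal morphisms in the virtual double category of pointed spans. -/
abbrev eltsPtPath {F : VDFunctor A Span.{u, v}} {a b : EltsObj F}
    (Γs : HPath (EltsHor (F := F)) a b) :
    HPath PtHor.{u, v} ⟨F.vert.obj a.obj, a.elt⟩ ⟨F.vert.obj b.obj, b.elt⟩ :=
  Γs.map (fun a => (⟨F.vert.obj a.obj, a.elt⟩ : PtObj.{u, v}))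
    (fun _ _ Γ => ⟨F.hor Γ.hor, Γ.elt⟩)

theorem eltsPtPath_eq (F : VDFunctor A Span.{u, v}) {a b : EltsObj F}
    (Γs : HPath (EltsHor (F := F)) a b) :
    F.path ((eltsForget F).path Γs) = ptForget.path (eltsPtPath Γs) :=
  (HPath.map_map (H' := A.Hor) (H'' := SpanHor.{u, v}) EltsObj.obj F.vert.obj
    (fun _ _ Γ => EltsHor.hor Γ) (fun _ _ Γ => F.hor Γ) Γs).trans
    (HPath.map_map (H' := PtHor.{u, v}) (H'' := SpanHor.{u, v})
      (fun a : EltsObj F => (⟨F.vert.obj a.obj, a.elt⟩ : PtObj.{u, v})) PtObj.set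
      (fun _ _ Γ => ⟨F.hor Γ.hor, Γ.elt⟩) (fun _ _ S => PtHor.span S) Γs).symm

theorem ptChain_elts {F : VDFunctor A Span.{u, v}} : ∀ {a b : EltsObj F}
    (Γs : HPath (EltsHor (F := F)) a b),
    Chain.cast (eltsPtPath_eq F Γs).symm (ptChain (eltsPtPath Γs)) = eltsChain Γs
  | _, _, .nil _ => rfl
  | _, _, .cons Γ Γs => (Chain.cast_cons (Γ := F.hor Γ.hor) Γ.elt _ (eltsPtPath_eq F Γs).symm).trans
      (congrArg (Chain.cons Γ.elt) (ptChain_elts Γs))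

/-- The underlying data of the functor from the virtual double category of elements to pointed
spans. -/
def eltsPtHom (F : VDFunctor A Span.{u, v}) : VDGraphHom (eltsGraph F) ptGraph.{u, v} where
  vert :=
    { obj := fun a => ⟨F.vert.obj a.obj, a.elt⟩
      map := fun f => ⟨F.vert.map f.map, f.map_elt⟩
      map_id := fun a => PtMap.ext (F.vert.map_id a.obj)
      map_comp := fun f g => PtMap.ext (F.vert.map_comp f.map g.map) }
  hor Γ := ⟨F.hor Γ.hor, Γ.elt⟩
  cell {_ _ _ _ Γs f f' Δ} θ := ⟨VDGraph.cast (X := spanGraph.{u, v})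
    (eltsPtPath_eq F Γs) rfl rfl (F.cell θ.cell),
    (Spans.fn_cast (eltsPtPath_eq F Γs) rfl rfl (F.cell θ.cell) _).trans
      ((congrArg (fun c => (SpanCell.fn (F.cell θ.cell) c).1) (ptChain_elts Γs)).trans θ.cell_elt)⟩

theorem eltsPtHom_forget (F : VDFunctor A Span.{u, v}) :
    (eltsPtHom F).comp ptForget.{u, v} = (eltsForget F).comp F.toVDGraphHom := by
  refine VDGraphHom.ext_cell rfl (fun _ => HEq.rfl) fun {_ _ _ _ Γs _ _ _} θ => ?_
  refine (VDGraphHom.comp_cell_heq _ _ θ).trans ?_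
  refine HEq.trans ?_ (VDGraphHom.comp_cell_heq _ _ θ).symm
  exact VDGraphHom.heq_cast (Y := Span.{u, v}) (eltsPtPath_eq F Γs) rfl rfl (F.cell θ.cell)

/-- The functor from the virtual double category of elements to pointed spans. -/
def EltsVDC.toPt (F : VDFunctor A Span.{u, v}) : VDFunctor (EltsVDC F) SpanPt.{u, v} :=
  VDFunctor.ofFaithful (ι := Unit) (eltsPtHom F) (fun _ => Q.{u, v})
    (fun θ κ h => Q_inj θ κ (h ()))
    (fun _ => (eltsPtHom_forget F).symm ▸ ((EltsVDC.proj F).comp F).preserves)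

theorem EltsVDC.w (F : VDFunctor A Span.{u, v}) :
    (EltsVDC.toPt F).comp Q.{u, v} = (EltsVDC.proj F).comp F :=
  VDProd.toHom_injective (eltsPtHom_forget F)

end Elts

namespace EltsVDC

variable {A B C : VDC.{max (u + 1) v}} {F : VDFunctor A Span.{u, v}} {G : VDFunctor B Span.{u, v}}

theorem carrier_eq (h : VDFunctor A B) (w : h.comp G = F)
    (a : A.Obj) : SpanObj.carrier (F.vert.obj a) =
    SpanObj.carrier (G.vert.obj (h.vert.obj a)) := by
  subst w; rfl

theorem apex_eq (h : VDFunctor A B) (w : h.comp G = F)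
    {a b : A.Obj} (Γ : A.Hor a b) : SpanHor.apex (F.hor Γ) =
    SpanHor.apex (G.hor (h.hor Γ)) := by
  subst w; rfl

/-- Transport of an element of a fibre. -/
def castFiber (h : VDFunctor A B) (w : h.comp G = F)
    {a b : A.Obj} {Γ : A.Hor a b} {i : SpanObj.carrier (F.vert.obj a)}
    {j : SpanObj.carrier (F.vert.obj b)} (s : SpanHor.Fiber (F.hor Γ) i j) :
    SpanHor.Fiber (G.hor (h.hor Γ)) (cast (carrier_eq h w a) i) (cast (carrier_eq h w b) j) :=
  ⟨cast (apex_eq h w Γ) s.1, by subst w; exact s.2⟩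

/-- The action of a functor over the virtual double category of spans on objects and vertical
morphisms of the virtual double categories of elements. -/
def mapVert (h : VDFunctor A B) (w : h.comp G = F) : EltsObj F ⥤ EltsObj G where
  obj a := ⟨h.vert.obj a.obj, cast (carrier_eq h w a.obj) a.elt⟩
  map f := ⟨h.vert.map f.map, by subst w; exact f.map_elt⟩
  map_id a := EltsMap.ext (h.vert.map_id a.obj)
  map_comp f g := EltsMap.ext (h.vert.map_comp f.map g.map)

/-- The action on horizontal morphisms. -/
def mapHor (h : VDFunctor A B) (w : h.comp G = F) {a b : EltsObj F} (Γ : EltsHor a b) :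
    EltsHor ((mapVert h w).obj a) ((mapVert h w).obj b) :=
  ⟨h.hor Γ.hor, castFiber h w Γ.elt⟩

/-- The image of a path. -/
abbrev mapPath (h : VDFunctor A B) (w : h.comp G = F)
    {a b : EltsObj F} (Γs : HPath (EltsHor (F := F)) a b) :
    HPath (EltsHor (F := G)) ((mapVert h w).obj a) ((mapVert h w).obj b) :=
  Γs.map (mapVert h w).obj (fun _ _ Γ => mapHor h w Γ)

theorem mapPath_eq (h : VDFunctor A B) (w : h.comp G = F)
    {a b : EltsObj F} (Γs : HPath (EltsHor (F := F)) a b) :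
    h.path ((eltsForget F).path Γs) = (eltsForget G).path (mapPath h w Γs) :=
  (HPath.map_map (H' := A.Hor) (H'' := B.Hor) EltsObj.obj h.vert.obj
    (fun _ _ Γ => EltsHor.hor Γ) (fun _ _ Γ => h.hor Γ) Γs).trans
    (HPath.map_map (H' := EltsHor (F := G)) (H'' := B.Hor) (mapVert h w).obj EltsObj.obj
      (fun _ _ Γ => mapHor h w Γ) (fun _ _ Γ => EltsHor.hor Γ) Γs).symm

theorem mapCell_elt (h : VDFunctor A B) (w : h.comp G = F)
    {a a' b b' : EltsObj F} {Γs : HPath (EltsHor (F := F)) a a'} {f : a ⟶ b}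
    {f' : a' ⟶ b'} {Δ : EltsHor b b'} (θ : EltsCell Γs f f' Δ) :
    (SpanCell.fn (G.cell (B.cast (mapPath_eq h w Γs) rfl rfl (h.cell θ.cell)))
      (eltsChain (mapPath h w Γs))).1 = (castFiber h w Δ.elt).1 := by
  subst w
  refine (congrArg (fun θ => (SpanCell.fn θ (eltsChain (mapPath h rfl Γs))).1)
    (G.cell_cast (mapPath_eq h rfl Γs) rfl rfl (h.cell θ.cell))).trans ?_
  refine (Spans.fn_cast (congrArg G.path (mapPath_eq h rfl Γs)) rfl rfl
    (G.cell (h.cell θ.cell)) _).trans ?_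
  refine Eq.trans ?_ θ.cell_elt
  refine Eq.trans ?_ (Spans.fn_cast (HPath.map_map _ _ _ _ _) rfl rfl
    (G.cell (h.cell θ.cell)) _).symm
  refine congrArg (fun c => (SpanCell.fn (G.cell (h.cell θ.cell)) c).1) ?_
  have e₀ : ∀ {a b : EltsObj (h.comp G)} (Γs : HPath (EltsHor (F := h.comp G)) a b),
      (h.comp G).path ((eltsForget (h.comp G)).path Γs) =
        G.path (h.path ((eltsForget (h.comp G)).path Γs)) := fun Γs =>
    (HPath.map_map (H' := B.Hor) (H'' := SpanHor.{u, v}) h.vert.obj G.vert.obj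
      (fun _ _ Γ => h.hor Γ) (fun _ _ Γ => G.hor Γ) _).symm
  have key : ∀ {a b : EltsObj (h.comp G)} (Γs : HPath (EltsHor (F := h.comp G)) a b)
      (e : G.path ((eltsForget G).path (mapPath h rfl Γs)) =
        G.path (h.path ((eltsForget (h.comp G)).path Γs)))
      (e' : (h.comp G).path ((eltsForget (h.comp G)).path Γs) =
        G.path (h.path ((eltsForget (h.comp G)).path Γs))),
      Chain.cast e (eltsChain (mapPath h rfl Γs)) = Chain.cast e' (eltsChain Γs) := by
    intro a b Γs
    induction Γs with
    | nil a => intro _ _; rfl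
    | cons Γ Γs ih =>
      intro _ _
      refine (Chain.cast_cons (Γ := G.hor (h.hor Γ.hor)) Γ.elt _
        (congrArg G.path (mapPath_eq h rfl Γs)).symm).trans ?_
      refine (congrArg (Chain.cons Γ.elt) (ih _ (e₀ Γs))).trans ?_
      exact (Chain.cast_cons (Γ := G.hor (h.hor Γ.hor)) Γ.elt _ (e₀ Γs)).symm
  exact key Γs _ _

/-- The underlying data of the action on functors over the virtual double category of spans. -/
def mapHom (h : VDFunctor A B) (w : h.comp G = F) : VDGraphHom (eltsGraph F) (eltsGraph G) where
  vert := mapVert h w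
  hor Γ := mapHor h w Γ
  cell {_ _ _ _ Γs _ _ _} θ :=
    ⟨B.cast (mapPath_eq h w Γs) rfl rfl (h.cell θ.cell), mapCell_elt h w θ⟩

theorem mapHom_forget (h : VDFunctor A B) (w : h.comp G = F)
    : (mapHom h w).comp (eltsForget G) = (eltsForget F).comp h.toVDGraphHom := by
  refine VDGraphHom.ext_cell rfl (fun _ => HEq.rfl) fun {_ _ _ _ Γs _ _ _} θ => ?_
  refine (VDGraphHom.comp_cell_heq _ _ θ).trans ?_
  refine HEq.trans ?_ (VDGraphHom.comp_cell_heq _ _ θ).symm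
  exact VDGraphHom.heq_cast (Y := B) (mapPath_eq h w Γs) rfl rfl (h.cell θ.cell)

/-- The action of the construction of elements on functors over the virtual double category of
spans. -/
def map (h : VDFunctor A B) (w : h.comp G = F) : VDFunctor (EltsVDC F) (EltsVDC G) :=
  VDFunctor.ofFaithful (ι := Unit) (mapHom h w) (fun _ => proj G)
    (fun θ κ h => eltsForget_inj θ κ (h ()))
    (fun _ => (mapHom_forget h w).symm ▸ ((proj F).comp h).preserves)

theorem map_proj (h : VDFunctor A B) (w : h.comp G = F)
    : (map h w).comp (proj G) = (proj F).comp h :=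
  VDProd.toHom_injective (mapHom_forget h w)

theorem ptHor_heq {I J : PtObj.{u, v}} {S S' : SpanHor I.set J.set} (e : S = S')
    {s : S.Fiber I.pt J.pt} {s' : S'.Fiber I.pt J.pt} (h : HEq s.1 s'.1) :
    (⟨S, s⟩ : PtHor I J) = ⟨S', s'⟩ := by
  subst e
  rw [Subtype.ext (eq_of_heq h)]

theorem map_toPt (h : VDFunctor A B) (w : h.comp G = F) :
    (map h w).comp (toPt G) = toPt F := by
  subst w
  refine VDFunctor.ext_faithful (ι := Unit) (fun _ => Q.{u, v})
    (fun θ κ h => Q_inj θ κ (h ())) rfl (fun _ => HEq.rfl) fun _ => ?_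
  refine (VDFunctor.assoc _ _ _).trans ((congrArg ((map h rfl).comp) (EltsVDC.w G)).trans ?_)
  refine (VDFunctor.assoc _ _ _).symm.trans ((congrArg (fun K => VDFunctor.comp K G)
    (map_proj h rfl)).trans ?_)
  exact (VDFunctor.assoc _ _ _).trans (EltsVDC.w _).symm

theorem map_id (F : VDFunctor A Span.{u, v}) (w : (VDFunctor.id A).comp F = F) :
    map (VDFunctor.id A) w = VDFunctor.id (EltsVDC F) :=
  VDFunctor.ext_faithful (ι := Unit) (fun _ => proj F)
    (fun θ κ h => eltsForget_inj θ κ (h ())) rfl (fun _ => HEq.rfl) fun _ =>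
    (map_proj _ w).trans ((VDFunctor.comp_id _).trans (VDFunctor.id_comp _).symm)

theorem map_comp {H : VDFunctor C Span.{u, v}} (h : VDFunctor A B) (w : h.comp G = F)
    (k : VDFunctor B C) (w' : k.comp H = G) (w'' : (h.comp k).comp H = F) :
    map (h.comp k) w'' = (map h w).comp (map k w') := by
  subst w' w
  refine VDFunctor.ext_faithful (ι := Unit) (fun _ => proj H)
    (fun θ κ h => eltsForget_inj θ κ (h ())) rfl (fun _ => HEq.rfl) fun _ => ?_
  refine (map_proj _ w'').trans ?_
  refine ((VDFunctor.assoc _ _ _).symm.trans ?_).trans (VDFunctor.assoc _ _ _).symm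
  refine (congrArg (fun K => VDFunctor.comp K k) (map_proj h rfl)).symm.trans ?_
  exact (VDFunctor.assoc _ _ _).trans (congrArg ((map h rfl).comp) (map_proj k rfl).symm)

end EltsVDC

theorem VDTrans.eqToHom_fn {X : VDC.{max (u + 1) v}} {F G : VDFunctor X Span.{u, v}} (e : F = G)
    (a : X.Obj) (x : SpanObj.carrier (F.vert.obj a)) :
    SpanMap.fn ((eqToHom e : VDTrans F G).vert.app a) x =
      cast (congrArg (fun K => SpanObj.carrier (K.vert.obj a)) e) x := by
  subst e; rfl

theorem VDTrans.eqToHom_cell_fn {X : VDC.{max (u + 1) v}} {F G : VDFunctor X Span.{u, v}}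
    (e : F = G) {a b : X.Obj} (Γ : X.Hor a b) {i : SpanObj.carrier (F.vert.obj a)}
    {j : SpanObj.carrier (F.vert.obj b)} (c : SpanChain (.single (F.hor Γ)) i j) :
    (SpanCell.fn ((eqToHom e : VDTrans F G).cell Γ) c).1 =
      cast (congrArg (fun K => SpanHor.apex (K.hor Γ)) e) c.2.1.1 := by
  subst e; rfl

theorem VDTrans.eqToHom_pt_fn {X : VDC.{max (u + 1) v}} {F G : VDFunctor X SpanPt.{u, v}}
    (e : F = G) (a : X.Obj) (x : SpanObj.carrier (PtObj.set (F.vert.obj a))) :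
    SpanMap.fn (PtMap.map ((eqToHom e : VDTrans F G).vert.app a)) x =
      cast (congrArg (fun K => SpanObj.carrier (PtObj.set (K.vert.obj a))) e) x := by
  subst e; rfl

theorem VDTrans.eqToHom_pt_cell_fn {X : VDC.{max (u + 1) v}} {F G : VDFunctor X SpanPt.{u, v}}
    (e : F = G) {a b : X.Obj} (Γ : X.Hor a b) {i : SpanObj.carrier (PtObj.set (F.vert.obj a))}
    {j : SpanObj.carrier (PtObj.set (F.vert.obj b))}
    (c : SpanChain (.single (PtHor.span (F.hor Γ))) i j) :
    (SpanCell.fn (PtCell.cell ((eqToHom e : VDTrans F G).cell Γ)) c).1 =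
      cast (congrArg (fun K => SpanHor.apex (PtHor.span (K.hor Γ))) e) c.2.1.1 := by
  subst e; rfl

theorem pt_fn_cast {I I' J J' : PtObj.{u, v}} {Ss : HPath PtHor.{u, v} I I'} {f g : I ⟶ J}
    {f' g' : I' ⟶ J'} {T : PtHor J J'} (e₁ : f = g) (e₂ : f' = g') (θ : PtCell Ss f f' T)
    {i : I.set.carrier} {j : I'.set.carrier}
    (c : SpanChain (Ss.map PtObj.set (fun _ _ S => S.span)) i j) :
    (SpanCell.fn (PtCell.cell (VDGraph.cast (X := ptGraph.{u, v}) rfl e₁ e₂ θ)) c).1 =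
      (θ.cell.fn c).1 := by
  subst e₁ e₂; rfl

/-- Components obtained from those of a vertical transformation by transport along equalities of
functors form a vertical transformation. -/
def VDTrans.copy {X Y : VDC.{v}} {F F' G G' : VDFunctor X Y} (α : VDTrans F G) (e : F' = F)
    (e' : G' = G) (γ : VDTransData F' G') (hv : ∀ A, HEq (γ.vert.app A) (α.vert.app A))
    (hc : ∀ {A B : X.Obj} (Γ : X.Hor A B), HEq (γ.cell Γ) (α.cell Γ)) : VDTrans F' G' where
  toVDTransData := γ
  naturality := by
    subst e e'
    rcases γ with ⟨γv, γc⟩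
    rcases α with ⟨⟨αv, αc⟩, hα⟩
    have e : γv = αv := NatTrans.ext (funext fun A => eq_of_heq (hv A))
    subst e
    have e' : @γc = @αc := by
      funext A B Γ
      exact eq_of_heq (hc Γ)
    subst e'
    intro A A' B B' Γs u u' Δ θ
    exact hα θ

namespace EltsVDC

variable {A B C : VDC.{max (u + 1) v}} {F : VDFunctor A Span.{u, v}} {G : VDFunctor B Span.{u, v}}
  {h k : VDFunctor A B}

/-- The components of the action of the construction of elements on 2-cells over the virtual double
category of spans. -/
def map₂Data (wh : h.comp G = F) (wk : k.comp G = F) (α : VDTrans h k)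
    (hα : VDTrans.whiskerRight α G = eqToHom (wh.trans wk.symm)) : VDTransData (map h wh) (map k wk) where
  vert :=
    { app := fun a => ⟨α.vert.app a.obj, by
        have h1 := congrArg (fun β : VDTrans (h.comp G) (k.comp G) => SpanMap.fn
          (β.vert.app a.obj) (cast (carrier_eq h wh a.obj) a.elt)) hα
        refine h1.trans ((VDTrans.eqToHom_fn _ _ _).trans ?_)
        exact cast_cast _ _ _⟩
      naturality := fun a b f => EltsMap.ext (α.vert.naturality f.map) }
  cell {a b} Γ := ⟨α.cell Γ.hor, by
    have h1 := congrArg (fun β : VDTrans (h.comp G) (k.comp G) => (SpanCell.fn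
      (β.cell Γ.hor) (eltsChain (.single (mapHor h wh Γ)))).1) hα
    refine h1.trans ((VDTrans.eqToHom_cell_fn _ _ _).trans ?_)
    exact cast_cast _ _ _⟩

/-- The action of the construction of elements on 2-cells over the virtual double category of
spans. -/
def map₂ (wh : h.comp G = F) (wk : k.comp G = F) (α : VDTrans h k)
    (hα : VDTrans.whiskerRight α G = eqToHom (wh.trans wk.symm)) : VDTrans (map h wh) (map k wk) :=
  VDTrans.ofFaithful (ι := Unit) (map₂Data wh wk α hα) (fun _ => proj G)
    (fun θ κ h => eltsForget_inj θ κ (h ()))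
    (fun _ => VDTrans.copy (VDTrans.whiskerLeft (proj F) α) (map_proj h wh) (map_proj k wk)
      { vert :=
          { app := fun a => α.vert.app (EltsObj.obj a)
            naturality := fun _ _ f => α.vert.naturality (EltsMap.map f) }
        cell := fun Γ => α.cell (EltsHor.hor Γ) }
      (fun _ => HEq.rfl) (fun _ => HEq.rfl))
    (fun _ _ => rfl) (fun _ _ _ _ => rfl)

theorem map₂_toPt (wh : h.comp G = F) (wk : k.comp G = F) (α : VDTrans h k)
    (hα : VDTrans.whiskerRight α G = eqToHom (wh.trans wk.symm)) : VDTrans.whiskerRight (map₂ wh wk α hα) (toPt G) =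
    eqToHom ((map_toPt h wh).trans (map_toPt k wk).symm) := by
  have hv : ∀ a : (EltsVDC F).Obj, (VDTrans.whiskerRight (map₂ wh wk α hα) (toPt G)).vert.app a =
      (eqToHom ((map_toPt h wh).trans (map_toPt k wk).symm) :
        VDTrans ((map h wh).comp (toPt G)) ((map k wk).comp (toPt G))).vert.app a := fun a => by
    refine PtMap.ext (SpanMap.ext (funext fun x => ?_))
    refine Eq.trans ?_ (VDTrans.eqToHom_pt_fn _ _ _).symm
    exact (congrArg (fun β : VDTrans (h.comp G) (k.comp G) => SpanMap.fn
      (β.vert.app (EltsObj.obj a)) x) hα).trans (VDTrans.eqToHom_fn _ _ _)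
  refine VDTrans.ext' hv fun {a b} Γ => ?_
  refine ptForget_inj _ _ (Spans.ext_cell fun c => ?_)
  refine ((congrArg (fun β : VDTrans (h.comp G) (k.comp G) => (SpanCell.fn
      (β.cell (EltsHor.hor Γ)) c).1) hα).trans (VDTrans.eqToHom_cell_fn _ _ _)).trans ?_
  have h2 := pt_fn_cast (Ss := .single (((map h wh).comp (toPt G)).hor Γ))
    (T := ((map k wk).comp (toPt G)).hor Γ) (hv a).symm (hv b).symm
    ((eqToHom ((map_toPt h wh).trans (map_toPt k wk).symm) :
      VDTrans ((map h wh).comp (toPt G)) ((map k wk).comp (toPt G))).cell Γ) c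
  exact (VDTrans.eqToHom_pt_cell_fn _ _ _).symm.trans h2.symm

end EltsVDC

namespace EltsVDC

variable {A B C : VDC.{max (u + 1) v}}

theorem map₂_whiskerLeft {F : VDFunctor A Span.{u, v}} {G : VDFunctor B Span.{u, v}}
    {H : VDFunctor C Span.{u, v}} (f : VDFunctor A B) (wf : f.comp G = F) {g h : VDFunctor B C}
    (wg : g.comp H = G) (wh : h.comp H = G) (η : VDTrans g h)
    (hη : VDTrans.whiskerRight η H = eqToHom (wg.trans wh.symm))
    (w : (f.comp g).comp H = F) (w' : (f.comp h).comp H = F)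
    (hη' : VDTrans.whiskerRight (VDTrans.whiskerLeft f η) H = eqToHom (w.trans w'.symm)) :
    map₂ w w' (VDTrans.whiskerLeft f η) hη' =
      (eqToHom (map_comp f wf g wg w) : map (f.comp g) w ⟶ (map f wf).comp (map g wg)) ≫
        (VDTrans.whiskerLeft (map f wf) (map₂ wg wh η hη) :
          (map f wf).comp (map g wg) ⟶ (map f wf).comp (map h wh)) ≫
        eqToHom (map_comp f wf h wh w').symm := by
  subst wg wf
  exact VDTrans.eq_conj _ _ _ _ (fun _ => HEq.rfl) (fun _ => HEq.rfl)

theorem map₂_whiskerRight {F : VDFunctor A Span.{u, v}} {G : VDFunctor B Span.{u, v}}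
    {H : VDFunctor C Span.{u, v}} {f g : VDFunctor A B} (wf : f.comp G = F) (wg : g.comp G = F)
    (η : VDTrans f g) (hη : VDTrans.whiskerRight η G = eqToHom (wf.trans wg.symm))
    (h : VDFunctor B C) (wh : h.comp H = G)
    (w : (f.comp h).comp H = F) (w' : (g.comp h).comp H = F)
    (hη' : VDTrans.whiskerRight (VDTrans.whiskerRight η h) H = eqToHom (w.trans w'.symm)) :
    map₂ w w' (VDTrans.whiskerRight η h) hη' =
      (eqToHom (map_comp f wf h wh w) : map (f.comp h) w ⟶ (map f wf).comp (map h wh)) ≫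
        (VDTrans.whiskerRight (map₂ wf wg η hη) (map h wh) :
          (map f wf).comp (map h wh) ⟶ (map g wg).comp (map h wh)) ≫
        eqToHom (map_comp g wg h wh w').symm := by
  subst wh wf
  refine VDTrans.eq_conj _ _ _ _ (fun _ => HEq.rfl) (fun {a b} Γ => heq_of_eq ?_)
  exact eltsForget_inj _ _ rfl

end EltsVDC

open TwoCat in
/-- The 2-functor between slices given by pullback along the functor from pointed spans to
spans. -/
def QStar : StrictPseudofunctor (Slice Span.{u, v}) (Slice SpanPt.{u, v}) :=
  StrictPseudofunctor.mk''
  { obj := fun P => ⟨EltsVDC P.arr, EltsVDC.toPt P.arr⟩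
    map := fun f => ⟨EltsVDC.map f.hom f.w, EltsVDC.map_toPt f.hom f.w⟩
    map₂ := fun {_ _ f g} η => ⟨EltsVDC.map₂ f.w g.w η.hom η.w, EltsVDC.map₂_toPt _ _ _ _⟩
    map₂_id := fun f => Slice.Hom₂.ext (VDTrans.ext' (fun _ => rfl)
      (fun _ => eltsForget_inj _ _ rfl))
    map₂_comp := fun f g => Slice.Hom₂.ext (VDTrans.ext' (fun _ => rfl)
      (fun _ => eltsForget_inj _ _ rfl))
    map_id := fun P => Slice.Hom.ext (EltsVDC.map_id _ _)
    map_comp := fun f g => Slice.Hom.ext (EltsVDC.map_comp _ f.w _ g.w _)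
    map₂_whisker_left := fun {P Q R} f {g h} η => Slice.Hom₂.ext (by
      simp only [Slice.hom₂_comp, Slice.hom₂_eqToHom, Slice.hom₂_whiskerLeft]
      exact EltsVDC.map₂_whiskerLeft f.hom f.w g.w h.w η.hom η.w _ _ _)
    map₂_whisker_right := fun {P Q R f g} η h => Slice.Hom₂.ext (by
      simp only [Slice.hom₂_comp, Slice.hom₂_eqToHom, Slice.hom₂_whiskerRight]
      exact EltsVDC.map₂_whiskerRight f.w g.w η.hom η.w h.hom h.w _ _ _) }

namespace Fams

variable {A : VDC.{max (u + 1) v}}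

variable (A) in
/-- The underlying sets and functions of families. -/
def setVert : FamObj.{u, v} A ⥤ SpanObj.{u, v} where
  obj P := P.set
  map f := ⟨f.fn⟩

/-- The path of spans underlying a path of horizontal morphisms of families. -/
abbrev spanPath {P Q : FamObj.{u, v} A} (Γs : HPath (FamHor (A := A)) P Q) :
    HPath SpanHor.{u, v} P.set Q.set :=
  Γs.map (setVert A).obj (fun _ _ Γ => Γ.span)

/-- A chain along the underlying path of spans, as a chain of indices. -/
abbrev ofSpanChain {P Q : FamObj.{u, v} A} (Γs : HPath (FamHor (A := A)) P Q) {i : P.idx}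
    {j : Q.idx} (c : SpanChain (spanPath Γs) i j) : FamChain Γs i j :=
  Chain.unmap (H' := SpanHor.{u, v}) (setVert A).obj (fun _ _ Γ => FamHor.span Γ) Γs c

/-- A chain of indices, as a chain along the underlying path of spans. -/
abbrev toSpanChain {P Q : FamObj.{u, v} A} {Γs : HPath (FamHor (A := A)) P Q} {i : P.idx}
    {j : Q.idx} (c : FamChain Γs i j) : SpanChain (spanPath Γs) i j :=
  Chain.remap (H' := SpanHor.{u, v}) (car' := SpanObj.carrier)
    (fib' := fun _ _ S i j => SpanHor.Fiber S i j) (setVert A).obj (fun _ _ Γ => FamHor.span Γ) c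

theorem ofSpanChain_toSpanChain {P Q : FamObj.{u, v} A} {Γs : HPath (FamHor (A := A)) P Q}
    {i : P.idx} {j : Q.idx} (c : FamChain Γs i j) : ofSpanChain Γs (toSpanChain c) = c :=
  Chain.unmap_remap (H' := SpanHor.{u, v}) (car' := SpanObj.carrier)
    (fib' := fun _ _ S i j => SpanHor.Fiber S i j) (setVert A).obj (fun _ _ Γ => FamHor.span Γ) c

variable (A) in
/-- The underlying multicells of spans of multicells of families. -/
def spanHom : VDGraphHom (famGraph.{u, v} A) spanGraph.{u, v} where
  vert := setVert A
  hor Γ := Γ.span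
  cell {_ _ _ _ Γs _ _ _} θ := ⟨fun c => θ.fn (ofSpanChain Γs c)⟩

theorem push_spanHom : ∀ {P P' Q Q' : FamObj.{u, v} A}
    {Δs : HPath (FamHor (A := A)) Q Q'} {f : P ⟶ Q} {f' : P' ⟶ Q'}
    (θs : (famGraph.{u, v} A).CellPath Δs f f') {i : P.idx} {i' : P'.idx}
    (c : SpanChain ((spanHom A).mapCells θs).top i i'),
    Spans.push ((spanHom A).mapCells θs) c =
      toSpanChain (push θs (ofSpanChain θs.top (c.cast ((spanHom A).top_mapCells θs)))).chain
  | _, _, _, _, _, _, _, .nil f, i, _, c => by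
    obtain ⟨⟨rfl⟩⟩ := c; rfl
  | _, _, _, _, _, _, _, .cons (Γs := Γs) θ θs, _, _, c => by
    obtain ⟨k, c₁, c₂, rfl⟩ : ∃ (k : _) (c₁ : SpanChain ((spanHom A).path Γs) _ k)
        (c₂ : SpanChain ((spanHom A).mapCells θs).top k _), c = Chain.append c₁ c₂ :=
      ⟨_, _, _, (Chain.append_split ((spanHom A).path Γs) c).symm⟩
    refine (Spans.push_cons ((spanHom A).cell θ) ((spanHom A).mapCells θs) c₁ c₂).trans ?_
    have h : (Chain.append c₁ c₂).cast
        ((spanHom A).top_mapCells (VDGraph.CellPath.cons (X := famGraph.{u, v} A) θ θs)) =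
        Chain.cast (HPath.map_append _ _ Γs θs.top).symm
          (Chain.append c₁ (Chain.cast ((spanHom A).top_mapCells θs) c₂)) :=
      Eq.symm ((congrArg (Chain.cast _) (Chain.append_cast _ _ _)).trans (Chain.cast_cast _ _ _))
    have h' := Chain.unmap_append (setVert A).obj (fun _ _ Γ => FamHor.span Γ) Γs θs.top c₁
      (Chain.cast ((spanHom A).top_mapCells θs) c₂)
    have h'' := (congrArg (ofSpanChain (Γs.append θs.top)) h).trans h'
    refine Eq.trans ?_ (congrArg (fun c => toSpanChain (push (VDGraph.CellPath.cons θ θs) c).chain)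
      h'').symm
    refine Eq.trans ?_ (congrArg (fun p => toSpanChain (Push.chain p)) (push_cons θ θs _ _)).symm
    exact congrArg (Chain.cons _) (push_spanHom θs c₂)

theorem comp_fn' {P P' Q Q' R R' : FamObj.{u, v} A} {Δs : HPath (FamHor (A := A)) Q Q'} {f : P ⟶ Q}
    {f' : P' ⟶ Q'} (θs : (famGraph.{u, v} A).CellPath Δs f f') {g : Q ⟶ R} {g' : Q' ⟶ R'}
    {Λ : FamHor R R'} (κ : FamCell Δs g g' Λ) {i : P.idx} {i' : P'.idx} {c c' : FamChain θs.top i i'}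
    (e : c = c') : (FamCell.fn ((data.{u, v} A).comp θs κ rfl rfl rfl) c).1 =
      (κ.fn (push θs c').chain).1 := by
  subst e; rfl

end Fams

/-- The functor sending a family to its set of indices, and a horizontal morphism of families to its
span of indices. -/
def FamVDC.toSpan (A : VDC.{max (u + 1) v}) : VDFunctor (FamVDC.{u, v} A) Span.{u, v} where
  toVDGraphHom := Fams.spanHom A
  cell_id Γ := rfl
  cell_comp θs _ _ _ κ := Spans.ext_cell fun c => by
    refine Eq.trans ?_ (Spans.comp_fn _ _ _ _ _ c).symm
    have h := Fams.push_spanHom θs (c.cast ((Fams.spanHom A).top_mapCells θs).symm)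
    have hc : Chain.cast ((Fams.spanHom A).top_mapCells θs)
        (c.cast ((Fams.spanHom A).top_mapCells θs).symm) = c :=
      (Chain.eq_cast_cast ((Fams.spanHom A).top_mapCells θs).symm c).symm
    refine Eq.trans ?_ (congrArg (fun d => (SpanCell.fn ((Fams.spanHom A).cell κ) d).1) h).symm
    refine Eq.trans ?_ (congrArg (fun d => (FamCell.fn κ d).1)
      (Fams.ofSpanChain_toSpanChain _)).symm
    exact Fams.comp_fn' θs κ (congrArg (Fams.ofSpanChain θs.top) hc.symm)

/-! ### Discrete opfibrations -/

/-- A vertical morphism with given domain. -/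
structure VDGraph.VertFrom (X : VDGraph.{v}) (A : X.Obj) where
  cod : X.Obj
  hom : A ⟶ cod

/-- A multicell with given top boundary. -/
structure VDGraph.CellFrom (X : VDGraph.{v}) {A A' : X.Obj} (Γs : HPath X.Hor A A') where
  left : X.VertFrom A
  right : X.VertFrom A'
  bot : X.Hor left.cod right.cod
  cell : X.Cell Γs left.hom right.hom bot

/-- A virtual double functor `P` is a discrete opfibration if each vertical morphism with domain
`P A` lifts uniquely to a vertical morphism with domain `A`, and each multicell with top boundary
the image of a path `Γs` lifts uniquely to a multicell with top boundary `Γs`. -/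
structure VDFunctor.IsDiscreteOpfibration {X Y : VDC.{v}} (P : VDFunctor X Y) : Prop where
  vert : ∀ (A : X.Obj) (g : Y.VertFrom (P.vert.obj A)),
    ∃! f : X.VertFrom A, (⟨P.vert.obj f.cod, P.vert.map f.hom⟩ : Y.VertFrom (P.vert.obj A)) = g
  cell : ∀ {A A' : X.Obj} (Γs : HPath X.Hor A A') (ν : Y.CellFrom (P.path Γs)),
    ∃! θ : X.CellFrom Γs,
      (⟨⟨P.vert.obj θ.left.cod, P.vert.map θ.left.hom⟩,
        ⟨P.vert.obj θ.right.cod, P.vert.map θ.right.hom⟩, P.hor θ.bot, P.cell θ.cell⟩ :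
          Y.CellFrom (P.path Γs)) = ν

open TwoCat in
/-- The 2-functor `VDC → VDC/Span` sending `A` to the virtual double category of families in `A`
with the functor `Fam A → Fam 1 → Span`. -/
def FamOne : StrictPseudofunctor VDC.{max (u + 1) v} (Slice Span.{u, v}) :=
  (toSlice Fam.{u, v} VDC.unitTerminal).comp (Slice.sum (FamVDC.toSpan.{u, v} VDC.unit))

open TwoCat in
/-- The construction of the virtual double category of elements, as a 2-functor: pullback along the
functor from pointed spans to spans, followed by the forgetful 2-functor. -/
def Elts : StrictPseudofunctor (Slice Span.{u, v}) VDC.{max (u + 1) v} :=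
  QStar.{u, v}.comp (Slice.forget SpanPt.{u, v})

open TwoCat in
/-- For a right 2-adjoint `S` of pullback along `Q`, the composite
`VDC → VDC/SpanPt → VDC/Span` of the 2-functor `SpanPt × -` and `S`. -/
def polyOne (S : StrictPseudofunctor (Slice SpanPt.{u, v}) (Slice Span.{u, v})) :
    StrictPseudofunctor VDC.{max (u + 1) v} (Slice Span.{u, v}) :=
  (prodOver (VDProd.twoProduct SpanPt.{u, v})).comp S

open TwoCat in
/-- The polynomial 2-functor `VDC → VDC/SpanPt → VDC/Span → VDC` associated with a right 2-adjoint
`S` of pullback along `Q`. -/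
def poly (S : StrictPseudofunctor (Slice SpanPt.{u, v}) (Slice Span.{u, v})) :
    StrictPseudofunctor VDC.{max (u + 1) v} VDC.{max (u + 1) v} :=
  (polyOne S).comp (Slice.forget Span.{u, v})

namespace TwoCat

open Bicategory

universe w₁ w₂ w₃ v₁ v₂ v₃ u₁ u₂ u₃

/-! ### Heterogeneous equality of 2-cells in strict 2-categories -/

section HEq

variable {K : Type u₁} [Bicategory.{w₁, v₁} K] {L : Type u₂} [Bicategory.{w₂, v₂} L]

theorem whiskerRight_heq {A B C : K} {f f' g g' : A ⟶ B} {η : f ⟶ g} {η' : f' ⟶ g'} {h h' : B ⟶ C}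
    (ef : f = f') (eg : g = g') (e : HEq η η') (eh : h = h') : HEq (η ▷ h) (η' ▷ h') := by
  subst ef eg eh; rw [eq_of_heq e]

theorem whiskerLeft_heq {A B C : K} {h h' : A ⟶ B} {f f' g g' : B ⟶ C} {η : f ⟶ g} {η' : f' ⟶ g'}
    (eh : h = h') (ef : f = f') (eg : g = g') (e : HEq η η') : HEq (h ◁ η) (h' ◁ η') := by
  subst ef eg eh; rw [eq_of_heq e]

theorem comp_heq {C : Type u₁} [Category.{v₁} C] {X X' Y Y' Z Z' : C} {f : X ⟶ Y} {f' : X' ⟶ Y'}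
    {g : Y ⟶ Z} {g' : Y' ⟶ Z'} (eX : X = X') (eY : Y = Y') (eZ : Z = Z') (ef : HEq f f')
    (eg : HEq g g') : HEq (f ≫ g) (f' ≫ g') := by
  subst eX eY eZ; rw [eq_of_heq ef, eq_of_heq eg]

theorem eqToHom_heq {C : Type u₁} [Category.{v₁} C] {X Y X' Y' : C} (e : X = Y) (e' : X' = Y')
    (h : X = X') : HEq (eqToHom e) (eqToHom e') := by
  subst e e' h; rfl

theorem conj_heq {C : Type u₁} [Category.{v₁} C] {X X' Y Y' : C} (f : X ⟶ Y) (e : X' = X)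
    (e' : Y = Y') : HEq (eqToHom e ≫ f ≫ eqToHom e') f := by
  subst e e'; simp

theorem eq_conj_of_heq {C : Type u₁} [Category.{v₁} C] {X X' Y Y' : C} {f : X ⟶ Y} {f' : X' ⟶ Y'}
    (e : X = X') (e' : Y' = Y) (h : HEq f f') : f = eqToHom e ≫ f' ≫ eqToHom e' := by
  subst e e'; simpa using h

theorem map₂_heq (R : StrictPseudofunctor K L) {A B : K} {f f' g g' : A ⟶ B} {η : f ⟶ g}
    {η' : f' ⟶ g'} (ef : f = f') (eg : g = g') (e : HEq η η') : HEq (R.map₂ η) (R.map₂ η') := by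
  subst ef eg; rw [eq_of_heq e]

theorem TwoNatTrans.naturality₂_heq {F G : StrictPseudofunctor K L} (ev : TwoNatTrans F G) {X Y : K}
    {f g : X ⟶ Y} (η : f ⟶ g) : HEq (F.map₂ η ▷ ev.app Y) (ev.app X ◁ G.map₂ η) := by
  rw [ev.naturality₂]
  exact conj_heq _ _ _

variable [Strict K] [Strict L]

theorem whiskerRight_whiskerRight_heq {A B C D : K} {f g : A ⟶ B} (η : f ⟶ g) (h : B ⟶ C)
    (k : C ⟶ D) : HEq (η ▷ h ▷ k) (η ▷ (h ≫ k)) := by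
  rw [whiskerRight_whiskerRight, Strict.associator_eqToIso, Strict.associator_eqToIso]
  simp only [eqToIso.hom, eqToIso.inv]
  exact conj_heq _ _ _

theorem whiskerLeft_whiskerLeft_heq {A B C D : K} (f : A ⟶ B) (g : B ⟶ C) {h k : C ⟶ D}
    (η : h ⟶ k) : HEq (f ◁ g ◁ η) ((f ≫ g) ◁ η) := by
  rw [whiskerLeft_whiskerLeft, Strict.associator_eqToIso, Strict.associator_eqToIso]
  simp only [eqToIso.hom, eqToIso.inv]
  exact conj_heq _ _ _

theorem whisker_assoc_heq {A B C D : K} (f : A ⟶ B) {g h : B ⟶ C} (η : g ⟶ h) (k : C ⟶ D) :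
    HEq ((f ◁ η) ▷ k) (f ◁ η ▷ k) := by
  rw [whisker_assoc, Strict.associator_eqToIso, Strict.associator_eqToIso]
  simp only [eqToIso.hom, eqToIso.inv]
  exact conj_heq _ _ _

theorem whiskerRight_id_heq {A B : K} {f g : A ⟶ B} (η : f ⟶ g) : HEq (η ▷ 𝟙 B) η := by
  rw [whiskerRight_id, Strict.rightUnitor_eqToIso, Strict.rightUnitor_eqToIso]
  simp only [eqToIso.hom, eqToIso.inv]
  exact conj_heq _ _ _

theorem id_whiskerLeft_heq {A B : K} {f g : A ⟶ B} (η : f ⟶ g) : HEq (𝟙 A ◁ η) η := by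
  rw [id_whiskerLeft, Strict.leftUnitor_eqToIso, Strict.leftUnitor_eqToIso]
  simp only [eqToIso.hom, eqToIso.inv]
  exact conj_heq _ _ _

theorem map₂_whiskerLeft_heq (R : StrictPseudofunctor K L) {A B C : K} (f : A ⟶ B) {g h : B ⟶ C}
    (η : g ⟶ h) : HEq (R.map₂ (f ◁ η)) (R.map f ◁ R.map₂ η) := by
  rw [map₂_whiskerLeft]
  exact conj_heq _ _ _

theorem map₂_whiskerRight_heq (R : StrictPseudofunctor K L) {A B C : K} {f g : A ⟶ B} (η : f ⟶ g)
    (h : B ⟶ C) : HEq (R.map₂ (η ▷ h)) (R.map₂ η ▷ R.map h) := by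
  rw [map₂_whiskerRight]
  exact conj_heq _ _ _

end HEq

/-! ### Universal arrows for 2-functors -/

section Universal

variable {K : Type u₁} [Bicategory.{w₁, v₁} K] {L : Type u₂} [Bicategory.{w₂, v₂} L]

/-- A universal arrow from a 2-functor `F` to an object `Y`: composition with `ev` is an isomorphism
of categories between `K(X, G)` and `L(FX, Y)`. -/
structure IsUniversal (F : StrictPseudofunctor K L) {Y : L} {G : K} (ev : F.obj G ⟶ Y) : Prop where
  lift : ∀ {X : K} (f : F.obj X ⟶ Y), ∃ g : X ⟶ G, F.map g ≫ ev = f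
  uniq : ∀ {X : K} (g g' : X ⟶ G), F.map g ≫ ev = F.map g' ≫ ev → g = g'
  lift₂ : ∀ {X : K} {g g' : X ⟶ G} (α : F.map g ≫ ev ⟶ F.map g' ≫ ev),
    ∃ β : g ⟶ g', F.map₂ β ▷ ev = α
  uniq₂ : ∀ {X : K} {g g' : X ⟶ G} (β β' : g ⟶ g'), F.map₂ β ▷ ev = F.map₂ β' ▷ ev → β = β'

namespace IsUniversal

variable {F : StrictPseudofunctor K L} {Y : L} {G : K} {ev : F.obj G ⟶ Y}

theorem uniq₂_heq (hev : IsUniversal F ev) {X : K} {g g' k k' : X ⟶ G} (β : g ⟶ g') (β' : k ⟶ k')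
    (e : g = k) (e' : g' = k') (h : HEq (F.map₂ β ▷ ev) (F.map₂ β' ▷ ev)) : HEq β β' := by
  subst e e'
  exact heq_of_eq (hev.uniq₂ _ _ (eq_of_heq h))

theorem lift₂_heq (hev : IsUniversal F ev) {X : K} {g g' : X ⟶ G} {f f' : F.obj X ⟶ Y} (α : f ⟶ f')
    (e : F.map g ≫ ev = f) (e' : F.map g' ≫ ev = f') :
    ∃ β : g ⟶ g', HEq (F.map₂ β ▷ ev) α := by
  subst e e'
  obtain ⟨β, h⟩ := hev.lift₂ α
  exact ⟨β, heq_of_eq h⟩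

end IsUniversal

variable [Strict K] [Strict L]

/-- A counit `FG ⟶ 1` of 2-functors, with its components typed without reference to `G.comp F`. -/
structure Counit (F : StrictPseudofunctor K L) (G : StrictPseudofunctor L K) where
  app : ∀ Y : L, F.obj (G.obj Y) ⟶ Y
  naturality : ∀ {X Y : L} (f : X ⟶ Y), F.map (G.map f) ≫ app Y = app X ≫ f
  naturality₂ : ∀ {X Y : L} {f g : X ⟶ Y} (η : f ⟶ g),
    HEq (F.map₂ (G.map₂ η) ▷ app Y) (app X ◁ η)

/-- The counit underlying a 2-natural transformation. -/
def TwoNatTrans.toCounit {F : StrictPseudofunctor K L} {G : StrictPseudofunctor L K}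
    (ev : TwoNatTrans (G.comp F) (StrictPseudofunctor.id L)) : Counit F G :=
  ⟨ev.app, ev.naturality, ev.naturality₂_heq⟩

/-- The 2-natural transformation given by a counit. -/
def Counit.toTwoNatTrans {F : StrictPseudofunctor K L} {G : StrictPseudofunctor L K}
    (ev : Counit F G) : TwoNatTrans (G.comp F) (StrictPseudofunctor.id L) :=
  ⟨ev.app, ev.naturality, fun η => eq_conj_of_heq _ _ (ev.naturality₂ η)⟩

theorem Counit.isUniversal {F : StrictPseudofunctor K L} {G : StrictPseudofunctor L K}
    (ev : Counit F G) (u : ∀ X : K, X ⟶ G.obj (F.obj X))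
    (nu : ∀ {X Y : K} (f : X ⟶ Y), f ≫ u Y = u X ≫ G.map (F.map f))
    (nu₂ : ∀ {X Y : K} {f g : X ⟶ Y} (η : f ⟶ g),
      HEq (η ▷ u Y) (u X ◁ G.map₂ (F.map₂ η)))
    (left : ∀ X : K, F.map (u X) ≫ ev.app (F.obj X) = 𝟙 (F.obj X))
    (right : ∀ Y : L, u (G.obj Y) ≫ G.map (ev.app Y) = 𝟙 (G.obj Y)) (Y : L) :
    IsUniversal F (ev.app Y) := by
  have key : ∀ {X : K} (g : X ⟶ G.obj Y),
      u X ≫ G.map (F.map g ≫ ev.app Y) = g := fun {X} g => by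
    rw [G.map_comp, ← Strict.assoc, ← nu, Strict.assoc, right, Strict.comp_id]
  have key' : ∀ {X : K} (f : F.obj X ⟶ Y),
      F.map (u X ≫ G.map f) ≫ ev.app Y = f := fun {X} f => by
    rw [F.map_comp, Strict.assoc, ev.naturality, ← Strict.assoc, left, Strict.id_comp]
  have key₂ : ∀ {X : K} {g g' : X ⟶ G.obj Y} (β : g ⟶ g'),
      HEq (u X ◁ G.map₂ (F.map₂ β ▷ ev.app Y)) β := fun {X g g'} β => by
    refine (whiskerLeft_heq rfl (G.map_comp _ _) (G.map_comp _ _)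
      (map₂_whiskerRight_heq G (F.map₂ β) (ev.app Y))).trans ?_
    refine (whisker_assoc_heq _ _ _).symm.trans ?_
    refine (whiskerRight_heq (nu g).symm (nu g').symm
      (nu₂ β).symm rfl).trans ?_
    refine (whiskerRight_whiskerRight_heq _ _ _).trans ?_
    refine (whiskerRight_heq rfl rfl HEq.rfl (right Y)).trans ?_
    exact whiskerRight_id_heq _
  have key₂' : ∀ {X : K} {f f' : F.obj X ⟶ Y} (α : f ⟶ f'),
      HEq (F.map₂ (u X ◁ G.map₂ α) ▷ ev.app Y) α := fun {X f f'} α => by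
    refine (whiskerRight_heq (F.map_comp _ _) (F.map_comp _ _)
      (map₂_whiskerLeft_heq F (u X) (G.map₂ α)) rfl).trans ?_
    refine (whisker_assoc_heq _ _ _).trans ?_
    refine (whiskerLeft_heq rfl (ev.naturality f) (ev.naturality f')
      (ev.naturality₂ α)).trans ?_
    refine (whiskerLeft_whiskerLeft_heq _ _ _).trans ?_
    refine (whiskerLeft_heq (left X) rfl rfl HEq.rfl).trans ?_
    exact id_whiskerLeft_heq _
  refine ⟨fun {X} f => ⟨_, key' f⟩, fun {X} g g' e => ?_, fun {X g g'} α => ?_,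
    fun {X g g'} β β' e => ?_⟩
  · rw [← key g, ← key g', e]
  · refine ⟨eqToHom (key g).symm ≫ (u X ◁ G.map₂ α) ≫ eqToHom (key g'), ?_⟩
    refine eq_of_heq ((whiskerRight_heq ?_ ?_ (map₂_heq F (key g).symm (key g').symm
      (conj_heq _ _ _)) rfl).trans (key₂' α))
    · rw [key]
    · rw [key]
  · exact eq_of_heq ((key₂ β).symm.trans ((heq_of_eq (by rw [e])).trans (key₂ β')))

theorem TwoAdjunction.isUniversal {F : StrictPseudofunctor K L} {G : StrictPseudofunctor L K}
    (h : TwoAdjunction F G) (Y : L) : IsUniversal F (h.counit.toCounit.app Y) :=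
  h.counit.toCounit.isUniversal h.unit.app h.unit.naturality h.unit.naturality₂_heq h.left_triangle
    h.right_triangle Y

/-- The comparison between two 2-functors equipped with universal arrows. -/
theorem exists_comparison {F : StrictPseudofunctor K L} {G G' : StrictPseudofunctor L K}
    (ev : Counit F G)
    (ev' : Counit F G')
    (hev' : ∀ Y, IsUniversal (G := G'.obj Y) F (ev'.app Y)) :
    ∃ i : TwoNatTrans G G', ∀ Y, F.map (i.app Y) ≫ ev'.app Y = ev.app Y := by
  choose i hi using fun Y => (hev' Y).lift (X := G.obj Y) (ev.app Y)
  have n : ∀ {X Y : L} (f : X ⟶ Y), F.map (G.map f) ≫ ev.app Y = ev.app X ≫ f :=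
    fun f => ev.naturality f
  have n' : ∀ {X Y : L} (f : X ⟶ Y), F.map (G'.map f) ≫ ev'.app Y = ev'.app X ≫ f :=
    fun f => ev'.naturality f
  have e₁ : ∀ {X Y : L} (f : X ⟶ Y), F.map (G.map f ≫ i Y) ≫ ev'.app Y = ev.app X ≫ f := fun f => by
    rw [F.map_comp, Strict.assoc, hi, n]
  have e₂ : ∀ {X Y : L} (f : X ⟶ Y), F.map (i X ≫ G'.map f) ≫ ev'.app Y = ev.app X ≫ f := fun f =>
      by
    rw [F.map_comp, Strict.assoc, n', ← Strict.assoc, hi]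
  have nat : ∀ {X Y : L} (f : X ⟶ Y), G.map f ≫ i Y = i X ≫ G'.map f := fun {X Y} f =>
    (hev' Y).uniq _ _ ((e₁ f).trans (e₂ f).symm)
  refine ⟨⟨i, nat, fun {X Y f g} η => eq_conj_of_heq _ _ ?_⟩, hi⟩
  refine (hev' Y).uniq₂_heq _ _ (nat f) (nat g) ?_
  refine HEq.trans ?_ (HEq.symm ?_) (b := ev.app X ◁ η)
  · refine (whiskerRight_heq (F.map_comp _ _) (F.map_comp _ _)
      (map₂_whiskerRight_heq F (G.map₂ η) (i Y)) rfl).trans ?_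
    refine (whiskerRight_whiskerRight_heq _ _ _).trans ?_
    refine (whiskerRight_heq rfl rfl HEq.rfl (hi Y)).trans ?_
    exact ev.naturality₂ η
  · refine (whiskerRight_heq (F.map_comp _ _) (F.map_comp _ _)
      (map₂_whiskerLeft_heq F (i X) (G'.map₂ η)) rfl).trans ?_
    refine (whisker_assoc_heq _ _ _).trans ?_
    refine (whiskerLeft_heq rfl (n' f) (n' g) (ev'.naturality₂ η)).trans ?_
    refine (whiskerLeft_whiskerLeft_heq _ _ _).trans ?_
    exact whiskerLeft_heq (hi X) rfl rfl HEq.rfl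

/-- Two 2-functors equipped with universal arrows with respect to the same 2-functor are
isomorphic. -/
theorem nonempty_twoNatIso {F : StrictPseudofunctor K L} {G G' : StrictPseudofunctor L K}
    (ev : Counit F G)
    (ev' : Counit F G')
    (hev : ∀ Y, IsUniversal (G := G.obj Y) F (ev.app Y))
    (hev' : ∀ Y, IsUniversal (G := G'.obj Y) F (ev'.app Y)) : Nonempty (TwoNatIso G G') := by
  obtain ⟨i, hi⟩ := exists_comparison ev ev' hev'
  obtain ⟨j, hj⟩ := exists_comparison ev' ev hev
  refine ⟨⟨i, j, fun Y => (hev Y).uniq _ _ ?_, fun Y => (hev' Y).uniq _ _ ?_⟩⟩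
  · rw [F.map_comp, Strict.assoc, hj, hi, F.map_id, Strict.id_comp]
  · rw [F.map_comp, Strict.assoc, hi, hj, F.map_id, Strict.id_comp]

/-- A 2-functor equipped with 2-natural universal arrows is a right 2-adjoint. -/
theorem nonempty_twoAdjunction {F : StrictPseudofunctor K L} {G : StrictPseudofunctor L K}
    (ev : Counit F G)
    (hev : ∀ Y, IsUniversal (G := G.obj Y) F (ev.app Y)) : Nonempty (TwoAdjunction F G) := by
  choose η hη using fun X => (hev (F.obj X)).lift (X := X) (𝟙 (F.obj X))
  have n : ∀ {X Y : L} (f : X ⟶ Y), F.map (G.map f) ≫ ev.app Y = ev.app X ≫ f :=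
    fun f => ev.naturality f
  have e₁ : ∀ {X Y : K} (f : X ⟶ Y), F.map (f ≫ η Y) ≫ ev.app (F.obj Y) = F.map f := fun f => by
    rw [F.map_comp, Strict.assoc, hη, Strict.comp_id]
  have e₂ : ∀ {X Y : K} (f : X ⟶ Y),
      F.map (η X ≫ G.map (F.map f)) ≫ ev.app (F.obj Y) = F.map f := fun f => by
    rw [F.map_comp, Strict.assoc, n, ← Strict.assoc, hη, Strict.id_comp]
  have nat : ∀ {X Y : K} (f : X ⟶ Y), f ≫ η Y = η X ≫ G.map (F.map f) := fun {X Y} f =>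
    (hev (F.obj Y)).uniq _ _ ((e₁ f).trans (e₂ f).symm)
  refine ⟨⟨⟨η, nat, fun {X Y f g} α => eq_conj_of_heq _ _ ?_⟩, ev.toTwoNatTrans, hη, fun Y => ?_⟩⟩
  · refine (hev (F.obj Y)).uniq₂_heq _ _ (nat f) (nat g) ?_
    refine HEq.trans ?_ (HEq.symm ?_) (b := F.map₂ α)
    · refine (whiskerRight_heq (F.map_comp _ _) (F.map_comp _ _)
        (map₂_whiskerRight_heq F α (η Y)) rfl).trans ?_
      refine (whiskerRight_whiskerRight_heq _ _ _).trans ?_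
      exact (whiskerRight_heq rfl rfl HEq.rfl (hη Y)).trans (whiskerRight_id_heq _)
    · refine (whiskerRight_heq (F.map_comp _ _) (F.map_comp _ _)
        (map₂_whiskerLeft_heq F (η X) (G.map₂ (F.map₂ α))) rfl).trans ?_
      refine (whisker_assoc_heq _ _ _).trans ?_
      refine (whiskerLeft_heq rfl (n _) (n _) (ev.naturality₂ (F.map₂ α))).trans ?_
      refine (whiskerLeft_whiskerLeft_heq _ _ _).trans ?_
      exact (whiskerLeft_heq (hη X) rfl rfl HEq.rfl).trans (id_whiskerLeft_heq _)
  · refine (hev Y).uniq _ _ ?_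
    change F.map (η (G.obj Y) ≫ G.map (ev.app Y)) ≫ ev.app Y = F.map (𝟙 (G.obj Y)) ≫ ev.app Y
    rw [F.map_comp, Strict.assoc, n, ← Strict.assoc]
    refine (congrArg (fun k => k ≫ ev.app Y) (hη (G.obj Y))).trans ?_
    rw [F.map_id]

/-- A 2-functor with a universal arrow to each object has a right 2-adjoint. -/
theorem exists_rightAdjoint (F : StrictPseudofunctor K L)
    (h : ∀ Y : L, ∃ (G : K) (ev : F.obj G ⟶ Y), IsUniversal F ev) :
    ∃ G : StrictPseudofunctor L K, Nonempty (TwoAdjunction F G) := by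
  choose G ev hev using h
  choose m hm using fun {X Y : L} (f : X ⟶ Y) => (hev Y).lift (ev X ≫ f)
  choose m₂ hm₂ using fun {X Y : L} {f g : X ⟶ Y} (η : f ⟶ g) =>
    (hev Y).lift₂_heq (ev X ◁ η) (hm f) (hm g)
  have hid : ∀ X : L, m (𝟙 X) = 𝟙 (G X) := fun X => (hev X).uniq _ _ (by
    rw [hm, F.map_id, Strict.comp_id, Strict.id_comp])
  have hcomp : ∀ {X Y Z : L} (f : X ⟶ Y) (g : Y ⟶ Z), m (f ≫ g) = m f ≫ m g := fun f g =>
    (hev _).uniq _ _ (by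
      rw [hm, F.map_comp, Strict.assoc, hm, ← Strict.assoc, ← Strict.assoc, hm])
  let R : StrictPseudofunctor L K := StrictPseudofunctor.mk''
    { obj := G
      map := m
      map₂ := m₂
      map₂_id := fun {X Y} f => (hev Y).uniq₂ _ _ (eq_of_heq ((hm₂ _).trans (by
        rw [F.map₂_id, whiskerLeft_id, id_whiskerRight, hm])))
      map₂_comp := fun {X Y f g h} η θ => (hev Y).uniq₂ _ _ (eq_of_heq ((hm₂ _).trans (by
        rw [F.map₂_comp, whiskerLeft_comp, comp_whiskerRight]
        exact comp_heq (hm f).symm (hm g).symm (hm h).symm (hm₂ η).symm (hm₂ θ).symm)))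
      map_id := hid
      map_comp := hcomp
      map₂_whisker_left := fun {X Y Z} f g g' η => eq_conj_of_heq _ _ (by
        refine (hev Z).uniq₂_heq _ _ (hcomp _ _) (hcomp _ _) ((hm₂ _).trans (HEq.symm ?_))
        refine (whiskerRight_heq (F.map_comp _ _) (F.map_comp _ _)
          (map₂_whiskerLeft_heq F (m f) (m₂ η)) rfl).trans ?_
        refine (whisker_assoc_heq _ _ _).trans ?_
        refine (whiskerLeft_heq rfl (hm _) (hm _) (hm₂ η)).trans ?_
        refine (whiskerLeft_whiskerLeft_heq _ _ _).trans ?_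
        refine (whiskerLeft_heq (hm f) rfl rfl HEq.rfl).trans ?_
        exact (whiskerLeft_whiskerLeft_heq _ _ _).symm)
      map₂_whisker_right := fun {X Y Z f f'} η g => eq_conj_of_heq _ _ (by
        refine (hev Z).uniq₂_heq _ _ (hcomp _ _) (hcomp _ _) ((hm₂ _).trans (HEq.symm ?_))
        refine (whiskerRight_heq (F.map_comp _ _) (F.map_comp _ _)
          (map₂_whiskerRight_heq F (m₂ η) (m g)) rfl).trans ?_
        refine (whiskerRight_whiskerRight_heq _ _ _).trans ?_
        refine (whiskerRight_heq rfl rfl HEq.rfl (hm g)).trans ?_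
        refine (whiskerRight_whiskerRight_heq _ _ _).symm.trans ?_
        refine (whiskerRight_heq (hm _) (hm _) (hm₂ η) rfl).trans ?_
        exact whisker_assoc_heq _ _ _) }
  refine ⟨R, nonempty_twoAdjunction ⟨ev, hm, hm₂⟩ hev⟩

end Universal

section Composite

variable {K : Type u₁} [Bicategory.{w₁, v₁} K] {L : Type u₂} [Bicategory.{w₂, v₂} L]
  {M : Type u₃} [Bicategory.{w₃, v₃} M] [Strict K] [Strict L] [Strict M]

theorem IsUniversal.comp {F' : StrictPseudofunctor K L} {F : StrictPseudofunctor L M} {Y : M}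
    {G : L} {ev : F.obj G ⟶ Y} (hev : IsUniversal F ev) {G' : K} {ev' : F'.obj G' ⟶ G}
    (hev' : IsUniversal F' ev') :
    IsUniversal (G := G') (F'.comp F) (F.map ev' ≫ ev) := by
  have e : ∀ {X : K} (g : X ⟶ G'),
      (F'.comp F).map g ≫ F.map ev' ≫ ev = F.map (F'.map g ≫ ev') ≫ ev := fun g => by
    rw [F.map_comp, Strict.assoc]; rfl
  have e₂ : ∀ {X : K} {g g' : X ⟶ G'} (β : g ⟶ g'),
      HEq ((F'.comp F).map₂ β ▷ (F.map ev' ≫ ev)) (F.map₂ (F'.map₂ β ▷ ev') ▷ ev) := fun β => by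
    refine (whiskerRight_whiskerRight_heq (F.map₂ (F'.map₂ β)) (F.map ev') ev).symm.trans ?_
    exact whiskerRight_heq (F.map_comp _ _).symm (F.map_comp _ _).symm
      (map₂_whiskerRight_heq F (F'.map₂ β) ev').symm rfl
  refine ⟨fun {X} f => ?_, fun {X} g g' h => ?_, fun {X g g'} α => ?_, fun {X g g'} β β' h => ?_⟩
  · obtain ⟨k, hk⟩ := hev.lift (X := F'.obj X) f
    obtain ⟨g, hg⟩ := hev'.lift k
    exact ⟨g, (e g).trans (by rw [hg, hk])⟩
  · exact hev'.uniq _ _ (hev.uniq _ _ ((e g).symm.trans (h.trans (e g'))))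
  · obtain ⟨γ, hγ⟩ := hev.lift₂_heq α (e g).symm (e g').symm
    obtain ⟨β, hβ⟩ := hev'.lift₂ γ
    exact ⟨β, eq_of_heq ((e₂ β).trans ((whiskerRight_heq rfl rfl (by rw [hβ]) rfl).trans hγ))⟩
  · exact hev'.uniq₂ _ _ (hev.uniq₂ _ _ (eq_of_heq ((e₂ β).symm.trans
      ((heq_of_eq h).trans (e₂ β')))))

end Composite

section Slices

variable {K : Type u₁} [Bicategory.{w₁, v₁} K] [Strict K] {L : Type u₂} [Bicategory.{w₂, v₂} L]
  [Strict L]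

/-- The projections from products `E × A` are universal arrows for the forgetful 2-functor from the
slice over `E`. -/
theorem prodOver_isUniversal {E : K} (P : ∀ A : K, TwoProduct E A) (A : K) :
    IsUniversal (G := (prodOver P).obj A) (Slice.forget E) (P A).snd where
  lift {X} f := ⟨⟨(P A).lift X.arr f, (P A).lift_fst _ _⟩, (P A).lift_snd _ _⟩
  uniq g g' h := Slice.Hom.ext ((P A).ext (g.w.trans g'.w.symm) h)
  lift₂ {X g g'} α :=
    ⟨⟨(P A).lift₂ (eqToHom (g.w.trans g'.w.symm)) α, (P A).lift₂_fst _ _⟩, (P A).lift₂_snd _ _⟩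
  uniq₂ β β' h := Slice.Hom₂.ext ((P A).ext₂ (β.w.trans β'.w.symm) h)

/-- The projections `E × A ⟶ A`, as a 2-natural transformation. -/
def prodOverSnd {E : K} (P : ∀ A : K, TwoProduct E A) :
    TwoNatTrans ((prodOver P).comp (Slice.forget E)) (StrictPseudofunctor.id K) where
  app A := (P A).snd
  naturality {A B} f := (P B).lift_snd _ _
  naturality₂ {A B f g} η := prodMap₂_snd P η

/-- For an isomorphism `t : X ⟶ Y`, universal arrows for a 2-functor on `K/Y` give universal arrows
for its composite with `Σ_t : K/X → K/Y`. -/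
theorem IsUniversal.sum {X Y : K} {t : X ⟶ Y} (ht : IsIsoCell t)
    {F : StrictPseudofunctor (Slice Y) L} {Z : L} {G : Slice X}
    {ev : F.obj ((Slice.sum t).obj G) ⟶ Z} (hev : IsUniversal F ev) :
    IsUniversal (G := G) ((Slice.sum t).comp F) ev := by
  obtain ⟨s, hs, -⟩ := ht
  have cancel : ∀ {A : K} (a b : A ⟶ X), a ≫ t = b ≫ t → a = b := fun a b h => by
    rw [← Strict.comp_id a, ← Strict.comp_id b, ← hs, ← Strict.assoc, ← Strict.assoc, h]
  refine ⟨fun {C} f => ?_, fun g g' h => ?_, fun {C g g'} α => ?_, fun β β' h => ?_⟩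
  · obtain ⟨g, hg⟩ := hev.lift (X := (Slice.sum t).obj C) f
    refine ⟨⟨g.hom, cancel _ _ ((Strict.assoc _ _ _).trans g.w)⟩, hg⟩
  · have e := hev.uniq (X := (Slice.sum t).obj _) ((Slice.sum t).map g) ((Slice.sum t).map g') h
    have e' : ((Slice.sum t).map g).hom = ((Slice.sum t).map g').hom := by rw [e]
    exact Slice.Hom.ext e'
  · obtain ⟨β, hβ⟩ := hev.lift₂ α
    refine ⟨⟨β.hom, ?_⟩, hβ⟩
    have w := β.w
    have h1 : HEq (β.hom ▷ G.arr) (β.hom ▷ (G.arr ≫ t) ▷ s) := by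
      refine (whiskerRight_id_heq (β.hom ▷ G.arr)).symm.trans ?_
      refine (whiskerRight_heq rfl rfl HEq.rfl hs.symm).trans ?_
      refine (whiskerRight_whiskerRight_heq _ _ _).symm.trans ?_
      exact whiskerRight_heq (Strict.assoc _ _ _) (Strict.assoc _ _ _)
        (whiskerRight_whiskerRight_heq _ _ _) rfl
    refine eq_of_heq (h1.trans ((heq_of_eq (congrArg (fun γ => γ ▷ s) w)).trans ?_))
    rw [eqToHom_whiskerRight']
    refine eqToHom_heq _ _ ?_
    change (g.hom ≫ G.arr ≫ t) ≫ s = g.hom ≫ G.arr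
    rw [Strict.assoc, Strict.assoc, hs, Strict.comp_id]
  · have e := hev.uniq₂ (X := (Slice.sum t).obj _) ((Slice.sum t).map₂ β) ((Slice.sum t).map₂ β') h
    have e' : ((Slice.sum t).map₂ β).hom = ((Slice.sum t).map₂ β').hom := by rw [e]
    exact Slice.Hom₂.ext e'

/-- An equalizer of a parallel pair of 1-cells in a strict 2-category, with its universal property
for 1-cells and 2-cells. -/
structure IsTwoEqualizer {Z X Y : K} (z : Z ⟶ X) (f g : X ⟶ Y) : Prop where
  w : z ≫ f = z ≫ g
  lift : ∀ {W : K} (a : W ⟶ X), a ≫ f = a ≫ g → ∃ l : W ⟶ Z, l ≫ z = a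
  uniq : ∀ {W : K} (l l' : W ⟶ Z), l ≫ z = l' ≫ z → l = l'
  lift₂ : ∀ {W : K} {l l' : W ⟶ Z} (α : l ≫ z ⟶ l' ≫ z), HEq (α ▷ f) (α ▷ g) →
    ∃ γ : l ⟶ l', γ ▷ z = α
  uniq₂ : ∀ {W : K} {l l' : W ⟶ Z} (γ γ' : l ⟶ l'), γ ▷ z = γ' ▷ z → γ = γ'

/-- In a 2-category with equalizers, a 2-functor between slices has a right 2-adjoint if its
composite with the forgetful 2-functor has one. -/
theorem exists_universal_of_equalizers
    (heq : ∀ {X Y : K} (f g : X ⟶ Y), ∃ (Z : K) (z : Z ⟶ X), IsTwoEqualizer z f g)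
    {B E : K} (S : StrictPseudofunctor (Slice B) (Slice E)) (R : StrictPseudofunctor K (Slice B))
    (c : ∀ Y : K, (S.obj (R.obj Y)).dom ⟶ Y)
    (n : ∀ {X Y : K} (f : X ⟶ Y), (S.map (R.map f)).hom ≫ c Y = c X ≫ f)
    (hu : ∀ Y : K, IsUniversal (G := R.obj Y) (S.comp (Slice.forget E)) (c Y)) (p : Slice E) :
    ∃ (G : Slice B) (ev : S.obj G ⟶ p), IsUniversal S ev := by
  obtain ⟨k, hk⟩ := (hu E).lift (X := R.obj p.dom) (S.obj (R.obj p.dom)).arr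
  obtain ⟨Z, z, hz⟩ := heq (R.map p.arr).hom k.hom
  have hk' : (S.map k).hom ≫ c E = (S.obj (R.obj p.dom)).arr := hk
  let G : Slice B := ⟨Z, z ≫ (R.obj p.dom).arr⟩
  let ζ : G ⟶ R.obj p.dom := ⟨z, rfl⟩
  have map_comp_hom : ∀ {C D D' : Slice B} (a : C ⟶ D) (b : D ⟶ D'),
      (S.map (a ≫ b)).hom = (S.map a).hom ≫ (S.map b).hom := fun a b =>
    congrArg Slice.Hom.hom (S.map_comp a b)
  have hcomp : ∀ {C D : Slice B} (a : C ⟶ D) (b : D ⟶ R.obj p.dom),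
      (S.map (a ≫ b)).hom ≫ c p.dom =
        (S.map a).hom ≫ (S.map b).hom ≫ c p.dom := fun a b => by
    rw [map_comp_hom, Strict.assoc]
  have over₁ : ∀ {C : Slice B} (a : C ⟶ R.obj p.dom),
      (S.map (a ≫ R.map p.arr)).hom ≫ c E =
        ((S.map a).hom ≫ c p.dom) ≫ p.arr := fun a => by
    rw [map_comp_hom, Strict.assoc, n, Strict.assoc]
  have over₂ : ∀ {C : Slice B} (a : C ⟶ R.obj p.dom),
      (S.map (a ≫ k)).hom ≫ c E = (S.obj C).arr := fun a => by
    rw [map_comp_hom, Strict.assoc, hk', (S.map a).w]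
  have ζw : ζ ≫ R.map p.arr = ζ ≫ k := Slice.Hom.ext hz.w
  let ev : S.obj G ⟶ p := ⟨(S.map ζ).hom ≫ c p.dom, by
    rw [← over₁, ζw, over₂]⟩
  refine ⟨G, ev, fun {C} f => ?_, fun {C} g g' e => ?_, fun {C g g'} α => ?_,
    fun {C g g'} β β' e => ?_⟩
  · obtain ⟨a, ha⟩ := (hu p.dom).lift (X := C) f.hom
    have ha' : (S.map a).hom ≫ c p.dom = f.hom := ha
    have haw : a ≫ R.map p.arr = a ≫ k := (hu E).uniq _ _ (by
      refine (over₁ a).trans (Eq.trans ?_ (over₂ a).symm)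
      rw [ha', f.w])
    obtain ⟨l, hl⟩ := hz.lift a.hom (congrArg Slice.Hom.hom haw)
    let l' : C ⟶ G := ⟨l, by
      change l ≫ z ≫ _ = _
      rw [← Strict.assoc, hl, a.w]⟩
    refine ⟨l', Slice.Hom.ext ?_⟩
    have e : l' ≫ ζ = a := Slice.Hom.ext hl
    change (S.map l').hom ≫ (S.map ζ).hom ≫ c p.dom = f.hom
    rw [← hcomp, e, ha']
  · have e' : (S.map g).hom ≫ (S.map ζ).hom ≫ c p.dom =
      (S.map g').hom ≫ (S.map ζ).hom ≫ c p.dom := congrArg Slice.Hom.hom e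
    rw [← hcomp, ← hcomp] at e'
    have e'' := (hu p.dom).uniq _ _ e'
    exact Slice.Hom.ext (hz.uniq _ _ (congrArg Slice.Hom.hom e''))
  · have hζ : ∀ g : C ⟶ G, (S.map (g ≫ ζ)).hom ≫ c p.dom = (S.map g ≫ ev).hom :=
      fun g => hcomp g ζ
    obtain ⟨β, hβ⟩ := (hu p.dom).lift₂_heq (g := g ≫ ζ) (g' := g' ≫ ζ) α.hom (hζ g) (hζ g')
    have hβ' : HEq ((S.map₂ β).hom ▷ c p.dom) α.hom := hβ
    have gw : ∀ g : C ⟶ G, (g ≫ ζ) ≫ R.map p.arr = (g ≫ ζ) ≫ k := fun g => by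
      rw [Strict.assoc, ζw, Strict.assoc]
    have hom₂ : ∀ {D : Slice B} (b : R.obj p.dom ⟶ D),
        HEq (S.map₂ (β ▷ b)).hom ((S.map₂ β).hom ▷ (S.map b).hom) := fun b => by
      rw [map₂_whiskerRight S β b, Slice.hom₂_comp, Slice.hom₂_comp, Slice.hom₂_eqToHom,
        Slice.hom₂_eqToHom]
      exact conj_heq _ _ _
    have step : ∀ {D : Slice B} (b : R.obj p.dom ⟶ D) {D' : K} (q : (S.obj D).dom ⟶ D'),
        HEq ((S.map₂ (β ▷ b)).hom ▷ q) ((S.map₂ β).hom ▷ ((S.map b).hom ≫ q)) :=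
      fun {_} b {_} q => (whiskerRight_heq (map_comp_hom _ _) (map_comp_hom _ _) (hom₂ b) rfl).trans
        (whiskerRight_whiskerRight_heq _ _ _)
    have hw : HEq (β ▷ R.map p.arr) (β ▷ k) := by
      refine (hu E).uniq₂_heq _ _ (gw g) (gw g') ?_
      refine (step (R.map p.arr) (c E)).trans
        (HEq.trans ?_ (step k (c E)).symm)
      refine (whiskerRight_heq rfl rfl HEq.rfl (n p.arr)).trans ?_
      refine (whiskerRight_whiskerRight_heq _ _ _).symm.trans ?_
      refine (whiskerRight_heq (hζ g) (hζ g') hβ' rfl).trans ?_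
      refine HEq.trans ?_ (whiskerRight_heq rfl rfl HEq.rfl hk').symm
      rw [α.w, (S.map₂ β).w]
      refine eqToHom_heq _ _ ?_
      rw [(S.map g ≫ ev).w, (S.map (g ≫ ζ)).w]
    have hw' : HEq (β.hom ▷ (R.map p.arr).hom) (β.hom ▷ k.hom) := by
      have congr_hom : ∀ {D : Slice B} {a b a' b' : C ⟶ D} (θ : a ⟶ b) (θ' : a' ⟶ b')
          (_ : a = a') (_ : b = b') (_ : HEq θ θ'), HEq θ.hom θ'.hom := by
        intro D a b a' b' θ θ' e e' e''
        subst e e'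
        rw [eq_of_heq e'']
      exact congr_hom _ _ (gw g) (gw g') hw
    obtain ⟨γ, hγ⟩ := hz.lift₂ (l := g.hom) (l' := g'.hom) β.hom hw'
    have γw : γ ▷ G.arr = eqToHom (g.w.trans g'.w.symm) := by
      have e := β.w
      have e' : HEq (γ ▷ (z ≫ (R.obj p.dom).arr)) (β.hom ▷ (R.obj p.dom).arr) :=
        (whiskerRight_whiskerRight_heq _ _ _).symm.trans
          (whiskerRight_heq rfl rfl (heq_of_eq hγ) rfl)
      refine eq_of_heq (e'.trans ((heq_of_eq e).trans (eqToHom_heq _ _ ?_)))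
      exact Strict.assoc _ _ _
    let γ' : g ⟶ g' := ⟨γ, γw⟩
    refine ⟨γ', Slice.Hom₂.ext (eq_of_heq (HEq.trans ?_ hβ'))⟩
    have e : γ' ▷ ζ = β := Slice.Hom₂.ext hγ
    subst e
    have hom₂' : HEq (S.map₂ (γ' ▷ ζ)).hom ((S.map₂ γ').hom ▷ (S.map ζ).hom) := by
      rw [map₂_whiskerRight S γ' ζ, Slice.hom₂_comp, Slice.hom₂_comp, Slice.hom₂_eqToHom,
        Slice.hom₂_eqToHom]
      exact conj_heq _ _ _
    refine (whiskerRight_whiskerRight_heq (S.map₂ γ').hom (S.map ζ).hom _).symm.trans ?_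
    exact whiskerRight_heq (map_comp_hom _ _).symm (map_comp_hom _ _).symm hom₂'.symm rfl
  · have hom₂' : ∀ γ : g ⟶ g', HEq ((S.map₂ (γ ▷ ζ)).hom ▷ c p.dom)
        (S.map₂ γ ▷ ev).hom := fun γ => by
      refine HEq.trans ?_ (whiskerRight_whiskerRight_heq (S.map₂ γ).hom (S.map ζ).hom _)
      refine whiskerRight_heq (map_comp_hom _ _) (map_comp_hom _ _) ?_ rfl
      rw [map₂_whiskerRight S γ ζ, Slice.hom₂_comp, Slice.hom₂_comp, Slice.hom₂_eqToHom,
        Slice.hom₂_eqToHom]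
      exact conj_heq _ _ _
    have e' : β ▷ ζ = β' ▷ ζ := (hu p.dom).uniq₂ _ _ (eq_of_heq ((hom₂' β).trans
      ((heq_of_eq (congrArg Slice.Hom₂.hom e)).trans (hom₂' β').symm)))
    exact Slice.Hom₂.ext (hz.uniq₂ _ _ (congrArg Slice.Hom₂.hom e'))

end Slices

end TwoCat

namespace Spans

theorem fn_heq {I I' J J' : SpanObj.{u, v}} {Ss Ss' : HPath SpanHor.{u, v} I I'} {f g : I ⟶ J}
    {f' g' : I' ⟶ J'} {T : SpanHor J J'} (hS : Ss = Ss') (h : f = g) (h' : f' = g')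
    {θ : SpanCell Ss f f' T} {θ' : SpanCell Ss' g g' T} (hθ : HEq θ θ') {i : I.carrier}
    {j : I'.carrier} {c : SpanChain Ss i j} {c' : SpanChain Ss' i j} (hc : HEq c c') :
    (θ.fn c).1 = (θ'.fn c').1 := by
  subst hS h h'
  rw [eq_of_heq hθ, eq_of_heq hc]

end Spans

namespace Chain

variable {O : Type w} {H : O → O → Type w} {car : O → Type u}
  {fib : ∀ A B : O, H A B → car A → car B → Type u}

theorem cons_heq {A B C : O} {Γ : H A B} {Γs Γs' : HPath H B C} {i : car A} {k : car B} {j : car C}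
    (s : fib _ _ Γ i k) (e : Γs = Γs') {c : Chain car fib Γs k j} {c' : Chain car fib Γs' k j}
    (h : HEq c c') : HEq (Chain.cons s c) (Chain.cons s c') := by
  subst e
  rw [eq_of_heq h]

end Chain

namespace VDTrans

variable {X Y : VDC.{v}} {F F' G G' : VDFunctor X Y}

theorem app_heq_of_eq_conj {α : F ⟶ G} {β : F' ⟶ G'} {e : F = F'} {e' : G' = G}
    (h : α = eqToHom e ≫ β ≫ eqToHom e') (A : X.Obj) : HEq (α.vert.app A) (β.vert.app A) := by
  subst e e'
  simp only [eqToHom_refl, Category.id_comp, Category.comp_id] at h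
  rw [h]

theorem cell_heq_of_eq_conj {α : F ⟶ G} {β : F' ⟶ G'} {e : F = F'} {e' : G' = G}
    (h : α = eqToHom e ≫ β ≫ eqToHom e') {A B : X.Obj} (Γ : X.Hor A B) :
    HEq (α.cell Γ) (β.cell Γ) := by
  subst e e'
  simp only [eqToHom_refl, Category.id_comp, Category.comp_id] at h
  rw [h]

theorem ext_heq {α β : F ⟶ G} (hv : ∀ A, α.vert.app A = β.vert.app A)
    (hc : ∀ {A B : X.Obj} (Γ : X.Hor A B), HEq (α.cell Γ) (β.cell Γ)) : α = β :=
  ext' hv fun Γ => eq_of_heq ((hc Γ).trans (VDGraphHom.heq_cast _ _ _ _).symm)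

end VDTrans

theorem VDFunctor.path_comp {X Y Z : VDC.{v}} (F : VDFunctor X Y) (G : VDFunctor Y Z) {A B : X.Obj}
    (Γs : HPath X.Hor A B) : (F.comp G).path Γs = G.path (F.path Γs) :=
  (HPath.map_map (H' := Y.Hor) (H'' := Z.Hor) _ _ _ _ Γs).symm

/-! ### The forgetful functor from pointed spans to spans -/

/-- The lift of a function along the forgetful functor from pointed spans to spans. -/
abbrev ptLift (I : PtObj.{u, v}) (J : SpanObj.{u, v}) (f : SpanMap I.set J) :
    SpanPt.{u, v}.VertFrom I :=
  ⟨(⟨J, f.fn I.pt⟩ : PtObj.{u, v}), (⟨f, rfl⟩ : PtMap I ⟨J, f.fn I.pt⟩)⟩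

theorem exists_eq_ptLift {I : PtObj.{u, v}} (x : SpanPt.{u, v}.VertFrom I) :
    ∃ (J : SpanObj.{u, v}) (f : SpanMap I.set J), x = ptLift I J f := by
  obtain ⟨⟨J, j⟩, ⟨f, hf⟩⟩ := x
  change PtObj.set I ⟶ J at f
  change SpanMap.fn f (PtObj.pt I) = j at hf
  subst hf
  exact ⟨J, f, rfl⟩

theorem Q_isDiscreteOpfibration : Q.{u, v}.IsDiscreteOpfibration where
  vert I g := by
    refine ⟨ptLift I g.cod g.hom, rfl, fun x hx => ?_⟩
    obtain ⟨J, f, rfl⟩ := exists_eq_ptLift x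
    subst hx
    rfl
  cell {I I'} Ss ν := by
    obtain ⟨⟨J, f⟩, ⟨J', f'⟩, T, θ⟩ := ν
    refine ⟨⟨ptLift I J f, ptLift I' J' f', (⟨T, SpanCell.fn θ (ptChain Ss)⟩ :
        PtHor.{u, v} (ptLift I J f).cod (ptLift I' J' f').cod),
      (⟨θ, rfl⟩ : PtCell Ss (ptLift I J f).hom (ptLift I' J' f').hom
        ⟨T, SpanCell.fn θ (ptChain Ss)⟩)⟩, rfl, ?_⟩
    rintro ⟨l, r, ⟨U, s⟩, ⟨κ, hκ⟩⟩ e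
    obtain ⟨K, g, rfl⟩ := exists_eq_ptLift l
    obtain ⟨K', g', rfl⟩ := exists_eq_ptLift r
    cases e
    change SpanCell _ (ptLift I K g).hom.map (ptLift I' K' g').hom.map U at κ
    obtain rfl : s = SpanCell.fn κ (ptChain Ss) := Subtype.ext hκ.symm
    rfl

/-! ### Elements as a pullback -/

namespace EltsVDC

variable {A W : VDC.{max (u + 1) v}} {F : VDFunctor A Span.{u, v}}

section Section

variable (b : VDFunctor W SpanPt.{u, v})

/-- The path of elements given by the chosen elements of pointed spans. -/
abbrev sectionPath {x y : W.Obj} (Γs : HPath W.Hor x y) :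
    HPath (EltsHor (F := b.comp Q.{u, v})) ⟨x, PtObj.pt (b.vert.obj x)⟩
      ⟨y, PtObj.pt (b.vert.obj y)⟩ :=
  Γs.map (fun x => (⟨x, PtObj.pt (b.vert.obj x)⟩ : EltsObj (b.comp Q.{u, v})))
    (fun _ _ Γ => ⟨Γ, PtHor.pt (b.hor Γ)⟩)

theorem sectionPath_forget : ∀ {x y : W.Obj} (Γs : HPath W.Hor x y),
    (sectionPath b Γs).map EltsObj.obj (fun _ _ Γ => EltsHor.hor Γ) = Γs
  | _, _, .nil _ => rfl
  | _, _, .cons Γ Γs => congrArg (HPath.cons Γ) (sectionPath_forget Γs)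

theorem sectionChain_heq : ∀ {x y : W.Obj} (Γs : HPath W.Hor x y),
    HEq (eltsChain (sectionPath b Γs)) (ptChain (b.path Γs))
  | _, _, .nil _ => HEq.rfl
  | _, _, .cons Γ Γs => Chain.cons_heq _ (by
      refine (congrArg (b.comp Q.{u, v}).path (sectionPath_forget b Γs)).trans ?_
      exact VDFunctor.path_comp b Q.{u, v} Γs) (sectionChain_heq Γs)

/-- The underlying data of the section of the projection given by the chosen elements. -/
def sectionHom : VDGraphHom W.toVDGraph (eltsGraph (b.comp Q.{u, v})) where
  vert :=
    { obj := fun x => ⟨x, PtObj.pt (b.vert.obj x)⟩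
      map := fun f => ⟨f, PtMap.map_pt (b.vert.map f)⟩
      map_id := fun _ => rfl
      map_comp := fun _ _ => rfl }
  hor Γ := ⟨Γ, PtHor.pt (b.hor Γ)⟩
  cell {_ _ _ _ Γs _ _ _} θ := ⟨W.cast (sectionPath_forget b Γs).symm rfl rfl θ, by
    refine Eq.trans ?_ (PtCell.cell_pt (b.cell θ))
    refine Spans.fn_heq ?_ rfl rfl ?_ (sectionChain_heq b Γs)
    · refine (congrArg (b.comp Q.{u, v}).path (sectionPath_forget b Γs)).trans ?_
      exact VDFunctor.path_comp b Q.{u, v} Γs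
    · refine HEq.trans ?_ (VDFunctor.comp_cell_heq b Q.{u, v} θ)
      exact VDFunctor.cell_heq (sectionPath_forget b Γs) rfl rfl (VDFunctor.heq_cast _ _ _ _)⟩

theorem sectionHom_forget :
    (sectionHom b).comp (eltsForget (b.comp Q.{u, v})) = (VDFunctor.id W).toVDGraphHom := by
  refine VDGraphHom.ext_cell rfl (fun _ => HEq.rfl) fun {_ _ _ _ Γs _ _ _} θ => ?_
  refine (VDGraphHom.comp_cell_heq _ _ θ).trans ?_
  refine HEq.trans ?_ (VDFunctor.id_cell_heq θ).symm
  exact VDFunctor.heq_cast (X := W) _ rfl rfl θ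

/-- The section of the projection given by the chosen elements. -/
def sec : VDFunctor W (EltsVDC (b.comp Q.{u, v})) :=
  VDFunctor.ofFaithful (ι := Unit) (sectionHom b) (fun _ => proj _)
    (fun θ κ h => eltsForget_inj θ κ (h ()))
    (fun _ => (sectionHom_forget b).symm ▸ (VDFunctor.id W).preserves)

theorem sec_proj : (sec b).comp (proj _) = VDFunctor.id W :=
  VDProd.toHom_injective (sectionHom_forget b)

theorem sec_toPt : (sec b).comp (toPt _) = b := by
  refine VDFunctor.ext_faithful (ι := Unit) (fun _ => Q.{u, v})
    (fun θ κ h => Q_inj θ κ (h ())) rfl (fun _ => HEq.rfl) fun _ => ?_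
  refine (VDFunctor.assoc _ _ _).trans ((congrArg ((sec b).comp) (EltsVDC.w _)).trans ?_)
  refine (VDFunctor.assoc _ _ _).symm.trans ((congrArg (fun K => VDFunctor.comp K _)
    (sec_proj b)).trans ?_)
  exact VDFunctor.id_comp _

end Section

/-- The functor to the virtual double category of elements induced by a commuting square. -/
def pair (a : VDFunctor W A) (b : VDFunctor W SpanPt.{u, v}) (h : a.comp F = b.comp Q.{u, v}) :
    VDFunctor W (EltsVDC F) :=
  (sec b).comp (map a h)

theorem pair_proj (a : VDFunctor W A) (b : VDFunctor W SpanPt.{u, v})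
    (h : a.comp F = b.comp Q.{u, v}) : (pair a b h).comp (proj F) = a := by
  refine (VDFunctor.assoc _ _ _).trans ((congrArg ((sec b).comp) (map_proj a h)).trans ?_)
  refine (VDFunctor.assoc _ _ _).symm.trans ((congrArg (fun K => VDFunctor.comp K a)
    (sec_proj b)).trans (VDFunctor.id_comp a))

theorem pair_toPt (a : VDFunctor W A) (b : VDFunctor W SpanPt.{u, v})
    (h : a.comp F = b.comp Q.{u, v}) : (pair a b h).comp (toPt F) = b :=
  (VDFunctor.assoc _ _ _).trans ((congrArg ((sec b).comp) (map_toPt a h)).trans (sec_toPt b))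

theorem pair_eta (l : VDFunctor W (EltsVDC F))
    (h : (l.comp (proj F)).comp F = (l.comp (toPt F)).comp Q.{u, v}) :
    pair (l.comp (proj F)) (l.comp (toPt F)) h = l :=
  VDFunctor.ext_faithful (ι := Unit) (fun _ => proj F)
    (fun θ κ h => eltsForget_inj θ κ (h ())) rfl (fun _ => HEq.rfl) fun _ => pair_proj _ _ h

theorem hom_ext {l l' : VDFunctor W (EltsVDC F)} (h : l.comp (proj F) = l'.comp (proj F))
    (h' : l.comp (toPt F) = l'.comp (toPt F)) : l = l' := by
  have e : ∀ l : VDFunctor W (EltsVDC F),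
      (l.comp (proj F)).comp F = (l.comp (toPt F)).comp Q.{u, v} := fun l =>
    (VDFunctor.assoc _ _ _).trans ((congrArg l.comp (EltsVDC.w F).symm).trans
      (VDFunctor.assoc _ _ _).symm)
  rw [← pair_eta l (e l), ← pair_eta l' (e l')]
  congr 1

/-- 2-cells into the virtual double category of elements. -/
theorem exists_pair₂ {l l' : VDFunctor W (EltsVDC F)}
    (α : l.comp (proj F) ⟶ l'.comp (proj F)) (β : l.comp (toPt F) ⟶ l'.comp (toPt F))
    (hv : ∀ x, HEq (F.vert.map (α.vert.app x)) (Q.{u, v}.vert.map (β.vert.app x)))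
    (hc : ∀ {x y : W.Obj} (Γ : W.Hor x y), HEq (F.cell (α.cell Γ)) (Q.{u, v}.cell (β.cell Γ))) :
    ∃ γ : l ⟶ l', VDTrans.whiskerRight γ (proj F) = α ∧ VDTrans.whiskerRight γ (toPt F) = β := by
  have hv' : ∀ x, F.vert.map (α.vert.app x) = PtMap.map (β.vert.app x) := fun x =>
    eq_of_heq (hv x)
  let γd : VDTransData l l' :=
    { vert :=
        { app := fun x => ⟨α.vert.app x,
            (congrArg (fun f => SpanMap.fn f (EltsObj.elt (l.vert.obj x))) (hv' x)).trans
              (PtMap.map_pt (β.vert.app x))⟩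
          naturality := fun _ _ f => EltsMap.ext (α.vert.naturality f) }
      cell := fun {x y} Γ => ⟨α.cell Γ, by
        refine Eq.trans ?_ (PtCell.cell_pt (β.cell Γ))
        exact Spans.fn_heq rfl (hv' x) (hv' y) (hc Γ) HEq.rfl⟩ }
  let γ : VDTrans l l' := VDTrans.ofFaithful (ι := Unit) γd (fun _ => proj F)
    (fun θ κ h => eltsForget_inj θ κ (h ())) (fun _ => α) (fun _ _ => rfl) (fun _ _ _ _ => rfl)
  refine ⟨γ, VDTrans.ext' (fun _ => rfl) (fun _ => rfl), ?_⟩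
  have hv'' : ∀ x, (VDTrans.whiskerRight γ (toPt F)).vert.app x = β.vert.app x := fun x =>
    PtMap.ext (hv' x)
  refine VDTrans.ext' hv'' fun {x y} Γ => Q_inj _ _ ?_
  refine eq_of_heq ((hc Γ).trans ?_)
  rw [VDFunctor.cell_cast]
  exact (VDGraphHom.heq_cast (Y := Span.{u, v}) _ _ _ _).symm

theorem hom_ext₂ {l l' : VDFunctor W (EltsVDC F)} {γ δ : l ⟶ l'}
    (h : VDTrans.whiskerRight γ (proj F) = VDTrans.whiskerRight δ (proj F)) : γ = δ := by
  have hv : ∀ x, γ.vert.app x = δ.vert.app x := fun x => EltsMap.ext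
    (congrArg (fun (α : VDTrans (l.comp (proj F)) (l'.comp (proj F))) => α.vert.app x) h)
  refine VDTrans.ext' hv fun Γ => eltsForget_inj _ _ ?_
  refine eq_of_heq ((VDTrans.cell_congr h Γ).trans (HEq.symm ?_))
  refine (heq_of_eq ((proj F).cell_cast _ _ _ _)).trans ?_
  exact VDGraphHom.heq_cast (Y := A) _ _ _ _

end EltsVDC

open TwoCat Bicategory in
/-- The virtual double category of elements is the pullback of the forgetful functor from pointed
spans to spans. -/
theorem EltsVDC.isTwoPullback {A : VDC.{max (u + 1) v}} (F : VDFunctor A Span.{u, v}) :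
    IsTwoPullback (K := VDC.{max (u + 1) v}) (EltsVDC.proj F) (EltsVDC.toPt F) F Q.{u, v} where
  w := (EltsVDC.w F).symm
  existsUnique {W} a b h := ⟨EltsVDC.pair a b h, ⟨EltsVDC.pair_proj a b h, EltsVDC.pair_toPt a b h⟩,
    fun l hl => EltsVDC.hom_ext (hl.1.trans (EltsVDC.pair_proj a b h).symm)
      (hl.2.trans (EltsVDC.pair_toPt a b h).symm)⟩
  existsUnique₂ {W} l l' α β h := by
    obtain ⟨γ, h₁, h₂⟩ := EltsVDC.exists_pair₂ α β
      (fun x => VDTrans.app_heq_of_eq_conj h x) (fun Γ => VDTrans.cell_heq_of_eq_conj h Γ)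
    exact ⟨γ, ⟨h₁, h₂⟩, fun δ hδ => EltsVDC.hom_ext₂ (hδ.1.trans h₁.symm)⟩

theorem VDFunctor.cell_congr {X Y : VDC.{v}} {F G : VDFunctor X Y} (e : F = G) {A A' B B' : X.Obj}
    {Γs : HPath X.Hor A A'} {u : A ⟶ B} {u' : A' ⟶ B'} {Δ : X.Hor B B'} (θ : X.Cell Γs u u' Δ) :
    HEq (F.cell θ) (G.cell θ) := by
  subst e; rfl

theorem VDFunctor.hor_congr {X Y : VDC.{v}} {F G : VDFunctor X Y} (e : F = G) {A B : X.Obj}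
    (Γ : X.Hor A B) : HEq (F.hor Γ) (G.hor Γ) := by
  subst e; rfl

theorem VDFunctor.map_congr {X Y : VDC.{v}} {F G : VDFunctor X Y} (e : F = G) {A B : X.Obj}
    (f : A ⟶ B) : HEq (F.vert.map f) (G.vert.map f) := by
  subst e; rfl

theorem VDFunctor.obj_congr {X Y : VDC.{v}} {F G : VDFunctor X Y} (e : F = G) (A : X.Obj) :
    F.vert.obj A = G.vert.obj A := by
  subst e; rfl

theorem VDFunctor.cell_cast_heq {X Y : VDC.{v}} (F : VDFunctor X Y) {A A' B B' : X.Obj}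
    {Γs Γs' : HPath X.Hor A A'} {u w : A ⟶ B} {u' w' : A' ⟶ B'} {Δ : X.Hor B B'} (hΓ : Γs = Γs')
    (h : u = w) (h' : u' = w') (θ : X.Cell Γs u u' Δ) :
    HEq (F.cell (X.cast hΓ h h' θ)) (F.cell θ) := by
  subst hΓ h h'; rfl

namespace VDTrans

variable {X Y : VDC.{v}} {F F' G G' : VDFunctor X Y}

theorem app_heq {α : VDTrans F G} {β : VDTrans F' G'} (e : F = F') (e' : G = G') (h : HEq α β)
    (A : X.Obj) : HEq (α.vert.app A) (β.vert.app A) := by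
  subst e e'; rw [eq_of_heq h]

theorem cell_heq {α : VDTrans F G} {β : VDTrans F' G'} (e : F = F') (e' : G = G') (h : HEq α β)
    {A B : X.Obj} (Γ : X.Hor A B) : HEq (α.cell Γ) (β.cell Γ) := by
  subst e e'; rw [eq_of_heq h]

end VDTrans

/-! ### Equalizers of virtual double categories -/

namespace VDEq

variable {X Y : VDC.{v}}

/-- An object on which two functors agree. -/
structure Obj (F G : VDFunctor X Y) : Type v where
  obj : X.Obj
  eq : F.vert.obj obj = G.vert.obj obj

/-- A vertical morphism on which two functors agree. -/
@[ext]
structure Map {F G : VDFunctor X Y} (a b : Obj F G) : Type v where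
  map : a.obj ⟶ b.obj
  eq : HEq (F.vert.map map) (G.vert.map map)

/-- A horizontal morphism on which two functors agree. -/
structure Hor {F G : VDFunctor X Y} (a b : Obj F G) : Type v where
  hor : X.Hor a.obj b.obj
  eq : HEq (F.hor hor) (G.hor hor)

instance Obj.category (F G : VDFunctor X Y) : Category.{v} (Obj F G) where
  Hom a b := Map a b
  id a := ⟨𝟙 a.obj, by
    rw [F.vert.map_id, G.vert.map_id, a.eq]⟩
  comp {a b c} f g := ⟨f.map ≫ g.map, by
    rw [F.vert.map_comp, G.vert.map_comp]
    exact TwoCat.comp_heq a.eq b.eq c.eq f.eq g.eq⟩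
  id_comp f := Map.ext (Category.id_comp f.map)
  comp_id f := Map.ext (Category.comp_id f.map)
  assoc f g h := Map.ext (Category.assoc f.map g.map h.map)

/-- A multicell on which two functors agree. -/
structure Cell {F G : VDFunctor X Y} {a a' b b' : Obj F G} (Γs : HPath (Hor (F := F) (G := G)) a a')
    (f : a ⟶ b) (f' : a' ⟶ b') (Δ : Hor b b') : Type v where
  cell : X.Cell (Γs.map Obj.obj (fun _ _ Γ => Γ.hor)) f.map f'.map Δ.hor
  eq : HEq (F.cell cell) (G.cell cell)

variable (F G : VDFunctor X Y)

/-- The underlying data of the equalizer. -/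
abbrev graph : VDGraph.{v} where
  Obj := Obj F G
  vert := Obj.category F G
  Hor := Hor (F := F) (G := G)
  Cell Γs f f' Δ := Cell Γs f f' Δ

/-- The underlying data of the inclusion of the equalizer. -/
def inclHom : VDGraphHom (graph F G) X.toVDGraph where
  vert := { obj := Obj.obj, map := Map.map }
  hor Γ := Γ.hor
  cell θ := θ.cell

theorem inclHom_eq : (inclHom F G).comp F.toVDGraphHom = (inclHom F G).comp G.toVDGraphHom := by
  refine VDGraphHom.ext_cell (CategoryTheory.Functor.hext (fun a => a.eq) (fun _ _ f => f.eq))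
    (fun Γ => Γ.eq) fun θ => ?_
  exact (VDGraphHom.comp_cell_heq (inclHom F G) F.toVDGraphHom θ).trans
    (θ.eq.trans (VDGraphHom.comp_cell_heq (inclHom F G) G.toVDGraphHom θ).symm)

theorem cell_comp_heq {K : VDFunctor X Y} {A A' B B' C C' : Obj F G}
    {Δs : HPath (graph F G).Hor B B'} {u : A ⟶ B} {u' : A' ⟶ B'}
    (θs : (graph F G).CellPath Δs u u') {v : B ⟶ C} {v' : B' ⟶ C'} {Λ : (graph F G).Hor C C'}
    (κ : (graph F G).Cell Δs v v' Λ) :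
    HEq (K.cell (X.comp ((inclHom F G).mapCells θs) κ.cell ((inclHom F G).top_mapCells θs)
        ((inclHom F G).vert.map_comp u v).symm ((inclHom F G).vert.map_comp u' v').symm))
      (Y.comp (((inclHom F G).comp K.toVDGraphHom).mapCells θs)
        (((inclHom F G).comp K.toVDGraphHom).cell κ)
        (((inclHom F G).comp K.toVDGraphHom).top_mapCells θs)
        (((inclHom F G).comp K.toVDGraphHom).vert.map_comp u v).symm
        (((inclHom F G).comp K.toVDGraphHom).vert.map_comp u' v').symm) := by
  refine (heq_of_eq (K.cell_comp' _ _ _ _ _)).trans ?_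
  refine (VDGraphHom.heq_cast (Y := Y) (HPath.map_map (H' := X.Hor) (H'' := Y.Hor) _ _ _ _ θs.top)
    rfl rfl _).symm.trans (heq_of_eq ?_)
  refine (VDCData.cast_comp _ _ _ _ _ _ _ _ _).trans ?_
  refine VDGraphHom.comp_heq (HPath.map_map _ _ _ _ Δs) rfl rfl rfl rfl ?_ ?_ _ _ _ _ _ _
  · exact ((heq_of_eq (VDGraphHom.mapCells_comp _ _ θs)).trans
      (VDGraphHom.heq_path_cast (Y := Y) _ rfl rfl _)).symm
  · exact (VDGraphHom.comp_cell_heq (inclHom F G) K.toVDGraphHom κ).symm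

theorem comp_congr {E : VDGraph.{v}} {K K' : VDGraphHom E Y.toVDGraph} (e : K = K')
    {A A' B B' C C' : E.Obj} {Δs : HPath E.Hor B B'} {u : A ⟶ B} {u' : A' ⟶ B'}
    (θs : E.CellPath Δs u u') {v : B ⟶ C} {v' : B' ⟶ C'} {Λ : E.Hor C C'}
    (κ : E.Cell Δs v v' Λ) :
    HEq (Y.comp (K.mapCells θs) (K.cell κ) (K.top_mapCells θs) (K.vert.map_comp u v).symm
        (K.vert.map_comp u' v').symm)
      (Y.comp (K'.mapCells θs) (K'.cell κ) (K'.top_mapCells θs) (K'.vert.map_comp u v).symm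
        (K'.vert.map_comp u' v').symm) := by
  subst e; rfl

theorem id_heq {A B A₂ B₂ : Y.Obj} (hA : A = A₂) (hB : B = B₂) {Γ : Y.Hor A B} {Γ₂ : Y.Hor A₂ B₂}
    (h : HEq Γ Γ₂) : HEq (Y.id Γ) (Y.id Γ₂) := by
  subst hA hB; rw [eq_of_heq h]

/-- Identities and composition of multicells of the equalizer. -/
abbrev data : VDCData.{v} where
  toVDGraph := graph F G
  id {a b} Γ := ⟨X.id Γ.hor, by
    refine (heq_of_eq (F.cell_id Γ.hor)).trans (HEq.trans ?_ (heq_of_eq (G.cell_id Γ.hor)).symm)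
    exact (VDGraphHom.heq_cast _ _ _ _).trans ((id_heq a.eq b.eq Γ.eq).trans
      (VDGraphHom.heq_cast _ _ _ _).symm)⟩
  comp θs _ _ _ κ _ _ _ e e₁ e₂ := ⟨X.comp ((inclHom F G).mapCells θs) κ.cell
    (((inclHom F G).top_mapCells θs).trans (congrArg (inclHom F G).path e)) (congrArg Map.map e₁)
    (congrArg Map.map e₂), by
      subst e e₁ e₂
      exact (cell_comp_heq F G θs κ).trans ((comp_congr (inclHom_eq F G) θs κ).trans
        (cell_comp_heq F G θs κ).symm)⟩

theorem inclHom_preserves : VDGraphHom.Preserves (X := data F G) (Y := X) (inclHom F G) :=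
  ⟨fun _ => rfl, fun _ _ _ _ _ => rfl⟩

variable {F G} in
theorem inclHom_inj {a a' b b' : Obj F G} {Γs : HPath (Hor (F := F) (G := G)) a a'} {f : a ⟶ b}
    {f' : a' ⟶ b'} {Δ : Hor b b'} (θ κ : Cell Γs f f' Δ) (h : θ.cell = κ.cell) : θ = κ := by
  cases θ; cases κ
  dsimp only at h
  subst h
  rfl

/-- The equalizer of two functors between virtual double categories. -/
def eq : VDC.{v} :=
  VDC.ofFaithful (data F G) (ι := Unit) (fun _ => X) (fun _ => inclHom F G)
    (fun _ => inclHom_preserves F G) (fun θ κ h => inclHom_inj θ κ (h ()))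

/-- The inclusion of the equalizer. -/
def incl : VDFunctor (eq F G) X where
  toVDGraphHom := inclHom F G
  cell_id := (inclHom_preserves F G).cell_id
  cell_comp := (inclHom_preserves F G).cell_comp

theorem incl_eq : (incl F G).comp F = (incl F G).comp G :=
  VDProd.toHom_injective (inclHom_eq F G)

variable {F G} {W : VDC.{v}}

/-- The underlying data of the functor to the equalizer induced by a functor. -/
def liftHom (a : VDFunctor W X) (h : a.comp F = a.comp G) :
    VDGraphHom W.toVDGraph (graph F G) where
  vert :=
    { obj := fun x => ⟨a.vert.obj x, VDFunctor.obj_congr h x⟩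
      map := fun f => ⟨a.vert.map f, VDFunctor.map_congr h f⟩
      map_id := fun x => Map.ext (a.vert.map_id x)
      map_comp := fun f g => Map.ext (a.vert.map_comp f g) }
  hor Γ := ⟨a.hor Γ, VDFunctor.hor_congr h Γ⟩
  cell {_ _ _ _ Γs _ _ _} θ :=
    ⟨X.cast (HPath.map_map (H' := Hor (F := F) (G := G)) _ _ _ _ Γs).symm rfl rfl (a.cell θ), by
      have hK : ∀ K : VDFunctor X Y, HEq (K.cell (X.cast
          (HPath.map_map (H' := Hor (F := F) (G := G)) (fun x => (⟨a.vert.obj x,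
            VDFunctor.obj_congr h x⟩ : Obj F G)) Obj.obj (fun _ _ Γ => ⟨a.hor Γ,
            VDFunctor.hor_congr h Γ⟩) (fun _ _ Γ => Γ.hor) Γs).symm rfl rfl (a.cell θ)))
          ((a.comp K).cell θ) := fun K =>
        (VDFunctor.cell_cast_heq K _ _ _ (a.cell θ)).trans (VDFunctor.comp_cell_heq a K θ).symm
      exact (hK F).trans ((VDFunctor.cell_congr h θ).trans (hK G).symm)⟩

theorem liftHom_incl (a : VDFunctor W X) (h : a.comp F = a.comp G) :
    (liftHom a h).comp (inclHom F G) = a.toVDGraphHom := by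
  refine VDGraphHom.ext_cell rfl (fun _ => HEq.rfl) fun {_ _ _ _ Γs _ _ _} θ => ?_
  refine (VDGraphHom.comp_cell_heq _ _ θ).trans ?_
  exact VDFunctor.heq_cast (X := X) _ rfl rfl (a.cell θ)

/-- The functor to the equalizer induced by a functor. -/
def lift (a : VDFunctor W X) (h : a.comp F = a.comp G) : VDFunctor W (eq F G) :=
  VDFunctor.ofFaithful (ι := Unit) (liftHom a h) (fun _ => incl F G)
    (fun θ κ h => inclHom_inj θ κ (h ())) (fun _ => (liftHom_incl a h).symm ▸ a.preserves)

theorem lift_incl (a : VDFunctor W X) (h : a.comp F = a.comp G) :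
    (lift a h).comp (incl F G) = a :=
  VDProd.toHom_injective (liftHom_incl a h)

theorem lift_eta (l : VDFunctor W (eq F G))
    (h : (l.comp (incl F G)).comp F = (l.comp (incl F G)).comp G) :
    lift (l.comp (incl F G)) h = l :=
  VDFunctor.ext_faithful (ι := Unit) (fun _ => incl F G)
    (fun θ κ h => inclHom_inj θ κ (h ())) rfl (fun _ => HEq.rfl) fun _ => lift_incl _ h

open TwoCat Bicategory in
theorem isTwoEqualizer (F G : VDFunctor X Y) :
    IsTwoEqualizer (K := VDC.{v}) (incl F G) F G where
  w := incl_eq F G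
  lift {W} a h := ⟨lift a h, lift_incl a h⟩
  uniq {W} l l' h := by
    have e : ∀ l : VDFunctor W (eq F G),
        (l.comp (incl F G)).comp F = (l.comp (incl F G)).comp G := fun l =>
      (VDFunctor.assoc _ _ _).trans ((congrArg l.comp (incl_eq F G)).trans
        (VDFunctor.assoc _ _ _).symm)
    have h' : VDFunctor.comp l (incl F G) = VDFunctor.comp l' (incl F G) := h
    rw [← lift_eta l (e l), ← lift_eta l' (e l')]
    congr 1
  lift₂ {W l l'} α h := by
    have e : ∀ l : VDFunctor W (eq F G),
        (l.comp (incl F G)).comp F = (l.comp (incl F G)).comp G := fun l =>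
      (VDFunctor.assoc _ _ _).trans ((congrArg l.comp (incl_eq F G)).trans
        (VDFunctor.assoc _ _ _).symm)
    let γd : VDTransData l l' :=
      { vert :=
          { app := fun x => ⟨(VDTransData.vert (VDTrans.toVDTransData α)).app x, VDTrans.app_heq
              (e l) (e l') h x⟩
            naturality := fun _ _ f => Map.ext ((VDTransData.vert (VDTrans.toVDTransData
                α)).naturality f) }
        cell := fun Γ => ⟨VDTransData.cell (VDTrans.toVDTransData α) Γ, VDTrans.cell_heq (e l) (e
            l') h Γ⟩ }
    exact ⟨VDTrans.ofFaithful (ι := Unit) γd (fun _ => incl F G)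
      (fun θ κ h => inclHom_inj θ κ (h ())) (fun _ => α) (fun _ _ => rfl) (fun _ _ _ _ => rfl), rfl⟩
  uniq₂ {W l l'} γ δ h := by
    have hv : ∀ x, (VDTransData.vert (VDTrans.toVDTransData γ)).app x = (VDTransData.vert
        (VDTrans.toVDTransData δ)).app x := fun x => Map.ext
      (congrArg (fun (α : VDTrans (l.comp (incl F G)) (l'.comp (incl F G))) => α.vert.app x) h)
    refine VDTrans.ext' hv fun Γ => inclHom_inj _ _ ?_
    refine eq_of_heq ((VDTrans.cell_congr h Γ).trans (HEq.symm ?_))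
    refine (heq_of_eq ((incl F G).cell_cast _ _ _ _)).trans ?_
    exact VDGraphHom.heq_cast (Y := X) _ _ _ _

end VDEq

theorem VDC.comp_hcongr {Y : VDC.{v}} {A A' B B' C C' A₁ A₁' B₁ B₁' C₁ C₁' : Y.Obj} (hA : A = A₁)
    (hA' : A' = A₁') (hB : B = B₁) (hB' : B' = B₁') (hC : C = C₁) (hC' : C' = C₁')
    {Δs : HPath Y.Hor B B'} {Δs₁ : HPath Y.Hor B₁ B₁'} (hΔ : HEq Δs Δs₁)
    {u : A ⟶ B} {u₁ : A₁ ⟶ B₁} (hu : HEq u u₁) {u' : A' ⟶ B'} {u₁' : A₁' ⟶ B₁'} (hu' : HEq u' u₁')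
    {θs : Y.CellPath Δs u u'} {θs₁ : Y.CellPath Δs₁ u₁ u₁'} (hθ : HEq θs θs₁)
    {v : B ⟶ C} {v₁ : B₁ ⟶ C₁} (hv : HEq v v₁) {v' : B' ⟶ C'} {v₁' : B₁' ⟶ C₁'} (hv' : HEq v' v₁')
    {Λ : Y.Hor C C'} {Λ₁ : Y.Hor C₁ C₁'} (hΛ : HEq Λ Λ₁)
    {κ : Y.Cell Δs v v' Λ} {κ₁ : Y.Cell Δs₁ v₁ v₁' Λ₁} (hκ : HEq κ κ₁)
    {Γs : HPath Y.Hor A A'} {Γs₁ : HPath Y.Hor A₁ A₁'} (hΓ : HEq Γs Γs₁)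
    {w : A ⟶ C} {w' : A' ⟶ C'} {w₁ : A₁ ⟶ C₁} {w₁' : A₁' ⟶ C₁'}
    (h : θs.top = Γs) (k : u ≫ v = w) (k' : u' ≫ v' = w')
    (h₁ : θs₁.top = Γs₁) (k₁ : u₁ ≫ v₁ = w₁) (k₁' : u₁' ≫ v₁' = w₁') :
    HEq (Y.comp θs κ h k k') (Y.comp θs₁ κ₁ h₁ k₁ k₁') := by
  subst hA hA' hB hB' hC hC'
  cases hΔ; cases hu; cases hu'; cases hθ; cases hv; cases hv'; cases hΛ; cases hκ; cases hΓ
  subst h k k' k₁ k₁'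
  rfl

/-! ### Constant families -/

namespace FamVDC

variable {X Y : VDC.{max (u + 1) v}}

/-- The family which is constant with value `x`, indexed by the set `b x`. -/
abbrev constObj (b : VDFunctor X Span.{u, v}) (x : X.Obj) : FamObj.{u, v} X :=
  ⟨SpanObj.carrier (b.vert.obj x), fun _ => x⟩

/-- The constant family of horizontal morphisms with value `Γ`, indexed by the span `b Γ`. -/
abbrev constHor (b : VDFunctor X Span.{u, v}) {x y : X.Obj} (Γ : X.Hor x y) :
    FamHor (constObj b x) (constObj b y) :=
  ⟨b.hor Γ, fun _ => Γ⟩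

variable (b : VDFunctor X Span.{u, v})

/-- The path of constant families determined by a path. -/
abbrev constPath {x y : X.Obj} (Γs : HPath X.Hor x y) :
    HPath (FamHor (A := X)) (constObj b x) (constObj b y) :=
  Γs.map (constObj b) (fun _ _ Γ => constHor b Γ)

/-- Chains along a path of constant families are chains along the path of indexing spans. -/
def constChain : ∀ {x y : X.Obj} (Γs : HPath X.Hor x y) {i : (constObj b x).idx}
    {j : (constObj b y).idx}, FamChain (constPath b Γs) i j → SpanChain (b.path Γs) i j
  | _, _, .nil _, _, _, c => c
  | _, _, .cons _ Γs, _, _, c => ⟨c.1, c.2.1, constChain Γs c.2.2⟩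

theorem constChain_append : ∀ {x y z : X.Obj} (Γs : HPath X.Hor x y) (Δs : HPath X.Hor y z)
    {i : (constObj b x).idx} {j : (constObj b y).idx} {k : (constObj b z).idx}
    (c : FamChain (constPath b Γs) i j) (d : FamChain (constPath b Δs) j k),
    constChain b (Γs.append Δs) (Chain.cast (HPath.map_append _ _ Γs Δs).symm (c.append d)) =
      Chain.cast (HPath.map_append _ _ Γs Δs).symm
        ((constChain b Γs c).append (constChain b Δs d))
  | _, _, _, .nil _, Δs, _, _, _, c, d => by
    obtain ⟨⟨rfl⟩⟩ := c; rfl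
  | _, _, _, .cons Γ Γs, Δs, _, _, _, c, d => by
    refine (congrArg (constChain b (HPath.cons Γ (Γs.append Δs))) (Chain.cast_cons
      (Γ := constHor b Γ) c.2.1 _ (HPath.map_append _ _ Γs Δs).symm)).trans ?_
    have h := Chain.cast_cons (Γ := b.hor Γ) c.2.1 ((constChain b Γs c.2.2).append (constChain b
        Δs d))
      (HPath.map_append _ _ Γs Δs).symm
    exact (congrArg (Chain.cons (Γ := b.hor Γ) c.2.1) (constChain_append Γs Δs c.2.2 d)).trans
        h.symm

theorem path_const : ∀ {x y : X.Obj} (Γs : HPath X.Hor x y) {i : (constObj b x).idx}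
    {j : (constObj b y).idx} (c : FamChain (constPath b Γs) i j), Fams.path c = Γs
  | _, _, .nil _, _, _, c => by
    obtain ⟨⟨rfl⟩⟩ := c; rfl
  | _, _, .cons Γ Γs, _, _, c => congrArg (HPath.cons Γ) (path_const Γs c.2.2)

/-- The underlying data of the functor to constant families. -/
def constHom : VDGraphHom X.toVDGraph (famGraph.{u, v} X) where
  vert :=
    { obj := constObj b
      map := fun {x y} f => (⟨SpanMap.fn (b.vert.map f), fun _ => f⟩ :
        FamMap (constObj b x) (constObj b y))
      map_id := fun x => congrArg (fun g : SpanMap _ _ => (⟨g.fn, fun _ => 𝟙 x⟩ :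
        FamMap (constObj b x) (constObj b x))) (b.vert.map_id x)
      map_comp := fun {x y z} f g => congrArg (fun k : SpanMap _ _ => (⟨k.fn, fun _ => f ≫ g⟩ :
        FamMap (constObj b x) (constObj b z))) (b.vert.map_comp f g) }
  hor Γ := constHor b Γ
  cell {_ _ _ _ Γs _ _ _} θ :=
    { fn := fun c => SpanCell.fn (b.cell θ) (constChain b Γs c)
      cell := fun c => X.cast (path_const b Γs c).symm rfl rfl θ }

theorem push_constHom {A A' B B' : X.Obj} {Δs : HPath X.Hor B B'} {f : A ⟶ B} {f' : A' ⟶ B'}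
    (θs : X.CellPath Δs f f') : ∀ {i : (constObj b A).idx} {j : (constObj b A').idx}
    (c : FamChain ((constHom b).mapCells θs).top i j),
    constChain b Δs (Fams.push ((constHom b).mapCells θs) c).chain =
        Spans.push (b.mapCells θs) (Chain.cast (b.top_mapCells θs).symm
          (constChain b θs.top (c.cast ((constHom b).top_mapCells θs)))) ∧
      HEq (Fams.push ((constHom b).mapCells θs) c).cells θs := by
  induction θs with
  | nil u =>
    intro i j c
    obtain ⟨⟨rfl⟩⟩ := c
    exact ⟨rfl, HEq.rfl⟩
  | @cons A A' A'' B B' B'' Γs u u' u'' Δ Δs θ θs ih =>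
    intro i j c
    obtain ⟨k, c₁, c₂, rfl⟩ : ∃ (k : _) (c₁ : FamChain (constPath b Γs) _ k)
        (c₂ : FamChain ((constHom b).mapCells θs).top k _), c = Chain.append c₁ c₂ :=
      ⟨_, _, _, (Chain.append_split (constPath b Γs) c).symm⟩
    have hp : Fams.push ((constHom b).mapCells (.cons θ θs)) (Chain.append c₁ c₂) =
        Fams.pushCons ((constHom b).cell θ) c₁ (Fams.push ((constHom b).mapCells θs) c₂) :=
      Fams.push_cons ((constHom b).cell θ) ((constHom b).mapCells θs) c₁ c₂
    obtain ⟨h₁, h₂⟩ := ih c₂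
    refine ⟨(congrArg (fun p => constChain b (.cons Δ Δs) (Fams.Push.chain p)) hp).trans ?_, ?_⟩
    · have e : (Chain.append c₁ c₂).cast
          ((constHom b).top_mapCells (VDGraph.CellPath.cons (X := X.toVDGraph) θ θs)) =
          Chain.cast (HPath.map_append _ _ Γs θs.top).symm
            (Chain.append c₁ (Chain.cast ((constHom b).top_mapCells θs) c₂)) :=
        Eq.symm ((congrArg (Chain.cast _) (Chain.append_cast _ _ _)).trans (Chain.cast_cast _ _ _))
      have e' := (congrArg (constChain b (Γs.append θs.top)) e).trans
        (constChain_append b Γs θs.top c₁ _)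
      have e'' : Chain.cast (b.top_mapCells (VDGraph.CellPath.cons θ θs)).symm
          (Chain.cast (HPath.map_append _ _ Γs θs.top).symm ((constChain b Γs c₁).append
            (constChain b θs.top (Chain.cast ((constHom b).top_mapCells θs) c₂)))) =
          Chain.append (constChain b Γs c₁) (Chain.cast (b.top_mapCells θs).symm
            (constChain b θs.top (Chain.cast ((constHom b).top_mapCells θs) c₂))) :=
        (Chain.cast_cast _ _ _).trans (Chain.append_cast _ _ _).symm
      have e₃ := (congrArg (Chain.cast (b.top_mapCells (VDGraph.CellPath.cons θ θs)).symm)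
        e').trans e''
      refine Eq.trans ?_ (congrArg (Spans.push (b.mapCells (.cons θ θs))) e₃).symm
      refine Eq.trans ?_ (Spans.push_cons (b.cell θ) (b.mapCells θs) _ _).symm
      exact congrArg (Chain.cons (Γ := b.hor Δ) (SpanCell.fn (b.cell θ) (constChain b Γs c₁))) h₁
    · refine (congr_arg_heq Fams.Push.cells hp).trans ?_
      exact VDGraphHom.cons_heq (Y := X) (path_const b Γs c₁) (path_const b Δs _) rfl rfl rfl
        (VDGraphHom.heq_cast _ rfl rfl _) h₂

/-- The functor sending `x` to the constant family with value `x` indexed by the set `b x`. -/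
def const : VDFunctor X (FamVDC.{u, v} X) where
  toVDGraphHom := constHom b
  cell_id {x y} Γ := Fams.ext_cell (A := X) fun c => by
    refine Eq.trans ?_ (Fams.toFn_cast (A := X) _ _ _ _ c).symm
    refine (Fams.castVal_eq (A := X) (x := Fams.toFn (Fams.idCell (constHor b Γ)) (Chain.cast rfl
        c))
      (y := Fams.toFn ((constHom b).cell (X.id Γ)) c) _ _ _ ?_ ?_).symm
    · refine Eq.trans ?_ (congrArg (fun θ => (SpanCell.fn θ (constChain b (.single Γ) c)).1)
        (b.cell_id Γ)).symm
      exact (Spans.fn_cast rfl (b.vert.map_id x).symm (b.vert.map_id y).symm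
        (Spans.idCell (b.hor Γ)) (constChain b (.single Γ) c)).symm
    · obtain ⟨k, s, ⟨⟨rfl⟩⟩⟩ := c
      exact HEq.rfl
  cell_comp {A A' B B' C C' Δs u u'} θs {v v' Λ} κ := Fams.ext_cell (A := X) fun c => by
    refine Eq.trans ?_ (Fams.comp_fn (A := X) _ _ _ _ _ c).symm
    obtain ⟨h₁, h₂⟩ := push_constHom b θs (Chain.cast ((constHom b).top_mapCells θs).symm c)
    refine (Fams.castVal_eq (A := X) _ _ _ ?_ ?_).symm
    · refine (congrArg (fun d => (SpanCell.fn (b.cell κ) d).1) h₁).trans ?_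
      refine Eq.trans ?_ (congrArg (fun θ => (SpanCell.fn θ (constChain b θs.top c)).1)
        (b.cell_comp θs κ)).symm
      refine Eq.trans ?_ (Spans.comp_fn _ _ _ _ _ _).symm
      refine congrArg (fun d => (SpanCell.fn (b.cell κ) (Spans.push (b.mapCells θs)
        (Chain.cast (b.top_mapCells θs).symm (constChain b θs.top d)))).1) ?_
      exact (Chain.eq_cast_cast ((constHom b).top_mapCells θs).symm c).symm
    · refine HEq.trans ?_ (VDGraphHom.heq_cast (Y := X) (path_const b θs.top c).symm rfl rfl
        (X.comp θs κ rfl rfl rfl)).symm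
      exact VDC.comp_hcongr rfl rfl rfl rfl rfl rfl (heq_of_eq (path_const b _ _)) HEq.rfl HEq.rfl
        h₂ HEq.rfl HEq.rfl HEq.rfl (VDGraphHom.heq_cast _ rfl rfl _)
        (heq_of_eq ((Fams.path_cast _ c).trans (path_const b _ c))) _ _ _ _ _ _

end FamVDC

/-! ### The unit: the family of elements -/

namespace FamVDC

variable {X : VDC.{max (u + 1) v}}

/-- The family of all elements over `x`, indexed by the set `b x`. -/
abbrev unitObj (b : VDFunctor X Span.{u, v}) (x : X.Obj) : FamObj.{u, v} (EltsVDC b) :=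
  ⟨SpanObj.carrier (b.vert.obj x), fun i => (⟨x, i⟩ : EltsObj b)⟩

/-- The family of all elements over `Γ`, indexed by the span `b Γ`. -/
abbrev unitHor (b : VDFunctor X Span.{u, v}) {x y : X.Obj} (Γ : X.Hor x y) :
    FamHor (unitObj b x) (unitObj b y) :=
  ⟨b.hor Γ, fun {i j} s => (⟨Γ, s⟩ : EltsHor (F := b) ⟨x, i⟩ ⟨y, j⟩)⟩

variable (b : VDFunctor X Span.{u, v})

/-- The map of families of elements determined by a vertical morphism. -/
def unitMap {x y : X.Obj} (f : x ⟶ y) (g : b.vert.obj x ⟶ b.vert.obj y) (h : b.vert.map f = g) :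
    FamMap (unitObj b x) (unitObj b y) :=
  ⟨SpanMap.fn g, fun i => (⟨f, congrArg (fun g => SpanMap.fn g i) h⟩ :
    EltsMap (F := b) ⟨x, i⟩ ⟨y, SpanMap.fn g i⟩)⟩

theorem unitMap_eq {x y : X.Obj} (f : x ⟶ y) (g : b.vert.obj x ⟶ b.vert.obj y)
    (h : b.vert.map f = g) : unitMap b f _ rfl = unitMap b f g h := by
  subst h; rfl

/-- The path of families of elements determined by a path. -/
abbrev unitPath {x y : X.Obj} (Γs : HPath X.Hor x y) :
    HPath (FamHor (A := EltsVDC b)) (unitObj b x) (unitObj b y) :=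
  Γs.map (unitObj b) (fun _ _ Γ => unitHor b Γ)

/-- Chains along a path of families of elements are chains along the path of indexing spans. -/
def unitChain : ∀ {x y : X.Obj} (Γs : HPath X.Hor x y) {i : (unitObj b x).idx}
    {j : (unitObj b y).idx}, FamChain (unitPath b Γs) i j → SpanChain (b.path Γs) i j
  | _, _, .nil _, _, _, c => c
  | _, _, .cons _ Γs, _, _, c => ⟨c.1, c.2.1, unitChain Γs c.2.2⟩

theorem path_unit : ∀ {x y : X.Obj} (Γs : HPath X.Hor x y) {i : (unitObj b x).idx}
    {j : (unitObj b y).idx} (c : FamChain (unitPath b Γs) i j),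
    (EltsVDC.proj b).path (Fams.path c) = Γs
  | _, _, .nil _, _, _, c => by
    obtain ⟨⟨rfl⟩⟩ := c; rfl
  | _, _, .cons Γ Γs, _, _, c => congrArg (HPath.cons Γ) (path_unit Γs c.2.2)

theorem eltsChain_path : ∀ {x y : X.Obj} (Γs : HPath X.Hor x y) {i : (unitObj b x).idx}
    {j : (unitObj b y).idx} (c : FamChain (unitPath b Γs) i j),
    Chain.cast (congrArg b.path (path_unit b Γs c))
      (eltsChain (F := b) (a := ⟨x, i⟩) (b := ⟨y, j⟩) (Fams.path c)) = unitChain b Γs c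
  | _, _, .nil _, _, _, c => by
    obtain ⟨⟨rfl⟩⟩ := c; rfl
  | _, _, .cons Γ Γs, _, _, c =>
    by
    have h := Chain.cast_cons (H := SpanHor.{u, v}) (Γ := b.hor Γ) c.2.1
      (eltsChain (F := b) (a := ⟨_, c.1⟩) (b := ⟨_, _⟩) (Fams.path c.2.2))
      (congrArg b.path (path_unit b Γs c.2.2))
    exact h.trans (congrArg (Chain.cons (Γ := b.hor Γ) c.2.1) (eltsChain_path Γs c.2.2))

/-- The underlying data of the functor to families of elements. -/
def unitHom : VDGraphHom X.toVDGraph (famGraph.{u, v} (EltsVDC b)) where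
  vert :=
    { obj := unitObj b
      map := fun {x y} f => unitMap b f _ rfl
      map_id := fun x => unitMap_eq b (𝟙 x) (𝟙 _) (b.vert.map_id x)
      map_comp := fun {x y z} f g => unitMap_eq b (f ≫ g) (_ ≫ _) (b.vert.map_comp f g) }
  hor Γ := unitHor b Γ
  cell {x x' y y' Γs f f' Δ} θ :=
    { fn := fun c => SpanCell.fn (b.cell θ) (unitChain b Γs c)
      cell := fun {i i'} c =>
        (⟨X.cast (path_unit b Γs c).symm rfl rfl θ, by
          refine (congrArg (fun κ => (SpanCell.fn κ _).1) (b.cell_cast (path_unit b Γs c).symm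
            rfl rfl θ)).trans ?_
          refine (Spans.fn_cast (congrArg b.path (path_unit b Γs c).symm) rfl rfl
            (b.cell θ) _).trans ?_
          exact congrArg (fun d => (SpanCell.fn (b.cell θ) d).1) (eltsChain_path b Γs c)⟩ :
        EltsCell (F := b) (a := ⟨x, i⟩) (a' := ⟨x', i'⟩) (b := ⟨y, _⟩) (b' := ⟨y', _⟩)
          (Fams.path c) ⟨f, rfl⟩ ⟨f', rfl⟩ ⟨Δ, SpanCell.fn (b.cell θ) (unitChain b Γs c)⟩) }

theorem unitChain_unmap : ∀ {x y : X.Obj} (Γs : HPath X.Hor x y) {i : (constObj b x).idx}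
    {j : (constObj b y).idx} (c : FamChain (constPath b Γs) i j)
    (e : constPath b Γs = (unitPath b Γs).map (Fams.mapVert (EltsVDC.proj b)).obj
      (fun _ _ Γ => Fams.mapHor (EltsVDC.proj b) Γ)),
    unitChain b Γs (Fams.unmap (EltsVDC.proj b) (unitPath b Γs) (Chain.cast e c)) =
      constChain b Γs c
  | _, _, .nil _, _, _, _, _ => rfl
  | _, _, .cons Γ Γs, _, _, c, e => by
    have h := Chain.cast_cons (Γ := constHor b Γ) c.2.1 c.2.2
      (HPath.map_map (H' := FamHor (A := EltsVDC b)) (H'' := FamHor (A := X)) (unitObj b)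
        (Fams.mapVert (EltsVDC.proj b)).obj (fun _ _ Γ => unitHor b Γ)
        (fun _ _ Γ => Fams.mapHor (EltsVDC.proj b) Γ) Γs).symm
    refine (congrArg (fun d => unitChain b (.cons Γ Γs) (Fams.unmap (EltsVDC.proj b)
      (unitPath b (.cons Γ Γs)) d)) h).trans ?_
    exact congrArg (Chain.cons (Γ := b.hor Γ) c.2.1) (unitChain_unmap Γs c.2.2 _)

theorem unitHom_proj : (unitHom b).comp (Fams.mapHom (EltsVDC.proj b)) = constHom b := by
  refine VDGraphHom.ext_cell rfl (fun _ => HEq.rfl) fun {x x' y y' Γs f f' Δ} θ => ?_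
  refine (VDGraphHom.comp_cell_heq _ _ θ).trans ?_
  refine Fams.heq_cell (A := X) (HPath.map_map (H' := FamHor (A := EltsVDC b))
    (H'' := FamHor (A := X)) (unitObj b)
        (Fams.mapVert (EltsVDC.proj b)).obj (fun _ _ Γ => unitHor b Γ)
        (fun _ _ Γ => Fams.mapHor (EltsVDC.proj b) Γ) Γs) (fun c => ?_) (fun c => ?_)
  · exact congrArg (fun d => (SpanCell.fn (b.cell θ) d).1) (unitChain_unmap b Γs c _)
  · exact (VDGraphHom.heq_cast (Y := X) _ rfl rfl _).trans
      ((VDGraphHom.heq_cast (Y := X) _ rfl rfl θ).trans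
        (VDGraphHom.heq_cast (Y := X) _ rfl rfl θ).symm)

/-- A multicell of families is determined by its image under a faithful functor. -/
theorem map_faithful {A B : VDC.{max (u + 1) v}} (F : VDFunctor A B)
    (hF : ∀ {a a' b b' : A.Obj} {Γs : HPath A.Hor a a'} {f : a ⟶ b} {f' : a' ⟶ b'}
      {Δ : A.Hor b b'} (θ κ : A.Cell Γs f f' Δ), F.cell θ = F.cell κ → θ = κ)
    {P P' R R' : FamObj.{u, v} A} {Γs : HPath (FamHor (A := A)) P P'} {f : P ⟶ R} {f' : P' ⟶ R'}
    {Δ : FamHor R R'} (θ κ : FamCell Γs f f' Δ)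
    (h : (FamVDC.map F).cell θ = (FamVDC.map F).cell κ) : θ = κ := by
  refine Fams.ext_cell fun {i i'} c => ?_
  obtain ⟨d, rfl⟩ : ∃ d, c = Fams.unmap F Γs d := ⟨_, (Fams.unmap_remap F c).symm⟩
  have h' : Fams.toFn ((Fams.mapHom F).cell θ) d = Fams.toFn ((Fams.mapHom F).cell κ) d :=
    congrArg (fun θ => Fams.toFn θ d) h
  have h₁ : (θ.fn (Fams.unmap F Γs d)) = (κ.fn (Fams.unmap F Γs d)) := congrArg Sigma.fst h'
  have h₂ : HEq ((Fams.mapHom F).cell θ |>.cell d) ((Fams.mapHom F).cell κ |>.cell d) := by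
    have := (Sigma.mk.inj h').2
    exact this
  refine Sigma.ext h₁ ?_
  have h₃ : HEq (F.cell (θ.cell (Fams.unmap F Γs d))) (F.cell (κ.cell (Fams.unmap F Γs d))) :=
    (VDGraphHom.heq_cast (Y := B) _ rfl rfl _).symm.trans
      (h₂.trans (VDGraphHom.heq_cast (Y := B) _ rfl rfl _))
  have key : ∀ {s t : Δ.span.Fiber (f.fn i) (f'.fn i')} (_ : s = t)
      (x : A.Cell (Fams.path (Fams.unmap F Γs d)) (f.map i) (f'.map i') (Δ.fam s))
      (y : A.Cell (Fams.path (Fams.unmap F Γs d)) (f.map i) (f'.map i') (Δ.fam t)),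
      HEq (F.cell x) (F.cell y) → HEq x y := by
    intro s t e x y hxy
    subst e
    exact heq_of_eq (hF _ _ (eq_of_heq hxy))
  exact key h₁ _ _ h₃

/-- The functor sending `x` to the family of all elements over `x`. -/
def unit : VDFunctor X (FamVDC.{u, v} (EltsVDC b)) :=
  VDFunctor.ofFaithful (ι := Unit) (unitHom b) (fun _ => FamVDC.map (EltsVDC.proj b))
    (fun θ κ h => map_faithful (EltsVDC.proj b) (fun θ κ h => eltsForget_inj θ κ h) θ κ (h ()))
    (fun _ => (unitHom_proj b).symm ▸ (const b).preserves)

theorem unit_proj : (unit b).comp (FamVDC.map (EltsVDC.proj b)) = const b :=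
  VDProd.toHom_injective (unitHom_proj b)

theorem unitChain_ofSpanChain : ∀ {x y : X.Obj} (Γs : HPath X.Hor x y) {i : (unitObj b x).idx}
    {j : (unitObj b y).idx} (c : SpanChain (b.path Γs) i j)
    (e : b.path Γs = Fams.spanPath (unitPath b Γs)),
    unitChain b Γs (Fams.ofSpanChain (unitPath b Γs) (Chain.cast e c)) = c
  | _, _, .nil _, _, _, _, _ => rfl
  | _, _, .cons Γ Γs, _, _, c, e => by
    have h := Chain.cast_cons (Γ := b.hor Γ) c.2.1 c.2.2
      (HPath.map_map (H' := FamHor (A := EltsVDC b)) (H'' := SpanHor.{u, v}) (unitObj b)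
        (Fams.setVert _).obj (fun _ _ Γ => unitHor b Γ) (fun _ _ Γ => FamHor.span Γ) Γs).symm
    refine (congrArg (fun d => unitChain b (.cons Γ Γs) (Fams.ofSpanChain
      (unitPath b (.cons Γ Γs)) d)) h).trans ?_
    exact congrArg (Chain.cons (Γ := b.hor Γ) c.2.1) (unitChain_ofSpanChain Γs c.2.2 _)

theorem unit_toSpan : (unit b).comp (toSpan (EltsVDC b)) = b := by
  refine VDFunctor.ext_cell rfl (fun _ => HEq.rfl) fun {x x' y y' Γs f f' Δ} θ => ?_
  refine heq_of_eq (Spans.ext_cell fun c => ?_)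
  refine (Spans.fn_cast (HPath.map_map _ _ _ _ _) rfl rfl
    ((Fams.spanHom (EltsVDC b)).cell ((unitHom b).cell θ)) c).trans ?_
  exact congrArg (fun d => (SpanCell.fn (b.cell θ) d).1) (unitChain_ofSpanChain b Γs c _)

end FamVDC

/-! ### The counit: evaluation of families at elements -/

namespace FamVDC

variable {A : VDC.{max (u + 1) v}}

/-- The chain of chosen indices along a path of horizontal morphisms with elements. -/
abbrev famChain {a b : EltsObj (toSpan.{u, v} A)} (Γs : HPath (EltsHor (F := toSpan.{u, v} A)) a
    b) :
    FamChain ((eltsForget (toSpan.{u, v} A)).path Γs) a.elt b.elt :=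
  Fams.ofSpanChain (A := A) ((eltsForget (toSpan.{u, v} A)).path Γs) (eltsChain Γs)

theorem famChain_append : ∀ {a b c : EltsObj (toSpan.{u, v} A)}
    (Γs : HPath (EltsHor (F := toSpan.{u, v} A)) a b)
    (Δs : HPath (EltsHor (F := toSpan.{u, v} A)) b c),
    famChain (Γs.append Δs) = Chain.cast (HPath.map_append _ _ Γs Δs).symm
      (Chain.append (famChain Γs) (famChain Δs))
  | _, _, _, .nil _, _ => rfl
  | _, _, _, .cons Γ Γs, Δs => by
    have h := Chain.cast_cons (H := FamHor (A := A)) (car := FamObj.idx)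
      (fib := fun _ _ Γ i j => Γ.span.Fiber i j) (Γ := Γ.hor) Γ.elt
      (Chain.append (famChain Γs) (famChain Δs)) (HPath.map_append _ _ Γs Δs).symm
    exact (congrArg (Chain.cons (H := FamHor (A := A)) (Γ := Γ.hor) Γ.elt)
      (famChain_append Γs Δs)).trans h.symm

/-- Transport of the codomain of a component of a map of families. -/
def castCod {P R : FamObj.{u, v} A} (f : FamMap P R) {i : P.idx} {j : R.idx} (h : f.fn i = j) :
    P.fam i ⟶ R.fam j := by
  subst h; exact f.map i

theorem castCod_comp {P R S : FamObj.{u, v} A} (f : P ⟶ R) (g : R ⟶ S) {i : P.idx} {j : R.idx}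
    {k : S.idx} (h : f.fn i = j) (h' : g.fn j = k) (h'' : (f ≫ g).fn i = k) :
    castCod (f ≫ g) h'' = castCod f h ≫ castCod g h' := by
  subst h h'; rfl

/-- Transport of the boundary of a component of a multicell of families. -/
def castCell {P P' R R' : FamObj.{u, v} A} {f : FamMap P R} {f' : FamMap P' R'} {i : P.idx}
    {i' : P'.idx} {j : R.idx} {j' : R'.idx} (h : f.fn i = j) (h' : f'.fn i' = j') {Δ : FamHor R R'}
    {s : Δ.span.Fiber (f.fn i) (f'.fn i')} {t : Δ.span.Fiber j j'} (e : s.1 = t.1)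
    {πs ρs : HPath A.Hor (P.fam i) (P'.fam i')} (eπ : πs = ρs)
    (θ : A.Cell πs (f.map i) (f'.map i') (Δ.fam s)) :
    A.Cell ρs (castCod f h) (castCod f' h') (Δ.fam t) := by
  subst h h' eπ
  have e' : s = t := Subtype.ext e
  subst e'
  exact θ

theorem castCell_heq {P P' R R' : FamObj.{u, v} A} {f : FamMap P R} {f' : FamMap P' R'} {i : P.idx}
    {i' : P'.idx} {j : R.idx} {j' : R'.idx} (h : f.fn i = j) (h' : f'.fn i' = j') {Δ : FamHor R R'}
    {s : Δ.span.Fiber (f.fn i) (f'.fn i')} {t : Δ.span.Fiber j j'} (e : s.1 = t.1)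
    {πs ρs : HPath A.Hor (P.fam i) (P'.fam i')} (eπ : πs = ρs)
    (θ : A.Cell πs (f.map i) (f'.map i') (Δ.fam s)) : HEq (castCell h h' e eπ θ) θ := by
  subst h h' eπ
  have e' : s = t := Subtype.ext e
  subst e'
  rfl

theorem path_famChain : ∀ {a b : EltsObj (toSpan.{u, v} A)}
    (Γs : HPath (EltsHor (F := toSpan.{u, v} A)) a b),
    Fams.path (famChain Γs) = Γs.map (H' := A.Hor) (fun a => a.obj.fam a.elt)
      (fun _ _ Γ => Γ.hor.fam Γ.elt)
  | _, _, .nil _ => rfl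
  | _, _, .cons Γ Γs => congrArg (HPath.cons (H := A.Hor) (Γ.hor.fam Γ.elt)) (path_famChain Γs)

variable (A) in
/-- The underlying data of the evaluation of families at elements. -/
def counitHom : VDGraphHom (eltsGraph (toSpan.{u, v} A)) A.toVDGraph where
  vert :=
    { obj := fun a => a.obj.fam a.elt
      map := fun f => castCod f.map f.map_elt
      map_id := fun a => rfl
      map_comp := fun f g => castCod_comp f.map g.map f.map_elt g.map_elt _ }
  hor Γ := Γ.hor.fam Γ.elt
  cell {a a' b b' Γs f f' Δ} θ := castCell f.map_elt f'.map_elt θ.cell_elt (path_famChain Γs)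
    (θ.cell.cell (famChain Γs))

theorem counitHom_cell_heq {a a' b b' : EltsObj (toSpan.{u, v} A)}
    {Γs : HPath (EltsHor (F := toSpan.{u, v} A)) a a'} {f : a ⟶ b} {f' : a' ⟶ b'} {Δ : EltsHor b b'}
    (θ : EltsCell Γs f f' Δ) :
    HEq ((counitHom A).cell θ) (FamCell.cell θ.cell (famChain Γs)) :=
  castCell_heq f.map_elt f'.map_elt θ.cell_elt (path_famChain Γs) (θ.cell.cell (famChain Γs))

theorem pushCons_heq {P P' P'' R R' R'' : FamObj.{u, v} A} {Γs : HPath (FamHor (A := A)) P P'}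
    {Δ : FamHor R R'} {Δs : HPath (FamHor (A := A)) R' R''} {f : P ⟶ R} {f' : P' ⟶ R'}
    {f'' : P'' ⟶ R''} (θ : FamCell Γs f f' Δ) {i : P.idx} {i' : P'.idx} {i'' : P''.idx}
    (c : FamChain Γs i i') (p : Fams.Push Δs f' f'' i' i'') {j : R.idx} {j' : R'.idx} {j'' :
        R''.idx}
    (h : f.fn i = j) (h' : f'.fn i' = j') (h'' : f''.fn i'' = j'') {s : Δ.span.Fiber j j'}
    (e : (θ.fn c).1 = s.1) {d : FamChain Δs j' j''} (hd : HEq p.chain d)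
    {πs : HPath A.Hor (P.fam i) (P'.fam i')} (eπ : Fams.path c = πs)
    {ρs : HPath A.Hor (R'.fam j') (R''.fam j'')} (eρ : Fams.path d = ρs)
    {κs : A.CellPath ρs (castCod f' h') (castCod f'' h'')} (hκ : HEq p.cells κs) :
    HEq (Fams.pushCons θ c p).chain
        (Chain.cons (H := FamHor (A := A)) (car := FamObj.idx)
          (fib := fun _ _ Γ i j => Γ.span.Fiber i j) s d) ∧
      HEq (Fams.pushCons θ c p).cells
        (VDGraph.CellPath.cons (castCell h h' e eπ (θ.cell c)) κs) := by
  subst h h' h'' eπ eρ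
  have e' : θ.fn c = s := Subtype.ext e
  subst e'
  obtain ⟨p, ps⟩ := p
  have hd' : p = d := eq_of_heq hd
  subst hd'
  have hκ' : ps = κs := eq_of_heq hκ
  subst hκ'
  exact ⟨HEq.rfl, HEq.rfl⟩

theorem push_famChain : ∀ {a a' b b' : EltsObj (toSpan.{u, v} A)}
    {Δs : HPath (EltsHor (F := toSpan.{u, v} A)) b b'} {f : a ⟶ b} {f' : a' ⟶ b'}
    (θs : (eltsGraph (toSpan.{u, v} A)).CellPath Δs f f'),
    HEq (Fams.push ((eltsForget (toSpan.{u, v} A)).mapCells θs) (Chain.cast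
        ((eltsForget (toSpan.{u, v} A)).top_mapCells θs).symm (famChain θs.top))).chain
        (famChain Δs) ∧
      HEq (Fams.push ((eltsForget (toSpan.{u, v} A)).mapCells θs) (Chain.cast
        ((eltsForget (toSpan.{u, v} A)).top_mapCells θs).symm (famChain θs.top))).cells
        ((counitHom A).mapCells θs)
  | ⟨a, i⟩, _, ⟨b, j⟩, _, _, _, _, .nil f => by
    have key : ∀ {a b : FamObj.{u, v} A} (f : a ⟶ b) {i : a.idx} {j : b.idx} (h : f.fn i = j),
        HEq (Chain.nil (H := FamHor (A := A)) (car := FamObj.idx)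
          (fib := fun _ _ Γ i j => Γ.span.Fiber i j) b (f.fn i))
          (Chain.nil (H := FamHor (A := A)) (car := FamObj.idx)
          (fib := fun _ _ Γ i j => Γ.span.Fiber i j) b j) ∧
        HEq (VDGraph.CellPath.nil (f.map i)) (VDGraph.CellPath.nil (castCod f h)) := by
      intro a b f i j h
      subst h
      exact ⟨HEq.rfl, HEq.rfl⟩
    exact key f.map f.map_elt
  | a, a'', b, b'', .cons Δ Δs, f, f'', .cons (Γs := Γs) (u' := f') θ θs => by
    have hc : Chain.cast ((eltsForget (toSpan.{u, v} A)).top_mapCells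
          (VDGraph.CellPath.cons θ θs)).symm (famChain (Γs.append θs.top)) =
        Chain.append (famChain Γs) (Chain.cast
          ((eltsForget (toSpan.{u, v} A)).top_mapCells θs).symm (famChain θs.top)) :=
      (congrArg (Chain.cast _) (famChain_append Γs θs.top)).trans
        ((Chain.cast_cast _ _ _).trans (Chain.append_cast _ _ _).symm)
    have hp : Fams.push ((eltsForget (toSpan.{u, v} A)).mapCells (.cons θ θs)) (Chain.cast
          ((eltsForget (toSpan.{u, v} A)).top_mapCells (VDGraph.CellPath.cons θ θs)).symm
          (famChain (Γs.append θs.top))) =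
        Fams.pushCons θ.cell (famChain Γs) (Fams.push ((eltsForget (toSpan.{u, v} A)).mapCells θs)
          (Chain.cast ((eltsForget (toSpan.{u, v} A)).top_mapCells θs).symm (famChain θs.top))) :=
      (congrArg (Fams.push _) hc).trans (Fams.push_cons _ _ _ _)
    obtain ⟨h₁, h₂⟩ := push_famChain θs
    obtain ⟨k₁, k₂⟩ := pushCons_heq θ.cell (famChain Γs) _ f.map_elt f'.map_elt f''.map_elt
      (s := Δ.elt) θ.cell_elt h₁ (path_famChain Γs) (path_famChain Δs) h₂
    exact ⟨(congr_arg_heq Fams.Push.chain hp).trans k₁, (congr_arg_heq Fams.Push.cells hp).trans k₂⟩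

theorem val_heq {P P' R R' S S' : FamObj.{u, v} A} {Δs : HPath (FamHor (A := A)) R R'} {f : P ⟶ R}
    {f' : P' ⟶ R'} {g : R ⟶ S} {g' : R' ⟶ S'} {Λ : FamHor S S'} (κ : FamCell Δs g g' Λ) {i : P.idx}
    {i' : P'.idx} (p : Fams.Push Δs f f' i i') {πs : HPath A.Hor (P.fam i) (P'.fam i')}
    (hp : p.cells.top = πs) {j : R.idx} {j' : R'.idx} {k : S.idx} {k' : S'.idx} (h : f.fn i = j)
    (h' : f'.fn i' = j') (l : g.fn j = k) (l' : g'.fn j' = k') {d : FamChain Δs j j'}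
    (hd : HEq p.chain d) {ρs : HPath A.Hor (R.fam j) (R'.fam j')} (eρ : Fams.path d = ρs)
    {κs : A.CellPath ρs (castCod f h) (castCod f' h')} (hκ : HEq p.cells κs)
    {s : Λ.span.Fiber k k'} (e : (κ.fn d).1 = s.1) {σs : HPath A.Hor (P.fam i) (P'.fam i')}
    (hσ : κs.top = σs) {w : P.fam i ⟶ S.fam k} {w' : P'.fam i' ⟶ S'.fam k'}
    (hw : castCod f h ≫ castCod g l = w) (hw' : castCod f' h' ≫ castCod g' l' = w') :
    HEq (Fams.val κ p hp).2 (A.comp κs (castCell l l' e eρ (κ.cell d)) hσ hw hw') := by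
  subst h h' l l' eρ hp
  have e' : κ.fn d = s := Subtype.ext e
  subst e'
  obtain ⟨p, ps⟩ := p
  have hd' : p = d := eq_of_heq hd
  subst hd'
  have hκ' : ps = κs := eq_of_heq hκ
  subst hκ' hσ hw hw'
  rfl

theorem comp_cell_heq {P P' R R' S S' : FamObj.{u, v} A} {Δs : HPath (FamHor (A := A)) R R'}
    {f : P ⟶ R} {f' : P' ⟶ R'} (θs : (famGraph.{u, v} A).CellPath Δs f f') {g : R ⟶ S} {g' : R' ⟶
        S'}
    {Λ : FamHor S S'} (κ : FamCell Δs g g' Λ) {Γs : HPath (FamHor (A := A)) P P'} {h : P ⟶ S}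
    {h' : P' ⟶ S'} (e : θs.top = Γs) (e₁ : f ≫ g = h) (e₂ : f' ≫ g' = h') {i : P.idx}
    {i' : P'.idx} (c : FamChain Γs i i') :
    HEq (FamCell.cell ((Fams.data.{u, v} A).comp θs κ e e₁ e₂) c)
      (Fams.val κ (Fams.push θs (Chain.cast e.symm c)) (Fams.push_top θs _)).2 := by
  subst e e₁ e₂
  rfl

variable (A) in
/-- The evaluation of families at elements. -/
def counit : VDFunctor (EltsVDC (toSpan.{u, v} A)) A where
  toVDGraphHom := counitHom A
  cell_id {a b} Γ := by
    refine eq_of_heq ((counitHom_cell_heq ((eltsData (toSpan.{u, v} A)).id Γ)).trans ?_)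
    exact (VDGraphHom.heq_cast (Y := A) rfl ((counitHom A).vert.map_id a).symm
      ((counitHom A).vert.map_id b).symm _).symm
  cell_comp {a a' b b' c c' Δs f f'} θs {g g' Λ} κ := by
    refine eq_of_heq ((counitHom_cell_heq ((eltsData (toSpan.{u, v} A)).comp θs κ rfl rfl
      rfl)).trans ?_)
    refine (comp_cell_heq ((eltsForget (toSpan.{u, v} A)).mapCells θs) κ.cell
      ((eltsForget (toSpan.{u, v} A)).top_mapCells θs) rfl rfl (famChain θs.top)).trans ?_
    obtain ⟨h₁, h₂⟩ := push_famChain θs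
    exact val_heq κ.cell _ _ (EltsMap.map_elt f) (EltsMap.map_elt f') (EltsMap.map_elt g)
      (EltsMap.map_elt g') h₁ (path_famChain Δs) h₂ (s := EltsHor.elt Λ) κ.cell_elt _ _ _

end FamVDC

/-! ### Evaluation along a functor to families -/

namespace FamVDC

variable {A B X Y : VDC.{max (u + 1) v}}

theorem toSpan_map (F : VDFunctor A B) :
    (FamVDC.map.{u, v} F).comp (toSpan B) = toSpan A := by
  refine VDFunctor.ext_cell rfl (fun _ => HEq.rfl) fun {P P' R R' Γs f f' Δ} θ => ?_
  refine heq_of_eq (Spans.ext_cell fun c => ?_)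
  refine (Spans.fn_cast (HPath.map_map _ _ _ _ _) rfl rfl
    ((Fams.spanHom B).cell ((Fams.mapHom F).cell θ)) c).trans ?_
  refine congrArg (fun d => (FamCell.fn θ d).1) ?_
  refine (Chain.unmap_unmap (Fams.mapVert F).obj (Fams.setVert B).obj
    (fun _ _ Γ => Fams.mapHor F Γ) (fun _ _ Γ => FamHor.span Γ) Γs _).symm.trans ?_
  refine congrArg (Fams.ofSpanChain Γs) ?_
  exact (Chain.cast_cast _ _ _).trans rfl

theorem cast_cell_heq {P P' R R' : FamObj.{u, v} A} {Γs Δs : HPath (FamHor (A := A)) P P'}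
    {f : P ⟶ R} {f' : P' ⟶ R'} {Δ : FamHor R R'} (e : Γs = Δs) (θ : FamCell Γs f f' Δ)
    {i : P.idx} {i' : P'.idx} (c : FamChain Δs i i') :
    HEq (FamCell.cell ((famGraph A).cast e rfl rfl θ) c) (θ.cell (Chain.cast e.symm c)) := by
  subst e; rfl

/-- The evaluation along a functor to families. -/
def down {b : VDFunctor X Span.{u, v}} (g : VDFunctor X (FamVDC.{u, v} A))
    (w : g.comp (toSpan A) = b) : VDFunctor (EltsVDC b) A :=
  (EltsVDC.map g w).comp (counit A)

variable {b : VDFunctor X Span.{u, v}}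

theorem down_cell_heq (g : VDFunctor X (FamVDC.{u, v} A)) (w : g.comp (toSpan A) = b)
    {x x' y y' : EltsObj b} {Γs : HPath (EltsHor (F := b)) x x'} {f : x ⟶ y} {f' : x' ⟶ y'}
    {Δ : EltsHor y y'} (θ : EltsCell Γs f f' Δ) :
    HEq ((down g w).cell θ) (FamCell.cell (g.cell θ.cell)
      (Chain.cast (EltsVDC.mapPath_eq g w Γs).symm (famChain (EltsVDC.mapPath g w Γs)))) := by
  refine (VDFunctor.comp_cell_heq (EltsVDC.map g w) (counit A) θ).trans ?_
  refine (counitHom_cell_heq ((EltsVDC.mapHom g w).cell θ)).trans ?_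
  exact cast_cell_heq (EltsVDC.mapPath_eq g w Γs) (g.cell θ.cell) _

theorem map_castCell (F : VDFunctor A B) {P P' R R' : FamObj.{u, v} A} {f : FamMap P R}
    {f' : FamMap P' R'} {i : P.idx} {i' : P'.idx} {j : R.idx} {j' : R'.idx} (h : f.fn i = j)
    (h' : f'.fn i' = j') {Δ : FamHor R R'}
    {s : Δ.span.Fiber (f.fn i) (f'.fn i')} {t : Δ.span.Fiber j j'} (e : s.1 = t.1)
    {πs ρs : HPath A.Hor (P.fam i) (P'.fam i')} (eπ : πs = ρs)
    (θ : A.Cell πs (f.map i) (f'.map i') (Δ.fam s)) :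
    HEq (F.cell (castCell h h' e eπ θ)) (F.cell θ) := by
  subst h h' eπ
  have e' : s = t := Subtype.ext e
  subst e'
  rfl

theorem map_castCod (F : VDFunctor A B) {P R : FamObj.{u, v} A} (f : FamMap P R) {i : P.idx}
    {j : R.idx} (h : f.fn i = j) :
    castCod ((Fams.mapVert F).map f) h = F.vert.map (castCod f h) := by
  subst h; rfl

theorem unmap_famChain (F : VDFunctor A B) : ∀ {a b : EltsObj (toSpan.{u, v} A)}
    (Γs : HPath (EltsHor (F := toSpan.{u, v} A)) a b)
    (e : (eltsForget (toSpan B)).path (EltsVDC.mapPath (FamVDC.map F) (toSpan_map F) Γs) =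
      (FamVDC.map F).path ((eltsForget (toSpan A)).path Γs)),
    Fams.unmap F ((eltsForget (toSpan A)).path Γs)
      (Chain.cast e (famChain (EltsVDC.mapPath (FamVDC.map F) (toSpan_map F) Γs))) = famChain Γs
  | _, _, .nil _, _ => rfl
  | _, _, .cons Γ Γs, e => by
    have h := Chain.cast_cons (H := FamHor (A := B)) (car := FamObj.idx)
      (fib := fun _ _ Γ i j => Γ.span.Fiber i j) (Γ := Fams.mapHor F Γ.hor) Γ.elt
      (famChain (EltsVDC.mapPath (FamVDC.map F) (toSpan_map F) Γs))
      (EltsVDC.mapPath_eq (FamVDC.map F) (toSpan_map F) Γs).symm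
    refine (congrArg (Fams.unmap F ((eltsForget (toSpan A)).path (.cons Γ Γs))) h).trans ?_
    exact congrArg (Chain.cons (H := FamHor (A := A)) (car := FamObj.idx)
      (fib := fun _ _ Γ i j => Γ.span.Fiber i j) (Γ := Γ.hor) Γ.elt) (unmap_famChain F Γs _)

theorem counit_naturality (F : VDFunctor A B) :
    (EltsVDC.map (FamVDC.map.{u, v} F) (toSpan_map F)).comp (counit B) = (counit A).comp F := by
  refine VDFunctor.ext_cell ?_ (fun _ => HEq.rfl) fun {x x' y y' Γs f f' Δ} θ => ?_
  · exact CategoryTheory.Functor.hext (fun _ => rfl) fun _ _ f =>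
      heq_of_eq (map_castCod F (EltsMap.map f) (EltsMap.map_elt f))
  · refine (down_cell_heq (FamVDC.map F) (toSpan_map F) θ).trans ?_
    refine (VDGraphHom.heq_cast (Y := B) _ rfl rfl _).trans ?_
    refine (Fams.fcell_congr F (EltsCell.cell θ) (unmap_famChain F Γs _)).trans ?_
    refine HEq.trans ?_ (VDFunctor.comp_cell_heq (counit A) F θ).symm
    exact (map_castCell F (EltsMap.map_elt f) (EltsMap.map_elt f') θ.cell_elt (path_famChain Γs)
      (θ.cell.cell (famChain Γs))).symm

theorem down_congr {b : VDFunctor X Span.{u, v}} {g g' : VDFunctor X (FamVDC.{u, v} A)}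
    (e : g = g') (w : g.comp (toSpan A) = b) (w' : g'.comp (toSpan A) = b) :
    down g w = down g' w' := by
  subst e; rfl

theorem map_down {b : VDFunctor X Span.{u, v}} {c : VDFunctor Y Span.{u, v}} (h : VDFunctor X Y)
    (w : h.comp c = b) (g : VDFunctor Y (FamVDC.{u, v} A)) (w' : g.comp (toSpan A) = c)
    (w'' : (h.comp g).comp (toSpan A) = b) :
    (EltsVDC.map h w).comp (down g w') = down (h.comp g) w'' :=
  (VDFunctor.assoc _ _ _).symm.trans
    (congrArg (fun K => VDFunctor.comp K (counit A)) (EltsVDC.map_comp h w g w' w'').symm)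

theorem down_comp {b : VDFunctor X Span.{u, v}} (g : VDFunctor X (FamVDC.{u, v} A))
    (w : g.comp (toSpan A) = b) (F : VDFunctor A B)
    (w' : (g.comp (FamVDC.map F)).comp (toSpan B) = b) :
    (down g w).comp F = down (g.comp (FamVDC.map F)) w' := by
  refine (VDFunctor.assoc _ _ _).trans ?_
  refine (congrArg ((EltsVDC.map g w).comp) (counit_naturality F).symm).trans ?_
  refine (VDFunctor.assoc _ _ _).symm.trans ?_
  exact congrArg (fun K => VDFunctor.comp K (counit B)) (EltsVDC.map_comp g w _ _ w').symm

theorem const_toSpan (b : VDFunctor X Span.{u, v}) : (const b).comp (toSpan X) = b :=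
  (congrArg (fun K => VDFunctor.comp K (toSpan X)) (unit_proj b)).symm.trans
    ((VDFunctor.assoc _ _ _).trans ((congrArg ((unit b).comp) (toSpan_map _)).trans
      (unit_toSpan b)))

theorem down_const (b : VDFunctor X Span.{u, v}) (w : (const b).comp (toSpan X) = b) :
    down (const b) w = EltsVDC.proj b := by
  refine VDFunctor.ext_cell ?_ (fun _ => HEq.rfl) fun {x x' y y' Γs f f' Δ} θ => ?_
  · have key : ∀ {x y : X.Obj} (f : x ⟶ y) {i : SpanObj.carrier (b.vert.obj x)}
        {j : SpanObj.carrier (b.vert.obj y)} (h : SpanMap.fn (b.vert.map f) i = j),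
        castCod ((const b).vert.map f) (i := i) (j := j) h = f := by
      intro x y f i j h
      subst h; rfl
    exact CategoryTheory.Functor.hext (fun _ => rfl) fun x y f =>
      heq_of_eq (key (EltsMap.map f) (EltsMap.map_elt f))
  · refine (down_cell_heq (const b) w θ).trans ?_
    exact VDGraphHom.heq_cast (Y := X) _ rfl rfl (EltsCell.cell θ)

theorem down_unit (b : VDFunctor X Span.{u, v}) (w : (unit b).comp (toSpan (EltsVDC b)) = b) :
    down (unit b) w = VDFunctor.id (EltsVDC b) := by
  refine VDFunctor.ext_faithful (ι := Unit) (fun _ => EltsVDC.proj b)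
    (fun θ κ h => eltsForget_inj θ κ (h ())) ?_ (fun _ => HEq.rfl) fun _ => ?_
  · have key : ∀ {x y : X.Obj} (f : x ⟶ y) {i : SpanObj.carrier (b.vert.obj x)}
        {j : SpanObj.carrier (b.vert.obj y)} (h : SpanMap.fn (b.vert.map f) i = j),
        castCod ((unit b).vert.map f) (i := i) (j := j) h =
          (⟨f, h⟩ : EltsMap (F := b) ⟨x, i⟩ ⟨y, j⟩) := by
      intro x y f i j h
      subst h; rfl
    exact CategoryTheory.Functor.hext (fun _ => rfl) fun x y f =>
      heq_of_eq (key (EltsMap.map f) (EltsMap.map_elt f))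
  · refine (down_comp (unit b) w (EltsVDC.proj b) ((VDFunctor.assoc _ _ _).trans
      ((congrArg ((unit b).comp) (toSpan_map _)).trans w))).trans ?_
    refine (down_congr (unit_proj b) _ (const_toSpan b)).trans ?_
    exact (down_const b _).trans (VDFunctor.id_comp _).symm

end FamVDC

namespace FamVDC

variable {A B X Y : VDC.{max (u + 1) v}}

theorem unitChain_down (g : VDFunctor X (FamVDC.{u, v} A)) : ∀ {x y : X.Obj}
    (Γs : HPath X.Hor x y) {i : FamObj.idx (g.vert.obj x)} {j : FamObj.idx (g.vert.obj y)}
    (c : FamChain (g.path Γs) i j)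
    (e : g.path Γs = (unitPath (g.comp (toSpan A)) Γs).map (Fams.mapVert (down g rfl)).obj
      (fun _ _ Γ => Fams.mapHor (down g rfl) Γ))
    (e' : (g.comp (toSpan A)).path Γs = Fams.spanPath (A := A) (g.path Γs)),
    Fams.ofSpanChain (A := A) (g.path Γs) (Chain.cast e' (unitChain (g.comp (toSpan A)) Γs
      (Fams.unmap (down g rfl) (unitPath (g.comp (toSpan A)) Γs) (Chain.cast e c)))) = c
  | _, _, .nil _, _, _, _, _, _ => rfl
  | x, y, .cons (B := z) Γ Γs, i, j, c, e, e' => by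
    obtain ⟨k, s, c⟩ := c
    have h := Chain.cast_cons (H := FamHor (A := A)) (car := FamObj.idx)
      (fib := fun _ _ Γ i j => Γ.span.Fiber i j) (Γ := g.hor Γ) s c
      (HPath.map_map (H' := FamHor (A := EltsVDC (g.comp (toSpan A)))) (H'' := FamHor (A := A))
        (unitObj (g.comp (toSpan A))) (Fams.mapVert (down g rfl)).obj
        (fun _ _ Γ => unitHor (g.comp (toSpan A)) Γ)
        (fun _ _ Γ => Fams.mapHor (down g rfl) Γ) Γs).symm
    refine (congrArg (fun d => Fams.ofSpanChain (A := A) (g.path (.cons Γ Γs)) (Chain.cast e'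
      (unitChain (g.comp (toSpan A)) (.cons Γ Γs)
      (Fams.unmap (down g rfl) (unitPath (g.comp (toSpan A)) (.cons Γ Γs)) d)))) h).trans ?_
    have h' := Chain.cast_cons (H := SpanHor.{u, v}) (Γ := FamHor.span (g.hor Γ)) s
      (unitChain (g.comp (toSpan A)) Γs (Fams.unmap (down g rfl) (unitPath (g.comp (toSpan A)) Γs)
        (Chain.cast (HPath.map_map (H' := FamHor (A := EltsVDC (g.comp (toSpan A))))
        (H'' := FamHor (A := A))
        (unitObj (g.comp (toSpan A))) (Fams.mapVert (down g rfl)).obj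
        (fun _ _ Γ => unitHor (g.comp (toSpan A)) Γ)
        (fun _ _ Γ => Fams.mapHor (down g rfl) Γ) Γs).symm c)))
      (VDFunctor.path_comp g (toSpan A) Γs)
    refine (congrArg (Fams.ofSpanChain (A := A) (g.path (.cons Γ Γs))) h').trans ?_
    exact congrArg (Chain.cons (H := FamHor (A := A)) (car := FamObj.idx)
      (fib := fun _ _ Γ i j => Γ.span.Fiber i j) (Γ := g.hor Γ) s) (unitChain_down g Γs c _ _)

theorem famChain_mapPath (g : VDFunctor X (FamVDC.{u, v} A)) : ∀ {x y : X.Obj}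
    (Γs : HPath X.Hor x y) {i : FamObj.idx (g.vert.obj x)} {j : FamObj.idx (g.vert.obj y)}
    (d : FamChain (unitPath (g.comp (toSpan A)) Γs) i j)
    (e : (eltsForget (toSpan A)).path (EltsVDC.mapPath g rfl (Fams.path d)) = g.path Γs)
    (e' : (g.comp (toSpan A)).path Γs = Fams.spanPath (A := A) (g.path Γs)),
    Chain.cast e (famChain (EltsVDC.mapPath g rfl (Fams.path d))) =
      Fams.ofSpanChain (A := A) (g.path Γs) (Chain.cast e' (unitChain (g.comp (toSpan A)) Γs d))
  | _, _, .nil _, _, _, d, _, _ => by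
    obtain ⟨⟨rfl⟩⟩ := d; rfl
  | x, y, .cons (B := z) Γ Γs, i, j, d, e, e' => by
    obtain ⟨k, s, d⟩ := d
    have e₀ : (eltsForget (toSpan A)).path (EltsVDC.mapPath g rfl (Fams.path d)) = g.path Γs :=
      (EltsVDC.mapPath_eq g rfl (Fams.path d)).symm.trans
        (congrArg g.path (path_unit (g.comp (toSpan A)) Γs d))
    have h := Chain.cast_cons (H := FamHor (A := A)) (car := FamObj.idx)
      (fib := fun _ _ Γ i j => Γ.span.Fiber i j) (Γ := g.hor Γ) s
      (famChain (EltsVDC.mapPath g rfl (Fams.path d))) e₀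
    refine h.trans ?_
    have h' := Chain.cast_cons (H := SpanHor.{u, v}) (Γ := FamHor.span (g.hor Γ)) s
      (unitChain (g.comp (toSpan A)) Γs d) (VDFunctor.path_comp g (toSpan A) Γs)
    refine Eq.trans ?_ (congrArg (Fams.ofSpanChain (A := A) (g.path (.cons Γ Γs))) h').symm
    exact congrArg (Chain.cons (H := FamHor (A := A)) (car := FamObj.idx)
      (fib := fun _ _ Γ i j => Γ.span.Fiber i j) (Γ := g.hor Γ) s)
      (famChain_mapPath g Γs d e₀ (VDFunctor.path_comp g (toSpan A) Γs))

theorem cell_congr_heq {P P' R R' : FamObj.{u, v} A} {Γs Δs : HPath (FamHor (A := A)) P P'}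
    {f g : P ⟶ R} {f' g' : P' ⟶ R'} {Δ : FamHor R R'} (e : Γs = Δs) (h : f = g) (h' : f' = g')
    {θ : FamCell Γs f f' Δ}
    {κ : FamCell Δs g g' Δ} (hθ : HEq θ κ) {i : P.idx} {i' : P'.idx} {c : FamChain Γs i i'}
    {d : FamChain Δs i i'} (hc : Chain.cast e c = d) : HEq (θ.cell c) (κ.cell d) := by
  subst e h h' hc
  rw [eq_of_heq hθ]
  rfl

/-- A functor to families is determined by its indexing functor and its evaluation. -/
theorem unit_down {b : VDFunctor X Span.{u, v}} (g : VDFunctor X (FamVDC.{u, v} A))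
    (w : g.comp (toSpan A) = b) : (unit b).comp (FamVDC.map (down g w)) = g := by
  subst w
  refine VDFunctor.ext_cell rfl (fun _ => HEq.rfl) fun {x x' y y' Γs f f' Δ} θ => ?_
  refine (VDFunctor.comp_cell_heq (unit _) (FamVDC.map (down g rfl)) θ).trans ?_
  have e : (unitPath (g.comp (toSpan A)) Γs).map (Fams.mapVert (down g rfl)).obj
      (fun _ _ Γ => Fams.mapHor (down g rfl) Γ) = g.path Γs :=
    HPath.map_map (H' := FamHor (A := EltsVDC (g.comp (toSpan A)))) (H'' := FamHor (A := A))
        (unitObj (g.comp (toSpan A))) (Fams.mapVert (down g rfl)).obj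
        (fun _ _ Γ => unitHor (g.comp (toSpan A)) Γ)
        (fun _ _ Γ => Fams.mapHor (down g rfl) Γ) Γs
  have hu : ∀ {i : FamObj.idx (g.vert.obj x)} {j : FamObj.idx (g.vert.obj x')}
      (c : FamChain (g.path Γs) i j), _ = c := fun c =>
    unitChain_down g Γs c e.symm (VDFunctor.path_comp g (toSpan A) Γs)
  refine Fams.heq_cell (A := A) e (fun c => ?_) (fun c => ?_)
  · refine (Spans.fn_cast (VDFunctor.path_comp g (toSpan A) Γs).symm rfl rfl
      ((Fams.spanHom A).cell (g.cell θ)) _).trans ?_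
    exact congrArg (fun d => (FamCell.fn (g.cell θ) d).1) (hu c)
  · refine (VDGraphHom.heq_cast (Y := A) _ rfl rfl _).trans ?_
    set d := Fams.unmap (down g rfl) (unitPath (g.comp (toSpan A)) Γs) (Chain.cast e.symm c)
    refine (down_cell_heq g rfl (FamCell.cell ((unitHom (g.comp (toSpan A))).cell θ) d)).trans ?_
    refine cell_congr_heq (A := A) (congrArg g.path (path_unit (g.comp (toSpan A)) Γs d)) rfl rfl
      (VDFunctor.cell_cast_heq g (path_unit (g.comp (toSpan A)) Γs d).symm rfl rfl θ) ?_
    refine (Chain.cast_cast _ _ _).trans ?_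
    exact (famChain_mapPath g Γs d _ (VDFunctor.path_comp g (toSpan A) Γs)).trans (hu c)

end FamVDC

namespace TwoCat

open Bicategory

theorem Counit.isUniversal_of_faithful {K : Type*} [Bicategory K] {L : Type*} [Bicategory L]
    [Strict K] [Strict L] {F : StrictPseudofunctor K L} {G : StrictPseudofunctor L K}
    (ev : Counit F G) (u : ∀ X : K, X ⟶ G.obj (F.obj X))
    (left : ∀ X : K, F.map (u X) ≫ ev.app (F.obj X) = 𝟙 (F.obj X)) (Y : L)
    (key : ∀ {X : K} (g : X ⟶ G.obj Y), u X ≫ G.map (F.map g ≫ ev.app Y) = g)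
    (uniq₂ : ∀ {X : K} {g g' : X ⟶ G.obj Y} (β β' : g ⟶ g'),
      F.map₂ β ▷ ev.app Y = F.map₂ β' ▷ ev.app Y → β = β') :
    IsUniversal F (ev.app Y) := by
  have key' : ∀ {X : K} (f : F.obj X ⟶ Y),
      F.map (u X ≫ G.map f) ≫ ev.app Y = f := fun {X} f => by
    rw [F.map_comp, Strict.assoc, ev.naturality, ← Strict.assoc, left, Strict.id_comp]
  have key₂' : ∀ {X : K} {f f' : F.obj X ⟶ Y} (α : f ⟶ f'),
      HEq (F.map₂ (u X ◁ G.map₂ α) ▷ ev.app Y) α := fun {X f f'} α => by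
    refine (whiskerRight_heq (F.map_comp _ _) (F.map_comp _ _)
      (map₂_whiskerLeft_heq F (u X) (G.map₂ α)) rfl).trans ?_
    refine (whisker_assoc_heq _ _ _).trans ?_
    refine (whiskerLeft_heq rfl (ev.naturality f) (ev.naturality f')
      (ev.naturality₂ α)).trans ?_
    refine (whiskerLeft_whiskerLeft_heq _ _ _).trans ?_
    refine (whiskerLeft_heq (left X) rfl rfl HEq.rfl).trans ?_
    exact id_whiskerLeft_heq _
  refine ⟨fun {X} f => ⟨_, key' f⟩, fun {X} g g' e => ?_, fun {X g g'} α => ?_, uniq₂⟩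
  · rw [← key g, ← key g', e]
  · refine ⟨eqToHom (key g).symm ≫ (u X ◁ G.map₂ α) ≫ eqToHom (key g'), ?_⟩
    refine eq_of_heq ((whiskerRight_heq ?_ ?_ (map₂_heq F (key g).symm (key g').symm
      (conj_heq _ _ _)) rfl).trans (key₂' α))
    · rw [key]
    · rw [key]

end TwoCat

theorem VDTrans.hext {X Y : VDC.{v}} {F F' G G' : VDFunctor X Y} (e : F = F') (e' : G = G')
    {α : VDTrans F G} {β : VDTrans F' G'} (hv : ∀ A, HEq (α.vert.app A) (β.vert.app A))
    (hc : ∀ {A B : X.Obj} (Γ : X.Hor A B), HEq (α.cell Γ) (β.cell Γ)) : HEq α β := by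
  subst e e'
  exact heq_of_eq (VDTrans.ext_heq (fun A => eq_of_heq (hv A)) hc)

namespace FamVDC

variable {A B X Y : VDC.{max (u + 1) v}}

theorem map_ext_castCod {P R : FamObj.{u, v} A} {f f' : FamMap P R}
    (h : ∀ i, ∃ (j : R.idx) (h : f.fn i = j) (h' : f'.fn i = j), castCod f h = castCod f' h') :
    f = f' := by
  rcases f with ⟨f, φ⟩
  rcases f' with ⟨f', φ'⟩
  have e : f = f' := funext fun i => by
    obtain ⟨j, h₁, h₂, -⟩ := h i
    exact h₁.trans h₂.symm
  subst e
  refine congrArg (FamMap.mk f) (funext fun i => ?_)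
  obtain ⟨j, h₁, h₂, h₃⟩ := h i
  have h₁' := h₁
  change f i = j at h₁'
  subst h₁'
  exact h₃

theorem heq_cell_of_eq {P P' R R' : FamObj.{u, v} A} {Γs Γs' : HPath (FamHor (A := A)) P P'}
    {f g : P ⟶ R} {f' g' : P' ⟶ R'} {Δ : FamHor R R'} {θ : FamCell Γs f f' Δ}
    {κ : FamCell Γs' g g' Δ} (e : Γs = Γs') (hf : f = g) (hf' : f' = g')
    (h : ∀ {i : P.idx} {i' : P'.idx} (c : FamChain Γs' i i'),
      (θ.fn (c.cast e.symm)).1 = (κ.fn c).1)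
    (h' : ∀ {i : P.idx} {i' : P'.idx} (c : FamChain Γs' i i'),
      HEq (θ.cell (c.cast e.symm)) (κ.cell c)) : HEq θ κ := by
  subst hf hf'
  exact Fams.heq_cell e h h'

variable {t : VDFunctor (FamVDC.{u, v} A) Span.{u, v}}
  {b : VDFunctor X Span.{u, v}} {g g' : VDFunctor X (FamVDC.{u, v} A)}

theorem map₂_down_faithful (wt : (VDFunctor.id (FamVDC.{u, v} A)).comp (toSpan A) = t)
    (w : g.comp t = b) (w' : g'.comp t = b) (β β' : VDTrans g g')
    (hβ : VDTrans.whiskerRight β t = eqToHom (w.trans w'.symm))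
    (hβ' : VDTrans.whiskerRight β' t = eqToHom (w.trans w'.symm))
    (h : VDTrans.whiskerRight (EltsVDC.map₂ w w' β hβ) (down (VDFunctor.id _) wt) =
      VDTrans.whiskerRight (EltsVDC.map₂ w w' β' hβ') (down (VDFunctor.id _) wt)) : β = β' := by
  subst wt
  subst w
  have hv : ∀ x, β.vert.app x = β'.vert.app x := fun x => by
    refine map_ext_castCod (A := A) fun i => ⟨_,
      EltsMap.map_elt ((EltsVDC.map₂ rfl w' β hβ).vert.app ⟨x, i⟩),
      EltsMap.map_elt ((EltsVDC.map₂ rfl w' β' hβ').vert.app ⟨x, i⟩), ?_⟩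
    exact congrArg (fun γ : VDTrans ((EltsVDC.map g rfl).comp (down (VDFunctor.id _) rfl))
      ((EltsVDC.map g' w').comp (down (VDFunctor.id _) rfl)) => γ.vert.app ⟨x, i⟩) h
  refine VDTrans.ext_heq hv fun {x y} Γ => ?_
  refine heq_cell_of_eq (A := A) rfl (hv x) (hv y) (fun {i j} c => ?_) (fun {i j} c => ?_)
  · obtain ⟨k, s, ⟨⟨rfl⟩⟩⟩ := c
    let e : EltsHor (F := g.comp ((VDFunctor.id (FamVDC A)).comp (toSpan A))) ⟨x, i⟩ ⟨y, k⟩ :=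
      ⟨Γ, s⟩
    exact ((EltsVDC.map₂ rfl w' β hβ).cell e).cell_elt.trans
      ((EltsVDC.map₂ rfl w' β' hβ').cell e).cell_elt.symm
  · obtain ⟨k, s, ⟨⟨rfl⟩⟩⟩ := c
    let e : EltsHor (F := g.comp ((VDFunctor.id (FamVDC A)).comp (toSpan A))) ⟨x, i⟩ ⟨y, k⟩ :=
      ⟨Γ, s⟩
    exact (down_cell_heq (VDFunctor.id (FamVDC.{u, v} A)) rfl
        ((EltsVDC.map₂ rfl w' β hβ).cell e)).symm.trans
      ((VDTrans.cell_heq rfl rfl (heq_of_eq h) e).trans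
        (down_cell_heq (VDFunctor.id (FamVDC.{u, v} A)) rfl ((EltsVDC.map₂ rfl w' β' hβ').cell e)))

theorem map₂_down_heq {X Y : VDC.{max (u + 1) v}} {F G : VDFunctor X Y} (η : VDTrans F G)
    {tX : VDFunctor (FamVDC.{u, v} X) Span.{u, v}} {tY : VDFunctor (FamVDC.{u, v} Y) Span.{u, v}}
    (wX : (VDFunctor.id (FamVDC.{u, v} X)).comp (toSpan X) = tX)
    (wY : (VDFunctor.id (FamVDC.{u, v} Y)).comp (toSpan Y) = tY)
    (wF : (FamVDC.map F).comp tY = tX) (wG : (FamVDC.map G).comp tY = tX)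
    (hη : VDTrans.whiskerRight (FamVDC.map₂ η) tY = eqToHom (wF.trans wG.symm))
    (nF : (EltsVDC.map (FamVDC.map F) wF).comp (down (VDFunctor.id _) wY) =
      (down (VDFunctor.id _) wX).comp F)
    (nG : (EltsVDC.map (FamVDC.map G) wG).comp (down (VDFunctor.id _) wY) =
      (down (VDFunctor.id _) wX).comp G) :
    HEq (VDTrans.whiskerRight (EltsVDC.map₂ wF wG (FamVDC.map₂ η) hη) (down (VDFunctor.id _) wY))
      (VDTrans.whiskerLeft (down (VDFunctor.id _) wX) η) := by
  subst wX wY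
  refine VDTrans.hext nF nG (fun a => HEq.rfl) fun {a b} Γ => ?_
  refine (down_cell_heq (VDFunctor.id (FamVDC.{u, v} Y)) rfl
    ((EltsVDC.map₂ wF wG (FamVDC.map₂ η) hη).cell Γ)).trans ?_
  exact HEq.rfl

theorem famOne_arr (A : VDC.{max (u + 1) v}) :
    (VDFunctor.id (FamVDC.{u, v} A)).comp (toSpan A) = (FamOne.{u, v}.obj A).arr :=
  (VDFunctor.id_comp _).trans (toSpan_map (VDC.toUnit A)).symm

theorem eltsCounit_naturality (F : VDFunctor A B)
    (w : (FamVDC.map F).comp (FamOne.{u, v}.obj B).arr = (FamOne.{u, v}.obj A).arr) :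
    (EltsVDC.map (FamVDC.map F) w).comp (down (VDFunctor.id _) (famOne_arr B)) =
      (down (VDFunctor.id _) (famOne_arr A)).comp F := by
  have w₁ : ((VDFunctor.id (FamVDC.{u, v} A)).comp (FamVDC.map F)).comp (toSpan B) =
      (FamOne.{u, v}.obj A).arr :=
    (VDFunctor.assoc _ _ _).trans ((congrArg (VDFunctor.comp _) (toSpan_map F)).trans
      (famOne_arr A))
  refine (map_down (FamVDC.map F) w (VDFunctor.id _) (famOne_arr B) ((VDFunctor.assoc _ _ _).trans
    ((congrArg (VDFunctor.comp _) (famOne_arr B)).trans w))).trans ?_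
  refine (down_congr ((VDFunctor.comp_id _).trans (VDFunctor.id_comp _).symm) _ w₁).trans ?_
  exact (down_comp (VDFunctor.id _) (famOne_arr A) F w₁).symm

open TwoCat in
/-- The evaluation of families at elements, as a counit. -/
def eltsCounit : Counit Elts.{u, v} FamOne.{u, v} where
  app A := down (VDFunctor.id _) (famOne_arr A)
  naturality {A B} F := eltsCounit_naturality F (FamOne.{u, v}.map F).w
  naturality₂ {A B F G} η :=
    map₂_down_heq η (famOne_arr A) (famOne_arr B) (FamOne.{u, v}.map F).w (FamOne.{u, v}.map G).w
      (FamOne.{u, v}.map₂ η).w (eltsCounit_naturality F _) (eltsCounit_naturality G _)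

open TwoCat in
/-- The families of elements, as a morphism over the virtual double category of spans. -/
def eltsUnit (P : Slice Span.{u, v}) : P ⟶ FamOne.{u, v}.obj (Elts.{u, v}.obj P) :=
  (⟨unit P.arr, (congrArg (VDFunctor.comp _) (toSpan_map (VDC.toUnit _))).trans
    (unit_toSpan P.arr)⟩ : Slice.Hom P (FamOne.{u, v}.obj (Elts.{u, v}.obj P)))

open TwoCat in
theorem eltsCounit_isUniversal (A : VDC.{max (u + 1) v}) :
    IsUniversal Elts.{u, v} (G := FamOne.{u, v}.obj A) (eltsCounit.{u, v}.app A) := by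
  refine eltsCounit.isUniversal_of_faithful eltsUnit (fun P => ?_) A (fun {P} g => ?_)
    fun {P g g'} β β' h => ?_
  · have w : ((unit P.arr).comp (VDFunctor.id (FamVDC (EltsVDC P.arr)))).comp
        (toSpan (EltsVDC P.arr)) = P.arr :=
      (congrArg (fun k => VDFunctor.comp k _) (VDFunctor.comp_id _)).trans (unit_toSpan P.arr)
    refine (map_down (unit P.arr) (eltsUnit P).w (VDFunctor.id _) (famOne_arr _) w).trans ?_
    exact (down_congr (VDFunctor.comp_id _) w (unit_toSpan P.arr)).trans (down_unit P.arr _)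
  · refine Slice.Hom.ext ?_
    have w : (VDFunctor.comp g.hom (VDFunctor.id (FamVDC A))).comp (toSpan A) = P.arr :=
      (VDFunctor.assoc _ _ _).trans ((congrArg (VDFunctor.comp _) (famOne_arr A)).trans g.w)
    have h := map_down g.hom g.w (VDFunctor.id _) (famOne_arr A) w
    refine (congrArg (fun k => (unit P.arr).comp (FamVDC.map k)) h).trans ?_
    exact (unit_down _ w).trans (VDFunctor.comp_id _)
  · refine Slice.Hom₂.ext ?_
    exact map₂_down_faithful (famOne_arr A) g.w g'.w β.hom β'.hom β.w β'.w h

open TwoCat in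
theorem elts_adjunction : Nonempty (TwoAdjunction Elts.{u, v} FamOne.{u, v}) :=
  nonempty_twoAdjunction eltsCounit eltsCounit_isUniversal

end FamVDC

/-! ### The polynomial 2-functor -/

namespace TwoCat

open Bicategory

section

variable {K : Type*} [Bicategory K] [Strict K] {L : Type*} [Bicategory L] [Strict L]
  {M : Type*} [Bicategory M] [Strict M]

/-- The counit of a composite of 2-functors. -/
def Counit.comp {F' : StrictPseudofunctor K L} {G' : StrictPseudofunctor L K}
    {F : StrictPseudofunctor L M} {G : StrictPseudofunctor M L} (ev' : Counit F' G')
    (ev : Counit F G) : Counit (F'.comp F) (G.comp G') where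
  app Y := F.map (ev'.app (G.obj Y)) ≫ ev.app Y
  naturality {X Y} f := by
    refine (Strict.assoc _ _ _).symm.trans ?_
    refine (congrArg (fun k => k ≫ ev.app Y) ((F.map_comp _ _).symm.trans
      ((congrArg F.map (ev'.naturality (G.map f))).trans (F.map_comp _ _)))).trans ?_
    rw [Strict.assoc, ev.naturality]
    exact (Strict.assoc _ _ _).symm
  naturality₂ {X Y f g} η := by
    refine (whiskerRight_whiskerRight_heq (F.map₂ (F'.map₂ (G'.map₂ (G.map₂ η)))) _ _).symm.trans ?_
    have e : ∀ f : X ⟶ Y, F.map (F'.map (G'.map (G.map f))) ≫ F.map (ev'.app (G.obj Y)) =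
        F.map (ev'.app (G.obj X)) ≫ F.map (G.map f) := fun f =>
      (F.map_comp _ _).symm.trans ((congrArg F.map (ev'.naturality (G.map f))).trans
        (F.map_comp _ _))
    refine (whiskerRight_heq (e f) (e g) (η' := F.map (ev'.app (G.obj X)) ◁ F.map₂ (G.map₂ η))
      ?_ rfl).trans ?_
    · refine (map₂_whiskerRight_heq F _ _).symm.trans ?_
      refine (map₂_heq F (ev'.naturality _) (ev'.naturality _) (ev'.naturality₂ (G.map₂ η))).trans
          ?_
      exact map₂_whiskerLeft_heq F _ _
    · refine (whisker_assoc_heq _ _ _).trans ?_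
      refine (whiskerLeft_heq rfl (ev.naturality f) (ev.naturality g) (ev.naturality₂ η)).trans ?_
      exact whiskerLeft_whiskerLeft_heq _ _ _

/-- Forgetting the maps to the base of a slice. -/
def TwoNatTrans.forget {X : L} {F G : StrictPseudofunctor K (Slice X)} (i : TwoNatTrans F G) :
    TwoNatTrans (F.comp (Slice.forget X)) (G.comp (Slice.forget X)) where
  app A := (i.app A).hom
  naturality f := congrArg Slice.Hom.hom (i.naturality f)
  naturality₂ {A B f g} η := by
    have h := congrArg Slice.Hom₂.hom (i.naturality₂ η)
    rw [Slice.hom₂_comp, Slice.hom₂_comp, Slice.hom₂_eqToHom, Slice.hom₂_eqToHom] at h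
    exact h

end

end TwoCat

open TwoCat in
theorem polyOne_iso (S : StrictPseudofunctor (Slice SpanPt.{u, v}) (Slice Span.{u, v}))
    (h : TwoAdjunction QStar.{u, v} S) : Nonempty (TwoNatIso FamOne.{u, v} (polyOne S)) :=
  nonempty_twoNatIso (F := Elts.{u, v}) FamVDC.eltsCounit
    (h.counit.toCounit.comp (prodOverSnd (VDProd.twoProduct SpanPt.{u, v})).toCounit)
    FamVDC.eltsCounit_isUniversal fun A => IsUniversal.comp
      (prodOver_isUniversal (VDProd.twoProduct SpanPt.{u, v}) A) (h.isUniversal _)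

open TwoCat in
theorem poly_iso (S : StrictPseudofunctor (Slice SpanPt.{u, v}) (Slice Span.{u, v}))
    (h : TwoAdjunction QStar.{u, v} S) : Nonempty (TwoNatIso Fam.{u, v} (poly S)) := by
  obtain ⟨i⟩ := polyOne_iso S h
  exact ⟨⟨⟨i.hom.forget.app, i.hom.forget.naturality, i.hom.forget.naturality₂⟩,
    ⟨i.inv.forget.app, i.inv.forget.naturality, i.inv.forget.naturality₂⟩,
    fun A => congrArg Slice.Hom.hom (i.hom_inv A), fun A => congrArg Slice.Hom.hom (i.inv_hom A)⟩⟩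

open TwoCat in
theorem Q_powerful : ∃ S : StrictPseudofunctor (Slice SpanPt.{u, v}) (Slice Span.{u, v}),
    Nonempty (TwoAdjunction QStar.{u, v} S) :=
  exists_rightAdjoint QStar fun p => exists_universal_of_equalizers
    (fun f g => ⟨_, _, VDEq.isTwoEqualizer f g⟩) QStar FamOne FamVDC.eltsCounit.app
    FamVDC.eltsCounit.naturality FamVDC.eltsCounit_isUniversal p

open TwoCat in
theorem toSpan_unit_isIsoCell : IsIsoCell (X := Fam.{u, v}.obj VDC.unit) (Y := Span.{u, v})
    (FamVDC.toSpan.{u, v} VDC.unit) := by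
  have hu := FamVDC.eltsCounit_isUniversal.{u, v} VDC.unit
  let P : Slice Span.{u, v} := ⟨Span, VDFunctor.id Span⟩
  obtain ⟨g, -⟩ := hu.lift (X := P) (VDC.toUnit _)
  have e : (FamOne.{u, v}.obj VDC.unit).arr = FamVDC.toSpan VDC.unit :=
    FamVDC.toSpan_map (VDC.toUnit VDC.unit)
  have w : g.hom.comp (FamVDC.toSpan VDC.unit) = VDFunctor.id Span :=
    (congrArg (VDFunctor.comp g.hom) e.symm).trans g.w
  let k : FamOne.{u, v}.obj VDC.unit ⟶ FamOne.{u, v}.obj VDC.unit :=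
    (⟨(FamVDC.toSpan VDC.unit).comp g.hom, (VDFunctor.assoc _ _ _).trans
      ((congrArg (VDFunctor.comp _) g.w).trans ((VDFunctor.comp_id _).trans e.symm))⟩ :
      Slice.Hom _ _)
  have hk : k = 𝟙 _ := hu.uniq _ _ (VDC.toUnit_uniq _ _)
  exact ⟨g.hom, congrArg Slice.Hom.hom hk, w⟩

open TwoCat in
theorem fam_isRightTwoAdjoint : IsRightTwoAdjoint (toSlice Fam.{u, v} VDC.unitTerminal) := by
  let F := (Slice.sum (X := Fam.{u, v}.obj VDC.unit) (Y := Span.{u, v})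
    (FamVDC.toSpan.{u, v} VDC.unit)).comp Elts.{u, v}
  let ev : Counit F (toSlice Fam.{u, v} VDC.unitTerminal) :=
    { app := fun A => FamVDC.eltsCounit.{u, v}.app A
      naturality := fun f => FamVDC.eltsCounit.{u, v}.naturality f
      naturality₂ := fun η => FamVDC.eltsCounit.{u, v}.naturality₂ η }
  exact ⟨F, nonempty_twoAdjunction ev fun A => IsUniversal.sum toSpan_unit_isIsoCell
    (FamVDC.eltsCounit_isUniversal A)⟩

/-! ### Split fibrations from cleavages over an isomorphic base -/

namespace TwoCat

open Bicategory

section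

variable {K : Type*} [Bicategory K] [Strict K]

/-- A split cleavage of a 1-cell `q : E ⟶ C`, preserved by precomposition, with its laws stated up to
heterogeneous equality. -/
structure Cleavage {E C : K} (q : E ⟶ C) where
  pull : ∀ {X : K} (e : X ⟶ E) {b b' : X ⟶ C} (w : e ≫ q = b') (β : b ⟶ b'), X ⟶ E
  lift : ∀ {X : K} (e : X ⟶ E) {b b' : X ⟶ C} (w : e ≫ q = b') (β : b ⟶ b'), pull e w β ⟶ e
  pull_over : ∀ {X : K} (e : X ⟶ E) {b b' : X ⟶ C} (w : e ≫ q = b') (β : b ⟶ b'), pull e w β ≫ q = b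
  lift_over : ∀ {X : K} (e : X ⟶ E) {b b' : X ⟶ C} (w : e ≫ q = b') (β : b ⟶ b'),
    HEq (lift e w β ▷ q) β
  pull_id : ∀ {X : K} (e : X ⟶ E) {b : X ⟶ C} (w : e ≫ q = b), pull e w (𝟙 b) = e
  lift_id : ∀ {X : K} (e : X ⟶ E) {b : X ⟶ C} (w : e ≫ q = b), HEq (lift e w (𝟙 b)) (𝟙 e)
  pull_comp : ∀ {X : K} (e : X ⟶ E) {b b' b'' : X ⟶ C} (w : e ≫ q = b'') (γ : b ⟶ b')
    (β : b' ⟶ b''), pull e w (γ ≫ β) = pull (pull e w β) (pull_over e w β) γ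
  lift_comp : ∀ {X : K} (e : X ⟶ E) {b b' b'' : X ⟶ C} (w : e ≫ q = b'') (γ : b ⟶ b')
    (β : b' ⟶ b''), HEq (lift e w (γ ≫ β)) (lift (pull e w β) (pull_over e w β) γ ≫ lift e w β)
  factor : ∀ {X : K} (e : X ⟶ E) {b b' : X ⟶ C} (w : e ≫ q = b') (β : b ⟶ b') {g : X ⟶ E}
    (wg : g ≫ q = b) (γ : g ⟶ e), HEq (γ ▷ q) β →
      ∃ ν : g ⟶ pull e w β, HEq (ν ▷ q) (𝟙 b) ∧ ν ≫ lift e w β = γ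
  unique : ∀ {X : K} (e : X ⟶ E) {b b' : X ⟶ C} (w : e ≫ q = b') (β : b ⟶ b') {g : X ⟶ E}
    (wg : g ≫ q = b) (ν ν' : g ⟶ pull e w β), HEq (ν ▷ q) (𝟙 b) → HEq (ν' ▷ q) (𝟙 b) →
      ν ≫ lift e w β = ν' ≫ lift e w β → ν = ν'
  pull_precomp : ∀ {X Y : K} (f : Y ⟶ X) (e : X ⟶ E) {b b' : X ⟶ C} (w : e ≫ q = b') (β : b ⟶ b')
    (w' : (f ≫ e) ≫ q = f ≫ b'), f ≫ pull e w β = pull (f ≫ e) w' (f ◁ β)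
  lift_precomp : ∀ {X Y : K} (f : Y ⟶ X) (e : X ⟶ E) {b b' : X ⟶ C} (w : e ≫ q = b') (β : b ⟶ b')
    (w' : (f ≫ e) ≫ q = f ≫ b'), HEq (f ◁ lift e w β) (lift (f ≫ e) w' (f ◁ β))

namespace Cleavage

variable {E B C : K} {q : E ⟶ C} (c : Cleavage q)

theorem pull_congr {X : K} {e e₁ : X ⟶ E} {b b' b₁ b₁' : X ⟶ C} {w : e ≫ q = b'} {w₁ : e₁ ≫ q = b₁'}
    {β : b ⟶ b'} {β₁ : b₁ ⟶ b₁'} (he : e = e₁) (hb : b = b₁) (hb' : b' = b₁') (h : HEq β β₁) :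
    c.pull e w β = c.pull e₁ w₁ β₁ := by
  subst he hb hb'
  rw [eq_of_heq h]

theorem lift_congr {X : K} {e e₁ : X ⟶ E} {b b' b₁ b₁' : X ⟶ C} {w : e ≫ q = b'} {w₁ : e₁ ≫ q = b₁'}
    {β : b ⟶ b'} {β₁ : b₁ ⟶ b₁'} (he : e = e₁) (hb : b = b₁) (hb' : b' = b₁') (h : HEq β β₁) :
    HEq (c.lift e w β) (c.lift e₁ w₁ β₁) := by
  subst he hb hb'
  rw [eq_of_heq h]

theorem exists_lift {X : K} (e : X ⟶ E) {a b b' : X ⟶ C} (w : e ≫ q = b') (β : b ⟶ b')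
    {g : X ⟶ E} (wg : g ≫ q = a) (δ : a ⟶ b) (γ : g ⟶ e) (h : HEq (γ ▷ q) (δ ≫ β)) :
    ∃! χ : g ⟶ c.pull e w β, HEq (χ ▷ q) δ ∧ χ ≫ c.lift e w β = γ := by
  have hc := c.pull_comp e w δ β
  have hl : eqToHom hc ≫ c.lift (c.pull e w β) (c.pull_over e w β) δ ≫ c.lift e w β =
      c.lift e w (δ ≫ β) :=
    eq_of_heq ((eqToHom_comp_heq _ _).trans (c.lift_comp e w δ β).symm)
  obtain ⟨ν, hν, hν'⟩ := c.factor e w (δ ≫ β) wg γ h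
  have cover : ∀ {k : X ⟶ E} (_ : k = c.pull (c.pull e w β) (c.pull_over e w β) δ) (ν : g ⟶ k)
      (e' : k = c.pull (c.pull e w β) (c.pull_over e w β) δ), HEq (ν ▷ q) (𝟙 a) →
      HEq ((ν ≫ eqToHom e') ▷ q) (𝟙 a) := by
    intro k hk ν e' h
    subst hk
    rw [eqToHom_refl, Category.comp_id]
    exact h
  refine ⟨ν ≫ eqToHom hc ≫ c.lift (c.pull e w β) (c.pull_over e w β) δ, ⟨?_, ?_⟩, fun χ hχ => ?_⟩
  · rw [← Category.assoc, comp_whiskerRight]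
    refine (comp_heq wg (c.pull_over _ _ _) (c.pull_over _ _ _) (cover hc ν hc hν)
      (c.lift_over _ (c.pull_over e w β) δ)).trans ?_
    rw [Category.id_comp]
  · rw [Category.assoc, Category.assoc, hl, hν']
  · obtain ⟨hχ, hχ'⟩ := hχ
    obtain ⟨ξ, hξ, hξ'⟩ := c.factor (c.pull e w β) (c.pull_over e w β) δ wg χ hχ
    have e₁ : ξ ≫ eqToHom hc.symm = ν := by
      refine c.unique e w (δ ≫ β) wg _ _ ?_ hν ?_
      · have key : ∀ {k k' : X ⟶ E} (ν : g ⟶ k) (e' : k = k'), HEq (ν ▷ q) (𝟙 a) →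
            HEq ((ν ≫ eqToHom e') ▷ q) (𝟙 a) := by
          intro k k' ν e' h
          subst e'
          rw [eqToHom_refl, Category.comp_id]
          exact h
        exact key ξ hc.symm hξ
      · rw [hν', ← hχ', ← hξ', ← hl]
        simp
    rw [← e₁, ← hξ']
    simp

/-- Whiskering with an isomorphism is injective on 1-cells. -/
theorem _root_.TwoCat.IsIsoCell.cancel {t : B ⟶ C} (ht : IsIsoCell t) {X : K} {a b : X ⟶ B}
    (h : a ≫ t = b ≫ t) : a = b := by
  obtain ⟨s, hs, -⟩ := ht
  rw [← Strict.comp_id a, ← Strict.comp_id b, ← hs, ← Strict.assoc, ← Strict.assoc, h]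

/-- Whiskering with an isomorphism is injective on 2-cells. -/
theorem _root_.TwoCat.IsIsoCell.cancel_heq {t : B ⟶ C} (ht : IsIsoCell t) {X : K}
    {a b a' b' : X ⟶ B} (η : a ⟶ b) (η' : a' ⟶ b') (ha : a = a') (hb : b = b')
    (h : HEq (η ▷ t) (η' ▷ t)) : HEq η η' := by
  obtain ⟨s, hs, -⟩ := ht
  have key : ∀ {a b : X ⟶ B} (η : a ⟶ b), HEq (η ▷ t ▷ s) η := fun η =>
    (whiskerRight_whiskerRight_heq η t s).trans
      ((whiskerRight_heq rfl rfl HEq.rfl hs).trans (whiskerRight_id_heq η))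
  subst ha hb
  exact (key η).symm.trans ((whiskerRight_heq rfl rfl h rfl).trans (key η'))

theorem _root_.TwoCat.isHomLift_iff {p : E ⟶ B} {X : K} {g e : X ⟶ E} {a b : X ⟶ B} (δ : a ⟶ b)
    (γ : g ⟶ e) (ha : g ≫ p = a) (hb : e ≫ p = b) :
    (postcomp X p).IsHomLift δ γ ↔ HEq (γ ▷ p) δ := by
  subst ha hb
  constructor
  · intro h
    exact heq_of_eq (@IsHomLift.eq_of_isHomLift _ _ _ _ (postcomp X p) _ _ δ γ h).symm
  · intro h
    rw [← eq_of_heq h]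
    exact Functor.IsHomLift.map γ

variable {p : E ⟶ B} {t : B ⟶ C}

theorem whisker_heq (hq : p ≫ t = q) {X : K} {g e : X ⟶ E} (γ : g ⟶ e) : HEq (γ ▷ q) (γ ▷ p ▷ t) :=
  (whiskerRight_heq rfl rfl HEq.rfl hq.symm).trans (whiskerRight_whiskerRight_heq γ p t).symm

theorem over_eq (hq : p ≫ t = q) {X : K} (e : X ⟶ E) : e ≫ q = (e ≫ p) ≫ t := by
  rw [Strict.assoc, hq]

theorem pull_base (hq : p ≫ t = q) (ht : IsIsoCell t) {X : K} {b : X ⟶ B} {e : X ⟶ E}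
    (β : b ⟶ e ≫ p) : c.pull e (over_eq hq e) (β ▷ t) ≫ p = b :=
  ht.cancel ((over_eq hq _).symm.trans (c.pull_over _ _ _))

theorem lift_base (hq : p ≫ t = q) (ht : IsIsoCell t) {X : K} {b : X ⟶ B} {e : X ⟶ E}
    (β : b ⟶ e ≫ p) : HEq (c.lift e (over_eq hq e) (β ▷ t) ▷ p) β :=
  ht.cancel_heq _ _ (c.pull_base hq ht β) rfl
    ((whisker_heq hq _).symm.trans (c.lift_over e (over_eq hq e) (β ▷ t)))

theorem whiskerRight_comp_eqToHom_heq {X : K} {a b b' : X ⟶ B} (γ : a ⟶ b) (e : b = b') :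
    HEq ((γ ≫ eqToHom e) ▷ t) (γ ▷ t) := by
  subst e
  rw [eqToHom_refl, Category.comp_id]

/-- The splitting of a functor of composition with `p` determined by a cleavage. -/
def splitting (hq : p ≫ t = q) (ht : IsIsoCell t) (X : K) : Splitting (postcomp X p) where
  obj {b e} β := c.pull e (over_eq hq e) (β ▷ t)
  obj_over {b e} β := c.pull_base hq ht β
  lift {b e} β := c.lift e (over_eq hq e) (β ▷ t)
  cartesian {b e} β :=
    { toIsHomLift := (isHomLift_iff β _ (c.pull_base hq ht β) rfl).2 (c.lift_base hq ht β)
      universal_property' := by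
        intro g δ γ h
        have hγ : HEq (γ ▷ p) (δ ≫ β) := (isHomLift_iff (δ ≫ β) γ rfl rfl).1 h
        have hγ' : HEq (γ ▷ q) ((δ ▷ t) ≫ (β ▷ t)) :=
          (whisker_heq hq γ).trans ((whiskerRight_heq rfl rfl hγ rfl).trans
            (heq_of_eq (comp_whiskerRight δ β t)))
        obtain ⟨χ, ⟨hχ, hχ'⟩, hu⟩ := c.exists_lift e (over_eq hq e) (β ▷ t)
          (over_eq hq g) (δ ▷ t) γ hγ'
        refine ⟨χ, ⟨(isHomLift_iff δ χ rfl (c.pull_base hq ht β)).2 ?_, hχ'⟩, fun ξ hξ => hu ξ ⟨?_,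
          hξ.2⟩⟩
        · exact ht.cancel_heq _ _ rfl (c.pull_base hq ht β) ((whisker_heq hq χ).symm.trans hχ)
        · exact (whisker_heq hq ξ).trans (whiskerRight_heq rfl (c.pull_base hq ht β)
            ((isHomLift_iff δ ξ rfl (c.pull_base hq ht β)).1 hξ.1) rfl) }
  obj_id e := (c.pull_congr (w₁ := over_eq hq e) rfl rfl rfl
    (heq_of_eq (id_whiskerRight (e ≫ p) t))).trans (c.pull_id e (over_eq hq e))
  lift_id e := eq_of_heq ((c.lift_congr (w₁ := over_eq hq e) rfl rfl rfl
    (heq_of_eq (id_whiskerRight (e ≫ p) t))).trans ((c.lift_id e (over_eq hq e)).trans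
      (eqToHom_heq rfl _ ((c.pull_congr rfl rfl rfl
        (heq_of_eq (id_whiskerRight (e ≫ p) t))).trans (c.pull_id e (over_eq hq e))).symm)))
  obj_comp {a b e} γ β := (c.pull_congr rfl rfl rfl (heq_of_eq (comp_whiskerRight γ β t))).trans
    ((c.pull_comp e (over_eq hq e) (γ ▷ t) (β ▷ t)).trans
      (c.pull_congr rfl rfl (congrArg (fun k => k ≫ t) (c.pull_base hq ht β)).symm
          (whiskerRight_comp_eqToHom_heq γ _).symm))
  lift_comp {a b e} γ β := by
    refine eq_of_heq (HEq.trans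
      (c.lift_congr (w₁ := over_eq hq e) rfl rfl rfl (heq_of_eq (comp_whiskerRight γ β t))) ?_)
    refine (c.lift_comp e (over_eq hq e) (γ ▷ t) (β ▷ t)).trans ?_
    refine HEq.trans ?_ (eqToHom_comp_heq _ _).symm
    exact comp_heq (c.pull_congr rfl rfl (congrArg (fun k => k ≫ t) (c.pull_base hq ht β)).symm
        (whiskerRight_comp_eqToHom_heq γ _).symm) rfl rfl
      (c.lift_congr rfl rfl (congrArg (fun k => k ≫ t) (c.pull_base hq ht β)).symm
        (whiskerRight_comp_eqToHom_heq γ _).symm) HEq.rfl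

theorem whiskerLeft_base_heq {X Y : K} (f : Y ⟶ X) {b : X ⟶ B} {e : X ⟶ E} (β : b ⟶ e ≫ p) :
    HEq (f ◁ (β ▷ t)) ((f ◁ β ≫ (α_ f e p).inv) ▷ t) := by
  refine (whisker_assoc_heq f β t).symm.trans ?_
  rw [Strict.associator_eqToIso]
  exact (whiskerRight_comp_eqToHom_heq (f ◁ β) (Strict.assoc f e p).symm).symm

/-- The split fibration structure on `p` determined by a cleavage. -/
def splitFibration (hq : p ≫ t = q) (ht : IsIsoCell t) : SplitFibration p where
  split X := c.splitting hq ht X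
  obj_precomp {X Y} f {b e} β := by
    have w' : (f ≫ e) ≫ q = f ≫ (e ≫ p) ≫ t := by rw [Strict.assoc, over_eq hq]
    refine (c.pull_precomp f e (over_eq hq e) (β ▷ t) w').trans ?_
    exact c.pull_congr rfl (Strict.assoc _ _ _).symm (by simp only [Strict.assoc])
      (whiskerLeft_base_heq f β)
  lift_precomp {X Y} f {b e} β := by
    have w' : (f ≫ e) ≫ q = f ≫ (e ≫ p) ≫ t := by rw [Strict.assoc, over_eq hq]
    refine eq_of_heq ((c.lift_precomp f e (over_eq hq e) (β ▷ t) w').trans ?_)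
    refine HEq.trans ?_ (eqToHom_comp_heq _ _).symm
    exact c.lift_congr rfl (Strict.assoc _ _ _).symm (by simp only [Strict.assoc])
      (whiskerLeft_base_heq f β)

theorem preservesLifts {E' : K} {q' : E' ⟶ C} {c' : Cleavage q'} {p' : E' ⟶ B} (hq : p ≫ t = q)
    (hq' : p' ≫ t = q') (ht : IsIsoCell t) (h : E ⟶ E') (w : h ≫ q' = q)
    (pull_comp : ∀ {X : K} (e : X ⟶ E) {b b' : X ⟶ C} (we : e ≫ q = b') (β : b ⟶ b')
      (we' : (e ≫ h) ≫ q' = b'), c.pull e we β ≫ h = c'.pull (e ≫ h) we' β)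
    (lift_comp : ∀ {X : K} (e : X ⟶ E) {b b' : X ⟶ C} (we : e ≫ q = b') (β : b ⟶ b')
      (we' : (e ≫ h) ≫ q' = b'), HEq (c.lift e we β ▷ h) (c'.lift (e ≫ h) we' β)) :
    PreservesLifts (c.splitFibration hq ht) (c'.splitFibration hq' ht) h := by
  have wp : h ≫ p' = p := ht.cancel (by rw [Strict.assoc, hq', w, hq])
  have we' : ∀ {X : K} (e : X ⟶ E), (e ≫ h) ≫ q' = (e ≫ p) ≫ t := fun e => by
    rw [Strict.assoc, w, over_eq hq]
  have e₁ : ∀ {X : K} (e : X ⟶ E), (e ≫ p) ≫ t = ((e ≫ h) ≫ p') ≫ t := fun e => by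
    rw [Strict.assoc e h, wp]
  exact
    { w := wp
      obj_comp := fun {X b e} β => (pull_comp e (over_eq hq e) (β ▷ t) (we' e)).trans
        (c'.pull_congr rfl rfl (e₁ e) (whiskerRight_comp_eqToHom_heq β _).symm)
      lift_comp := fun {X b e} β => eq_of_heq (((lift_comp e (over_eq hq e) (β ▷ t) (we' e)).trans
        (c'.lift_congr rfl rfl (e₁ e) (whiskerRight_comp_eqToHom_heq β _).symm)).trans
          (eqToHom_comp_heq _ _).symm) }

end Cleavage

end

end TwoCat

/-! ### Elements along 2-cells between functors to spans -/

namespace Spans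

variable {X : VDC.{max (u + 1) v}} {b b' b'' : VDFunctor X Span.{u, v}}

/-- The chain with a single element. -/
abbrev singleChain {I J : SpanObj.{u, v}} (S : SpanHor I J) {i : I.carrier} {j : J.carrier}
    (s : S.Fiber i j) : SpanChain (.single S) i j := ⟨j, s, ⟨⟨rfl⟩⟩⟩

/-- The action of a 2-cell on chains. -/
def transChain (β : VDTrans b b') : ∀ {x y : X.Obj} (Γs : HPath X.Hor x y)
    {i : SpanObj.carrier (b.vert.obj x)} {j : SpanObj.carrier (b.vert.obj y)},
    SpanChain (b.path Γs) i j →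
      SpanChain (b'.path Γs) (SpanMap.fn (β.vert.app x) i) (SpanMap.fn (β.vert.app y) j)
  | x, _, .nil _, _, _, c => ⟨⟨congrArg (SpanMap.fn (β.vert.app x)) c.down.down⟩⟩
  | _, _, .cons Γ Γs, _, _, c =>
    Chain.cons (Γ := b'.hor Γ) (SpanCell.fn (β.cell Γ) (singleChain (b.hor Γ) c.2.1))
      (transChain β Γs c.2.2)

theorem push_cells (β : VDTrans b b') : ∀ {x y : X.Obj} (Γs : HPath X.Hor x y)
    {i : SpanObj.carrier (b.vert.obj x)} {j : SpanObj.carrier (b.vert.obj y)}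
    (c : SpanChain (b.path Γs) i j),
    push (β.cells Γs) (Chain.cast (β.top_cells Γs).symm c) = transChain β Γs c
  | _, _, .nil _, _, _, _ => rfl
  | _, _, .cons Γ Γs, _, _, c => by
    have h := Chain.cast_cons (Γ := b.hor Γ) c.2.1 c.2.2 (β.top_cells Γs).symm
    refine (congrArg (push (β.cells (.cons Γ Γs))) h).trans ?_
    exact congrArg (Chain.cons (Γ := b'.hor Γ) _) (push_cells β Γs c.2.2)

theorem cell_transChain (β : VDTrans b b') {x x' y y' : X.Obj} {Γs : HPath X.Hor x x'}
    {f : x ⟶ y} {f' : x' ⟶ y'} {Δ : X.Hor y y'} (θ : X.Cell Γs f f' Δ)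
    {i : SpanObj.carrier (b.vert.obj x)} {j : SpanObj.carrier (b.vert.obj x')}
    (c : SpanChain (b.path Γs) i j) :
    (SpanCell.fn (b'.cell θ) (transChain β Γs c)).1 =
      (SpanCell.fn (β.cell Δ) (singleChain (b.hor Δ) (SpanCell.fn (b.cell θ) c))).1 := by
  have n := congrArg (fun κ => (SpanCell.fn κ c).1) (β.naturality θ)
  have n' := (comp_fn _ _ _ _ _ c).symm.trans (n.trans (comp_fn _ _ _ _ _ c))
  refine (congrArg (fun d => (SpanCell.fn (b'.cell θ) d).1) (push_cells β Γs c)).symm.trans ?_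
  refine n'.symm.trans (congrArg (fun d => (SpanCell.fn (β.cell Δ) d).1) ?_)
  exact (congrArg (push (VDGraph.CellPath.single (b.cell θ))) (Chain.append_nil c)).symm.trans
    (push_cons (b.cell θ) (.nil _) c _)

end Spans

namespace EltsVDC

variable {X Y : VDC.{max (u + 1) v}} {b b' b'' : VDFunctor X Span.{u, v}}

/-- The action of a 2-cell on elements of objects and vertical morphisms. -/
def laxVert (β : VDTrans b b') : EltsObj b ⥤ EltsObj b' where
  obj a := ⟨a.obj, SpanMap.fn (β.vert.app a.obj) a.elt⟩
  map {a a'} f := ⟨f.map, (congrArg (fun g : SpanMap _ _ => g.fn a.elt)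
    (β.vert.naturality f.map)).symm.trans (congrArg (SpanMap.fn (β.vert.app a'.obj)) f.map_elt)⟩

/-- The action of a 2-cell on elements of horizontal morphisms. -/
def laxHor (β : VDTrans b b') {a a' : EltsObj b} (Γ : EltsHor a a') :
    EltsHor ((laxVert β).obj a) ((laxVert β).obj a') :=
  ⟨Γ.hor, SpanCell.fn (β.cell Γ.hor) (Spans.singleChain (b.hor Γ.hor) Γ.elt)⟩

/-- The image of a path. -/
abbrev laxPath (β : VDTrans b b') {a a' : EltsObj b} (Γs : HPath (EltsHor (F := b)) a a') :
    HPath (EltsHor (F := b')) ((laxVert β).obj a) ((laxVert β).obj a') :=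
  Γs.map (laxVert β).obj (fun _ _ Γ => laxHor β Γ)

theorem laxPath_eq (β : VDTrans b b') {a a' : EltsObj b} (Γs : HPath (EltsHor (F := b)) a a') :
    (eltsForget b).path Γs = (eltsForget b').path (laxPath β Γs) :=
  (HPath.map_map (H' := EltsHor (F := b')) (H'' := X.Hor) (laxVert β).obj EltsObj.obj
    (fun _ _ Γ => laxHor β Γ) (fun _ _ Γ => EltsHor.hor Γ) Γs).symm

theorem eltsChain_laxPath (β : VDTrans b b') : ∀ {a a' : EltsObj b}
    (Γs : HPath (EltsHor (F := b)) a a')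
    (e : b'.path ((eltsForget b').path (laxPath β Γs)) = b'.path ((eltsForget b).path Γs)),
    Chain.cast e (eltsChain (laxPath β Γs)) =
      Spans.transChain β ((eltsForget b).path Γs) (eltsChain Γs)
  | _, _, .nil _, _ => rfl
  | _, _, .cons Γ Γs, e => by
    have h := Chain.cast_cons (H := SpanHor.{u, v}) (Γ := b'.hor Γ.hor) (laxHor β Γ).elt
      (eltsChain (laxPath β Γs)) (congrArg b'.path (laxPath_eq β Γs).symm)
    exact h.trans (congrArg (Chain.cons (Γ := b'.hor Γ.hor) _) (eltsChain_laxPath β Γs _))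

/-- The underlying data of the action of a 2-cell on elements. -/
def laxHom (β : VDTrans b b') : VDGraphHom (eltsGraph b) (eltsGraph b') where
  vert := laxVert β
  hor Γ := laxHor β Γ
  cell {_ _ _ _ Γs _ _ Δ} θ := ⟨X.cast (laxPath_eq β Γs) rfl rfl θ.cell, by
    refine (congrArg (fun κ => (SpanCell.fn κ _).1) (b'.cell_cast (laxPath_eq β Γs)
      rfl rfl θ.cell)).trans ?_
    refine (Spans.fn_cast (congrArg b'.path (laxPath_eq β Γs)) rfl rfl
      (b'.cell θ.cell) _).trans ?_
    refine (congrArg (fun d => (SpanCell.fn (b'.cell θ.cell) d).1)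
      (eltsChain_laxPath β Γs _)).trans ?_
    refine (Spans.cell_transChain β θ.cell (eltsChain Γs)).trans ?_
    have key : ∀ {x y : X.Obj} (Δ : X.Hor x y) {i i' : SpanObj.carrier (b.vert.obj x)}
        {j j' : SpanObj.carrier (b.vert.obj y)} (_ : i = i') (_ : j = j')
        (s : SpanHor.Fiber (b.hor Δ) i j)
        (s' : SpanHor.Fiber (b.hor Δ) i' j') (_ : s.1 = s'.1),
        (SpanCell.fn (β.cell Δ) (Spans.singleChain (b.hor Δ) s)).1 =
          (SpanCell.fn (β.cell Δ) (Spans.singleChain (b.hor Δ) s')).1 := by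
      intro x y Δ i i' j j' hi hj s s' h
      subst hi hj
      rw [Subtype.ext h]
    exact key Δ.hor (EltsMap.map_elt _) (EltsMap.map_elt _) _ _ θ.cell_elt⟩

theorem laxHom_forget (β : VDTrans b b') :
    (laxHom β).comp (eltsForget b') = eltsForget b := by
  refine VDGraphHom.ext_cell rfl (fun _ => HEq.rfl) fun {_ _ _ _ Γs _ _ _} θ => ?_
  refine (VDGraphHom.comp_cell_heq _ _ θ).trans ?_
  exact VDGraphHom.heq_cast (Y := X) (laxPath_eq β Γs) rfl rfl θ.cell

/-- The action of a 2-cell on elements. -/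
def lax (β : VDTrans b b') : VDFunctor (EltsVDC b) (EltsVDC b') :=
  VDFunctor.ofFaithful (ι := Unit) (laxHom β) (fun _ => proj b')
    (fun θ κ h => eltsForget_inj θ κ (h ()))
    (fun _ => (laxHom_forget β).symm ▸ (proj b).preserves)

theorem lax_proj (β : VDTrans b b') : (lax β).comp (proj b') = proj b :=
  VDProd.toHom_injective (laxHom_forget β)

theorem lax_id (b : VDFunctor X Span.{u, v}) :
    lax (𝟙 b : b ⟶ b) = VDFunctor.id (EltsVDC b) :=
  VDFunctor.ext_faithful (ι := Unit) (fun _ => proj b)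
    (fun θ κ h => eltsForget_inj θ κ (h ())) rfl (fun _ => HEq.rfl) fun _ =>
    (lax_proj _).trans (VDFunctor.id_comp _).symm

theorem lax_comp (β : b ⟶ b') (γ : b' ⟶ b'') : lax (β ≫ γ) = (lax β).comp (lax γ) :=
  VDFunctor.ext_faithful (ι := Unit) (fun _ => proj b'')
    (fun θ κ h => eltsForget_inj θ κ (h ())) rfl (fun _ => HEq.rfl) fun _ => by
    refine (lax_proj _).trans (Eq.symm ((VDFunctor.assoc _ _ _).trans ?_))
    exact (congrArg ((lax β).comp) (lax_proj γ)).trans (lax_proj β)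

theorem map_lax {c c' : VDFunctor Y Span.{u, v}} (h : VDFunctor X Y) (β : VDTrans c c') :
    (map h rfl).comp (lax β) = (lax (VDTrans.whiskerLeft h β)).comp (map h rfl) :=
  VDFunctor.ext_faithful (ι := Unit) (fun _ => proj c')
    (fun θ κ h => eltsForget_inj θ κ (h ())) rfl (fun _ => HEq.rfl) fun _ => by
    refine (VDFunctor.assoc _ _ _).trans ((congrArg _ (lax_proj β)).trans ?_)
    refine (map_proj h rfl).trans (Eq.symm ?_)
    refine (VDFunctor.assoc _ _ _).trans ((congrArg _ (map_proj h rfl)).trans ?_)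
    exact (VDFunctor.assoc _ _ _).symm.trans
      (congrArg (fun k => VDFunctor.comp k h) (lax_proj _))

end EltsVDC

/-! ### The action of 2-cells on families of elements -/

namespace FamVDC

variable {A B X Y : VDC.{max (u + 1) v}} {b b' b'' : VDFunctor X Span.{u, v}}

/-- The components of the reindexing of constant families along a 2-cell. -/
def const₂Data (β : VDTrans b b') : VDTransData (const b) (const b') where
  vert :=
    { app := fun x => (⟨SpanMap.fn (β.vert.app x), fun _ => 𝟙 x⟩ :
        FamMap (constObj b x) (constObj b' x))
      naturality := fun x y f => by
        have key : ∀ {g g' : SpanMap (b.vert.obj x) (b'.vert.obj y)} (_ : g = g')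
            {k k' : x ⟶ y} (_ : k = k'), (⟨g.fn, fun _ => k⟩ :
            FamMap (constObj b x) (constObj b' y)) = ⟨g'.fn, fun _ => k'⟩ := by
          rintro g _ rfl k _ rfl
          rfl
        exact key (β.vert.naturality f) ((Category.comp_id f).trans (Category.id_comp f).symm) }
  cell {x y} Γ :=
    { fn := fun c => SpanCell.fn (β.cell Γ) (constChain b (.single Γ) c)
      cell := fun c => X.cast (path_const b (.single Γ) c).symm rfl rfl (X.id Γ) }

theorem push_const₂Data (β : VDTrans b b') : ∀ {x y : X.Obj} (Γs : HPath X.Hor x y)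
    {i : (constObj b x).idx} {j : (constObj b y).idx} (c : FamChain (constPath b Γs) i j),
    constChain b' Γs (Fams.push ((const₂Data β).cells Γs)
        (Chain.cast ((const₂Data β).top_cells Γs).symm c)).chain =
        Spans.transChain β Γs (constChain b Γs c) ∧
      HEq (Fams.push ((const₂Data β).cells Γs)
        (Chain.cast ((const₂Data β).top_cells Γs).symm c)).cells (X.ids Γs)
  | _, _, .nil _, _, _, c => by
    obtain ⟨⟨rfl⟩⟩ := c
    exact ⟨rfl, HEq.rfl⟩
  | _, _, .cons Γ Γs, _, _, c => by
    have h := Chain.cast_cons (Γ := constHor b Γ) c.2.1 c.2.2 ((const₂Data β).top_cells Γs).symm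
    have hp := congrArg (Fams.push ((const₂Data β).cells (.cons Γ Γs))) h
    obtain ⟨h₁, h₂⟩ := push_const₂Data β Γs c.2.2
    refine ⟨(congrArg (fun p => constChain b' (.cons Γ Γs) (Fams.Push.chain p)) hp).trans ?_,
      (congr_arg_heq Fams.Push.cells hp).trans ?_⟩
    · exact congrArg (Chain.cons (Γ := b'.hor Γ) (SpanCell.fn (β.cell Γ)
        (Spans.singleChain (b.hor Γ) c.2.1))) h₁
    · exact VDGraphHom.cons_heq (Y := X) rfl (path_const b' Γs _) rfl rfl rfl HEq.rfl h₂

theorem comp_fn_val {P P' R R' S S' : FamObj.{u, v} A} {Δs : HPath (FamHor (A := A)) R R'}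
    {f : P ⟶ R} {f' : P' ⟶ R'} (θs : (famGraph.{u, v} A).CellPath Δs f f') {g : R ⟶ S} {g' : R' ⟶
        S'}
    {Λ : FamHor S S'} (κ : FamCell Δs g g' Λ) {Γs : HPath (FamHor (A := A)) P P'} {h : P ⟶ S}
    {h' : P' ⟶ S'} (e : θs.top = Γs) (e₁ : f ≫ g = h) (e₂ : f' ≫ g' = h') {i : P.idx}
    {i' : P'.idx} (c : FamChain Γs i i') :
    (FamCell.fn ((Fams.data.{u, v} A).comp θs κ e e₁ e₂) c).1 =
      (κ.fn (Fams.push θs (Chain.cast e.symm c)).chain).1 := by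
  subst e e₁ e₂
  rfl

theorem push_single {P P' R R' : FamObj.{u, v} A} {Γs : HPath (FamHor (A := A)) P P'}
    {Δ : FamHor R R'} {f : P ⟶ R} {f' : P' ⟶ R'} (θ : FamCell Γs f f' Δ) {i : P.idx} {i' : P'.idx}
    (c : FamChain Γs i i') :
    Fams.push (VDGraph.CellPath.single (X := famGraph.{u, v} A) θ)
        (Chain.cast (HPath.append_nil Γs).symm c) =
      (⟨⟨f'.fn i', θ.fn c, ⟨⟨rfl⟩⟩⟩, VDGraph.CellPath.single (θ.cell c)⟩ :
        Fams.Push (.single Δ) f f' i i') :=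
  (congrArg (Fams.push (VDGraph.CellPath.single (X := famGraph.{u, v} A) θ))
    (Chain.append_nil c)).symm.trans (Fams.push_cons θ (.nil _) c _)

theorem val_congr_heq {P P' R R' S S' : FamObj.{u, v} A} {Δs : HPath (FamHor (A := A)) R R'}
    {f : P ⟶ R} {f' : P' ⟶ R'} {g : R ⟶ S} {g' : R' ⟶ S'} {Λ : FamHor S S'} (κ : FamCell Δs g g' Λ)
    {i : P.idx} {i' : P'.idx} {p q : Fams.Push Δs f f' i i'} (e : p = q)
    {πs ρs : HPath A.Hor (P.fam i) (P'.fam i')} (h : p.cells.top = πs) (h' : q.cells.top = ρs) :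
    HEq (Fams.val κ p h).2 (A.comp q.cells (κ.cell q.chain) h' rfl rfl) := by
  subst e h h'; rfl

theorem comp_const_heq {x x' y y' : X.Obj} {Γs : HPath X.Hor x x'} {f : x ⟶ y} {f' : x' ⟶ y'}
    {Δ : X.Hor y y'} (θ : X.Cell Γs f f' Δ) {P P' : FamObj.{u, v} X} {h : P ⟶ constObj b x}
    {h' : P' ⟶ constObj b x'} {i : P.idx} {i' : P'.idx} (p : Fams.Push (constPath b Γs) h h' i i')
    {πs : HPath X.Hor (P.fam i) (P'.fam i')} (e : p.cells.top = πs) (hP : P.fam i = x)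
    (hP' : P'.fam i' = x') (hh : HEq (h.map i) (𝟙 x)) (hh' : HEq (h'.map i') (𝟙 x'))
    (hp : HEq p.cells (X.ids Γs)) (hπ : HEq πs Γs) :
    HEq (Fams.val ((constHom b).cell θ) p e).2 θ := by
  obtain ⟨c, cs⟩ := p
  refine HEq.trans (VDC.comp_hcongr (Y := X) (θs₁ := X.ids Γs) (κ₁ := θ) hP hP' rfl rfl rfl rfl
    (heq_of_eq (path_const b Γs c)) hh hh' hp HEq.rfl HEq.rfl HEq.rfl
    (VDGraphHom.heq_cast (Y := X) _ rfl rfl θ) hπ _ _ _ (X.top_ids Γs) rfl rfl) ?_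
  exact (heq_of_eq (X.id_comp' θ _ _ _)).trans (VDGraphHom.heq_cast (Y := X) _ _ _ θ)

/-- The reindexing of constant families along a 2-cell. -/
def const₂ (β : VDTrans b b') : VDTrans (const b) (const b') where
  toVDTransData := const₂Data β
  naturality {x x' y y' Γs f f' Δ} θ := by
    refine eq_of_heq (Fams.heq_cell (A := X) rfl (fun c => ?_) (fun c => ?_))
    · obtain ⟨h₁, -⟩ := push_const₂Data β Γs c
      refine (comp_fn_val _ _ _ _ _ _).trans (Eq.trans ?_ (comp_fn_val _ _ _ _ _ _).symm)
      refine (congrArg (fun p => (FamCell.fn ((const₂Data β).cell Δ) (Fams.Push.chain p)).1)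
        (push_single ((constHom b).cell θ) c)).trans ?_
      refine Eq.trans ?_ (congrArg (fun d => (SpanCell.fn (b'.cell θ) d).1) h₁).symm
      exact (Spans.cell_transChain β θ (constChain b Γs c)).symm
    · obtain ⟨-, h₂⟩ := push_const₂Data β Γs c
      refine (comp_cell_heq _ _ _ _ _ c).trans (HEq.trans ?_ (comp_cell_heq _ _ _ _ _ c).symm)
      have e₁ : (VDGraph.CellPath.single ((constHom b).cell θ |>.cell c)).top = Fams.path c :=
        HPath.append_nil _
      refine (val_congr_heq ((const₂Data β).cell Δ) (push_single ((constHom b).cell θ) c)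
        (Fams.push_top _ _) e₁).trans ?_
      have e₂ := path_const b Γs c
      refine HEq.trans (b := θ) ?_ (HEq.symm ?_)
      · refine HEq.trans (VDC.comp_hcongr (Y := X) (θs₁ := .single θ) (κ₁ := X.id Δ) rfl rfl rfl rfl
          rfl rfl HEq.rfl HEq.rfl HEq.rfl ?_ HEq.rfl HEq.rfl HEq.rfl ?_ (heq_of_eq e₂) _ _ _
          (HPath.append_nil _) rfl rfl) ?_
        · exact VDGraphHom.cons_heq (Y := X) e₂ rfl rfl rfl rfl
            (VDGraphHom.heq_cast (Y := X) _ rfl rfl θ) HEq.rfl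
        · exact HEq.rfl
        · exact (heq_of_eq (X.comp_id' θ _ _ _)).trans (VDGraphHom.heq_cast (Y := X) _ _ _ θ)
      · exact comp_const_heq θ _ _ rfl rfl HEq.rfl HEq.rfl h₂ (heq_of_eq ((Fams.path_cast _
          c).trans e₂))

end FamVDC

namespace FamVDC

variable {A B X Y : VDC.{max (u + 1) v}} {b b' b'' : VDFunctor X Span.{u, v}}

/-- The components of the reindexing of families of elements along a 2-cell. -/
def unit₂Data (β : VDTrans b b') :
    VDTransData ((unit b).comp (FamVDC.map (EltsVDC.lax β))) (unit b') where
  vert :=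
    { app := fun x => (⟨SpanMap.fn (β.vert.app x), fun i =>
          𝟙 (⟨x, SpanMap.fn (β.vert.app x) i⟩ : EltsObj b')⟩ :
        FamMap ((Fams.mapVert (EltsVDC.lax β)).obj (unitObj b x)) (unitObj b' x))
      naturality := fun x y f => by
        have key : ∀ {g g' : SpanObj.carrier (b.vert.obj x) → SpanObj.carrier (b'.vert.obj y)}
            (_ : g = g') (k k' : ∀ i, x ⟶ y) (_ : k = k')
            (p : ∀ i, SpanMap.fn (b'.vert.map (k i)) (SpanMap.fn (β.vert.app x) i) = g i)
            (p' : ∀ i, SpanMap.fn (b'.vert.map (k' i)) (SpanMap.fn (β.vert.app x) i) = g' i),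
            (⟨g, fun i => (⟨k i, p i⟩ : EltsMap (F := b') ⟨x, _⟩ ⟨y, _⟩)⟩ :
            FamMap ((Fams.mapVert (EltsVDC.lax β)).obj (unitObj b x)) (unitObj b' y)) =
            ⟨g', fun i => (⟨k' i, p' i⟩ : EltsMap (F := b') ⟨x, _⟩ ⟨y, _⟩)⟩ := by
          rintro g _ rfl k _ rfl p p'
          rfl
        exact key (congrArg SpanMap.fn (β.vert.naturality f)) _ _
          (funext fun _ => (Category.comp_id f).trans (Category.id_comp f).symm) _ _ }
  cell {x y} Γ :=
    { fn := fun c => SpanCell.fn (β.cell Γ) (⟨c.1, c.2.1, c.2.2⟩ : SpanChain (.single (b.hor Γ)) _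
        _)
      cell := fun c => by
        obtain ⟨k, s, ⟨⟨rfl⟩⟩⟩ := c
        exact (EltsVDC b').id (EltsVDC.laxHor (a := ⟨x, _⟩) (a' := ⟨y, _⟩) β ⟨Γ, s⟩) }

theorem unit_lax_proj (β : VDTrans b b') : ((unit b).comp (FamVDC.map (EltsVDC.lax β))).comp
    (FamVDC.map (EltsVDC.proj b')) = const b :=
  (VDFunctor.assoc _ _ _).trans ((congrArg ((unit b).comp)
    ((Fams.map_comp _ _).symm.trans (congrArg FamVDC.map (EltsVDC.lax_proj β)))).trans (unit_proj
        b))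

/-- The image of the reindexing of families of elements in constant families. -/
def unit₂Proj (β : VDTrans b b') :
    VDTrans (((unit b).comp (FamVDC.map (EltsVDC.lax β))).comp (FamVDC.map (EltsVDC.proj b')))
      ((unit b').comp (FamVDC.map (EltsVDC.proj b'))) :=
  VDTrans.copy (const₂ β) (unit_lax_proj β) (unit_proj b')
    { vert := Functor.whiskerRight (unit₂Data β).vert (FamVDC.map (EltsVDC.proj b')).vert
      cell := fun Γ => (FamVDC.map (EltsVDC.proj b')).cell ((unit₂Data β).cell Γ) }
    (fun _ => HEq.rfl) (fun Γ => Fams.heq_cell (A := X) rfl (fun c => by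
      obtain ⟨k, s, ⟨⟨rfl⟩⟩⟩ := c; rfl) (fun c => by
      obtain ⟨k, s, ⟨⟨rfl⟩⟩⟩ := c; rfl))

/-- The reindexing of families of elements along a 2-cell. -/
def unit₂ (β : VDTrans b b') :
    VDTrans ((unit b).comp (FamVDC.map (EltsVDC.lax β))) (unit b') :=
  VDTrans.ofFaithful (ι := Unit) (unit₂Data β) (fun _ => FamVDC.map (EltsVDC.proj b'))
    (fun θ κ h => map_faithful (EltsVDC.proj b') (fun θ κ h => eltsForget_inj θ κ h) θ κ (h ()))
    (fun _ => unit₂Proj β) (fun _ _ => rfl) (fun _ _ _ _ => rfl)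

theorem unit₂_toSpan (β : b ⟶ b') : HEq (VDTrans.whiskerRight (unit₂ β) (toSpan _)) β := by
  refine VDTrans.hext ?_ (unit_toSpan b') (fun _ => HEq.rfl) (fun Γ => ?_)
  · exact (VDFunctor.assoc _ _ _).trans ((congrArg ((unit b).comp) (toSpan_map _)).trans
      (unit_toSpan b))
  · refine heq_of_eq (Spans.ext_cell fun c => ?_)
    obtain ⟨k, s, ⟨⟨rfl⟩⟩⟩ := c
    rfl

theorem unit₂_id (b : VDFunctor X Span.{u, v}) : HEq (unit₂ (𝟙 b : b ⟶ b)) (𝟙 (unit b) : unit b ⟶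
    unit b) := by
  refine VDTrans.hext ?_ rfl (fun _ => HEq.rfl) (fun Γ => ?_)
  · exact (congrArg (fun F => (unit b).comp (FamVDC.map F)) (EltsVDC.lax_id b)).trans
      ((congrArg ((unit b).comp) (Fams.map_id _)).trans (VDFunctor.comp_id _))
  · refine Fams.heq_cell (A := EltsVDC b) rfl (fun c => ?_) (fun c => ?_)
    · obtain ⟨k, s, ⟨⟨rfl⟩⟩⟩ := c; rfl
    · obtain ⟨k, s, ⟨⟨rfl⟩⟩⟩ := c; rfl

end FamVDC

namespace FamVDC

variable {A B X Y : VDC.{max (u + 1) v}} {b b' b'' : VDFunctor X Span.{u, v}}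

theorem comp_single_fn {P P' R R' S S' : FamObj.{u, v} A} {Γs : HPath (FamHor (A := A)) P P'}
    {Δ : FamHor R R'} {f : P ⟶ R} {f' : P' ⟶ R'} (θ : FamCell Γs f f' Δ) {g : R ⟶ S} {g' : R' ⟶ S'}
    {Λ : FamHor S S'} (κ : FamCell (.single Δ) g g' Λ) {i : P.idx} {i' : P'.idx}
    (e : (VDGraph.CellPath.single (X := famGraph.{u, v} A) θ).top = Γs) {h : P ⟶ S} {h' : P' ⟶ S'}
    (e₁ : f ≫ g = h) (e₂ : f' ≫ g' = h') (c : FamChain Γs i i') :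
    (FamCell.fn ((Fams.data.{u, v} A).comp (VDGraph.CellPath.single (X := famGraph.{u, v} A) θ) κ
      e e₁ e₂) c).1 = (κ.fn (⟨f'.fn i', θ.fn c, ⟨⟨rfl⟩⟩⟩ : FamChain (.single Δ) _ _)).1 :=
  (comp_fn_val _ κ e e₁ e₂ c).trans
    (congrArg (fun p => (κ.fn (Fams.Push.chain p)).1) (push_single θ c))

theorem comp_single_cell {P P' R R' S S' : FamObj.{u, v} A} {Γs : HPath (FamHor (A := A)) P P'}
    {Δ : FamHor R R'} {f : P ⟶ R} {f' : P' ⟶ R'} (θ : FamCell Γs f f' Δ) {g : R ⟶ S} {g' : R' ⟶ S'}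
    {Λ : FamHor S S'} (κ : FamCell (.single Δ) g g' Λ) {i : P.idx} {i' : P'.idx}
    (e : (VDGraph.CellPath.single (X := famGraph.{u, v} A) θ).top = Γs) {h : P ⟶ S} {h' : P' ⟶ S'}
    (e₁ : f ≫ g = h) (e₂ : f' ≫ g' = h') (c : FamChain Γs i i') :
    HEq (FamCell.cell ((Fams.data.{u, v} A).comp
        (VDGraph.CellPath.single (X := famGraph.{u, v} A) θ) κ e e₁ e₂) c)
      (A.comp (.single (θ.cell c)) (κ.cell (⟨f'.fn i', θ.fn c, ⟨⟨rfl⟩⟩⟩ : FamChain (.single Δ) _ _))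
        (HPath.append_nil _) rfl rfl) :=
  (comp_cell_heq _ κ e e₁ e₂ c).trans
    (val_congr_heq κ (push_single θ c) (Fams.push_top _ _) (HPath.append_nil _))

/-- Composition with a multicell whose components are identities. -/
theorem comp_single_cell_id {P P' R R' S S' : FamObj.{u, v} A} {Γs : HPath (FamHor (A := A)) P P'}
    {Δ : FamHor R R'} {f : P ⟶ R} {f' : P' ⟶ R'} (θ : FamCell Γs f f' Δ) {g : R ⟶ S} {g' : R' ⟶ S'}
    {Λ : FamHor S S'} (κ : FamCell (.single Δ) g g' Λ) {i : P.idx} {i' : P'.idx}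
    (e : (VDGraph.CellPath.single (X := famGraph.{u, v} A) θ).top = Γs) {h : P ⟶ S} {h' : P' ⟶ S'}
    (e₁ : f ≫ g = h) (e₂ : f' ≫ g' = h') (c : FamChain Γs i i')
    (hf : S.fam (g.fn (f.fn i)) = R.fam (f.fn i)) (hf' : S'.fam (g'.fn (f'.fn i')) = R'.fam (f'.fn
        i'))
    (hg : HEq (g.map (f.fn i)) (𝟙 (R.fam (f.fn i))))
    (hg' : HEq (g'.map (f'.fn i')) (𝟙 (R'.fam (f'.fn i'))))
    (hΛ : HEq (Λ.fam (κ.fn (⟨f'.fn i', θ.fn c, ⟨⟨rfl⟩⟩⟩ : FamChain (.single Δ) _ _)))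
      (Δ.fam (θ.fn c)))
    (hκ : HEq (κ.cell (⟨f'.fn i', θ.fn c, ⟨⟨rfl⟩⟩⟩ : FamChain (.single Δ) _ _))
      (A.id (Δ.fam (θ.fn c)))) :
    HEq (FamCell.cell ((Fams.data.{u, v} A).comp
        (VDGraph.CellPath.single (X := famGraph.{u, v} A) θ) κ e e₁ e₂) c) (θ.cell c) := by
  refine (comp_single_cell θ κ e e₁ e₂ c).trans ?_
  refine HEq.trans (b := A.comp (.single (θ.cell c)) (A.id (Δ.fam (θ.fn c)))
    (HPath.append_nil (Fams.path c)) rfl rfl) (VDC.comp_hcongr (Y := A) rfl rfl rfl rfl hf hf'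
      HEq.rfl HEq.rfl HEq.rfl HEq.rfl hg hg' hΛ hκ HEq.rfl _ _ _ _ _ _) ?_
  exact (heq_of_eq (A.comp_id' (θ.cell c) _ _ _)).trans (VDGraphHom.heq_cast (Y := A) _ _ _ _)

theorem map_cell_heq (F : VDFunctor A B) {P P' R R' : FamObj.{u, v} A}
    {Γs : HPath (FamHor (A := A)) P P'} {f : P ⟶ R} {f' : P' ⟶ R'} {Δ : FamHor R R'}
    (θ : FamCell Γs f f' Δ) {i : P.idx} {i' : P'.idx}
    (c : FamChain ((FamVDC.map.{u, v} F).path Γs) i i') :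
    HEq (FamCell.cell ((Fams.mapHom.{u, v} F).cell θ) c) (F.cell (θ.cell (Fams.unmap F Γs c))) :=
  VDGraphHom.heq_cast (Y := B) _ rfl rfl _

theorem unit₂_comp (β : b ⟶ b') (γ : b' ⟶ b'') : HEq (unit₂ (β ≫ γ))
    (VDTrans.comp (VDTrans.whiskerRight (unit₂ β) (FamVDC.map (EltsVDC.lax γ))) (unit₂ γ)) := by
  refine VDTrans.hext ?_ rfl (fun x => ?_) (fun {x y} Γ => ?_)
  · exact (congrArg (fun F => (unit b).comp (FamVDC.map F)) (EltsVDC.lax_comp β γ)).trans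
      ((congrArg ((unit b).comp) (Fams.map_comp _ _)).trans (VDFunctor.assoc _ _ _).symm)
  · refine heq_of_eq (congrArg (FamMap.mk _) (funext fun i => ?_))
    exact EltsMap.ext (Category.comp_id _).symm
  · have hv : ∀ x, (unit₂ (β ≫ γ)).vert.app x = (VDTrans.comp (VDTrans.whiskerRight (unit₂ β)
        (FamVDC.map (EltsVDC.lax γ))) (unit₂ γ)).vert.app x := fun x =>
      congrArg (FamMap.mk _) (funext fun i => EltsMap.ext (Category.comp_id _).symm)
    refine heq_cell_of_eq (A := EltsVDC b'') rfl (hv x) (hv y) (fun c => ?_) (fun c => ?_)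
    · obtain ⟨k, s, ⟨⟨rfl⟩⟩⟩ := c
      refine Eq.trans ?_ (comp_single_fn (A := EltsVDC b'')
        ((Fams.mapHom (EltsVDC.lax γ)).cell ((unit₂Data β).cell Γ)) ((unit₂Data γ).cell Γ)
        (HPath.append_nil _) rfl rfl ⟨k, s, ⟨⟨rfl⟩⟩⟩).symm
      exact Spans.comp_fn (VDGraph.CellPath.single (β.cell Γ)) (γ.cell Γ) rfl rfl rfl
        ⟨k, s, ⟨⟨rfl⟩⟩⟩
    · obtain ⟨k, s, ⟨⟨rfl⟩⟩⟩ := c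
      refine HEq.trans ?_ (comp_single_cell_id (A := EltsVDC b'')
        ((Fams.mapHom (EltsVDC.lax γ)).cell ((unit₂Data β).cell Γ)) ((unit₂Data γ).cell Γ)
        (HPath.append_nil _) rfl rfl ⟨k, s, ⟨⟨rfl⟩⟩⟩ rfl rfl HEq.rfl HEq.rfl HEq.rfl HEq.rfl).symm
      refine HEq.symm ((map_cell_heq (EltsVDC.lax γ) ((unit₂Data β).cell Γ)
        ⟨k, s, ⟨⟨rfl⟩⟩⟩).trans ?_)
      exact (heq_of_eq ((EltsVDC.lax γ).cell_id _)).trans (VDGraphHom.heq_cast _ _ _ _)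

theorem unit_map (f : VDFunctor X Y) (c : VDFunctor Y Span.{u, v}) :
    (unit (f.comp c)).comp (FamVDC.map (EltsVDC.map f rfl)) = f.comp (unit c) := by
  have w : (f.comp (unit c)).comp (toSpan (EltsVDC c)) = f.comp c :=
    (VDFunctor.assoc _ _ _).trans (congrArg (VDFunctor.comp f) (unit_toSpan c))
  refine Eq.trans ?_ (unit_down (f.comp (unit c)) w)
  refine congrArg (fun k => (unit (f.comp c)).comp (FamVDC.map k)) ?_
  refine Eq.trans ?_ (map_down f rfl (unit c) (unit_toSpan c) w)
  exact (VDFunctor.comp_id _).symm.trans (congrArg (VDFunctor.comp _) (down_unit c _).symm)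

theorem unit_lax_map (f : VDFunctor X Y) {c c' : VDFunctor Y Span.{u, v}} (β : VDTrans c c') :
    ((unit (f.comp c)).comp (FamVDC.map (EltsVDC.lax (VDTrans.whiskerLeft f β)))).comp
      (FamVDC.map (EltsVDC.map f rfl)) = f.comp ((unit c).comp (FamVDC.map (EltsVDC.lax β))) := by
  refine (VDFunctor.assoc _ _ _).trans ?_
  refine (congrArg (VDFunctor.comp (unit (f.comp c))) ((Fams.map_comp _ _).symm.trans
    ((congrArg FamVDC.map (EltsVDC.map_lax f β).symm).trans (Fams.map_comp _ _)))).trans ?_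
  refine (VDFunctor.assoc _ _ _).symm.trans ?_
  exact (congrArg (fun k => VDFunctor.comp k _) (unit_map f c)).trans (VDFunctor.assoc _ _ _)

theorem unit₂_map (f : VDFunctor X Y) {c c' : VDFunctor Y Span.{u, v}} (β : VDTrans c c') :
    HEq (VDTrans.whiskerRight (unit₂ (VDTrans.whiskerLeft f β)) (FamVDC.map (EltsVDC.map f rfl)))
      (VDTrans.whiskerLeft f (unit₂ β)) := by
  refine VDTrans.hext (unit_lax_map f β) (unit_map f c') (fun x => ?_) (fun {x y} Γ => ?_)
  · refine heq_of_eq (congrArg (FamMap.mk _) (funext fun i => ?_))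
    exact EltsMap.ext (f.vert.map_id _)
  · have hv : ∀ x, (VDTrans.whiskerRight (unit₂ (VDTrans.whiskerLeft f β))
        (FamVDC.map (EltsVDC.map f rfl))).vert.app x =
        (VDTrans.whiskerLeft f (unit₂ β)).vert.app x := fun x =>
      congrArg (FamMap.mk _) (funext fun i => EltsMap.ext (f.vert.map_id _))
    refine heq_cell_of_eq (A := EltsVDC c') rfl (hv x) (hv y) (fun d => ?_) (fun d => ?_)
    · obtain ⟨k, s, ⟨⟨rfl⟩⟩⟩ := d
      rfl
    · obtain ⟨k, s, ⟨⟨rfl⟩⟩⟩ := d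
      refine (map_cell_heq (EltsVDC.map f rfl) ((unit₂Data (VDTrans.whiskerLeft f β)).cell Γ)
        ⟨k, s, ⟨⟨rfl⟩⟩⟩).trans ?_
      exact (heq_of_eq ((EltsVDC.map f rfl).cell_id _)).trans (VDGraphHom.heq_cast _ _ _ _)

end FamVDC

/-! ### Reindexing of functors to families -/

namespace FamVDC

open TwoCat Bicategory

variable {A B X Y : VDC.{max (u + 1) v}}

/-- The reindexing of a functor to families along a 2-cell. -/
def pull (e : X ⟶ FamVDC.{u, v} A) {b b' : X ⟶ Span.{u, v}} (w : e ≫ toSpan A = b') (β : b ⟶ b') :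
    X ⟶ FamVDC.{u, v} A :=
  (unit b).comp (FamVDC.map ((EltsVDC.lax β).comp (down e w)))

theorem unit_lax_down (e : X ⟶ FamVDC.{u, v} A) {b b' : X ⟶ Span.{u, v}} (w : e ≫ toSpan A = b')
    (β : b ⟶ b') : ((unit b).comp (FamVDC.map (EltsVDC.lax β))).comp (FamVDC.map (down e w)) =
      pull e w β :=
  (VDFunctor.assoc _ _ _).trans (congrArg ((unit b).comp) (Fams.map_comp.{u, v} _ _).symm)

/-- The 2-cell from the reindexing of a functor to families to the functor. -/
def pullHom (e : X ⟶ FamVDC.{u, v} A) {b b' : X ⟶ Span.{u, v}} (w : e ≫ toSpan A = b') (β : b ⟶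
    b') :
    pull e w β ⟶ e :=
  eqToHom (unit_lax_down e w β).symm ≫
    (VDTrans.whiskerRight (unit₂ β) (FamVDC.map (down e w)) :
      ((unit b).comp (FamVDC.map (EltsVDC.lax β))).comp (FamVDC.map (down e w)) ⟶
        (unit b').comp (FamVDC.map (down e w))) ≫ eqToHom (unit_down e w)

theorem pullHom_heq (e : X ⟶ FamVDC.{u, v} A) {b b' : X ⟶ Span.{u, v}} (w : e ≫ toSpan A = b')
    (β : b ⟶ b') :
    HEq (pullHom e w β) (VDTrans.whiskerRight (unit₂ β) (FamVDC.map (down e w))) :=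
  conj_heq _ _ _

theorem pull_over (e : X ⟶ FamVDC.{u, v} A) {b b' : X ⟶ Span.{u, v}} (w : e ≫ toSpan A = b')
    (β : b ⟶ b') : pull e w β ≫ toSpan A = b :=
  (VDFunctor.assoc _ _ _).trans ((congrArg ((unit b).comp) (toSpan_map _)).trans (unit_toSpan b))

theorem down_pull (e : X ⟶ FamVDC.{u, v} A) {b b' : X ⟶ Span.{u, v}} (w : e ≫ toSpan A = b')
    (β : b ⟶ b') (w' : pull e w β ≫ toSpan A = b) :
    down (pull e w β) w' = (EltsVDC.lax β).comp (down e w) :=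
  (down_comp (unit b) (unit_toSpan b) _ w').symm.trans
    ((congrArg (fun k => VDFunctor.comp k _) (down_unit b _)).trans (VDFunctor.id_comp _))

theorem pullHom_over (e : X ⟶ FamVDC.{u, v} A) {b b' : X ⟶ Span.{u, v}} (w : e ≫ toSpan A = b')
    (β : b ⟶ b') : HEq (pullHom e w β ▷ toSpan A) β := by
  refine (whiskerRight_heq (unit_lax_down e w β).symm (unit_down e w).symm
    (pullHom_heq e w β) rfl).trans ?_
  refine (whiskerRight_whiskerRight_heq (K := VDC.{max (u + 1) v}) (unit₂ β)
    (FamVDC.map (down e w)) (toSpan A)).trans ?_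
  exact (whiskerRight_heq (K := VDC.{max (u + 1) v}) rfl rfl HEq.rfl (toSpan_map _)).trans
    (unit₂_toSpan β)

theorem pull_id (e : X ⟶ FamVDC.{u, v} A) {b : X ⟶ Span.{u, v}} (w : e ≫ toSpan A = b) :
    pull e w (𝟙 b) = e :=
  (congrArg (fun k => (unit b).comp (FamVDC.map (VDFunctor.comp k (down e w))))
    (EltsVDC.lax_id b)).trans
    ((congrArg (fun k => (unit b).comp (FamVDC.map k)) (VDFunctor.id_comp _)).trans (unit_down e w))

theorem id_whiskerRight_heq {K : Type*} [Bicategory K] {P R S : K} {f f' : P ⟶ R} {η : f ⟶ f'}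
    (h : f = f') (hη : HEq η (𝟙 f')) (g : R ⟶ S) : HEq (η ▷ g) (𝟙 (f' ≫ g)) := by
  subst h
  rw [eq_of_heq hη, id_whiskerRight]

theorem pullHom_id (e : X ⟶ FamVDC.{u, v} A) {b : X ⟶ Span.{u, v}} (w : e ≫ toSpan A = b) :
    HEq (pullHom e w (𝟙 b)) (𝟙 e) := by
  refine (pullHom_heq e w (𝟙 b)).trans ?_
  refine (id_whiskerRight_heq (K := VDC.{max (u + 1) v}) ?_ (unit₂_id b)
    (FamVDC.map (down e w))).trans ?_
  · exact (congrArg (fun k => (unit b).comp (FamVDC.map k)) (EltsVDC.lax_id b)).trans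
      ((congrArg ((unit b).comp) (Fams.map_id _)).trans (VDFunctor.comp_id _))
  · exact congr_arg_heq (fun k => 𝟙 k) (unit_down e w)

theorem pull_comp (e : X ⟶ FamVDC.{u, v} A) {b b' b'' : X ⟶ Span.{u, v}} (w : e ≫ toSpan A = b'')
    (γ : b ⟶ b') (β : b' ⟶ b'') (w' : pull e w β ≫ toSpan A = b') :
    pull e w (γ ≫ β) = pull (pull e w β) w' γ := by
  refine congrArg (fun k => (unit b).comp (FamVDC.map k)) ?_
  refine (congrArg (fun k => VDFunctor.comp k (down e w)) (EltsVDC.lax_comp γ β)).trans ?_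
  exact (VDFunctor.assoc _ _ _).trans (congrArg (VDFunctor.comp _) (down_pull e w β w').symm)

theorem unit_lax_comp {b b' b'' : X ⟶ Span.{u, v}} (γ : b ⟶ b') (β : b' ⟶ b'') :
    (unit b).comp (FamVDC.map (EltsVDC.lax (γ ≫ β))) =
      ((unit b).comp (FamVDC.map (EltsVDC.lax γ))).comp (FamVDC.map (EltsVDC.lax β)) :=
  (congrArg (fun k => (unit b).comp (FamVDC.map k)) (EltsVDC.lax_comp γ β)).trans
    ((congrArg ((unit b).comp) (Fams.map_comp.{u, v} _ _)).trans (VDFunctor.assoc _ _ _).symm)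

theorem pullHom_comp (e : X ⟶ FamVDC.{u, v} A) {b b' b'' : X ⟶ Span.{u, v}}
    (w : e ≫ toSpan A = b'') (γ : b ⟶ b') (β : b' ⟶ b'') (w' : pull e w β ≫ toSpan A = b') :
    HEq (pullHom e w (γ ≫ β)) (pullHom (pull e w β) w' γ ≫ pullHom e w β) := by
  refine (pullHom_heq e w (γ ≫ β)).trans ?_
  refine (whiskerRight_heq (K := VDC.{max (u + 1) v}) (unit_lax_comp γ β) rfl (unit₂_comp γ β)
    rfl).trans ?_
  refine (heq_of_eq (comp_whiskerRight (B := VDC.{max (u + 1) v})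
    (f := ((unit b).comp (FamVDC.map (EltsVDC.lax γ))).comp (FamVDC.map (EltsVDC.lax β)))
    (g := (unit b').comp (FamVDC.map (EltsVDC.lax β))) (h := unit b'')
    (VDTrans.whiskerRight (unit₂ γ) (FamVDC.map (EltsVDC.lax β))) (unit₂ β)
    (FamVDC.map (down e w)))).trans ?_
  have h : (FamVDC.map (EltsVDC.lax β)).comp (FamVDC.map (down e w)) =
      FamVDC.map (down (pull e w β) w') :=
    (Fams.map_comp.{u, v} _ _).symm.trans (congrArg FamVDC.map.{u, v} (down_pull e w β w').symm)
  refine comp_heq ?_ ?_ (unit_down e w) ?_ (pullHom_heq e w β).symm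
  · refine (VDFunctor.assoc _ _ _).trans ?_
    exact (congrArg (VDFunctor.comp _) h).trans (unit_lax_down _ w' γ)
  · exact unit_lax_down e w β
  · refine (whiskerRight_whiskerRight_heq (K := VDC.{max (u + 1) v}) (unit₂ γ) _ _).trans ?_
    exact (whiskerRight_heq (K := VDC.{max (u + 1) v}) rfl rfl HEq.rfl h).trans
      (pullHom_heq _ w' γ).symm

theorem pull_precomp (f : Y ⟶ X) (e : X ⟶ FamVDC.{u, v} A) {b b' : X ⟶ Span.{u, v}}
    (w : e ≫ toSpan A = b') (β : b ⟶ b') (w' : (f ≫ e) ≫ toSpan A = f ≫ b') :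
    f ≫ pull e w β = pull (f ≫ e) w' (f ◁ β) := by
  refine (congrArg (VDFunctor.comp f) (unit_lax_down e w β).symm).trans ?_
  refine (VDFunctor.assoc _ _ _).symm.trans ?_
  refine (congrArg (fun k => VDFunctor.comp k _) (unit_lax_map f β).symm).trans ?_
  refine (VDFunctor.assoc _ _ _).trans ?_
  refine (congrArg (VDFunctor.comp _) ((Fams.map_comp.{u, v} _ _).symm.trans
    (congrArg FamVDC.map.{u, v} (map_down f rfl e w w')))).trans ?_
  exact unit_lax_down (f ≫ e) w' (f ◁ β)

theorem pullHom_precomp (f : Y ⟶ X) (e : X ⟶ FamVDC.{u, v} A) {b b' : X ⟶ Span.{u, v}}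
    (w : e ≫ toSpan A = b') (β : b ⟶ b') (w' : (f ≫ e) ≫ toSpan A = f ≫ b') :
    HEq (f ◁ pullHom e w β) (pullHom (f ≫ e) w' (f ◁ β)) := by
  have h : (FamVDC.map (EltsVDC.map f rfl)).comp (FamVDC.map (down e w)) =
      FamVDC.map (down (f ≫ e) w') :=
    (Fams.map_comp.{u, v} _ _).symm.trans (congrArg FamVDC.map.{u, v} (map_down f rfl e w w'))
  refine (whiskerLeft_heq rfl (unit_lax_down e w β).symm (unit_down e w).symm
    (pullHom_heq e w β)).trans ?_
  refine (whisker_assoc_heq (K := VDC.{max (u + 1) v}) f (unit₂ β) (FamVDC.map (down e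
      w))).symm.trans ?_
  refine (whiskerRight_heq (K := VDC.{max (u + 1) v}) (unit_lax_map f β).symm (unit_map f b').symm
    (unit₂_map f β).symm rfl).trans ?_
  refine (whiskerRight_whiskerRight_heq (K := VDC.{max (u + 1) v}) _ _ _).trans ?_
  exact (whiskerRight_heq (K := VDC.{max (u + 1) v}) rfl rfl HEq.rfl h).trans
    (pullHom_heq (f ≫ e) w' (f ◁ β)).symm

theorem pull_map (F : A ⟶ B) (e : X ⟶ FamVDC.{u, v} A) {b b' : X ⟶ Span.{u, v}}
    (w : e ≫ toSpan A = b') (β : b ⟶ b') (w' : (e ≫ FamVDC.map.{u, v} F) ≫ toSpan B = b') :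
    pull e w β ≫ FamVDC.map.{u, v} F = pull (e ≫ FamVDC.map.{u, v} F) w' β := by
  refine (VDFunctor.assoc _ _ _).trans ((congrArg ((unit b).comp) (Fams.map_comp.{u, v} _
      _).symm).trans ?_)
  refine congrArg (fun k => (unit b).comp (FamVDC.map k)) ((VDFunctor.assoc _ _ _).trans ?_)
  exact congrArg (VDFunctor.comp _) (down_comp e w F w')

theorem pullHom_map (F : A ⟶ B) (e : X ⟶ FamVDC.{u, v} A) {b b' : X ⟶ Span.{u, v}}
    (w : e ≫ toSpan A = b') (β : b ⟶ b') (w' : (e ≫ FamVDC.map.{u, v} F) ≫ toSpan B = b') :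
    HEq (pullHom e w β ▷ FamVDC.map.{u, v} F) (pullHom (e ≫ FamVDC.map.{u, v} F) w' β) := by
  refine (whiskerRight_heq (unit_lax_down e w β).symm (unit_down e w).symm
    (pullHom_heq e w β) rfl).trans ?_
  refine (whiskerRight_whiskerRight_heq (K := VDC.{max (u + 1) v}) (unit₂ β) _ _).trans ?_
  exact (whiskerRight_heq (K := VDC.{max (u + 1) v}) rfl rfl HEq.rfl
    ((Fams.map_comp.{u, v} _ _).symm.trans (congrArg FamVDC.map.{u, v} (down_comp e w F w')))).trans
    (pullHom_heq _ w' β).symm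

end FamVDC

namespace FamVDC

variable {A B X Y : VDC.{max (u + 1) v}}

section

variable {b b' : VDFunctor X Span.{u, v}} (β : VDTrans b b') (D : VDFunctor (EltsVDC b') A)
  {g : VDFunctor X (FamVDC.{u, v} A)}

/-- The image of the reindexing of families of elements under a functor. -/
abbrev unitMap₂ : VDTrans (((unit b).comp (FamVDC.map (EltsVDC.lax β))).comp (FamVDC.map.{u, v} D))
    ((unit b').comp (FamVDC.map.{u, v} D)) :=
  VDTrans.whiskerRight (unit₂ β) (FamVDC.map D)

theorem comp_unitMap₂_app (ν : VDTrans g (((unit b).comp (FamVDC.map (EltsVDC.lax β))).comp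
    (FamVDC.map.{u, v} D))) (x : X.Obj) :
    (VDTrans.comp ν (unitMap₂ β D)).vert.app x =
      (⟨fun i => SpanMap.fn (β.vert.app x) (FamMap.fn (ν.vert.app x) i),
        fun i => FamMap.map (ν.vert.app x) i⟩ : FamMap (g.vert.obj x)
        (((unit b').comp (FamVDC.map.{u, v} D)).vert.obj x)) :=
  congrArg (FamMap.mk _) (funext fun _ =>
    (congrArg (CategoryStruct.comp _) (D.vert.map_id _)).trans (Category.comp_id _))

theorem comp_unitMap₂_fn (ν : VDTrans g (((unit b).comp (FamVDC.map (EltsVDC.lax β))).comp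
    (FamVDC.map.{u, v} D))) {x y : X.Obj} (Γ : X.Hor x y) {i : FamObj.idx (g.vert.obj x)}
    {j : FamObj.idx (g.vert.obj y)} (c : FamChain (.single (g.hor Γ)) i j) :
    (FamCell.fn ((VDTrans.comp ν (unitMap₂ β D)).cell Γ) c).1 =
      (SpanCell.fn (β.cell Γ) (Spans.singleChain (b.hor Γ) (FamCell.fn (ν.cell Γ) c))).1 :=
  comp_single_fn (ν.cell Γ) ((unitMap₂ β D).cell Γ) rfl rfl rfl c

theorem comp_unitMap₂_cell (ν : VDTrans g (((unit b).comp (FamVDC.map (EltsVDC.lax β))).comp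
    (FamVDC.map.{u, v} D))) {x y : X.Obj} (Γ : X.Hor x y) {i : FamObj.idx (g.vert.obj x)}
    {j : FamObj.idx (g.vert.obj y)} (c : FamChain (.single (g.hor Γ)) i j) :
    HEq (FamCell.cell ((VDTrans.comp ν (unitMap₂ β D)).cell Γ) c) (FamCell.cell (ν.cell Γ) c) := by
  refine comp_single_cell_id (ν.cell Γ) ((unitMap₂ β D).cell Γ) rfl rfl rfl c rfl rfl
    (heq_of_eq (D.vert.map_id _)) (heq_of_eq (D.vert.map_id _)) HEq.rfl ?_
  refine (map_cell_heq D ((unit₂Data β).cell Γ) ⟨_, _, ⟨⟨rfl⟩⟩⟩).trans ?_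
  exact (heq_of_eq (D.cell_id _)).trans (VDGraphHom.heq_cast _ _ _ _)

theorem comp_unitMap₂_injective (ν ν' : VDTrans g (((unit b).comp (FamVDC.map (EltsVDC.lax β))).comp
    (FamVDC.map.{u, v} D)))
    (h : VDTrans.whiskerRight ν (toSpan A) = VDTrans.whiskerRight ν' (toSpan A))
    (h' : VDTrans.comp ν (unitMap₂ β D) = VDTrans.comp ν' (unitMap₂ β D)) : ν = ν' := by
  have hv : ∀ x, ν.vert.app x = ν'.vert.app x := fun x => by
    have h₁ : FamMap.fn (ν.vert.app x) = FamMap.fn (ν'.vert.app x) :=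
      congrArg (fun ν : VDTrans (g.comp (toSpan A)) _ => SpanMap.fn (ν.vert.app x)) h
    have h₂ := (comp_unitMap₂_app β D ν x).symm.trans
      ((congrArg (fun ν : VDTrans g ((unit b').comp (FamVDC.map D)) => ν.vert.app x) h').trans
        (comp_unitMap₂_app β D ν' x))
    revert h₁ h₂
    generalize ν.vert.app x = f
    generalize ν'.vert.app x = f'
    intro h₁ h₂
    rcases f with ⟨f, φ⟩
    rcases f' with ⟨f', φ'⟩
    change f = f' at h₁
    subst h₁
    refine congrArg (FamMap.mk f) ?_
    injection h₂
  refine VDTrans.ext_heq hv fun {x y} Γ => ?_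
  refine heq_cell_of_eq (A := A) rfl (hv x) (hv y) (fun {i j} c => ?_) (fun {i j} c => ?_)
  · obtain ⟨k, s, ⟨⟨rfl⟩⟩⟩ := c
    exact congrArg (fun ν : VDTrans (g.comp (toSpan A)) _ => (SpanCell.fn (ν.cell Γ)
      (Spans.singleChain (FamHor.span (g.hor Γ)) s)).1) h
  · refine (comp_unitMap₂_cell β D ν Γ c).symm.trans (HEq.trans ?_ (comp_unitMap₂_cell β D ν' Γ c))
    exact congr_arg_heq (fun ν : VDTrans g ((unit b').comp (FamVDC.map D)) =>
      FamCell.cell (ν.cell Γ) c) h'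

end

section

variable {g e : VDFunctor X (FamVDC.{u, v} A)} (γ : VDTrans g e)

/-- The components of the action on elements of a 2-cell between functors to families. -/
def laxMap₂Data : VDTransData (EltsVDC.map g (rfl : g.comp (toSpan A) = _))
    ((EltsVDC.lax (VDTrans.whiskerRight γ (toSpan A))).comp
      (EltsVDC.map e (rfl : e.comp (toSpan A) = _))) where
  vert :=
    { app := fun a => ⟨γ.vert.app a.obj, rfl⟩
      naturality := fun a a' f => EltsMap.ext (γ.vert.naturality f.map) }
  cell Γ := ⟨γ.cell Γ.hor, rfl⟩

/-- The action on elements of a 2-cell between functors to families. -/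
def laxMap₂ : VDTrans (EltsVDC.map g (rfl : g.comp (toSpan A) = _))
    ((EltsVDC.lax (VDTrans.whiskerRight γ (toSpan A))).comp
      (EltsVDC.map e (rfl : e.comp (toSpan A) = _))) :=
  VDTrans.ofFaithful (ι := Unit) (laxMap₂Data γ) (fun _ => EltsVDC.proj (toSpan A))
    (fun θ κ h => eltsForget_inj θ κ (h ()))
    (fun _ => VDTrans.copy (VDTrans.whiskerLeft (EltsVDC.proj _) γ) (EltsVDC.map_proj g rfl)
      ((VDFunctor.assoc _ _ _).trans ((congrArg (VDFunctor.comp _) (EltsVDC.map_proj e rfl)).trans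
        ((VDFunctor.assoc _ _ _).symm.trans (congrArg (fun k => VDFunctor.comp k e)
          (EltsVDC.lax_proj (VDTrans.whiskerRight γ (toSpan A)))))))
      { vert :=
          { app := fun a => γ.vert.app (EltsObj.obj a)
            naturality := fun _ _ f => γ.vert.naturality (EltsMap.map f) }
        cell := fun Γ => γ.cell (EltsHor.hor Γ) }
      (fun _ => HEq.rfl) (fun _ => HEq.rfl))
    (fun _ _ => rfl) (fun _ _ _ _ => rfl)

/-- The 2-cell of families determined by the action on elements of a 2-cell. -/
abbrev unitLaxMap₂ := VDTrans.whiskerLeft (unit (g.comp (toSpan A)))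
  (FamVDC.map₂ (VDTrans.whiskerRight (laxMap₂ γ) (counit A)))

theorem unit_lax_down' : ((unit (g.comp (toSpan A))).comp (FamVDC.map (EltsVDC.lax
      (VDTrans.whiskerRight γ (toSpan A))))).comp (FamVDC.map (down e rfl)) =
    (unit (g.comp (toSpan A))).comp (FamVDC.map (((EltsVDC.lax
      (VDTrans.whiskerRight γ (toSpan A))).comp (EltsVDC.map e rfl)).comp (counit A))) :=
  (VDFunctor.assoc _ _ _).trans (congrArg (VDFunctor.comp _) ((Fams.map_comp.{u, v} _ _).symm.trans
    (congrArg FamVDC.map.{u, v} (VDFunctor.assoc _ _ _).symm)))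

/-- The factorization of a 2-cell through the reindexing along its underlying 2-cell. -/
def pullLift : VDTrans g (((unit (g.comp (toSpan A))).comp (FamVDC.map (EltsVDC.lax
    (VDTrans.whiskerRight γ (toSpan A))))).comp (FamVDC.map (down e rfl))) :=
  VDTrans.copy (unitLaxMap₂ γ) (unit_down.{u, v} g rfl).symm (unit_lax_down'.{u, v} γ)
    { vert :=
        { app := fun x => (⟨fun i => i, fun i => FamMap.map (γ.vert.app x) i⟩ :
            FamMap (g.vert.obj x) (⟨FamObj.idx (g.vert.obj x), fun i =>
              FamObj.fam (e.vert.obj x) (FamMap.fn (γ.vert.app x) i)⟩ : FamObj.{u, v} A))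
          naturality := fun x y f => (unitLaxMap₂ γ).vert.naturality f }
      cell := fun {x y} Γ =>
        { fn := fun c => ⟨c.2.1.1, c.2.1.2.1, c.2.1.2.2.trans c.2.2.down.down⟩
          cell := fun c => by
            obtain ⟨k, s, ⟨⟨rfl⟩⟩⟩ := c
            exact FamCell.cell (γ.cell Γ) ⟨k, s, ⟨⟨rfl⟩⟩⟩ } }
    (fun _ => HEq.rfl) (fun {x y} Γ => Fams.heq_cell.{u, v} (A := A) rfl (fun c => by
      obtain ⟨k, s, ⟨⟨rfl⟩⟩⟩ := c; rfl) (fun {i j} c => by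
      obtain ⟨k, s, ⟨⟨rfl⟩⟩⟩ := c
      exact (counitHom_cell_heq.{u, v} ((laxMap₂Data γ).cell (A := ⟨x, i⟩) (B := ⟨y, k⟩) ⟨Γ,
          s⟩)).symm))

theorem pullLift_over : HEq (VDTrans.whiskerRight (pullLift γ) (toSpan A))
    (VDTrans.id (g.comp (toSpan A))) := by
  refine VDTrans.hext rfl ?_ (fun _ => HEq.rfl) fun Γ => ?_
  · exact (VDFunctor.assoc _ _ _).trans ((congrArg (VDFunctor.comp _) (toSpan_map _)).trans
      ((VDFunctor.assoc _ _ _).trans ((congrArg (VDFunctor.comp _) (toSpan_map _)).trans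
        (unit_toSpan _))))
  · refine heq_of_eq (Spans.ext_cell fun c => ?_)
    obtain ⟨k, s, ⟨⟨rfl⟩⟩⟩ := c
    rfl

theorem pullLift_comp : HEq (VDTrans.comp (pullLift γ)
    (unitMap₂ (VDTrans.whiskerRight γ (toSpan A)) (down e rfl))) γ := by
  have hv : ∀ x, (VDTrans.comp (pullLift γ)
      (unitMap₂ (VDTrans.whiskerRight γ (toSpan A)) (down e rfl))).vert.app x = γ.vert.app x :=
    fun x => comp_unitMap₂_app _ _ (pullLift γ) x
  refine VDTrans.hext rfl (unit_down e rfl) (fun x => heq_of_eq (hv x)) fun {x y} Γ => ?_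
  refine heq_cell_of_eq (A := A) rfl (hv x) (hv y) (fun {i j} c => ?_) (fun {i j} c => ?_)
  · obtain ⟨k, s, ⟨⟨rfl⟩⟩⟩ := c
    exact comp_unitMap₂_fn _ _ (pullLift γ) Γ ⟨k, s, ⟨⟨rfl⟩⟩⟩
  · obtain ⟨k, s, ⟨⟨rfl⟩⟩⟩ := c
    exact comp_unitMap₂_cell _ _ (pullLift γ) Γ ⟨k, s, ⟨⟨rfl⟩⟩⟩

end

end FamVDC

namespace FamVDC

open TwoCat Bicategory

variable {A B X Y : VDC.{max (u + 1) v}}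

theorem exists_pullLift {e g : X ⟶ FamVDC.{u, v} A} {b b' : X ⟶ Span.{u, v}} (w : e ≫ toSpan A = b')
    (β : b ⟶ b') (wg : g ≫ toSpan A = b) (γ : g ⟶ e) (h : HEq (γ ▷ toSpan A) β) :
    ∃ ν : g ⟶ pull e w β, HEq (ν ▷ toSpan A) (𝟙 b) ∧ ν ≫ pullHom e w β = γ := by
  subst wg w
  obtain rfl := eq_of_heq h
  have hν : HEq ((pullLift γ : g ⟶ _) ≫ eqToHom (unit_lax_down e rfl (γ ▷ toSpan A)))
      (pullLift γ) := comp_eqToHom_heq _ _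
  refine ⟨(pullLift γ : g ⟶ _) ≫ eqToHom (unit_lax_down e rfl (γ ▷ toSpan A)), ?_, ?_⟩
  · exact (whiskerRight_heq (K := VDC.{max (u + 1) v}) rfl
      (unit_lax_down e rfl (γ ▷ toSpan A)).symm hν rfl).trans (pullLift_over γ)
  · refine eq_of_heq ((comp_heq rfl (unit_lax_down e rfl (γ ▷ toSpan A)).symm
      (unit_down e rfl).symm hν (pullHom_heq e rfl (γ ▷ toSpan A))).trans (pullLift_comp γ))

theorem pullHom_cancel {e g : X ⟶ FamVDC.{u, v} A} {b b' : X ⟶ Span.{u, v}} (w : e ≫ toSpan A = b')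
    (β : b ⟶ b') (ν ν' : g ⟶ pull e w β) (h : ν ▷ toSpan A = ν' ▷ toSpan A)
    (h' : ν ≫ pullHom e w β = ν' ≫ pullHom e w β) : ν = ν' := by
  have key : ∀ {p e' : X ⟶ FamVDC.{u, v} A} (hp : ((unit b).comp
      (FamVDC.map (EltsVDC.lax β))).comp (FamVDC.map (down e w)) = p)
      (he : (unit b').comp (FamVDC.map (down e w)) = e') (l : p ⟶ e')
      (_ : HEq l (unitMap₂ β (down e w))) (ν ν' : g ⟶ p) (_ : ν ▷ toSpan A = ν' ▷ toSpan A)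
      (_ : ν ≫ l = ν' ≫ l), ν = ν' := by
    intro p e' hp he l hl ν ν' h h'
    subst hp he
    obtain rfl := eq_of_heq hl
    exact comp_unitMap₂_injective β (down e w) ν ν' h h'
  exact key (unit_lax_down e w β) (unit_down e w) _ (pullHom_heq e w β) ν ν' h h'

variable (A) in
/-- The functor sending families to their indexing sets and spans has a split cleavage. -/
def cleavage : Cleavage (K := VDC.{max (u + 1) v}) (toSpan.{u, v} A) where
  pull := pull
  lift := pullHom
  pull_over := pull_over
  lift_over := pullHom_over
  pull_id := pull_id
  lift_id := pullHom_id
  pull_comp e _ _ _ w γ β := pull_comp e w γ β _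
  lift_comp e _ _ _ w γ β := pullHom_comp e w γ β _
  factor _ _ _ w β _ wg γ h := exists_pullLift w β wg γ h
  unique _ _ _ w β _ _ ν ν' h h' := pullHom_cancel w β ν ν' (eq_of_heq (h.trans h'.symm))
  pull_precomp := pull_precomp
  lift_precomp := pullHom_precomp

end FamVDC

open TwoCat in
theorem fam_isFamilial : IsFamilial Fam.{u, v} VDC.unitTerminal :=
  ⟨fam_isRightTwoAdjoint, fun A => (FamVDC.cleavage A).splitFibration
      (FamVDC.toSpan_map (VDC.toUnit A)) toSpan_unit_isIsoCell,
    fun {A B} f => (FamVDC.cleavage A).preservesLifts (c' := FamVDC.cleavage B)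
      (FamVDC.toSpan_map (VDC.toUnit A)) (FamVDC.toSpan_map (VDC.toUnit B)) toSpan_unit_isIsoCell
      (Fam.map f) (FamVDC.toSpan_map f) (fun e _ _ we β we' => FamVDC.pull_map f e we β we')
      (fun e _ _ we β we' => FamVDC.pullHom_map f e we β we')⟩

theorem mainTheorem7 :
    -- `Q` is a discrete opfibration
    Q.{u, v}.IsDiscreteOpfibration ∧
    -- the square of `Elts F`, `F` and `Q` is a pullback in the 2-category of virtual double categories
    (∀ F : TwoCat.Slice Span.{u, v}, TwoCat.IsTwoPullback (EltsVDC.proj F.arr)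
      (EltsVDC.toPt F.arr) F.arr Q.{u, v}) ∧
    -- `Q` is powerful
    (∃ S : StrictPseudofunctor (TwoCat.Slice SpanPt.{u, v}) (TwoCat.Slice Span.{u, v}),
      Nonempty (TwoCat.TwoAdjunction QStar.{u, v} S)) ∧
    -- `Fam` is the polynomial 2-functor induced by `Q`, compatibly with the maps to `Span`
    (∀ S : StrictPseudofunctor (TwoCat.Slice SpanPt.{u, v}) (TwoCat.Slice Span.{u, v}),
      Nonempty (TwoCat.TwoAdjunction QStar.{u, v} S) →
        Nonempty (TwoCat.TwoNatIso FamOne.{u, v} (polyOne S)) ∧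
        Nonempty (TwoCat.TwoNatIso Fam.{u, v} (poly S))) ∧
    -- `Fam` is familial
    TwoCat.IsFamilial Fam.{u, v} VDC.unitTerminal ∧
    -- `Fam 1` is canonically isomorphic to `Span`
    TwoCat.IsIsoCell (X := Fam.{u, v}.obj VDC.unit) (Y := Span.{u, v})
      (FamVDC.toSpan.{u, v} VDC.unit) ∧
    -- `Elts` is left 2-adjoint to the 2-functor from virtual double categories to the slice over `Span`
    Nonempty (TwoCat.TwoAdjunction Elts.{u, v} FamOne.{u, v}) := by
  exact ⟨Q_isDiscreteOpfibration, fun F => EltsVDC.isTwoPullback F.arr, Q_powerful,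
    fun S ⟨h⟩ => ⟨polyOne_iso S h, poly_iso S h⟩, fam_isFamilial,
    toSpan_unit_isIsoCell, FamVDC.elts_adjunction⟩
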